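/- Let $q\ge 3$ be an integer, $\lambda=2\cos(\pi/q)$ (these are the parameters $\lambda<2$ of the cofinite Hecke triangle groups), $S=\begin{pmatrix}0&1\\-1&0\end{pmatrix}$, $T=\begin{pmatrix}1&\lambda\\0&1\end{pmatrix}$, and let $\Gamma_\lambda=\langle S,T\rangle\subseteq \mathrm{PSL}_2(\mathbb R)$. Put $\mathcal T=\frac1{\sqrt2}\begin{pmatrix}1&-1\\1&1\end{pmatrix}$, $\Lambda=\mathcal T\Gamma_\lambda\mathcal T^{-1}$, and $h_k=\mathcal T\big((TS)^kS\big)^{-1}\mathcal T^{-1}\in\Lambda$ for $1\le k\le q-1$. Let $\eta\colon\Lambda\to U(V)$ be a unitary representation on a finite-dimensional complex inner product space $V$, and let $\mathrm{sd}(\eta)=\dim\ker(\eta(\mathcal T T\mathcal T^{-1})-1)$ be its degree of singularity. The Selberg zeta function is $$Z(s,\eta)=\prod_{[g]}\prod_{k=0}^\infty\det\big(1-\eta(g)N(g)^{-(s+k)}\big),\qquad \mathrm{Re}\,s>1,$$ where $[g]$ runs through the $\Lambda$-conjugacy classes of primitive hyperbolic elements of $\Lambda$ (hyperbolic elements that are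 not proper powers in $\Lambda$) and $N(g)$ is the square of the eigenvalue of $g$ of larger absolute value. With $\mu=\frac{\lambda-1}{\lambda+1}$ let $E_1=(\mu,1)$, $E_r=(-\mu,\mu)$, $E_{q-1}=(-1,-\mu)$. Call open discs $\mathcal E_1,\mathcal E_r,\mathcal E_{q-1}\subseteq\mathbb C$ of positive finite radius with real centres admissible if (i) $\overline{E_j}\subseteq\mathcal E_j$ for $j\in\{1,r,q-1\}$; (ii) $z\mapsto-\bar z$ maps $\mathcal E_r$ onto $\mathcal E_r$ and $\mathcal E_1$ onto $\mathcal E_{q-1}$; (iii) $h_k^{-1}.\overline{\mathcal E_j}\subseteq\mathcal E_r$ for $2\le k\le q-2$ and all $j$; (iv) $h_1^{-n}.\overline{\mathcal E_j}\subseteq\mathcal E_1$ for $n\ge1$, $j\in\{r,q-1\}$; (v) $h_{q-1}^{-n}.\overline{\mathcal E_j}\subseteq\mathcal E_{q-1}$ for $n\ge1$, $j\in\{1,r\}$; (vi) $|(h_1^{-1})'|<1$ on $\mathcal E_{q-1}$; (vii) $|(h_{q-1}^{-1})'|<1$ on $\mathcal E_1$; (viii) $\mathrm{Re}\,z>-1$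 on $\overline{\mathcal E_1}$; (ix) $\mathrm{Re}\,z<1$ on $\overline{\mathcal E_{q-1}}$; (x) $-1<\mathrm{Re}\,z<1$ on $\overline{\mathcal E_r}$. Let $B(\mathcal E;V)=B(\mathcal E_1;V)\oplus B(\mathcal E_r;V)\oplus B(\mathcal E_{q-1};V)$, where $B(\mathcal E_j;V)$ is the space of continuous functions $\overline{\mathcal E_j}\to V$ that are holomorphic on $\mathcal E_j$, with the supremum norm. For $h\in\Lambda$ with $h^{-1}=\begin{pmatrix}a&b\\c&d\end{pmatrix}$ put $\beta_s(h)f(z)=\big((cz+d)^{-2}\big)^s\,\eta(h)f(h^{-1}.z)$ (principal branch), and let $$\widetilde{\mathcal L}_{s,\eta}=\begin{pmatrix}0&\sum_{k=2}^{q-2}\beta_s(h_k)&\sum_{n\ge1}\beta_s(h_{q-1}^n)\\ \sum_{n\ge1}\beta_s(h_1^n)&\sum_{k=2}^{q-2}\beta_s(h_k)&\sum_{n\ge1}\beta_s(h_{q-1}^n)\\ \sum_{n\ge1}\beta_s(h_1^n)&\sum_{k=2}^{q-2}\beta_s(h_k)&0\end{pmatrix}.$$ Theorem. Admissible discs exist,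 and for every choice of admissible discs the following holds. For $\mathrm{Re}\,s>\frac12$ the matrix above defines a bounded operator $\widetilde{\mathcal L}_{s,\eta}$ on $B(\mathcal E;V)$. The map $s\mapsto\widetilde{\mathcal L}_{s,\eta}$ extends to a meromorphic operator-valued function on $\mathbb C$, holomorphic off $\frac12(1-\mathbb N_0)=\{\frac{1-k}2: k=0,1,2,\dots\}$ and with values there that are nuclear of order $0$; the extension is denoted by the same symbol. (i) For $\mathrm{Re}\,s>1$ the product defining $Z(s,\eta)$ converges and $Z(s,\eta)=\det(1-\widetilde{\mathcal L}_{s,\eta})$ (Fredholm determinant). (ii) The function $s\mapsto\det(1-\widetilde{\mathcal L}_{s,\eta})$, $s\notin\frac12(1-\mathbb N_0)$, is holomorphic and extends to a meromorphic function on $\mathbb C$; its poles are contained in $\frac12(1-\mathbb N_0)$ and have order at most $4\,\mathrm{sd}(\eta)$. In particular $Z(\cdot,\eta)$ has a meromorphic continuation to $\mathbb C$ with these properties. -/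

import Mathlib

open scoped MatrixGroups

noncomputable section

namespace HeckeZeta

/-! ### Hecke triangle groups and their conjugates -/

/-- The group `PSL₂(ℝ)`. -/
abbrev PSLR : Type := Matrix.ProjectiveSpecialLinearGroup (Fin 2) ℝ

/-- The class in `PSL₂(ℝ)` of a matrix in `SL₂(ℝ)`. -/
def toPSL : SL(2, ℝ) →* PSLR := QuotientGroup.mk' (Subgroup.center SL(2, ℝ))

/-- The parameter `λ = 2 cos (π / q)`. -/
def lam (q : ℕ) : ℝ := 2 * Real.cos (Real.pi / q)

/-- `S = (0, 1; -1, 0)`. -/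
def matS : SL(2, ℝ) := ⟨!![0, 1; -1, 0], by simp [Matrix.det_fin_two_of]⟩

/-- `T = (1, λ; 0, 1)`. -/
def matT (q : ℕ) : SL(2, ℝ) := ⟨!![1, lam q; 0, 1], by simp [Matrix.det_fin_two_of]⟩

/-- `𝒯 = 2^(-1/2) (1, -1; 1, 1)`, acting by `x ↦ (x - 1) / (x + 1)`. -/
def matC : SL(2, ℝ) :=
  ⟨!![1 / √2, -(1 / √2); 1 / √2, 1 / √2], by
    have h : (√2 : ℝ) * √2 = 2 := Real.mul_self_sqrt (by norm_num)
    have h0 : (√2 : ℝ) ≠ 0 := by positivity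
    rw [Matrix.det_fin_two_of]
    field_simp
    nlinarith⟩

/-- `g_k = ((T S)^k S)⁻¹`. -/
def matG (q k : ℕ) : SL(2, ℝ) := ((matT q * matS) ^ k * matS)⁻¹

/-- `h_k = 𝒯 g_k 𝒯⁻¹`. -/
def matH (q k : ℕ) : SL(2, ℝ) := matC * matG q k * matC⁻¹

/-- The Hecke triangle group `Γ_λ ⊆ PSL₂(ℝ)`, generated by `S` and `T`. -/
def Gam (q : ℕ) : Subgroup PSLR := Subgroup.closure {toPSL matS, toPSL (matT q)}

/-- The conjugate lattice `Λ = 𝒯 Γ_λ 𝒯⁻¹`. -/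
def Lam (q : ℕ) : Subgroup PSLR := (Gam q).map (MulAut.conj (toPSL matC)).toMonoidHom

theorem conj_mem_Lam (q : ℕ) {A : SL(2, ℝ)} (hA : toPSL A ∈ Gam q) :
    toPSL (matC * A * matC⁻¹) ∈ Lam q :=
  ⟨toPSL A, hA, by simp [MulAut.conj_apply]⟩

theorem toPSL_matS_mem (q : ℕ) : toPSL matS ∈ Gam q := Subgroup.subset_closure (by simp)

theorem toPSL_matT_mem (q : ℕ) : toPSL (matT q) ∈ Gam q := Subgroup.subset_closure (by simp)

theorem toPSL_matG_mem (q k : ℕ) : toPSL (matG q k) ∈ Gam q := by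
  unfold matG
  rw [map_inv, map_mul, map_pow, map_mul]
  exact inv_mem (mul_mem (pow_mem (mul_mem (toPSL_matT_mem q) (toPSL_matS_mem q)) k)
    (toPSL_matS_mem q))

/-- `h_k` as an element of `Λ`. -/
def eltH (q k : ℕ) : Lam q := ⟨toPSL (matH q k), conj_mem_Lam q (toPSL_matG_mem q k)⟩

/-- `𝒯 T 𝒯⁻¹` as an element of `Λ`: it generates the stabilizer in `Λ` of the cusp `1 = 𝒯.∞`,
and every cusp of `Λ` is equivalent to this one. -/
def eltT (q : ℕ) : Lam q :=
  ⟨toPSL (matC * matT q * matC⁻¹), conj_mem_Lam q (toPSL_matT_mem q)⟩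

/-! ### The Selberg zeta function -/

/-- An element of `PSL₂(ℝ)` is hyperbolic if its trace (defined up to sign) has absolute value
greater than `2`. -/
def IsHyperbolic (g : PSLR) : Prop :=
  ∃ A : SL(2, ℝ), toPSL A = g ∧ 2 < |(A : Matrix (Fin 2) (Fin 2) ℝ).trace|

/-- The norm of a hyperbolic element: the square of its eigenvalue of larger absolute value.
The set of squares of eigenvalues does not depend on the representing matrix, which is unique up
to sign. -/
def hypNorm (g : PSLR) : ℝ :=
  sSup ((fun μ : ℝ => μ ^ 2) ''
    spectrum ℝ ((Quotient.out g : SL(2, ℝ)) : Matrix (Fin 2) (Fin 2) ℝ))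

/-- Primitive hyperbolic elements of `Λ`: hyperbolic, and not a proper power in `Λ`. -/
def IsPrimitiveHyperbolic {q : ℕ} (g : Lam q) : Prop :=
  IsHyperbolic (g : PSLR) ∧ ∀ (h : Lam q) (n : ℕ), h ^ n = g → n ≤ 1

/-- The set of `Λ`-conjugacy classes of primitive hyperbolic elements of `Λ`. -/
def PrimClass (q : ℕ) : Type :=
  {c : ConjClasses (Lam q) // ∃ g : Lam q, IsPrimitiveHyperbolic g ∧ ConjClasses.mk g = c}

section Rep

variable {V : Type*} [NormedAddCommGroup V] [InnerProductSpace ℂ V]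

/-- The factor `det (1 - η(g) N(g)^(-(s + k)))`; it depends only on the conjugacy class of `g`. -/
def zetaFactor {q : ℕ} (η : Lam q →* (V ≃ₗᵢ[ℂ] V)) (s : ℂ) (g : Lam q) (k : ℕ) : ℂ :=
  LinearMap.det ((LinearMap.id : V →ₗ[ℂ] V)
    - ((hypNorm (g : PSLR) : ℂ) ^ (-(s + k))) • ((η g).toLinearEquiv : V →ₗ[ℂ] V))

/-- The same factor, as a function on conjugacy classes of primitive hyperbolic elements. -/
def classFactor {q : ℕ} (η : Lam q →* (V ≃ₗᵢ[ℂ] V)) (s : ℂ) (c : PrimClass q) (k : ℕ) : ℂ :=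
  zetaFactor η s (Quotient.out c.1) k

/-- The Selberg zeta function
`Z(s, η) = ∏_{[g]} ∏_{k ≥ 0} det (1 - η(g) N(g)^(-(s + k)))`. -/
def selbergZeta {q : ℕ} (η : Lam q →* (V ≃ₗᵢ[ℂ] V)) (s : ℂ) : ℂ :=
  ∏' c : PrimClass q, ∏' k : ℕ, classFactor η s c k

/-- The degree of singularity `sd(η)`: since `Λ` has a single cusp, it is the dimension of the
space of vectors fixed by a generator of the stabilizer of that cusp. -/
def sd {q : ℕ} (η : Lam q →* (V ≃ₗᵢ[ℂ] V)) : ℕ :=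
  Module.finrank ℂ (LinearMap.ker
    (((η (eltT q)).toLinearEquiv : V →ₗ[ℂ] V) - (LinearMap.id : V →ₗ[ℂ] V)))

end Rep

/-! ### Nuclear operators of order zero and their Fredholm determinants -/

section Nuclear

variable {X : Type*} [NormedAddCommGroup X] [NormedSpace ℂ X]

/-- `L = ∑ φ_n ⊗ e_n` with `∑ (‖φ_n‖ ‖e_n‖)^p < ∞` for every `p > 0`. -/
def IsNuclearRep (L : X →L[ℂ] X) (φ : ℕ → X →L[ℂ] ℂ) (e : ℕ → X) : Prop :=
  (∀ p : ℝ, 0 < p → Summable fun n => (‖φ n‖ * ‖e n‖) ^ p) ∧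
    ∀ x : X, HasSum (fun n => φ n x • e n) (L x)

/-- `L` is nuclear of order zero. -/
def IsNuclearOrderZero (L : X →L[ℂ] X) : Prop :=
  ∃ (φ : ℕ → X →L[ℂ] ℂ) (e : ℕ → X), IsNuclearRep L φ e

/-- The Fredholm series `∑_I (-1)^|I| det (φ_i(e_j))_{i, j ∈ I}` over the finite subsets `I` of
`ℕ`, that is `∑_m (-1)^m Tr (⋀^m L)` for `L = ∑ φ_n ⊗ e_n`. -/
def repDet (φ : ℕ → X →L[ℂ] ℂ) (e : ℕ → X) : ℂ :=
  ∑' I : Finset ℕ, (-1 : ℂ) ^ I.card * Matrix.det (Matrix.of fun i j : I => φ i (e j))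

open Classical in
/-- The Fredholm determinant `det (1 - L)` of a nuclear operator `L` of order zero (its value does
not depend on the representation used). -/
def fredholmDet (L : X →L[ℂ] X) : ℂ :=
  if h : IsNuclearOrderZero L then repDet h.choose h.choose_spec.choose else 0

end Nuclear

/-! ### Function spaces -/

section Spaces

variable (V : Type*) [NormedAddCommGroup V] [InnerProductSpace ℂ V]

variable {V} in
/-- A function on the closed disc, extended by zero to `ℂ`. -/
def ext0 {c r : ℝ} (f : C(Metric.closedBall (c : ℂ) r, V)) (z : ℂ) : V :=
  open Classical in if h : z ∈ Metric.closedBall (c : ℂ) r then f ⟨z, h⟩ else 0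

/-- The space of continuous functions on the closed disc with centre `c` and radius `r` which
are holomorphic in the open disc, with the supremum norm. -/
def DiscSpace (c r : ℝ) : Submodule ℂ C(Metric.closedBall (c : ℂ) r, V) where
  carrier := {f | DifferentiableOn ℂ (ext0 f) (Metric.ball (c : ℂ) r)}
  zero_mem' := by
    have h : ext0 (0 : C(Metric.closedBall (c : ℂ) r, V)) = fun _ => 0 := by
      funext z; simp [ext0]
    simp only [Set.mem_ofPred_eq, h]
    exact differentiableOn_const 0
  add_mem' := by
    intro f g hf hg
    have h : ext0 (f + g) = fun z => ext0 f z + ext0 g z := by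
      funext z; by_cases hz : z ∈ Metric.closedBall (c : ℂ) r <;> simp [ext0, hz]
    simp only [Set.mem_ofPred_eq, h]
    exact DifferentiableOn.add hf hg
  smul_mem' := by
    intro a f hf
    have h : ext0 (a • f) = fun z => a • ext0 f z := by
      funext z; by_cases hz : z ∈ Metric.closedBall (c : ℂ) r <;> simp [ext0, hz]
    simp only [Set.mem_ofPred_eq, h]
    exact DifferentiableOn.const_smul hf a

/-- The direct sum `B(𝓔; V)` of the spaces of three discs; the indices `0, 1, 2` stand for
`1, r, q - 1`. -/
abbrev BSpace (c r : Fin 3 → ℝ) : Type _ := (i : Fin 3) → DiscSpace V (c i) (r i)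

end Spaces

/-! ### Möbius action, admissible discs, the transfer operator -/

/-- `cz + d` for `A = (a, b; c, d)`. -/
def denom (A : SL(2, ℝ)) (z : ℂ) : ℂ := (A 1 0 : ℂ) * z + (A 1 1 : ℂ)

/-- `(az + b) / (cz + d)` for `A = (a, b; c, d)`, used where `cz + d ≠ 0`. -/
def moebius (A : SL(2, ℝ)) (z : ℂ) : ℂ := ((A 0 0 : ℂ) * z + (A 0 1 : ℂ)) / denom A z

/-- `j_s(A, z) = ((cz + d)^(-2))^s`, principal branch. -/
def jfac (s : ℂ) (A : SL(2, ℝ)) (z : ℂ) : ℂ := ((denom A z ^ 2)⁻¹) ^ s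

/-- `A` maps the set `K` into the bounded set `U` (in particular no point of `K` goes to `∞`). -/
def MapsInto (A : SL(2, ℝ)) (K U : Set ℂ) : Prop :=
  ∀ z ∈ K, denom A z ≠ 0 ∧ moebius A z ∈ U

/-- The intervals `E_1, E_r, E_{q-1}`. -/
def interval (q : ℕ) : Fin 3 → Set ℝ :=
  ![Set.Ioo ((lam q - 1) / (lam q + 1)) 1,
    Set.Ioo (-((lam q - 1) / (lam q + 1))) ((lam q - 1) / (lam q + 1)),
    Set.Ioo (-1) (-((lam q - 1) / (lam q + 1)))]

/-- The open disc with real centre `c i` and radius `r i`. -/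
def disc (c r : Fin 3 → ℝ) (i : Fin 3) : Set ℂ := Metric.ball (c i : ℂ) (r i)

/-- Its closure. -/
def cdisc (c r : Fin 3 → ℝ) (i : Fin 3) : Set ℂ := Metric.closedBall (c i : ℂ) (r i)

/-- The properties required of the discs `𝓔_1, 𝓔_r, 𝓔_{q-1}` (indices `0, 1, 2`). -/
structure AdmissibleDiscs (q : ℕ) (c r : Fin 3 → ℝ) : Prop where
  radius_pos : ∀ i, 0 < r i
  interval_subset : ∀ i, ∀ x ∈ closure (interval q i), (x : ℂ) ∈ disc c r i
  symm_mid : (fun z : ℂ => -(starRingEnd ℂ) z) '' disc c r 1 = disc c r 1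
  symm_outer : (fun z : ℂ => -(starRingEnd ℂ) z) '' disc c r 0 = disc c r 2
  maps_mid : ∀ k ∈ Finset.Icc 2 (q - 2), ∀ i,
    MapsInto (matH q k)⁻¹ (cdisc c r i) (disc c r 1)
  maps_first : ∀ n : ℕ, 1 ≤ n → ∀ i, i ≠ 0 →
    MapsInto ((matH q 1) ^ n)⁻¹ (cdisc c r i) (disc c r 0)
  maps_last : ∀ n : ℕ, 1 ≤ n → ∀ i, i ≠ 2 →
    MapsInto ((matH q (q - 1)) ^ n)⁻¹ (cdisc c r i) (disc c r 2)
  deriv_first : ∀ z ∈ disc c r 2, ‖deriv (moebius (matH q 1)⁻¹) z‖ < 1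
  deriv_last : ∀ z ∈ disc c r 0, ‖deriv (moebius (matH q (q - 1))⁻¹) z‖ < 1
  re_first : ∀ z ∈ cdisc c r 0, -1 < z.re
  re_last : ∀ z ∈ cdisc c r 2, z.re < 1
  re_mid : ∀ z ∈ cdisc c r 1, -1 < z.re ∧ z.re < 1

section Transfer

variable {V : Type*} [NormedAddCommGroup V] [InnerProductSpace ℂ V]

/-- `(β_s(h_k^n) f)(z) = j_s(h_k^(-n), z) η(h_k^n) (f(h_k^(-n).z))`. -/
def beta {q : ℕ} (η : Lam q →* (V ≃ₗᵢ[ℂ] V)) (s : ℂ) (k n : ℕ) (f : ℂ → V) (z : ℂ) : V :=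
  jfac s ((matH q k) ^ n)⁻¹ z • η (eltH q k ^ n) (f (moebius ((matH q k) ^ n)⁻¹ z))

/-- `L` is the operator on `B(𝓔; V)` given by the matrix of (pointwise convergent) series
`(0, ∑_k β_s(h_k), ∑_n β_s(h_{q-1}^n); ∑_n β_s(h_1^n), ∑_k β_s(h_k), ∑_n β_s(h_{q-1}^n);
∑_n β_s(h_1^n), ∑_k β_s(h_k), 0)` with `2 ≤ k ≤ q - 2` and `n ≥ 1`. -/
def IsTransferOperator {q : ℕ} (η : Lam q →* (V ≃ₗᵢ[ℂ] V)) (c r : Fin 3 → ℝ) (s : ℂ)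
    (L : BSpace V c r →L[ℂ] BSpace V c r) : Prop :=
  ∀ (f : BSpace V c r) (i : Fin 3) (z : Metric.closedBall (c i : ℂ) (r i)),
    (i ≠ 0 → Summable fun n : ℕ => beta η s 1 (n + 1) (ext0 (f 0).1) z) ∧
    (i ≠ 2 → Summable fun n : ℕ => beta η s (q - 1) (n + 1) (ext0 (f 2).1) z) ∧
    (L f i).1 z =
      (if i = 0 then 0 else ∑' n : ℕ, beta η s 1 (n + 1) (ext0 (f 0).1) z)
      + ∑ k ∈ Finset.Icc 2 (q - 2), beta η s k 1 (ext0 (f 1).1) z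
      + (if i = 2 then 0 else ∑' n : ℕ, beta η s (q - 1) (n + 1) (ext0 (f 2).1) z)

end Transfer

/-- The set `½ (1 - ℕ₀)`. -/
def poleSet : Set ℂ := {s | ∃ k : ℕ, s = (1 - (k : ℂ)) / 2}

end HeckeZeta

end

set_option linter.unusedSectionVars false

open Filter Topology Metric Complex Finset Matrix SpecialLinearGroup ContinuousLinearMap Set Real Function
  Fintype Module LinearMap List Sum Subtype

namespace HeckeZeta

noncomputable section

local notation "𝔻(" c "," r ")" => closedBall (c : ℂ) r
local notation "𝔟" => stdOrthonormalBasis ℂ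

/-! ### Fredholm determinants of infinite matrices -/

section Fdet

variable {ι κ : Type*}

open scoped Classical in
/-- The terms of the Fredholm series of an infinite matrix. -/
def fterm (M : ι → ι → ℂ) (I : Finset ι) : ℂ :=
  (-1 : ℂ) ^ I.card * Matrix.det (Matrix.of fun i j : I => M i j)

/-- The Fredholm determinant `det (1 - M)` of an infinite matrix. -/
def fdet (M : ι → ι → ℂ) : ℂ := ∑' I : Finset ι, fterm M I

theorem norm_det_le_of_le {n : Type*} [Fintype n] [DecidableEq n] (A : Matrix n n ℂ) (a b : n → ℝ)
    (h : ∀ i j, ‖A i j‖ ≤ a i * b j) : ‖A.det‖ ≤ (Fintype.card n).factorial * ∏ i, (a i * b i) := by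
  rw [det_apply]; refine (norm_sum_le _ _).trans ?_
  have hσ : ∀ σ : Equiv.Perm n, ‖Equiv.Perm.sign σ • ∏ i, A (σ i) i‖ ≤ ∏ i, (a i * b i) := by
    intro σ
    have h1 : ‖Equiv.Perm.sign σ • ∏ i, A (σ i) i‖ = ∏ i, ‖A (σ i) i‖ := by
      rcases Int.units_eq_one_or (Equiv.Perm.sign σ) with h | h <;> simp [h]
    rw [h1]
    calc ∏ i, ‖A (σ i) i‖ ≤ ∏ i, (a (σ i) * b i) :=
          Finset.prod_le_prod (fun _ _ => norm_nonneg _) fun i _ => h _ _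
      _ = ∏ i, (a i * b i) := by rw [prod_mul_distrib, prod_mul_distrib, Equiv.prod_comp σ a]
  refine (Finset.sum_le_sum fun σ _ => hσ σ).trans ?_; simp [card_perm]

theorem succ_mul_le_add_pow {s x : ℝ} (hs : 0 ≤ s) (hx : 0 ≤ x) (m : ℕ) :
    (m + 1) * x * s ^ m ≤ (s + x) ^ (m + 1) := by
  induction m with
  | zero => simp [hs]
  | succ m ih =>
    have h1 : s ^ (m + 1) ≤ (s + x) ^ (m + 1) := by gcongr; linarith
    have h2 := mul_le_mul_of_nonneg_right ih hs; have h3 := mul_le_mul_of_nonneg_right h1 hx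
    push_cast
    calc ((m : ℝ) + 1 + 1) * x * s ^ (m + 1)
        = (m + 1) * x * s ^ m * s + s ^ (m + 1) * x := by ring
      _ ≤ (s + x) ^ (m + 1) * s + (s + x) ^ (m + 1) * x := add_le_add h2 h3
      _ = _ := by ring

theorem factorial_mul_prod_le (x : ι → ℝ) (hx : ∀ i, 0 ≤ x i) (I : Finset ι) :
    (I.card.factorial : ℝ) * ∏ i ∈ I, x i ≤ (∑ i ∈ I, x i) ^ I.card := by
  classical
  induction I using Finset.induction_on with
  | empty => simp
  | insert j J hj ih =>
    rw [card_insert_of_notMem hj, Finset.prod_insert hj, sum_insert hj,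
      Nat.factorial_succ]
    have h0 : 0 ≤ ∑ i ∈ J, x i := Finset.sum_nonneg fun i _ => hx i
    have h1 := succ_mul_le_add_pow h0 (hx j) J.card
    have h2 := mul_le_mul_of_nonneg_left ih (mul_nonneg (by positivity : (0:ℝ) ≤ J.card + 1) (hx j))
    push_cast
    calc ((J.card : ℝ) + 1) * J.card.factorial * (x j * ∏ i ∈ J, x i)
        = (J.card + 1) * x j * (J.card.factorial * ∏ i ∈ J, x i) := by ring
      _ ≤ _ := h2
      _ ≤ _ := by rw [add_comm (x j)]; exact h1

/-- A convergent majorant of the Fredholm series. -/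
def fbound (a b : ι → ℝ) (I : Finset ι) : ℝ := ∏ i ∈ I, ((∑' j, √(a j * b j)) * √(a i * b i))

theorem summable_fbound {a b : ι → ℝ} (hs : Summable fun i => √(a i * b i)) :
    Summable (fbound a b) :=
  summable_finsetProd_of_summable_nonneg
    (fun i => mul_nonneg (tsum_nonneg fun _ => sqrt_nonneg _) (sqrt_nonneg _))
    (hs.mul_left _)

theorem norm_fterm_le {a b : ι → ℝ} (ha : ∀ i, 0 ≤ a i) (hb : ∀ i, 0 ≤ b i)
    (hs : Summable fun i => √(a i * b i)) {M : ι → ι → ℂ} (hM : ∀ i j, ‖M i j‖ ≤ a i * b j)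
    (I : Finset ι) : ‖fterm M I‖ ≤ fbound a b I := by
  classical
  have h1 := norm_det_le_of_le (Matrix.of fun i j : I => M i j) (fun i => a i) (fun i => b i)
    (fun i j => hM i j)
  rw [card_coe, prod_coe_sort I (fun i => a i * b i)] at h1
  have h2 : ∏ i ∈ I, (a i * b i) = (∏ i ∈ I, √(a i * b i)) * ∏ i ∈ I, √(a i * b i) := by
    rw [← prod_mul_distrib]
    exact Finset.prod_congr rfl fun i _ => (mul_self_sqrt (mul_nonneg (ha i) (hb i))).symm
  have h3 := factorial_mul_prod_le (fun i => √(a i * b i)) (fun i => sqrt_nonneg _) I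
  have h4 : (∑ i ∈ I, √(a i * b i)) ^ I.card ≤ (∑' j, √(a j * b j)) ^ I.card := by
    refine pow_le_pow_left₀ (Finset.sum_nonneg fun _ _ => sqrt_nonneg _) ?_ _
    exact hs.sum_le_tsum _ fun _ _ => sqrt_nonneg _
  rw [fterm, norm_mul, norm_pow, norm_neg, norm_one, one_pow, one_mul]; refine h1.trans ?_
  rw [h2, ← mul_assoc, fbound, prod_mul_distrib, prod_const]
  exact mul_le_mul_of_nonneg_right (h3.trans h4) (Finset.prod_nonneg fun i _ => sqrt_nonneg _)

theorem tendsto_fdet {α : Type*} {l : Filter α} {a b : ι → ℝ} (ha : ∀ i, 0 ≤ a i)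
    (hb : ∀ i, 0 ≤ b i) (hs : Summable fun i => √(a i * b i)) {N : α → ι → ι → ℂ} {M : ι → ι → ℂ}
    (hN : ∀ᶠ k in l, ∀ i j, ‖N k i j‖ ≤ a i * b j)
    (hlim : ∀ i j, Tendsto (fun k => N k i j) l (𝓝 (M i j))) :
    Tendsto (fun k => fdet (N k)) l (𝓝 (fdet M)) := by
  refine tendsto_tsum_of_dominated_convergence (summable_fbound hs) (fun I => ?_) ?_
  · refine Tendsto.mul tendsto_const_nhds ?_; simp only [det_apply]
    refine tendsto_finsetSum _ fun σ _ => Tendsto.const_smul ?_ _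
    exact tendsto_finsetProd _ fun i _ => hlim _ _
  · filter_upwards [hN] with k hk I using norm_fterm_le ha hb hs hk I

theorem differentiableOn_fdet {U : Set ℂ} (hU : IsOpen U) {a b : ι → ℝ} (ha : ∀ i, 0 ≤ a i)
    (hb : ∀ i, 0 ≤ b i) (hs : Summable fun i => √(a i * b i)) {N : ℂ → ι → ι → ℂ}
    (hN : ∀ s ∈ U, ∀ i j, ‖N s i j‖ ≤ a i * b j)
    (hd : ∀ i j, DifferentiableOn ℂ (fun s => N s i j) U) :
    DifferentiableOn ℂ (fun s => fdet (N s)) U := by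
  refine differentiableOn_tsum_of_summable_norm (summable_fbound hs) (fun I => ?_) hU
    fun I s hsU => norm_fterm_le ha hb hs (hN s hsU) I
  refine DifferentiableOn.mul (differentiableOn_const _) ?_; simp only [det_apply]
  refine DifferentiableOn.fun_sum fun σ _ => DifferentiableOn.const_smul ?_ _
  exact DifferentiableOn.fun_finsetProd fun i _ => hd _ _

theorem det_one_sub_eq_sum {n : Type*} [Fintype n] [DecidableEq n] (A : Matrix n n ℂ) :
    (1 - A).det = ∑ I : Finset n, (-1 : ℂ) ^ I.card *
    (A.submatrix (Subtype.val : I → n) (Subtype.val : I → n)).det := by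
  have h := detRowAlternating.map_add_univ (R := ℂ) (fun i => (-A) i)
    (fun i => (1 : Matrix n n ℂ) i)
  have h1 : (fun i => (-A) i) + (fun i => (1 : Matrix n n ℂ) i) = (1 - A : Matrix n n ℂ) := by
    ext i j; simp [sub_eq_add_neg, add_comm]
  rw [h1] at h; change (1 - A).det = _ at h; rw [h]; refine Finset.sum_congr rfl fun I _ => ?_
  have := det_piecewise_one_eq_submatrix_det (-A) I; refine this.trans ?_; rw [submatrix_neg]
  simp [det_neg]

/-- The truncation of an infinite matrix to a finite set of indices. -/
def trunc (F : Finset ι) (M : ι → ι → ℂ) : ι → ι → ℂ :=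
  open Classical in fun i j => if i ∈ F ∧ j ∈ F then M i j else 0

theorem norm_trunc_le {a b : ι → ℝ} (ha : ∀ i, 0 ≤ a i) (hb : ∀ i, 0 ≤ b i) {M : ι → ι → ℂ}
    (hM : ∀ i j, ‖M i j‖ ≤ a i * b j) (F : Finset ι) (i j : ι) : ‖trunc F M i j‖ ≤ a i * b j := by
  unfold trunc
  split_ifs
  · exact hM i j
  · simpa using mul_nonneg (ha i) (hb j)

open scoped Classical in
theorem fdet_trunc (F : Finset ι) (M : ι → ι → ℂ) :
    fdet (trunc F M) = (1 - Matrix.of fun i j : F => M i j).det := by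
  rw [det_one_sub_eq_sum, fdet, tsum_eq_sum (s := F.powerset)]
  · symm
    refine sum_bij (fun (I : Finset F) _ => I.map (Embedding.subtype _))
      (fun I _ => ?_) (fun I _ J _ h => Finset.map_injective _ h) (fun J hJ => ?_) (fun I _ => ?_)
    · rw [Finset.mem_powerset]; intro x hx; obtain ⟨y, -, rfl⟩ := Finset.mem_map.1 hx; exact y.2
    · refine ⟨J.subtype (· ∈ F), Finset.mem_univ _, ?_⟩; rw [subtype_map, filter_true_of_mem]
      exact fun x hx => Finset.mem_powerset.1 hJ hx
    · rw [fterm, card_map]; congr 1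
      let e : I ≃ (I.map (Embedding.subtype (· ∈ F)) : Finset ι) :=
        Equiv.ofBijective (fun x => ⟨x.1.1, Finset.mem_map.2 ⟨x.1, x.2, rfl⟩⟩) ⟨by
          intro x y h; exact Subtype.ext (Subtype.ext (by simpa using h)), by
          rintro ⟨y, hy⟩; obtain ⟨x, hx, rfl⟩ := Finset.mem_map.1 hy; exact ⟨⟨x, hx⟩, rfl⟩⟩
      rw [← det_submatrix_equiv_self e (Matrix.of fun i j => trunc F M i j)]; congr 1; ext i j
      have he : ∀ x, (e x : ι) = x.1.1 := fun _ => rfl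
      simp only [submatrix_apply, of_apply, he, trunc]; rw [if_pos ⟨i.1.2, j.1.2⟩]
  · intro I hI
    obtain ⟨x, hxI, hxF⟩ : ∃ x ∈ I, x ∉ F := by by_contra! h; exact hI (Finset.mem_powerset.2 h)
    rw [fterm, det_eq_zero_of_row_eq_zero (⟨x, hxI⟩ : I), mul_zero]; intro j; simp [trunc, hxF]

theorem trunc_eventually_eq (i j : ι) :
    ∀ᶠ F : Finset ι in atTop, ∀ M : ι → ι → ℂ, trunc F M i j = M i j := by
  classical
  filter_upwards [eventually_ge_atTop {i, j}] with F hF M; exact if_pos ⟨hF (by simp), hF (by simp)⟩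

open scoped Classical in
theorem tendsto_fdet_trunc {a b : ι → ℝ} (ha : ∀ i, 0 ≤ a i) (hb : ∀ i, 0 ≤ b i)
    (hs : Summable fun i => √(a i * b i)) {M : ι → ι → ℂ} (hM : ∀ i j, ‖M i j‖ ≤ a i * b j) :
    Tendsto (fun F : Finset ι => (1 - Matrix.of fun i j : F => M i j).det) atTop (𝓝 (fdet M)) := by
  simp only [← fdet_trunc]
  refine tendsto_fdet ha hb hs (Eventually.of_forall fun F => norm_trunc_le ha hb hM F)
    fun i j => tendsto_const_nhds.congr' ((trunc_eventually_eq i j).mono fun F hF => (hF M).symm)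

theorem summable_of_summable_sqrt {a : ι → ℝ} (ha : ∀ i, 0 ≤ a i)
    (hs : Summable fun i => √(a i)) : Summable a := by
  have h := hs.tendsto_cofinite_zero.eventually (Iio_mem_nhds zero_lt_one)
  refine Summable.of_norm_bounded_eventually hs ?_; filter_upwards [h] with i hi
  rw [norm_of_nonneg (ha i)]; nlinarith [mul_self_sqrt (ha i), sqrt_nonneg (a i), hi]

theorem tendsto_fdet_trunc_mul {a b : ι → ℝ} {u v : κ → ℝ} (ha : ∀ i, 0 ≤ a i) (hb : ∀ i, 0 ≤ b i)
    (hu : ∀ i, 0 ≤ u i) (hv : ∀ i, 0 ≤ v i) (hab : Summable fun i => √(a i * b i))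
    (huv : Summable fun k => u k * v k) {A : ι → κ → ℂ} {B : κ → ι → ℂ}
    (hA : ∀ i k, ‖A i k‖ ≤ a i * u k) (hB : ∀ k i, ‖B k i‖ ≤ v k * b i) :
    Tendsto (fun p : Finset ι × Finset κ =>
    fdet (trunc p.1 fun i j => ∑ k ∈ p.2, A i k * B k j)) atTop
    (𝓝 (fdet (fun i j => ∑' k, A i k * B k j))) := by
  classical
  have hterm : ∀ i j k, ‖A i k * B k j‖ ≤ a i * b j * (u k * v k) := by
    intro i j k; rw [norm_mul]
    calc _ ≤ (a i * u k) * (v k * b j) :=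
          mul_le_mul (hA i k) (hB k j) (norm_nonneg _) (mul_nonneg (ha i) (hu k))
      _ = _ := by ring
  set C := ∑' k, u k * v k with hC
  have hC0 : 0 ≤ C := tsum_nonneg fun k => mul_nonneg (hu k) (hv k)
  have hs : Summable fun i => √(C * a i * b i) := by
    simp_rw [mul_assoc, sqrt_mul hC0]; exact hab.mul_left _
  refine tendsto_fdet (a := fun i => C * a i) (b := b) (fun i => mul_nonneg hC0 (ha i)) hb hs
    (Eventually.of_forall fun p => ?_) fun i j => ?_
  · refine norm_trunc_le (fun i => mul_nonneg hC0 (ha i)) hb (fun i j => ?_) _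
    calc ‖∑ k ∈ p.2, A i k * B k j‖ ≤ ∑ k ∈ p.2, a i * b j * (u k * v k) :=
          norm_sum_le_of_le _ fun k _ => hterm i j k
      _ = a i * b j * ∑ k ∈ p.2, u k * v k := (mul_sum _ _ _).symm
      _ ≤ a i * b j * C := by
          refine mul_le_mul_of_nonneg_left ?_ (mul_nonneg (ha i) (hb j))
          exact huv.sum_le_tsum _ fun k _ => mul_nonneg (hu k) (hv k)
      _ = _ := by ring
  · have h1 : Tendsto (fun G : Finset κ => ∑ k ∈ G, A i k * B k j) atTop
        (𝓝 (∑' k, A i k * B k j)) :=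
      ((huv.mul_left (a i * b j)).of_norm_bounded (hterm i j)).hasSum
    rw [← prod_atTop_atTop_eq]; refine Tendsto.congr' ?_ (h1.comp tendsto_snd)
    exact (tendsto_fst.eventually (trunc_eventually_eq i j)).mono fun p hp =>
      (hp fun i j => ∑ k ∈ p.2, A i k * B k j).symm

theorem fdet_mul_comm {a b : ι → ℝ} {u v : κ → ℝ} (ha : ∀ i, 0 ≤ a i) (hb : ∀ i, 0 ≤ b i)
    (hu : ∀ i, 0 ≤ u i) (hv : ∀ i, 0 ≤ v i) (hab : Summable fun i => √(a i * b i))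
    (huv : Summable fun k => √(u k * v k)) {A : ι → κ → ℂ} {B : κ → ι → ℂ}
    (hA : ∀ i k, ‖A i k‖ ≤ a i * u k) (hB : ∀ k i, ‖B k i‖ ≤ v k * b i) :
    fdet (fun i j => ∑' k, A i k * B k j) = fdet (fun k l => ∑' i, B k i * A i l) := by
  classical
  have hab' := summable_of_summable_sqrt (fun i => mul_nonneg (ha i) (hb i)) hab
  have huv' := summable_of_summable_sqrt (fun i => mul_nonneg (hu i) (hv i)) huv
  have h1 := tendsto_fdet_trunc_mul ha hb hu hv hab huv' hA hB
  have huv2 : Summable fun k => √(v k * u k) := by simpa only [mul_comm] using huv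
  have hab2 : Summable fun i => b i * a i := by simpa only [mul_comm] using hab'
  have h2 := tendsto_fdet_trunc_mul hv hu hb ha huv2 hab2 hB hA; rw [← prod_atTop_atTop_eq] at h1 h2
  have h3 := h2.comp (tendsto_snd (f := (atTop : Filter (Finset ι)))
    (g := (atTop : Filter (Finset κ))) |>.prodMk tendsto_fst)
  refine tendsto_nhds_unique h1 (h3.congr fun p => ?_); obtain ⟨F, G⟩ := p
  simp only [Function.comp]; rw [fdet_trunc, fdet_trunc]
  have hl : (Matrix.of fun i j : G => ∑ k ∈ F, B i k * A k j)
      = (Matrix.of fun (i : G) (k : F) => B i k) * (Matrix.of fun (k : F) (j : G) => A k j) := by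
    ext i j; simp only [of_apply, Matrix.mul_apply]
    exact (sum_coe_sort F (fun k => B i k * A k j)).symm
  have hr : (Matrix.of fun i j : F => ∑ k ∈ G, A i k * B k j)
      = (Matrix.of fun (i : F) (k : G) => A i k) * (Matrix.of fun (k : G) (j : F) => B k j) := by
    ext i j; simp only [of_apply, Matrix.mul_apply]
    exact (sum_coe_sort G (fun k => A i k * B k j)).symm
  rw [hl, hr, det_one_sub_mul_comm]

end Fdet

section ExpFormula

theorem hasDerivAt_det_one_sub_smul {n : Type*} [Fintype n] [DecidableEq n] (N R : Matrix n n ℂ)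
    (t : ℂ) (hR : (1 - t • N) * R = 1) :
    HasDerivAt (fun z : ℂ => (1 - z • N).det) (-((1 - t • N).det * (N * R).trace)) t := by
  have hR' : R * (1 - t • N) = 1 := mul_eq_one_comm.1 hR
  have h1 : ∀ z : ℂ, (1 - z • N).det = (1 - t • N).det * (1 + (-(z - t)) • (N * R)).det := by
    intro z
    have h2 : (1 - z • N) = (1 + (-(z - t)) • (N * R)) * (1 - t • N) := by
      rw [add_mul, one_mul, smul_mul_assoc, mul_assoc, hR', mul_one]
      module
    rw [h2, det_mul, mul_comm]
  set q := (Matrix.det (1 + (Polynomial.X : Polynomial ℂ) • (N * R).map Polynomial.C)).divX.divX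
  rw [show (fun z : ℂ => (1 - z • N).det) = _ from
    funext fun z => (h1 z).trans (congrArg _ (det_one_add_smul _ _))]
  have h4 : HasDerivAt (fun z : ℂ => -(z - t)) (-1) t := ((hasDerivAt_id t).sub_const t).neg
  have h5 := ((h4.const_mul (N * R).trace).const_add 1).add
    (((q.hasDerivAt (-(t - t))).comp t h4).mul (h4.pow 2))
  refine (h5.const_mul (1 - t • N).det).congr_deriv ?_; simp

theorem eventually_eq_exp_of_hasDerivAt {A : Type*} [NormedRing A] [NormedAlgebra ℂ A]
    [FiniteDimensional ℂ A] (τ : A →ₗ[ℂ] ℂ) (N : A) {f : ℂ → ℂ} (h0 : f 0 = 1)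
    (hf : ∀ R t, (1 - t • N) * R = 1 → HasDerivAt f (-(f t * τ (N * R))) t) :
    ∀ᶠ t : ℂ in 𝓝 0, f t = Complex.exp (-∑' k : ℕ, τ (N ^ (k + 1)) / (k + 1) * t ^ (k + 1)) := by
  have := FiniteDimensional.complete ℂ A; let σ : A →L[ℂ] ℂ := LinearMap.toContinuousLinearMap τ
  set δ : ℝ := 1 / (2 * (‖N‖ + 1)) with hδ; have hδ0 : 0 < δ := by positivity
  have hN : ∀ t ∈ ball (0 : ℂ) δ, ‖t‖ * ‖N‖ ≤ 1 / 2 := fun t ht => by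
    rw [mem_ball_zero_iff, hδ, lt_div_iff₀ (by positivity)] at ht
    nlinarith [norm_nonneg t]
  have hN' : ∀ t ∈ ball (0 : ℂ) δ, ‖t • N‖ < 1 := fun t ht => by rw [norm_smul]; linarith [hN t ht]
  set g : ℂ → ℂ := fun t => ∑' k : ℕ, τ (N ^ (k + 1)) / (k + 1) * t ^ (k + 1) with hg
  have hg' : ∀ t ∈ ball (0 : ℂ) δ, HasDerivAt g (∑' k : ℕ, τ (N ^ (k + 1)) * t ^ k) t := by
    intro t ht
    refine hasDerivAt_tsum_of_isPreconnected 
      (g := fun (k : ℕ) t => τ (N ^ (k + 1)) / (k + 1) * t ^ (k + 1))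
      (g' := fun (k : ℕ) t => τ (N ^ (k + 1)) * t ^ k) (u := fun (k : ℕ) => ‖σ‖ * ‖N‖ * (1 / 2) ^ k)
      ((summable_geometric_of_lt_one (by norm_num) (by norm_num)).mul_left _) isOpen_ball
      (convex_ball (0 : ℂ) δ).isPreconnected (fun k y _ => ?_) (fun k t ht => ?_)
      (mem_ball_self hδ0) ?_ ht
    · refine ((hasDerivAt_pow (k + 1) y).const_mul (τ (N ^ (k + 1)) / (k + 1))).congr_deriv ?_
      have : ((k : ℂ) + 1) ≠ 0 := Nat.cast_add_one_ne_zero k; push_cast; field_simp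
    · rw [norm_mul, norm_pow]
      calc ‖σ (N ^ (k + 1))‖ * ‖t‖ ^ k ≤ ‖σ‖ * ‖N‖ ^ (k + 1) * ‖t‖ ^ k := by
            gcongr; exact σ.le_opNorm_of_le (norm_pow_le' N k.succ_pos)
        _ = ‖σ‖ * ‖N‖ * (‖t‖ * ‖N‖) ^ k := by ring
        _ ≤ _ := by gcongr; exact hN t ht
    · simp [summable_zero]
  have hd : ∀ z ∈ ball (0 : ℂ) δ, HasDerivAt (fun z => f z * Complex.exp (g z)) 0 z := by
    intro z hz; have h1 := ((summable_geometric_of_norm_lt_one (hN' z hz)).hasSum.mul_left N).mapL σ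
    have h2 : τ (N * ∑' k, (z • N) ^ k) = ∑' k : ℕ, τ (N ^ (k + 1)) * z ^ k :=
      h1.tsum_eq.symm.trans (tsum_congr fun k => by simp [σ, smul_pow, ← pow_succ', mul_comm])
    refine ((hf _ z (mul_neg_geom_series _ (hN' z hz))).mul (hg' z hz).cexp).congr_deriv ?_; rw [h2]
    ring
  filter_upwards [ball_mem_nhds (0 : ℂ) hδ0] with t ht; rw [Complex.exp_neg]
  refine eq_inv_of_mul_eq_one_left ((isOpen_ball.is_const_of_deriv_eq_zero
    (convex_ball (0 : ℂ) δ).isPreconnected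
    (fun z hz => (hd z hz).differentiableAt.differentiableWithinAt)
    (fun z hz => (hd z hz).deriv) ht (mem_ball_self hδ0)).trans ?_)
  simp [hg, h0]

theorem det_one_sub_smul_eventually_eq_exp {n : Type*} [Fintype n] [DecidableEq n]
    (N : Matrix n n ℂ) : ∀ᶠ t : ℂ in 𝓝 0, (1 - t • N).det
    = Complex.exp (-∑' k : ℕ, (N ^ (k + 1)).trace / (k + 1) * t ^ (k + 1)) :=
  let _ : NormedRing (Matrix n n ℂ) := Matrix.linftyOpNormedRing
  let _ : NormedAlgebra ℂ (Matrix n n ℂ) := Matrix.linftyOpNormedAlgebra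
  eventually_eq_exp_of_hasDerivAt (traceLinearMap n ℂ ℂ) N (by simp)
    fun R t => hasDerivAt_det_one_sub_smul N R t

theorem differentiableOn_tsum_pow {c : ℕ → ℂ} {r : ℝ}
    (hc : ∀ x : ℝ, 0 ≤ x → x < r → Summable fun n => ‖c n‖ * x ^ (n + 1)) :
    DifferentiableOn ℂ (fun t : ℂ => ∑' n, c n * t ^ (n + 1)) (ball 0 r) := by
  intro t ht; obtain ⟨x, hx1, hx2⟩ := exists_between (show ‖t‖ < r by simpa using ht)
  have h0 : 0 ≤ x := (norm_nonneg t).trans hx1.le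
  have h1 : DifferentiableOn ℂ (fun t : ℂ => ∑' n, c n * t ^ (n + 1)) (ball 0 x) := by
    refine differentiableOn_tsum_of_summable_norm (hc x h0 hx2)
      (fun n => by fun_prop) isOpen_ball fun n z hz => ?_
    rw [norm_mul, norm_pow]; have : ‖z‖ ≤ x := by simpa using (mem_ball.1 hz).le
    gcongr
  exact (h1.differentiableAt (isOpen_ball.mem_nhds (by simpa using hx1))).differentiableWithinAt

theorem eq_exp_of_eventually_eq_exp {f : ℂ → ℂ} {c : ℕ → ℂ} {r : ℝ}
    (hf : DifferentiableOn ℂ f (ball 0 r))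
    (hc : ∀ x : ℝ, 0 ≤ x → x < r → Summable fun n => ‖c n‖ * x ^ (n + 1))
    (h : ∀ᶠ t in 𝓝 (0 : ℂ), f t = Complex.exp (-∑' n, c n * t ^ (n + 1))) :
    ∀ t ∈ ball (0 : ℂ) r, f t = Complex.exp (-∑' n, c n * t ^ (n + 1)) := by
  intro t ht; have hr : 0 < r := dist_nonneg.trans_lt (mem_ball.1 ht)
  have h1 : AnalyticOnNhd ℂ f (ball 0 r) := hf.analyticOnNhd isOpen_ball
  have h2 : AnalyticOnNhd ℂ (fun t => Complex.exp (-∑' n, c n * t ^ (n + 1))) (ball 0 r) :=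
    (differentiableOn_tsum_pow hc).neg.cexp.analyticOnNhd isOpen_ball
  exact h1.eqOn_of_preconnected_of_eventuallyEq h2 (convex_ball (0 : ℂ) r).isPreconnected
    (mem_ball_self hr) h ht

/-- If `‖tr (N ^ (k + 1))‖ ≤ C B ^ (k + 1)`, the expansion of `det (1 - t N)` holds for
`|t| < 1 / B`. -/
theorem det_one_sub_smul_eq_exp {n : Type*} [Fintype n] [DecidableEq n] (N : Matrix n n ℂ) {C B : ℝ}
    (hB : 0 ≤ B) (hN : ∀ k, ‖(N ^ (k + 1)).trace‖ ≤ C * B ^ (k + 1)) {t : ℂ} (ht : ‖t‖ * B < 1) :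
    (1 - t • N).det = Complex.exp (-∑' k : ℕ, (N ^ (k + 1)).trace / (k + 1) * t ^ (k + 1)) := by
  obtain ⟨r, hr2, hr⟩ := (((continuous_mul_const B).continuousAt.eventually
    (Iio_mem_nhds ht)).filter_mono nhdsWithin_le_nhds |>.and (self_mem_nhdsWithin (s := Ioi ‖t‖))).exists
  refine eq_exp_of_eventually_eq_exp (r := r) (f := fun t => (1 - t • N).det)
    (c := fun k => (N ^ (k + 1)).trace / (k + 1)) ?_ ?_
    (det_one_sub_smul_eventually_eq_exp N) t (by simpa using hr)
  · simp only [det_apply]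
    refine DifferentiableOn.fun_sum fun σ _ => DifferentiableOn.const_smul ?_ _
    refine DifferentiableOn.fun_finsetProd fun i _ => ?_
    simp only [Matrix.sub_apply, Matrix.smul_apply, smul_eq_mul]; fun_prop
  · intro x hx hxr
    have hxB : x * B < 1 := lt_of_le_of_lt (mul_le_mul_of_nonneg_right hxr.le hB) hr2
    have hg : Summable fun k : ℕ => C * (x * B) ^ (k + 1) :=
      (((summable_nat_add_iff 1).2 (summable_geometric_of_lt_one (by positivity) hxB)).mul_left C)
    refine hg.of_nonneg_of_le (fun k => by positivity) fun k => ?_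
    rw [norm_div]
    have h1 : (1 : ℝ) ≤ ‖((k : ℂ) + 1)‖ := by rw [← Nat.cast_succ, Complex.norm_natCast]; simp
    calc ‖(N ^ (k + 1)).trace‖ / ‖((k : ℂ) + 1)‖ * x ^ (k + 1)
        ≤ C * B ^ (k + 1) * x ^ (k + 1) := by
          gcongr; exact (div_le_self (norm_nonneg _) h1).trans (hN k)
      _ = _ := by rw [mul_pow]; ring

end ExpFormula

section FdetExp

variable {ι : Type*}

/-- `fpow M n` is the power `M ^ (n + 1)` of an infinite matrix. -/
def fpow (M : ι → ι → ℂ) : ℕ → ι → ι → ℂ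
  | 0 => M
  | n + 1 => fun i j => ∑' k, fpow M n i k * M k j

theorem norm_fpow_le {b : ι → ℝ} (hb : ∀ i, 0 ≤ b i) (hs : Summable b) {M : ι → ι → ℂ}
    (hM : ∀ i j, ‖M i j‖ ≤ b j) (n : ℕ) (i j : ι) : ‖fpow M n i j‖ ≤ (∑' k, b k) ^ n * b j := by
  induction n generalizing i j with
  | zero => simpa [fpow] using hM i j
  | succ n ih =>
    have h1 : ∀ k, ‖fpow M n i k * M k j‖ ≤ ((∑' k, b k) ^ n * b j) * b k := by
      intro k; rw [norm_mul]
      calc _ ≤ ((∑' k, b k) ^ n * b k) * b j :=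
            mul_le_mul (ih i k) (hM k j) (norm_nonneg _)
              (mul_nonneg (pow_nonneg (tsum_nonneg hb) _) (hb k))
        _ = _ := by ring
    calc ‖fpow M (n + 1) i j‖ ≤ ∑' k, ((∑' k, b k) ^ n * b j) * b k :=
          tsum_of_norm_bounded (hs.mul_left _).hasSum h1
      _ = _ := by rw [tsum_mul_left]; ring

theorem tendsto_fpow_trunc {b : ι → ℝ} (hb : ∀ i, 0 ≤ b i) (hs : Summable b) {M : ι → ι → ℂ}
    (hM : ∀ i j, ‖M i j‖ ≤ b j) (n : ℕ) (i j : ι) :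
    Tendsto (fun F => fpow (trunc F M) n i j) atTop (𝓝 (fpow M n i j)) := by
  have ht : ∀ i j, Tendsto (fun F => trunc F M i j) atTop (𝓝 (M i j)) := fun i j =>
    tendsto_const_nhds.congr' ((trunc_eventually_eq i j).mono fun F hF => (hF M).symm)
  have hT : ∀ F i j, ‖trunc F M i j‖ ≤ b j := fun F i j => by
    simpa using norm_trunc_le (a := fun _ => 1) (fun _ => zero_le_one) hb (by simpa using hM) F i j
  induction n generalizing i j with
  | zero => exact ht i j
  | succ n ih =>
    refine tendsto_tsum_of_dominated_convergence (bound := fun k => (∑' k, b k) ^ n * b k * b j)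
      ((hs.mul_left _).mul_right _) (fun k => (ih i k).mul (ht k j))
      (Eventually.of_forall fun F k => ?_)
    rw [norm_mul]
    exact mul_le_mul (norm_fpow_le hb hs (hT F) n i k) (hT F k j) (norm_nonneg _)
      (mul_nonneg (pow_nonneg (tsum_nonneg hb) _) (hb k))

open scoped Classical in
theorem fpow_trunc (F : Finset ι) (M : ι → ι → ℂ) (n : ℕ) :
    (∀ i j : F, fpow (trunc F M) n i j = ((Matrix.of fun i j : F => M i j) ^ (n + 1)) i j) ∧
    (∀ i j, j ∉ F → fpow (trunc F M) n i j = 0) := by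
  induction n with
  | zero => exact ⟨fun i j => by simp [fpow, trunc], fun i j hj => by simp [fpow, trunc, hj]⟩
  | succ n ih =>
    refine ⟨fun i j => ?_, fun i j hj => ?_⟩
    · rw [pow_succ, Matrix.mul_apply]; change ∑' k, fpow (trunc F M) n i k * trunc F M k j = _
      rw [tsum_eq_sum (s := F)]
      · rw [← sum_coe_sort F]; refine Finset.sum_congr rfl fun k _ => ?_; rw [ih.1 i k]
        simp [trunc]
      · intro k hk; simp [ih.2 _ _ hk]
    · simp [fpow, trunc, hj]

theorem fdet_smul_eventually_eq_exp {b : ι → ℝ} (hb : ∀ i, 0 ≤ b i) (hs : Summable fun i => √(b i))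
    {M : ι → ι → ℂ} (hM : ∀ i j, ‖M i j‖ ≤ b j) : ∀ᶠ t in 𝓝 (0 : ℂ), fdet (fun i j => t * M i j)
    = Complex.exp (-∑' n : ℕ, (∑' i, fpow M n i i) / (n + 1) * t ^ (n + 1)) := by
  classical
  have hs1 := summable_of_summable_sqrt hb hs; set B := ∑' k, b k with hB
  have hB0 : 0 ≤ B := tsum_nonneg hb
  have hball : ball (0 : ℂ) (1 / (B + 1)) ∈ 𝓝 (0 : ℂ) := ball_mem_nhds _ (by positivity)
  filter_upwards [hball] with t ht
  have htB : ‖t‖ * B < 1 := by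
    have h1 : ‖t‖ < 1 / (B + 1) := by simpa using ht
    rw [lt_div_iff₀ (by positivity)] at h1
    nlinarith [norm_nonneg t]
  have hT : ∀ F i j, ‖trunc F M i j‖ ≤ b j := fun F i j => by
    simpa using norm_trunc_le (a := fun _ => 1) (fun _ => zero_le_one) hb (by simpa using hM) F i j
  have htr : ∀ (F : Finset ι) (n : ℕ), ((Matrix.of fun i j : F => M i j) ^ (n + 1)).trace
      = ∑' i, fpow (trunc F M) n i i := by
    intro F n; rw [tsum_eq_sum (s := F) fun i hi => (fpow_trunc F M n).2 i i hi, ← sum_coe_sort F]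
    exact Finset.sum_congr rfl fun i _ => ((fpow_trunc F M n).1 i i).symm
  have htrb : ∀ (N : ι → ι → ℂ), (∀ i j, ‖N i j‖ ≤ b j) → ∀ n : ℕ,
      ‖∑' i, fpow N n i i‖ ≤ B ^ (n + 1) := by
    intro N hN n
    refine (tsum_of_norm_bounded (hs1.mul_left (B ^ n)).hasSum
      fun i => norm_fpow_le hb hs1 hN n i i).trans ?_
    rw [tsum_mul_left, pow_succ]
  have hlim1 : Tendsto (fun F : Finset ι => (1 - t • Matrix.of fun i j : F => M i j).det) atTop
      (𝓝 (fdet (fun i j => t * M i j))) := by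
    have h1 := tendsto_fdet_trunc (a := fun _ => ‖t‖) (b := b) (M := fun i j => t * M i j)
      (fun _ => norm_nonneg t) hb
      (by simpa only [sqrt_mul (norm_nonneg t)] using hs.mul_left (√‖t‖))
      (fun i j => by rw [norm_mul]; exact mul_le_mul_of_nonneg_left (hM i j) (norm_nonneg t))
    exact h1
  have hlim2 : Tendsto (fun F : Finset ι => Complex.exp (-∑' n : ℕ,
      (∑' i, fpow (trunc F M) n i i) / (n + 1) * t ^ (n + 1))) atTop
      (𝓝 (Complex.exp (-∑' n : ℕ, (∑' i, fpow M n i i) / (n + 1) * t ^ (n + 1)))) := by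
    refine (Complex.continuous_exp.tendsto _).comp (Tendsto.neg ?_)
    have hg : Summable fun n : ℕ => (‖t‖ * B) ^ (n + 1) :=
      (summable_nat_add_iff 1).2 (summable_geometric_of_lt_one (by positivity) htB)
    refine tendsto_tsum_of_dominated_convergence hg (fun n => ?_)
      (Eventually.of_forall fun F n => ?_)
    · refine Tendsto.mul_const _ (Tendsto.div_const ?_ _)
      exact tendsto_tsum_of_dominated_convergence (hs1.mul_left (B ^ n))
        (fun i => tendsto_fpow_trunc hb hs1 hM n i i)
        (Eventually.of_forall fun F i => norm_fpow_le hb hs1 (hT F) n i i)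
    · rw [norm_mul, norm_div, norm_pow, mul_pow, mul_comm]
      have h1 : (1 : ℝ) ≤ ‖((n : ℂ) + 1)‖ := by rw [← Nat.cast_succ, Complex.norm_natCast]; simp
      gcongr; exact (div_le_self (norm_nonneg _) h1).trans (htrb _ (hT F) n)
  refine tendsto_nhds_unique hlim1 (hlim2.congr fun F => ?_)
  rw [det_one_sub_smul_eq_exp (C := 1) _ hB0 (fun n => ?_) htB]
  · simp only [htr]
  · rw [htr, one_mul]; exact htrb _ (hT F) n

/-- `det (1 - M) = exp (- ∑ tr (M ^ n) / n)`, as soon as the series converges absolutely. -/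
theorem fdet_eq_exp {b : ι → ℝ} (hb : ∀ i, 0 ≤ b i)
    (hs : Summable fun i => √(b i)) {M : ι → ι → ℂ} (hM : ∀ i j, ‖M i j‖ ≤ b j)
    (hc : Summable fun n : ℕ => ‖(∑' i, fpow M n i i) / ((n : ℂ) + 1)‖) :
    fdet M = Complex.exp (-∑' n : ℕ, (∑' i, fpow M n i i) / (n + 1)) := by
  have hentire : DifferentiableOn ℂ (fun t : ℂ => fdet (fun i j => t * M i j))
      (ball 0 1) := by
    refine differentiableOn_fdet isOpen_ball (a := fun _ => 1) (b := b)
      (fun _ => zero_le_one) hb (by simpa using hs) (fun t ht i j => ?_) fun i j => by fun_prop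
    have : ‖t‖ ≤ 1 := by simpa using (mem_ball.1 ht).le
    rw [norm_mul]; exact mul_le_mul this (hM i j) (norm_nonneg _) zero_le_one
  have hball := eq_exp_of_eventually_eq_exp hentire (fun x hx0 hx1 => ?_)
    (fdet_smul_eventually_eq_exp hb hs hM)
  · have ht : ∀ᶠ x : ℝ in 𝓝[<] 1, 0 < x ∧ x < 1 := by
      filter_upwards [Ioo_mem_nhdsLT (zero_lt_one' ℝ)] with x hx using hx
    have hto : Tendsto (fun x : ℝ => (x : ℂ)) (𝓝[<] 1) (𝓝 1) := by
      have : Tendsto (fun x : ℝ => (x : ℂ)) (𝓝 1) (𝓝 ((1 : ℝ) : ℂ)) := continuous_ofReal.tendsto 1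
      simpa using this.mono_left nhdsWithin_le_nhds
    have hl1 : Tendsto (fun x : ℝ => fdet (fun i j => (x : ℂ) * M i j)) (𝓝[<] 1) (𝓝 (fdet M)) := by
      refine tendsto_fdet (a := fun _ => 1) (b := b) (fun _ => zero_le_one) hb (by simpa using hs)
        ?_ fun i j => ?_
      · filter_upwards [ht] with x hx i j; rw [norm_mul, norm_real, norm_of_nonneg hx.1.le]
        exact mul_le_mul hx.2.le (hM i j) (norm_nonneg _) zero_le_one
      · simpa using hto.mul_const (M i j)
    have hl2 : Tendsto (fun x : ℝ => Complex.exp (-∑' n : ℕ,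
        (∑' i, fpow M n i i) / (n + 1) * (x : ℂ) ^ (n + 1))) (𝓝[<] 1)
        (𝓝 (Complex.exp (-∑' n : ℕ, (∑' i, fpow M n i i) / (n + 1)))) := by
      refine (Complex.continuous_exp.tendsto _).comp (Tendsto.neg ?_)
      refine tendsto_tsum_of_dominated_convergence hc (fun n => ?_) ?_
      · simpa using (hto.pow (n + 1)).const_mul ((∑' i, fpow M n i i) / ((n : ℂ) + 1))
      · filter_upwards [ht] with x hx n; rw [norm_mul, norm_pow, norm_real, norm_of_nonneg hx.1.le]
        exact mul_le_of_le_one_right (norm_nonneg _) (pow_le_one₀ hx.1.le hx.2.le)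
    refine tendsto_nhds_unique hl1 (hl2.congr' ?_); filter_upwards [ht] with x hx
    refine (hball x ?_).symm; simpa [abs_of_pos hx.1] using hx.2
  · refine hc.of_nonneg_of_le (fun n => by positivity) fun n => ?_
    exact mul_le_of_le_one_right (norm_nonneg _) (pow_le_one₀ hx0 hx1.le)

end FdetExp

/-! ### Fredholm determinants with finitely many rescaled columns -/

section Scaled

variable {κ ι : Type*} [Fintype κ]

theorem fterm_mul_column {α : Type*} (w : α → ℂ) (N : α → α → ℂ) (I : Finset α) :
    fterm (fun i j => w j * N i j) I = (∏ j ∈ I, w j) * fterm N I := by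
  classical
  unfold fterm; have h := det_mul_row (fun j : I => w j) (Matrix.of fun i j : I => N i j)
  rw [prod_coe_sort I w] at h; simp only [of_apply] at h; rw [h]; ring

/-- The Fredholm series of `N`, the columns of index in `κ` being divided by `t`, multiplied by
`t ^ |κ|`. -/
def scaledDet (N : κ ⊕ ι → κ ⊕ ι → ℂ) (t : ℂ) : ℂ :=
  ∑' I : Finset (κ ⊕ ι), t ^ (Fintype.card κ - I.toLeft.card) * fterm N I

theorem scaledDet_eq (N : κ ⊕ ι → κ ⊕ ι → ℂ) {t : ℂ} (ht : t ≠ 0) :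
    scaledDet N t = t ^ Fintype.card κ *
    fdet (fun i j => Sum.elim (fun _ => t⁻¹) (fun _ => 1) j * N i j) := by
  rw [fdet, ← tsum_mul_left, scaledDet]; refine tsum_congr fun I => ?_
  rw [fterm_mul_column, ← mul_assoc]; congr 1
  have h1 : ∏ j ∈ I, (Sum.elim (fun _ => t⁻¹) (fun _ => 1) j : ℂ) = t⁻¹ ^ I.toLeft.card := by
    conv_lhs => rw [← toLeft_disjSum_toRight (u := I)]
    rw [prod_disjSum]; simp
  have h2 : I.toLeft.card ≤ Fintype.card κ := card_le_univ _
  rw [h1, inv_pow, ← div_eq_mul_inv, eq_div_iff (pow_ne_zero _ ht), ← pow_add,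
    Nat.sub_add_cancel h2]

theorem differentiableOn_scaledDet {U : Set ℂ} (hU : IsOpen U) {s₀ : ℂ}
    (hU1 : ∀ s ∈ U, ‖s - s₀‖ ≤ 1) {a b : κ ⊕ ι → ℝ} (ha : ∀ i, 0 ≤ a i)
    (hb : ∀ i, 0 ≤ b i) (hs : Summable fun i => √(a i * b i)) {N : ℂ → κ ⊕ ι → κ ⊕ ι → ℂ}
    (hN : ∀ s ∈ U, ∀ i j, ‖N s i j‖ ≤ a i * b j)
    (hd : ∀ i j, DifferentiableOn ℂ (fun s => N s i j) U) :
    DifferentiableOn ℂ (fun s => scaledDet (N s) (s - s₀)) U := by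
  refine differentiableOn_tsum_of_summable_norm (summable_fbound hs) (fun I => ?_) hU
    fun I s hsU => ?_
  · refine DifferentiableOn.mul (by fun_prop) (DifferentiableOn.mul (differentiableOn_const _) ?_)
    simp only [det_apply]
    refine DifferentiableOn.fun_sum fun σ _ => DifferentiableOn.const_smul ?_ _
    exact DifferentiableOn.fun_finsetProd fun i _ => hd _ _
  · rw [norm_mul, norm_pow]
    refine (mul_le_of_le_one_left (norm_nonneg _) (pow_le_one₀ (norm_nonneg _) (hU1 s hsU))).trans ?_
    exact norm_fterm_le ha hb hs (hN s hsU) I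

end Scaled

/-! ### Independence of the representation -/

section AbelBasis

/-- A biorthogonal-type system with respect to which every element is the limit of its Abel
means. -/
structure AbelBasis (X : Type*) [NormedAddCommGroup X] [NormedSpace ℂ X] (ι : Type*) where
  deg : ι → ℕ
  coeff : ι → X →L[ℂ] ℂ
  vec : ι → X
  norm_coeff_le : ∀ j, ‖coeff j‖ ≤ 1
  norm_vec_le : ∀ j, ‖vec j‖ ≤ 1
  summable_pow : ∀ t : ℝ, 0 ≤ t → t < 1 → Summable fun j => t ^ deg j
  mean : ℝ → X → X
  hasSum_mean : ∀ t : ℝ, 0 < t → t < 1 → ∀ f,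
    HasSum (fun j => ((t : ℂ) ^ deg j * coeff j f) • vec j) (mean t f)
  norm_mean_le : ∀ t : ℝ, 0 < t → t < 1 → ∀ f, ‖mean t f‖ ≤ ‖f‖
  tendsto_mean : ∀ f, Tendsto (fun t => mean t f) (𝓝[<] 1) (𝓝 f)

variable {X : Type*} [NormedAddCommGroup X] [NormedSpace ℂ X] {ι α : Type*}

theorem AbelBasis.tendsto_fdet (𝔅 : AbelBasis X ι) {L : X →L[ℂ] X} {φ : α → X →L[ℂ] ℂ} {e : α → X}
    (hs : Summable fun i => √(‖φ i‖ * ‖e i‖)) (hL : ∀ x, HasSum (fun i => φ i x • e i) (L x)) :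
    Tendsto (fun t : ℝ => fdet fun j k => (t : ℂ) ^ 𝔅.deg k * 𝔅.coeff j (L (𝔅.vec k))) (𝓝[<] 1)
    (𝓝 (fdet fun i j => φ i (e j))) := by
  have hlim : Tendsto (fun t : ℝ => fdet fun i j => φ i (𝔅.mean t (e j))) (𝓝[<] 1)
      (𝓝 (fdet fun i j => φ i (e j))) := by
    refine HeckeZeta.tendsto_fdet (a := fun i => ‖φ i‖) (b := fun j => ‖e j‖)
      (fun _ => norm_nonneg _) (fun _ => norm_nonneg _) hs ?_ fun i j => ?_
    · filter_upwards [Ioo_mem_nhdsLT (zero_lt_one' ℝ)] with t ht i j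
      exact ((φ i).le_opNorm _).trans
        (mul_le_mul_of_nonneg_left (𝔅.norm_mean_le t ht.1 ht.2 _) (norm_nonneg _))
    · exact ((φ i).continuous.tendsto _).comp (𝔅.tendsto_mean (e j))
  refine hlim.congr' ?_; filter_upwards [Ioo_mem_nhdsLT (zero_lt_one' ℝ)] with t ht
  have h1 := fdet_mul_comm (a := fun i => ‖φ i‖) (b := fun j => ‖e j‖)
    (u := fun k => t ^ 𝔅.deg k) (v := fun _ => 1) (A := fun i k => (t : ℂ) ^ 𝔅.deg k * φ i (𝔅.vec k))
    (B := fun k j => 𝔅.coeff k (e j)) (fun _ => norm_nonneg _) (fun _ => norm_nonneg _)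
    (fun k => pow_nonneg ht.1.le _) (fun _ => zero_le_one) hs ?_ ?_ ?_
  · refine Eq.trans ?_ (h1.trans ?_)
    · congr 1; funext i j; have h2 := (𝔅.hasSum_mean t ht.1 ht.2 (e j)).mapL (φ i)
      rw [← h2.tsum_eq]; refine tsum_congr fun k => ?_; rw [map_smul, smul_eq_mul]; ring
    · congr 1; funext k l; have h2 := ((hL (𝔅.vec l)).mapL (𝔅.coeff k)).mul_left ((t : ℂ) ^ 𝔅.deg l)
      rw [← h2.tsum_eq]; refine tsum_congr fun i => ?_; rw [map_smul, smul_eq_mul]; ring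
  · have h3 := 𝔅.summable_pow (√t) (sqrt_nonneg t)
      ((sqrt_lt' one_pos).2 (by simpa using ht.2))
    refine h3.congr fun k => ?_
    rw [mul_one, eq_comm, sqrt_eq_iff_mul_self_eq (pow_nonneg ht.1.le _)
      (pow_nonneg (sqrt_nonneg _) _), ← mul_pow, mul_self_sqrt ht.1.le]
  · intro i k; rw [norm_mul, norm_pow, norm_real, norm_of_nonneg ht.1.le, mul_comm]
    refine mul_le_mul_of_nonneg_right ?_ (pow_nonneg ht.1.le _)
    exact ((φ i).le_opNorm _).trans (mul_le_of_le_one_right (norm_nonneg _) (𝔅.norm_vec_le k))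
  · intro k j
    exact ((𝔅.coeff k).le_opNorm _).trans
      (mul_le_mul_of_nonneg_right (𝔅.norm_coeff_le k) (norm_nonneg _))

theorem repDet_eq_fdet (φ : ℕ → X →L[ℂ] ℂ) (e : ℕ → X) :
    repDet φ e = fdet fun i j => φ i (e j) := by
  unfold repDet fdet fterm; refine tsum_congr fun I => ?_
  congr!

/-- On a space with an Abel basis the Fredholm determinant may be computed from any
representation. -/
theorem AbelBasis.fredholmDet_eq (𝔅 : AbelBasis X ι) {L : X →L[ℂ] X} (hN : IsNuclearOrderZero L)
    {φ : α → X →L[ℂ] ℂ} {e : α → X} (hs : Summable fun i => √(‖φ i‖ * ‖e i‖))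
    (hL : ∀ x, HasSum (fun i => φ i x • e i) (L x)) :
    fredholmDet L = fdet fun i j => φ i (e j) := by
  rw [fredholmDet, dif_pos hN, repDet_eq_fdet]; have h := hN.choose_spec.choose_spec
  refine tendsto_nhds_unique (𝔅.tendsto_fdet ?_ h.2) (𝔅.tendsto_fdet hs hL)
  simpa only [sqrt_eq_rpow] using h.1 (1 / 2) (by norm_num)

theorem isNuclearOrderZero_of_countable [Countable α] {L : X →L[ℂ] X} {φ : α → X →L[ℂ] ℂ}
    {e : α → X} (hs : ∀ p : ℝ, 0 < p → Summable fun i => (‖φ i‖ * ‖e i‖) ^ p)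
    (hL : ∀ x, HasSum (fun i => φ i x • e i) (L x)) : IsNuclearOrderZero L := by
  obtain ⟨E⟩ : Nonempty (ℕ ≃ α ⊕ ℕ) := nonempty_equiv_of_countable
  have hr : ∀ x, x ∉ Set.range (Sum.inl : α → α ⊕ ℕ) → ∃ n, x = Sum.inr n := by
    rintro (a | n) h
    · exact absurd ⟨a, rfl⟩ h
    · exact ⟨n, rfl⟩
  refine ⟨fun n => Sum.elim φ 0 (E n), fun n => Sum.elim e 0 (E n), fun p hp => ?_, fun x => ?_⟩
  · refine (E.summable_iff (f := fun a : α ⊕ ℕ =>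
      (‖(Sum.elim φ 0 a : X →L[ℂ] ℂ)‖ * ‖(Sum.elim e 0 a : X)‖) ^ p)).2 ?_
    rw [← Injective.summable_iff (Sum.inl_injective (α := α) (β := ℕ))]
    · exact hs p hp
    · intro a ha; obtain ⟨n, rfl⟩ := hr a ha; simp [zero_rpow hp.ne']
  · refine (E.hasSum_iff (f := fun a : α ⊕ ℕ =>
      (Sum.elim φ 0 a : X →L[ℂ] ℂ) x • (Sum.elim e 0 a : X))).2 ?_
    rw [← Injective.hasSum_iff (Sum.inl_injective (α := α) (β := ℕ))]
    · exact hL x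
    · intro a ha; obtain ⟨n, rfl⟩ := hr a ha; simp

end AbelBasis

/-! ### The spaces of holomorphic functions on discs -/

section Disc

variable {V : Type*} [NormedAddCommGroup V] [InnerProductSpace ℂ V] {c r : ℝ}

theorem ext0_apply (f : C(𝔻(c, r), V)) {z : ℂ} (hz : z ∈ 𝔻(c, r)) : ext0 f z = f ⟨z, hz⟩ := by
  simp only [ext0, dif_pos hz]

theorem ext0_coe (f : C(𝔻(c, r), V)) (z : 𝔻(c, r)) : ext0 f z = f z := ext0_apply f z.2

theorem continuousOn_ext0 (f : C(𝔻(c, r), V)) : ContinuousOn (ext0 f) 𝔻(c, r) := by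
  rw [continuousOn_iff_continuous_domRestrict]; convert f.continuous using 1; funext z
  exact ext0_coe f z

theorem norm_ext0_le (f : C(𝔻(c, r), V)) (z : ℂ) : ‖ext0 f z‖ ≤ ‖f‖ := by
  by_cases hz : z ∈ 𝔻(c, r)
  · rw [ext0_apply f hz]; exact f.norm_coe_le_norm _
  · simp [ext0, hz]

theorem ext0_add (f g : C(𝔻(c, r), V)) (z : ℂ) : ext0 (f + g) z = ext0 f z + ext0 g z := by
  by_cases hz : z ∈ 𝔻(c, r) <;> simp [ext0, hz]

theorem ext0_smul (a : ℂ) (f : C(𝔻(c, r), V)) (z : ℂ) : ext0 (a • f) z = a • ext0 f z := by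
  by_cases hz : z ∈ 𝔻(c, r) <;> simp [ext0, hz]

theorem diffContOnCl_ext0 (f : DiscSpace V c r) : DiffContOnCl ℂ (ext0 f.1) (ball (c : ℂ) r) :=
  ⟨f.2, (continuousOn_ext0 f.1).mono closure_ball_subset_closedBall⟩

theorem isClosed_discSpace [CompleteSpace V] : IsClosed (DiscSpace V c r : Set C(𝔻(c, r), V)) := by
  refine IsSeqClosed.isClosed fun f g hf hfg => ?_
  rw [ContinuousMap.tendsto_iff_tendstoUniformly] at hfg
  change DifferentiableOn ℂ (ext0 g) (ball (c : ℂ) r)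
  have h : TendstoLocallyUniformlyOn (fun n => ext0 (f n)) (ext0 g) atTop
      (ball (c : ℂ) r) := by
    refine TendstoUniformlyOn.tendstoLocallyUniformlyOn ?_; rw [tendstoUniformly_iff] at hfg
    rw [tendstoUniformlyOn_iff]; intro ε hε; filter_upwards [hfg ε hε] with n hn z hz
    rw [ext0_apply _ (ball_subset_closedBall hz),
      ext0_apply _ (ball_subset_closedBall hz)]
    exact hn _
  exact h.differentiableOn (Eventually.of_forall fun n => hf n) isOpen_ball

instance [CompleteSpace V] : CompleteSpace (DiscSpace V c r) := isClosed_discSpace.completeSpace_coe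

open scoped Classical in
/-- The element of the disc space given by a function which is continuous on the closed disc and
holomorphic inside. -/
def toDisc (V : Type*) [NormedAddCommGroup V] [InnerProductSpace ℂ V] (c r : ℝ)
    (g : ℂ → V) : DiscSpace V c r :=
  if h : ContinuousOn g 𝔻(c, r) ∧
      DifferentiableOn ℂ g (ball (c : ℂ) r) then
    ⟨⟨fun z => g z, continuousOn_iff_continuous_domRestrict.1 h.1⟩, by
      refine h.2.congr fun z hz => ?_; rw [ext0_apply _ (ball_subset_closedBall hz)]
      rfl⟩
  else 0

theorem toDisc_apply {g : ℂ → V} (h1 : ContinuousOn g 𝔻(c, r))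
    (h2 : DifferentiableOn ℂ g (ball (c : ℂ) r)) (z : 𝔻(c, r)) : (toDisc V c r g).1 z = g z := by
  rw [toDisc, dif_pos ⟨h1, h2⟩]
  rfl

theorem norm_toDisc_le {g : ℂ → V} {C : ℝ} (hC : 0 ≤ C)
    (h : ∀ z ∈ 𝔻(c, r), ‖g z‖ ≤ C) : ‖toDisc V c r g‖ ≤ C := by
  rw [toDisc]
  split_ifs with hg
  · exact (ContinuousMap.norm_le _ hC).2 fun z => h z z.2
  · simpa using hC

theorem discSpace_ext {f g : DiscSpace V c r} (h : ∀ z, f.1 z = g.1 z) : f = g :=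
  Subtype.ext (ContinuousMap.ext h)

theorem norm_discSpace_le {f : DiscSpace V c r} {C : ℝ} (hC : 0 ≤ C)
    (h : ∀ z, ‖f.1 z‖ ≤ C) : ‖f‖ ≤ C :=
  (ContinuousMap.norm_le _ hC).2 h

theorem norm_discSpace_apply_le (f : DiscSpace V c r) (z : 𝔻(c, r)) :
    ‖f.1 z‖ ≤ ‖f‖ := f.1.norm_coe_le_norm z

/-- Evaluation at a point of the closed disc. -/
def evalDisc (z : 𝔻(c, r)) : DiscSpace V c r →L[ℂ] V :=
  mkContinuous
    { toFun := fun f => f.1 z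
      map_add' := fun _ _ => rfl
      map_smul' := fun _ _ => rfl } 1 fun f => by simpa using norm_discSpace_apply_le f z

@[simp]
theorem evalDisc_apply (z : 𝔻(c, r)) (f : DiscSpace V c r) : evalDisc z f = f.1 z := rfl

/-- The Taylor coefficients at the centre, with respect to the monomials `((z - c) / r) ^ m`. -/
def taylor [CompleteSpace V] (hr : 0 < r) (m : ℕ) : DiscSpace V c r →L[ℂ] V :=
  mkContinuous
    { toFun := fun f => cauchyPowerSeries (ext0 f.1) c r m fun _ => (r : ℂ)
      map_add' := fun f g => by
        have hi : ∀ f : DiscSpace V c r,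
            CircleIntegrable (fun z => ((r : ℂ) / (z - c)) ^ m • (z - c)⁻¹ • ext0 f.1 z) c r := by
          intro f; refine ContinuousOn.circleIntegrable hr.le ?_
          have h0 : ∀ z ∈ sphere (c : ℂ) r, z - c ≠ 0 := fun z hz h => by
            rw [mem_sphere_iff_norm, h, norm_zero] at hz; exact hr.ne hz
          have h1 := (continuousOn_ext0 f.1).mono sphere_subset_closedBall
          refine ContinuousOn.smul ?_ (ContinuousOn.smul ?_ h1)
          · exact (ContinuousOn.div continuousOn_const (by fun_prop) h0).pow m
          · exact ContinuousOn.inv₀ (by fun_prop) h0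
        simp only [cauchyPowerSeries_apply]
        rw [← smul_add, ← circleIntegral.integral_add (hi f) (hi g)]; congr 2; funext z
        change _ • _ • ext0 (f.1 + g.1) z = _; rw [ext0_add, smul_add, smul_add]
      map_smul' := fun a f => by
        simp only [cauchyPowerSeries_apply, RingHom.id_apply]
        rw [smul_comm a, ← circleIntegral.integral_smul a]; congr 2; funext z
        change _ • _ • ext0 (a • f.1) z = _
        rw [ext0_smul, smul_comm a, smul_comm a] } 1 fun f => by
    simp only [LinearMap.coe_mk, AddHom.coe_mk, cauchyPowerSeries_apply, one_mul]
    have h := circleIntegral.norm_two_pi_i_inv_smul_integral_le_of_norm_le_const (c := (c : ℂ))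
      (f := fun z => ((r : ℂ) / (z - c)) ^ m • (z - c)⁻¹ • ext0 f.1 z) (C := ‖f‖ / r) hr.le
      fun z hz => by
        rw [mem_sphere_iff_norm] at hz
        rw [norm_smul, norm_smul, norm_pow, norm_div, norm_inv, hz, norm_real,
          norm_of_nonneg hr.le, div_self hr.ne', one_pow, one_mul, inv_mul_eq_div]
        exact div_le_div_of_nonneg_right (norm_ext0_le f.1 z) hr.le
    rwa [mul_div_cancel₀ _ hr.ne'] at h

theorem norm_taylor_le [CompleteSpace V] (hr : 0 < r) (m : ℕ) :
    ‖(taylor hr m : DiscSpace V c r →L[ℂ] V)‖ ≤ 1 :=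
  mkContinuous_norm_le _ zero_le_one _

theorem taylor_eq_circleIntegral [CompleteSpace V] (hr : 0 < r) (m : ℕ) (f : DiscSpace V c r) :
    taylor hr m f = (2 * π * Complex.I : ℂ)⁻¹ •
    ∮ z in C(c, r), ((r : ℂ) / (z - c)) ^ m • (z - c)⁻¹ • ext0 f.1 z := by
  change cauchyPowerSeries (ext0 f.1) c r m (fun _ => (r : ℂ)) = _; rw [cauchyPowerSeries_apply]

theorem hasSum_taylor [CompleteSpace V] (hr : 0 < r) (f : DiscSpace V c r) {z : ℂ}
    (hz : z ∈ ball (c : ℂ) r) :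
    HasSum (fun m => ((z - c) / r) ^ m • taylor hr m f) (ext0 f.1 z) := by
  lift r to NNReal using hr.le
  have h := (diffContOnCl_ext0 f).hasFPowerSeriesOnBall (R := r) (by exact_mod_cast hr)
  have h2 := h.hasSum (y := z - c) (by
    rw [mem_eball, edist_zero_right]; rw [mem_ball_iff_norm] at hz
    rw [← ofReal_norm, ← ENNReal.ofReal_coe_nnreal]; exact (ENNReal.ofReal_lt_ofReal_iff hr).2 hz)
  rw [add_sub_cancel] at h2; convert h2 using 2 with m
  have h3 := (cauchyPowerSeries (ext0 f.1) c r m).map_smul_univ (fun _ => (z - c) / (r : ℂ))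
    fun _ => (r : ℂ)
  have hr' : ((r : ℝ) : ℂ) ≠ 0 := by exact_mod_cast hr.ne'
  simp only [smul_eq_mul, div_mul_cancel₀ _ hr', prod_const, card_univ,
    Fintype.card_fin] at h3
  rw [h3]
  rfl

/-- The monomial `((z - c) / r) ^ m • v`. -/
def mono (c r : ℝ) (m : ℕ) (v : V) : DiscSpace V c r := toDisc V c r fun z => ((z - c) / r) ^ m • v

theorem mono_apply (m : ℕ) (v : V) (z : 𝔻(c, r)) :
    (mono c r m v).1 z = (((z : ℂ) - c) / r) ^ m • v :=
  toDisc_apply (by fun_prop) (by fun_prop) z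

theorem norm_mono_le (hr : 0 < r) (m : ℕ) (v : V) : ‖mono c r m v‖ ≤ ‖v‖ := by
  refine norm_discSpace_le (norm_nonneg _) fun z => ?_
  rw [mono_apply, norm_smul, norm_pow, norm_div, norm_real, norm_of_nonneg hr.le]
  refine mul_le_of_le_one_left (norm_nonneg _) (pow_le_one₀ (by positivity) ?_)
  exact (div_le_one hr).2 (mem_closedBall_iff_norm.1 z.2)

end Disc

section DiscParam

variable {V : Type*} [NormedAddCommGroup V] [InnerProductSpace ℂ V] {c r : ℝ}

theorem continuousOn_toDisc {U : Set ℂ} {F : ℂ → ℂ → V}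
    (hF : ContinuousOn (fun p : ℂ × ℂ => F p.1 p.2) (U ×ˢ 𝔻(c, r)))
    (hz : ∀ s ∈ U, DifferentiableOn ℂ (F s) (ball (c : ℂ) r)) :
    ContinuousOn (fun s => toDisc V c r (F s)) U := by
  have hc : ∀ s ∈ U, ContinuousOn (F s) 𝔻(c, r) := fun s hs =>
    hF.comp (f := fun z => (s, z)) (by fun_prop) fun z hz => ⟨hs, hz⟩
  rw [continuousOn_iff_continuous_domRestrict, Topology.IsInducing.subtypeVal.continuous_iff]
  refine ContinuousMap.continuous_of_continuous_uncurry _ ?_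
  exact (hF.comp_continuous (f := fun p : U × 𝔻(c, r) => ((p.1 : ℂ), (p.2 : ℂ)))
    (by fun_prop) fun p => ⟨p.1.2, p.2.2⟩).congr
    fun p => (toDisc_apply (hc p.1 p.1.2) (hz p.1 p.1.2) p.2).symm

/-- A continuous Banach-valued function is holomorphic as soon as it is holomorphic after
composition with the members of a separating family of continuous linear maps. -/
theorem differentiableOn_of_separating {E F κ : Type*} [NormedAddCommGroup E] [NormedSpace ℂ E]
    [CompleteSpace E] [NormedAddCommGroup F] [NormedSpace ℂ F] [CompleteSpace F]
    (ℓ : κ → E →L[ℂ] F) (hℓ : ∀ x y, (∀ k, ℓ k x = ℓ k y) → x = y) {U : Set ℂ} (hU : IsOpen U)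
    {Y : ℂ → E} (hY : ContinuousOn Y U) (hd : ∀ k, DifferentiableOn ℂ (fun s => ℓ k (Y s)) U) :
    DifferentiableOn ℂ Y U := by
  intro s₀ hs₀; obtain ⟨R, hR, hRU⟩ := nhds_basis_closedBall.mem_iff.1 (hU.mem_nhds hs₀)
  have hsph : ContinuousOn Y (sphere s₀ R) := hY.mono (sphere_subset_closedBall.trans hRU)
  have hcirc := hsph.circleIntegrable hR.le
  lift R to NNReal using hR.le
  have hps := hasFPowerSeriesOn_cauchy_integral hcirc (by exact_mod_cast hR)
  have heq : ∀ w ∈ ball s₀ (R : ℝ), ((2 * π * Complex.I : ℂ)⁻¹ •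
      ∮ z in C(s₀, R), (z - w)⁻¹ • Y z) = Y w := by
    intro w hw; refine hℓ _ _ fun k => ?_
    have hci : CircleIntegrable (fun z => (z - w)⁻¹ • Y z) s₀ R := by
      refine ContinuousOn.circleIntegrable hR.le
        (ContinuousOn.smul (f := fun z => (z - w)⁻¹) ?_ hsph)
      refine ContinuousOn.inv₀ (by fun_prop) fun x hx h => ?_
      rw [sub_eq_zero] at h; rw [h, mem_sphere_iff_norm] at hx; rw [mem_ball_iff_norm] at hw
      exact hw.ne hx
    have h1 := intervalIntegral_comp_comm (ℓ k) hci.out; rw [map_smul, circleIntegral, ← h1]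
    have h2 : DiffContOnCl ℂ (fun s => ℓ k (Y s)) (ball s₀ R) :=
      DifferentiableOn.diffContOnCl ((hd k).mono (closure_ball_subset_closedBall.trans hRU))
    rw [← h2.two_pi_i_inv_smul_circleIntegral_sub_inv_smul hw, circleIntegral]
    simp only [map_smul]
  refine (hps.analyticAt.differentiableAt.congr_of_eventuallyEq ?_).differentiableWithinAt
  filter_upwards [ball_mem_nhds s₀ hR] with w hw using (heq w hw).symm

theorem differentiableOn_toDisc [CompleteSpace V] {U : Set ℂ} (hU : IsOpen U) {F : ℂ → ℂ → V}
    (hF : ContinuousOn (fun p : ℂ × ℂ => F p.1 p.2) (U ×ˢ 𝔻(c, r)))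
    (hs : ∀ z ∈ 𝔻(c, r), DifferentiableOn ℂ (fun s => F s z) U)
    (hz : ∀ s ∈ U, DifferentiableOn ℂ (F s) (ball (c : ℂ) r)) :
    DifferentiableOn ℂ (fun s => toDisc V c r (F s)) U := by
  have hc : ∀ s ∈ U, ContinuousOn (F s) 𝔻(c, r) := fun s hs =>
    hF.comp (f := fun z => (s, z)) (by fun_prop) fun z hz => ⟨hs, hz⟩
  refine differentiableOn_of_separating (fun z => evalDisc (V := V) (c := c) (r := r) z)
    (fun f g h => discSpace_ext h) hU (continuousOn_toDisc hF hz) fun z => ?_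
  exact (hs z z.2).congr fun s hs => toDisc_apply (hc s hs) (hz s hs) z

section ParametricIntegral

variable {E : Type*} [NormedAddCommGroup E] [NormedSpace ℂ E]

theorem continuousOn_integral_param {X : Type*} [TopologicalSpace X] [FirstCountableTopology X]
    {S : Set X} {l : ℝ} (hl : 0 ≤ l) {F : X → ℝ → E}
    (hF : ContinuousOn (fun p : X × ℝ => F p.1 p.2) (S ×ˢ Set.Icc 0 l)) :
    ContinuousOn (fun x => ∫ u in (0 : ℝ)..l, F x u) S := by
  rw [continuousOn_iff_continuous_domRestrict]
  have h1 : Continuous (uncurry fun (x : S) (u : ℝ) => F x (projIcc 0 l hl u)) :=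
    hF.comp_continuous
      (f := fun p : S × ℝ => ((p.1 : X), ((projIcc 0 l hl p.2 : Set.Icc 0 l) : ℝ)))
      (by fun_prop) fun p => ⟨p.1.2, (projIcc 0 l hl p.2).2⟩
  have h2 := intervalIntegral.continuous_parametric_intervalIntegral_of_continuous'
    (μ := MeasureTheory.volume) h1 0 l
  convert h2 using 1; funext x; refine intervalIntegral.integral_congr fun u hu => ?_
  rw [Set.uIcc_of_le hl] at hu; simp [projIcc_of_mem hl hu]

/-- Integration over `[0, l]` as a continuous linear map. -/
def integralCLM (E : Type*) [NormedAddCommGroup E] [NormedSpace ℂ E] {l : ℝ}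
    (hl : 0 ≤ l) : C(Set.Icc (0 : ℝ) l, E) →L[ℂ] E :=
  have hc : ∀ f : C(Set.Icc (0 : ℝ) l, E), Continuous fun u => f (projIcc 0 l hl u) :=
    fun f => by fun_prop
  mkContinuous
    { toFun := fun f => ∫ u in (0 : ℝ)..l, f (projIcc 0 l hl u)
      map_add' := fun f g => intervalIntegral.integral_add ((hc f).intervalIntegrable _ _)
        ((hc g).intervalIntegrable _ _)
      map_smul' := fun a f => intervalIntegral.integral_smul a _ } l fun f => by
    have h := intervalIntegral.norm_integral_le_of_norm_le_const (a := 0) (b := l) (C := ‖f‖)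
      (f := fun u => f (projIcc 0 l hl u)) fun u _ => f.norm_coe_le_norm _
    rw [sub_zero, abs_of_nonneg hl, mul_comm] at h; exact h

theorem differentiableOn_integral_param [CompleteSpace E] {U : Set ℂ} (hU : IsOpen U) {l : ℝ}
    (hl : 0 ≤ l) {F : ℂ → ℝ → E} (hF : ContinuousOn (fun p : ℂ × ℝ => F p.1 p.2) (U ×ˢ Set.Icc 0 l))
    (hs : ∀ u ∈ Set.Icc 0 l, DifferentiableOn ℂ (fun s => F s u) U) :
    DifferentiableOn ℂ (fun s => ∫ u in (0 : ℝ)..l, F s u) U := by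
  classical
  let Y : ℂ → C(Set.Icc (0 : ℝ) l, E) := fun s => if h : ContinuousOn (F s) (Set.Icc 0 l) then
      ⟨fun u => F s u, continuousOn_iff_continuous_domRestrict.1 h⟩ else 0
  have hc : ∀ s ∈ U, ContinuousOn (F s) (Set.Icc 0 l) := fun s hs =>
    hF.comp (f := fun u => (s, u)) (by fun_prop) fun u hu => ⟨hs, hu⟩
  have hYe : ∀ s ∈ U, ∀ u, Y s u = F s u := fun s hs u => by simp only [Y, dif_pos (hc s hs)]; rfl
  have hYc : ContinuousOn Y U := by
    rw [continuousOn_iff_continuous_domRestrict]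
    refine ContinuousMap.continuous_of_continuous_uncurry _ ?_
    exact (hF.comp_continuous (f := fun p : U × Set.Icc (0 : ℝ) l => ((p.1 : ℂ), (p.2 : ℝ)))
      (by fun_prop) fun p => ⟨p.1.2, p.2.2⟩).congr fun p => (hYe p.1 p.1.2 p.2).symm
  have hYd : DifferentiableOn ℂ Y U := by
    refine differentiableOn_of_separating
      (fun u => ContinuousMap.evalCLM ℂ u) (fun f g h => ContinuousMap.ext h) hU hYc fun u => ?_
    exact (hs u u.2).congr fun s hs => hYe s hs u
  have h := (integralCLM E hl).differentiable.comp_differentiableOn hYd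
  refine h.congr fun s hs => ?_; change _ = ∫ u in (0 : ℝ)..l, Y s (projIcc 0 l hl u)
  refine intervalIntegral.integral_congr fun u hu => ?_; rw [Set.uIcc_of_le hl] at hu
  simp only [hYe s hs, projIcc_of_mem hl hu]

end ParametricIntegral

theorem norm_taylor_apply_le [CompleteSpace V] (hr : 0 < r) (m : ℕ)
    (f : DiscSpace V c r) : ‖taylor hr m f‖ ≤ ‖f‖ := by
  exact (le_opNorm _ f).trans (mul_le_of_le_one_left (norm_nonneg _) (norm_taylor_le hr m))

end DiscParam

section Basis

variable {V : Type*} [NormedAddCommGroup V] [InnerProductSpace ℂ V] [FiniteDimensional ℂ V]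
  [CompleteSpace V] {c r : Fin 3 → ℝ}

/-- The index set of the monomial basis: degree, disc, coordinate. -/
abbrev Idx (V : Type*) [NormedAddCommGroup V] [InnerProductSpace ℂ V] : Type :=
  ℕ × Fin 3 × Fin (finrank ℂ V)

/-- The coefficient functionals. -/
def coeffB (hr : ∀ i, 0 < r i) (j : Idx V) : BSpace V c r →L[ℂ] ℂ :=
  (innerSL ℂ (𝔟 V j.2.2)).comp
    ((taylor (hr j.2.1) j.1).comp (ContinuousLinearMap.proj j.2.1))

theorem coeffB_apply (hr : ∀ i, 0 < r i) (j : Idx V) (f : BSpace V c r) :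
    coeffB hr j f = inner ℂ (𝔟 V j.2.2) (taylor (hr j.2.1) j.1 (f j.2.1)) := rfl

/-- The monomials. -/
def vecB (c r : Fin 3 → ℝ) (j : Idx V) : BSpace V c r :=
  Pi.single j.2.1 (mono (c j.2.1) (r j.2.1) j.1 (𝔟 V j.2.2))

theorem norm_coeffB_le (hr : ∀ i, 0 < r i) (j : Idx V) : ‖coeffB (c := c) hr j‖ ≤ 1 := by
  refine opNorm_le_bound _ zero_le_one fun f => ?_; rw [coeffB_apply, one_mul]
  refine (norm_inner_le_norm _ _).trans ?_; rw [OrthonormalBasis.norm_eq_one, one_mul]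
  exact (norm_taylor_apply_le _ _ _).trans (norm_le_pi_norm f _)

theorem norm_vecB_le (hr : ∀ i, 0 < r i) (j : Idx V) : ‖vecB c r j‖ ≤ 1 := by
  rw [vecB, Pi.norm_single]
  exact (norm_mono_le (hr _) _ _).trans (by rw [OrthonormalBasis.norm_eq_one])

theorem summable_pow_deg {t : ℝ} (h0 : 0 ≤ t) (h1 : t < 1) : Summable fun j : Idx V => t ^ j.1 := by
  have h := (summable_geometric_of_lt_one h0 h1).mul_of_nonneg
    (g := fun _ : Fin 3 × Fin (finrank ℂ V) => (1 : ℝ))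
    (Summable.of_finite) (fun n => pow_nonneg h0 n) (fun _ => zero_le_one)
  simpa using h

/-- The Taylor series of the components of an element of `B(𝓔; V)`. -/
theorem hasSum_coeffB (hr : ∀ i, 0 < r i) (f : BSpace V c r) (i : Fin 3) {z w : ℂ}
    (hw : w ∈ ball (c i : ℂ) (r i)) (g : V →L[ℂ] V) {t : ℂ}
    (hz : (w - c i) / r i = t * ((z - c i) / r i))
    (hs : Summable fun j : Idx V => (t ^ j.1 * coeffB hr j f) •
    (if j.2.1 = i then ((z - c i) / r i) ^ j.1 • g (𝔟 V j.2.2) else 0)) :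
    HasSum (fun j : Idx V => (t ^ j.1 * coeffB hr j f) •
    (if j.2.1 = i then ((z - c i) / r i) ^ j.1 • g (𝔟 V j.2.2) else 0)) (g (ext0 (f i).1 w)) := by
  have h1 := (hasSum_taylor (hr i) (f i) hw).mapL g; refine (hs.hasSum_iff).2 ?_
  refine (HasSum.unique ?_ h1); refine hs.hasSum.prod_fiberwise fun m => ?_
  have h2 : ((w - c i) / r i) ^ m • taylor (hr i) m (f i) = ∑ l, (((w - c i) / r i) ^ m *
      inner ℂ (𝔟 V l) (taylor (hr i) m (f i))) • 𝔟 V l := by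
    conv_lhs => rw [← (𝔟 V).sum_repr' (taylor (hr i) m (f i))]
    rw [Finset.smul_sum]; exact Finset.sum_congr rfl fun l _ => by rw [smul_smul]
  rw [h2, map_sum]
  have h3 := hasSum_fintype (fun p : Fin 3 × Fin (finrank ℂ V) =>
    (t ^ m * coeffB hr (m, p) f) • (if p.1 = i then ((z - c i) / r i) ^ m •
      g (𝔟 V p.2) else 0))
  convert h3 using 1; rw [sum_prod_type, Finset.sum_eq_single i]
  · refine Finset.sum_congr rfl fun l _ => ?_
    rw [if_pos rfl, hz, mul_pow, coeffB_apply, map_smul, smul_smul]; congr 1; ring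
  · intro b _ hb; simp [hb]
  · simp

theorem vecB_apply (j : Idx V) (i : Fin 3) (z : 𝔻(c i, r i)) :
    (vecB c r j i).1 z = if j.2.1 = i then (((z : ℂ) - c i) / r i) ^ j.1 • 𝔟 V j.2.2 else 0 := by
  obtain ⟨m, i', l⟩ := j; by_cases h : i' = i
  · subst h; rw [if_pos rfl, vecB, Pi.single_eq_same, mono_apply]
  · rw [if_neg h, vecB, Pi.single_eq_of_ne (Ne.symm h)]; rfl

theorem dilate_mem {c r t : ℝ} (hr : 0 < r) (h0 : 0 ≤ t) (h1 : t < 1) {z : ℂ}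
    (hz : z ∈ 𝔻(c, r)) : (c : ℂ) + t * (z - c) ∈ ball (c : ℂ) r := by
  rw [mem_closedBall_iff_norm] at hz
  rw [mem_ball_iff_norm, add_sub_cancel_left, norm_mul, norm_real, norm_of_nonneg h0]
  nlinarith [norm_nonneg (z - c)]

theorem dilate_mem' {c r t : ℝ} (h0 : 0 ≤ t) (h1 : t ≤ 1) {z : ℂ} (hz : z ∈ 𝔻(c, r)) :
    (c : ℂ) + t * (z - c) ∈ 𝔻(c, r) := by
  rw [mem_closedBall_iff_norm] at hz
  rw [mem_closedBall_iff_norm, add_sub_cancel_left, norm_mul, norm_real,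
    norm_of_nonneg h0]
  exact (mul_le_of_le_one_left (norm_nonneg _) h1).trans hz

/-- The dilation `f (c + t (z - c))`. -/
def dilate (t : ℝ) (f : BSpace V c r) : BSpace V c r := fun i =>
  toDisc V (c i) (r i) fun z => ext0 (f i).1 (c i + t * (z - c i))

theorem dilate_apply (hr : ∀ i, 0 < r i) {t : ℝ} (h0 : 0 ≤ t) (h1 : t < 1) (f : BSpace V c r)
    (i : Fin 3) (z : 𝔻(c i, r i)) : (dilate t f i).1 z = ext0 (f i).1 (c i + t * (z - c i)) := by
  refine toDisc_apply (g := fun z => ext0 (f i).1 (c i + t * (z - c i)))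
    ((continuousOn_ext0 (f i).1).comp (by fun_prop) fun z hz => ?_)
    (DifferentiableOn.comp (t := ball (c i : ℂ) (r i)) (f i).2 (by fun_prop)
      fun z hz => ?_) z
  · exact dilate_mem' h0 h1.le hz
  · exact dilate_mem (hr i) h0 h1 (ball_subset_closedBall hz)

/-- The monomials form an Abel basis of `B(𝓔; V)`. -/
def discBasis (hr : ∀ i, 0 < r i) : AbelBasis (BSpace V c r) (Idx V) where
  deg j := j.1
  coeff := coeffB hr
  vec := vecB c r
  norm_coeff_le := norm_coeffB_le hr
  norm_vec_le := norm_vecB_le hr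
  summable_pow t h0 h1 := summable_pow_deg h0 h1
  mean := dilate
  hasSum_mean t h0 h1 f := by
    have hs : Summable fun j : Idx V => ((t : ℂ) ^ j.1 * coeffB hr j f) • vecB c r j := by
      refine ((summable_pow_deg (V := V) h0.le h1).mul_right ‖f‖).of_norm_bounded fun j => ?_
      rw [norm_smul, norm_mul, norm_pow, norm_real, norm_of_nonneg h0.le]
      refine (mul_le_of_le_one_right (by positivity) (norm_vecB_le hr j)).trans ?_
      refine mul_le_mul_of_nonneg_left ?_ (by positivity)
      exact ((coeffB hr j).le_opNorm f).trans
        (mul_le_of_le_one_left (norm_nonneg _) (norm_coeffB_le hr j))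
    rw [hs.hasSum_iff]; refine funext fun i => discSpace_ext fun z => ?_
    have h2 := (hs.hasSum.mapL (ContinuousLinearMap.proj (R := ℂ)
      (φ := fun i => DiscSpace V (c i) (r i)) i)).mapL (evalDisc (V := V) z)
    simp only [map_smul, ContinuousLinearMap.proj_apply, evalDisc_apply, vecB_apply] at h2
    have h3 := hasSum_coeffB (c := c) hr f i (z := z) (dilate_mem (hr i) h0.le h1 z.2)
      (ContinuousLinearMap.id ℂ V) (t := t) (by rw [add_sub_cancel_left, mul_div_assoc]) h2.summable
    rw [dilate_apply hr h0.le h1]; exact h2.unique h3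
  norm_mean_le t h0 h1 f := by
    refine (pi_norm_le_iff_of_nonneg (norm_nonneg f)).2 fun i => ?_
    exact norm_toDisc_le (norm_nonneg _) fun z _ => (norm_ext0_le _ _).trans (norm_le_pi_norm f i)
  tendsto_mean f := by
    refine tendsto_pi_nhds.2 fun i => ?_; rw [Topology.IsInducing.subtypeVal.tendsto_nhds_iff]
    set K := 𝔻(c i, r i); let cl : ℝ → ℝ := fun t => max 0 (min t 1)
    have hcl : ∀ t, 0 ≤ cl t ∧ cl t ≤ 1 := fun t =>
      ⟨le_max_left _ _, max_le zero_le_one (min_le_right _ _)⟩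
    let D : ℝ → C(K, V) := fun t =>
      ⟨fun z => (f i).1 ⟨c i + cl t * (z - c i), dilate_mem' (hcl t).1 (hcl t).2 z.2⟩, by fun_prop⟩
    have hD : Continuous D := by
      refine ContinuousMap.continuous_of_continuous_uncurry _ ?_
      change Continuous fun p : ℝ × K =>
        (f i).1 ⟨c i + cl p.1 * (p.2 - c i), dilate_mem' (hcl p.1).1 (hcl p.1).2 p.2.2⟩
      refine (f i).1.continuous.comp (Continuous.subtype_mk ?_ _); fun_prop
    have h1 : D 1 = (f i).1 := by ext z; simp [D, cl]
    rw [← h1]; refine ((hD.tendsto 1).mono_left nhdsWithin_le_nhds).congr' ?_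
    filter_upwards [Ioo_mem_nhdsLT (zero_lt_one' ℝ)] with t ht; ext z
    have h2 : cl t = t := by simp [cl, ht.1.le, ht.2.le]
    change _ = (dilate t f i).1 z
    have h3 : (c i : ℂ) + t * (z - c i) = c i + cl t * (z - c i) := by rw [h2]
    rw [dilate_apply hr ht.1.le ht.2, h3, ext0_apply _ (dilate_mem' (hcl t).1 (hcl t).2 z.2)]
    rfl

end Basis

section SeparatelyHolomorphic

variable {A : Type*} [NormedRing A] [NormedAlgebra ℂ A]

/-- `F (s, v)` is jointly continuous on `U × {Re v > 0}` and holomorphic in each variable. -/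
structure SepHol (F : ℂ → ℂ → A) (U : Set ℂ) : Prop where
  cont : ContinuousOn (fun p : ℂ × ℂ => F p.1 p.2) (U ×ˢ {v : ℂ | 0 < v.re})
  diff_left : ∀ v : ℂ, 0 < v.re → DifferentiableOn ℂ (fun s => F s v) U
  diff_right : ∀ s ∈ U, DifferentiableOn ℂ (F s) {v : ℂ | 0 < v.re}

theorem isOpen_re_pos : IsOpen {v : ℂ | 0 < v.re} := isOpen_lt continuous_const continuous_re

theorem isOpen_re_gt (a : ℝ) : IsOpen {s : ℂ | a < s.re} := isOpen_lt continuous_const continuous_re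

namespace SepHol

variable {F G : ℂ → ℂ → A} {U : Set ℂ}

theorem mono {U' : Set ℂ} (h : SepHol F U) (hU : U' ⊆ U) : SepHol F U' :=
  ⟨h.cont.mono (Set.prod_mono hU le_rfl), fun v hv => (h.diff_left v hv).mono hU,
    fun s hs => h.diff_right s (hU hs)⟩

theorem congr (h : SepHol F U) (hG : ∀ s ∈ U, ∀ v : ℂ, 0 < v.re → G s v = F s v) : SepHol G U :=
  ⟨h.cont.congr fun p hp => hG p.1 hp.1 p.2 hp.2,
    fun v hv => (h.diff_left v hv).congr fun s hs => hG s hs v hv,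
    fun s hs => (h.diff_right s hs).congr fun v hv => hG s hs v hv⟩

theorem of_local (hU : IsOpen U)
    (h : ∀ s ∈ U, ∃ W, IsOpen W ∧ s ∈ W ∧ W ⊆ U ∧ SepHol F W) : SepHol F U := by
  refine ⟨fun p hp => ?_, fun v hv s hs => ?_, fun s hs => ?_⟩
  · obtain ⟨W, hW, hsW, -, hF⟩ := h p.1 hp.1
    exact (hF.cont.continuousAt ((hW.prod isOpen_re_pos).mem_nhds ⟨hsW, hp.2⟩)).continuousWithinAt
  · obtain ⟨W, hW, hsW, -, hF⟩ := h s hs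
    exact ((hF.diff_left v hv).differentiableAt (hW.mem_nhds hsW)).differentiableWithinAt
  · obtain ⟨W, hW, hsW, -, hF⟩ := h s hs; exact hF.diff_right s hsW

theorem add (hF : SepHol F U) (hG : SepHol G U) : SepHol (fun s v => F s v + G s v) U :=
  ⟨hF.cont.add hG.cont, fun v hv => (hF.diff_left v hv).add (hG.diff_left v hv),
    fun s hs => (hF.diff_right s hs).add (hG.diff_right s hs)⟩

theorem sub (hF : SepHol F U) (hG : SepHol G U) : SepHol (fun s v => F s v - G s v) U :=
  ⟨hF.cont.sub hG.cont, fun v hv => (hF.diff_left v hv).sub (hG.diff_left v hv),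
    fun s hs => (hF.diff_right s hs).sub (hG.diff_right s hs)⟩

theorem smul {f : ℂ → ℂ} (hf : DifferentiableOn ℂ f U) (hF : SepHol F U) :
    SepHol (fun s v => f s • F s v) U := by
  refine ⟨?_, fun v hv => hf.smul (hF.diff_left v hv),
    fun s hs => (hF.diff_right s hs).const_smul (f s)⟩
  have h1 : ContinuousOn (fun p : ℂ × ℂ => f p.1) (U ×ˢ {v : ℂ | 0 < v.re}) :=
    hf.continuousOn.comp (by fun_prop) fun p hp => hp.1
  exact h1.smul hF.cont

theorem smul_const {f : ℂ → ℂ → ℂ} (hf : SepHol f U) (a : A) : SepHol (fun s v => f s v • a) U :=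
  ⟨hf.cont.smul continuousOn_const, fun v hv => (hf.diff_left v hv).smul_const a,
    fun s hs => (hf.diff_right s hs).smul_const a⟩

theorem comp {W : Set ℂ} {φ ψ : ℂ → ℂ} (hF : SepHol F U) (hφ : DifferentiableOn ℂ φ W)
    (hφU : MapsTo φ W U) (hψ : DifferentiableOn ℂ ψ {v : ℂ | 0 < v.re})
    (hψp : ∀ v : ℂ, 0 < v.re → 0 < (ψ v).re) : SepHol (fun s v => F (φ s) (ψ v)) W := by
  refine ⟨?_, fun v hv => (hF.diff_left _ (hψp v hv)).comp hφ hφU,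
    fun s hs => (hF.diff_right _ (hφU hs)).comp hψ hψp⟩
  refine hF.cont.comp (f := fun p : ℂ × ℂ => (φ p.1, ψ p.2)) ?_ fun p hp => ⟨hφU hp.1, hψp _ hp.2⟩
  exact (hφ.continuousOn.comp (by fun_prop) fun p hp => hp.1).prodMk
    (hψ.continuousOn.comp (by fun_prop) fun p hp => hp.2)

theorem tsum [CompleteSpace A] (hU : IsOpen U) {F : ℕ → ℂ → ℂ → A} (hF : ∀ n, SepHol (F n) U)
    {u : ℕ → ℝ} (hu : Summable u) (hb : ∀ n, ∀ s ∈ U, ∀ v : ℂ, 0 < v.re → ‖F n s v‖ ≤ u n) :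
    SepHol (fun s v => ∑' n, F n s v) U := by
  refine ⟨?_, fun v hv => ?_, fun s hs => ?_⟩
  · exact continuousOn_tsum (fun n => (hF n).cont) hu fun n p hp => hb n p.1 hp.1 p.2 hp.2
  · exact differentiableOn_tsum_of_summable_norm hu (fun n => (hF n).diff_left v hv) hU
      fun n s hs => hb n s hs v hv
  · exact differentiableOn_tsum_of_summable_norm hu (fun n => (hF n).diff_right s hs)
      isOpen_re_pos fun n v hv => hb n s hs v hv

theorem integral [CompleteSpace A] (hU : IsOpen U) {l : ℝ} (hl : 0 ≤ l) {k : ℝ → A}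
    (hk : Continuous k) (hF : SepHol F U) :
    SepHol (fun s v => ∫ u in (0 : ℝ)..l, k u * F s (v + u)) U := by
  have hp : ∀ v : ℂ, 0 < v.re → ∀ u ∈ Set.Icc (0 : ℝ) l, 0 < (v + u : ℂ).re := fun v hv u hu => by
    simpa using add_pos_of_pos_of_nonneg hv hu.1
  have hc : ContinuousOn (fun p : (ℂ × ℂ) × ℝ => k p.2 * F p.1.1 (p.1.2 + p.2))
      ((U ×ˢ {v : ℂ | 0 < v.re}) ×ˢ Set.Icc 0 l) := by
    refine ContinuousOn.mul (by fun_prop) ?_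
    exact hF.cont.comp (f := fun p : (ℂ × ℂ) × ℝ => (p.1.1, p.1.2 + (p.2 : ℂ))) (by fun_prop)
      fun p hp' => ⟨hp'.1.1, hp _ hp'.1.2 _ hp'.2⟩
  refine ⟨continuousOn_integral_param (F := fun (p : ℂ × ℂ) u => k u * F p.1 (p.2 + u)) hl hc,
    fun v hv => ?_, fun s hs => ?_⟩
  · refine differentiableOn_integral_param (F := fun s u => k u * F s (v + u)) hU hl ?_ fun u hu => ?_
    · exact hc.comp (f := fun p : ℂ × ℝ => ((p.1, v), p.2)) (by fun_prop)
        fun p hp => ⟨⟨hp.1, hv⟩, hp.2⟩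
    · exact (differentiableOn_const (k u)).mul (hF.diff_left _ (hp v hv u hu))
  · refine differentiableOn_integral_param (F := fun v u => k u * F s (v + u)) isOpen_re_pos hl ?_
      fun u hu => ?_
    · exact hc.comp (f := fun p : ℂ × ℝ => ((s, p.1), p.2)) (by fun_prop)
        fun p hp => ⟨⟨hs, hp.1⟩, hp.2⟩
    · exact (differentiableOn_const (k u)).mul
        ((hF.diff_right s hs).comp (by fun_prop) fun v hv => hp v hv u hu)

theorem cpow {a : ℝ} (ha : 0 ≤ a) {f : ℂ → ℂ} (hf : Differentiable ℂ f) :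
    SepHol (A := ℂ) (fun s v => (v + a) ^ f s) Set.univ := by
  have hm : ∀ v : ℂ, 0 < v.re → v + a ∈ slitPlane := fun v hv =>
    Or.inl (by simpa using add_pos_of_pos_of_nonneg hv ha)
  refine ⟨?_, fun v hv => ?_, fun s hs => ?_⟩
  · refine ContinuousOn.cpow (by fun_prop) ?_ fun p hp => hm _ hp.2
    exact (hf.continuous.comp continuous_fst).continuousOn
  · exact hf.differentiableOn.const_cpow (Or.inl (slitPlane_ne_zero (hm v hv)))
  · exact DifferentiableOn.cpow (by fun_prop) (differentiableOn_const _) fun v hv => hm v hv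

end SepHol

end SeparatelyHolomorphic

theorem norm_cpow_neg_le {x s : ℂ} {σ T : ℝ} {n : ℕ} (hσ : 0 ≤ σ) (hs : σ ≤ s.re) (hT : |s.im| ≤ T)
    (hx : (n : ℝ) + 1 ≤ x.re) : ‖x ^ (-s)‖ ≤ ((n : ℝ) + 1) ^ (-σ) * Real.exp (π * T) := by
  have hn : (0 : ℝ) < (n : ℝ) + 1 := by positivity
  have hx0 : x ≠ 0 := by rintro rfl; simp only [zero_re] at hx; linarith
  have hxn : (n : ℝ) + 1 ≤ ‖x‖ := hx.trans (re_le_norm x)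
  rw [norm_cpow_of_ne_zero hx0, div_eq_mul_inv, ← Real.exp_neg]
  refine mul_le_mul ?_ ?_ (exp_nonneg _) (by positivity)
  · rw [neg_re]
    calc ‖x‖ ^ (-s.re) ≤ ((n : ℝ) + 1) ^ (-s.re) := rpow_le_rpow_of_nonpos hn hxn (by linarith)
      _ ≤ _ := rpow_le_rpow_of_exponent_le (by linarith [n.cast_nonneg (α := ℝ)]) (by linarith)
  · refine exp_le_exp.2 ?_; rw [neg_im, mul_neg, neg_neg]
    calc x.arg * s.im ≤ |x.arg| * |s.im| := by rw [← abs_mul]; exact le_abs_self _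
      _ ≤ _ := mul_le_mul (abs_arg_le_pi x) hT (abs_nonneg _) pi_pos.le

theorem summable_succ_rpow {σ : ℝ} (h : 1 < σ) : Summable fun n : ℕ => ((n : ℝ) + 1) ^ (-σ) := by
  have := (summable_nat_add_iff 1).2 (summable_nat_rpow (p := -σ).2 (by linarith))
  simpa using this

/-- A power bounded element `ω` of a Banach algebra whose peripheral eigenvalue `1` is
semisimple and isolated: `P` is the spectral projection, `B` the reduced resolvent at `1`. -/
structure LerchData (A : Type*) [NormedRing A] [NormedAlgebra ℂ A] where
  /-- the step -/
  l : ℝ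
  one_le : 1 ≤ l
  /-- the power bounded element -/
  ω : A
  /-- the projection to the fixed space -/
  P : A
  /-- the reduced resolvent -/
  B : A
  norm_pow_le : ∀ n, ‖ω ^ n‖ ≤ 1
  P_mul : P * ω = P
  mul_P : ω * P = P
  P_mul_P : P * P = P
  B_mul : B * (1 - ω) = 1 - P
  B_mul_P : B * P = 0

namespace LerchData

variable {A : Type*} [NormedRing A] [NormedAlgebra ℂ A] (𝔏 : LerchData A)

theorem l_pos : 0 < 𝔏.l := zero_lt_one.trans_le 𝔏.one_le

/-- The nodes `v + (n + 1) l`. -/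
def node (n : ℕ) (v : ℂ) : ℂ := v + (((n : ℝ) + 1) * 𝔏.l : ℝ)

theorem le_re_node (n : ℕ) {v : ℂ} (hv : 0 < v.re) : (n : ℝ) + 1 ≤ (𝔏.node n v).re := by
  have h1 := 𝔏.one_le
  have h2 : (n : ℝ) + 1 ≤ ((n : ℝ) + 1) * 𝔏.l := le_mul_of_one_le_right (by positivity) h1
  simp only [node, add_re, ofReal_re]; linarith

theorem node_succ (n : ℕ) (v : ℂ) : 𝔏.node (n + 1) v = 𝔏.node n v + 𝔏.l := by
  simp only [node]; push_cast; ring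

theorem node_add (n : ℕ) (v w : ℂ) : 𝔏.node n (v + w) = 𝔏.node n v + w := by simp only [node]; ring

/-- The Hurwitz–Lerch series `∑ (v + n l)^(-s) ω^n` over `n ≥ 1`. -/
def series (s v : ℂ) : A := ∑' n : ℕ, 𝔏.node n v ^ (-s) • 𝔏.ω ^ (n + 1)

theorem norm_term_le {s v : ℂ} {σ T : ℝ} (hσ : 0 ≤ σ) (hs : σ ≤ s.re) (hT : |s.im| ≤ T)
    (hv : 0 < v.re) (n : ℕ) : ‖𝔏.node n v ^ (-s) • 𝔏.ω ^ (n + 1)‖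
    ≤ ((n : ℝ) + 1) ^ (-σ) * Real.exp (π * T) := by
  rw [norm_smul]
  exact (mul_le_of_le_one_right (norm_nonneg _) (𝔏.norm_pow_le _)).trans
    (norm_cpow_neg_le hσ hs hT (𝔏.le_re_node n hv))

theorem exists_strip {a : ℝ} {s : ℂ} (hs : a < s.re) : ∃ σ T : ℝ, a < σ ∧
    s ∈ {s : ℂ | σ < s.re ∧ |s.im| < T} ∧ IsOpen {s : ℂ | σ < s.re ∧ |s.im| < T} := by
  obtain ⟨σ, h1, h2⟩ := exists_between hs; refine ⟨σ, |s.im| + 1, h1, ⟨h2, by linarith⟩, ?_⟩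
  exact (isOpen_lt continuous_const continuous_re).inter
    (isOpen_lt (continuous_abs.comp continuous_im) continuous_const)

theorem summable_term [CompleteSpace A] {s v : ℂ} (hs : 1 < s.re) (hv : 0 < v.re) :
    Summable fun n : ℕ => 𝔏.node n v ^ (-s) • 𝔏.ω ^ (n + 1) :=
  ((summable_succ_rpow hs).mul_right _).of_norm_bounded fun n =>
    𝔏.norm_term_le (by linarith) le_rfl le_rfl hv n

theorem sepHol_cpow_node (n : ℕ) : SepHol (A := ℂ) (fun s v => 𝔏.node n v ^ (-s)) Set.univ :=
  SepHol.cpow (by have := 𝔏.l_pos; positivity) differentiable_neg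

theorem sepHol_series [CompleteSpace A] : SepHol 𝔏.series {s : ℂ | 1 < s.re} := by
  refine SepHol.of_local (isOpen_re_gt 1) fun s hs => ?_
  obtain ⟨σ, T, h1, hmem, hop⟩ := exists_strip hs
  refine ⟨_, hop, hmem, fun s hs => h1.trans hs.1, ?_⟩
  refine SepHol.tsum hop (fun n => ((𝔏.sepHol_cpow_node n).mono (Set.subset_univ _)).smul_const _)
    ((summable_succ_rpow h1).mul_right _) fun n s hs v hv =>
      𝔏.norm_term_le (by linarith) hs.1.le hs.2.le hv n

/-- The kernel of the recursion. -/
def kernel (u : ℝ) : A := (((𝔏.l - u) / 𝔏.l : ℝ) : ℂ) • 𝔏.P - 𝔏.B * 𝔏.ω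

theorem continuous_kernel : Continuous 𝔏.kernel := by unfold kernel; fun_prop

/-- The inhomogeneous term of the recursion. -/
def source (s v : ℂ) : A := 𝔏.node 0 v ^ (-s) • (𝔏.B * 𝔏.ω)
    + ∫ u in (0 : ℝ)..𝔏.l, (((𝔏.l - u) / 𝔏.l ^ 2 : ℝ) : ℂ) • 𝔏.P * (𝔏.node 0 (v + u) ^ (-s) • (1 : A))

/-- The singular part of the Hurwitz–Lerch series. -/
def sing (s v : ℂ) : A := (𝔏.node 0 v ^ (1 - s) / (𝔏.l * (s - 1))) • 𝔏.P

/-- Successive continuations of the regular part of the Hurwitz–Lerch series. -/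
def reg : ℕ → ℂ → ℂ → A
  | 0, s, v => 𝔏.series s v - 𝔏.sing s v
  | k + 1, s, v => 𝔏.source s v + s • ∫ u in (0 : ℝ)..𝔏.l, 𝔏.kernel u * reg k (s + 1) (v + u)

theorem sepHol_source [CompleteSpace A] : SepHol 𝔏.source Set.univ := by
  refine ((𝔏.sepHol_cpow_node 0).smul_const _).add ?_
  exact SepHol.integral (F := fun s v => 𝔏.node 0 v ^ (-s) • (1 : A)) isOpen_univ 𝔏.l_pos.le
    (k := fun u => (((𝔏.l - u) / 𝔏.l ^ 2 : ℝ) : ℂ) • 𝔏.P) (by fun_prop)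
    ((𝔏.sepHol_cpow_node 0).smul_const _)

theorem sepHol_sing : SepHol 𝔏.sing {s : ℂ | s ≠ 1} := by
  have h1 : SepHol (A := ℂ) (fun s v => 𝔏.node 0 v ^ (1 - s)) {s : ℂ | s ≠ 1} :=
    (SepHol.cpow (by have := 𝔏.l_pos; positivity) (f := fun s => 1 - s) (by fun_prop)).mono
      (Set.subset_univ _)
  have h2 : DifferentiableOn ℂ (fun s : ℂ => ((𝔏.l : ℂ) * (s - 1))⁻¹) {s : ℂ | s ≠ 1} := by
    refine DifferentiableOn.inv (by fun_prop) fun s hs => ?_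
    exact mul_ne_zero (ofReal_ne_zero.2 𝔏.l_pos.ne') (sub_ne_zero.2 hs)
  refine ((h1.smul_const 𝔏.P).smul h2).congr fun s hs v hv => ?_
  rw [sing, smul_smul, div_eq_mul_inv, mul_comm]

theorem sepHol_reg [CompleteSpace A] (k : ℕ) : SepHol (𝔏.reg k) {s : ℂ | 1 - (k : ℝ) < s.re} := by
  induction k with
  | zero =>
    have h : {s : ℂ | 1 - ((0 : ℕ) : ℝ) < s.re} = {s : ℂ | 1 < s.re} := by simp
    rw [h]; refine 𝔏.sepHol_series.sub (𝔏.sepHol_sing.mono fun s hs => ?_); rintro rfl; simp at hs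
  | succ k ih =>
    refine (𝔏.sepHol_source.mono (Set.subset_univ _)).add (SepHol.smul differentiableOn_id ?_)
    refine SepHol.integral (F := fun s v => 𝔏.reg k (s + 1) v) (isOpen_re_gt _) 𝔏.l_pos.le
      𝔏.continuous_kernel ?_
    refine ih.comp (φ := fun s => s + 1) (ψ := fun v => v) (by fun_prop) (fun s hs => ?_)
      (by fun_prop) fun v hv => hv
    simp only [mem_ofPred_eq, add_re, one_re] at hs ⊢; push_cast at hs; linarith

theorem re_add_pos {v : ℂ} (hv : 0 < v.re) {u : ℝ} (hu : 0 ≤ u) : 0 < (v + u : ℂ).re := by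
  simpa using add_pos_of_pos_of_nonneg hv hu

theorem continuousOn_cpow_add {x : ℂ} (hx : 0 < x.re) {l : ℝ} (hl : 0 ≤ l) (s : ℂ) :
    ContinuousOn (fun u : ℝ => (x + u) ^ s) (Set.uIcc 0 l) := by
  rw [Set.uIcc_of_le hl]
  exact ContinuousOn.cpow (by fun_prop) continuousOn_const fun u hu => Or.inl (re_add_pos hx hu.1)

theorem hasDerivAt_cpow_add {x s : ℂ} (hx : 0 < x.re) {u : ℝ} (hu : 0 ≤ u) :
    HasDerivAt (fun t : ℝ => (x + t) ^ s) (s * (x + u) ^ (s - 1)) u := by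
  have h1 : HasDerivAt (fun t : ℂ => x + t) 1 (u : ℂ) := (hasDerivAt_id _).const_add x
  have h2 := h1.cpow_const (c := s) (Or.inl (re_add_pos hx hu))
  simpa using h2.comp_ofReal

theorem integral_cpow_add {x s : ℂ} (hx : 0 < x.re) {l : ℝ} (hl : 0 ≤ l) :
    s * ∫ u in (0 : ℝ)..l, (x + u) ^ (-(s + 1)) = x ^ (-s) - (x + l) ^ (-s) := by
  have h := intervalIntegral.integral_eq_sub_of_hasDerivAt (a := 0) (b := l)
    (f := fun t : ℝ => -(x + t) ^ (-s)) (f' := fun u => s * (x + u) ^ (-(s + 1)))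
    (fun u hu => ?_) ((continuousOn_cpow_add hx hl _).const_mul s).intervalIntegrable
  · rw [intervalIntegral.integral_const_mul] at h; rw [h]; simp; ring
  · rw [Set.uIcc_of_le hl] at hu; refine (hasDerivAt_cpow_add hx hu.1).neg.congr_deriv ?_
    rw [show -s - 1 = -(s + 1) by ring]
    ring

theorem integral_sub_mul_cpow_add {x s : ℂ} (hx : 0 < x.re) {l : ℝ} (hl : 0 ≤ l) (hs : s ≠ 1) :
    s * ∫ u in (0 : ℝ)..l, ((l - u : ℝ) : ℂ) * (x + u) ^ (-(s + 1))
    = l * x ^ (-s) - (x ^ (1 - s) - (x + l) ^ (1 - s)) / (s - 1) := by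
  have hs1 : s - 1 ≠ 0 := sub_ne_zero.2 hs
  have hc : ContinuousOn (fun u : ℝ => ((l - u : ℝ) : ℂ) * (x + u) ^ (-(s + 1))) (Set.uIcc 0 l) :=
    ContinuousOn.mul (by fun_prop) (continuousOn_cpow_add hx hl _)
  have h := intervalIntegral.integral_eq_sub_of_hasDerivAt (a := 0) (b := l)
    (f := fun t : ℝ => -(((l - t : ℝ) : ℂ) * (x + t) ^ (-s)) + (x + t) ^ (1 - s) / (s - 1))
    (f' := fun u => s * (((l - u : ℝ) : ℂ) * (x + u) ^ (-(s + 1))))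
    (fun u hu => ?_) (hc.const_mul s).intervalIntegrable
  · rw [intervalIntegral.integral_const_mul] at h; rw [h]; simp; ring
  · rw [Set.uIcc_of_le hl] at hu
    have h1 : HasDerivAt (fun t : ℝ => ((l - t : ℝ) : ℂ)) (-1) u := by
      have := ((hasDerivAt_id u).const_sub l).ofReal_comp; simpa using this
    refine ((h1.mul (hasDerivAt_cpow_add (s := -s) hx hu.1)).neg.add
      ((hasDerivAt_cpow_add (s := 1 - s) hx hu.1).div_const (s - 1))).congr_deriv ?_
    rw [show -s - 1 = -(s + 1) by ring, show 1 - s - 1 = -s by ring]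
    field_simp; ring

theorem P_mul_pow (n : ℕ) : 𝔏.P * 𝔏.ω ^ n = 𝔏.P := by
  induction n with
  | zero => simp
  | succ n ih => rw [pow_succ, ← mul_assoc, ih, 𝔏.P_mul]

theorem kernel_mul_P (u : ℝ) : 𝔏.kernel u * 𝔏.P = (((𝔏.l - u) / 𝔏.l : ℝ) : ℂ) • 𝔏.P := by
  rw [kernel, sub_mul, smul_mul_assoc, 𝔏.P_mul_P, mul_assoc, 𝔏.mul_P, 𝔏.B_mul_P, sub_zero]

theorem kernel_mul_pow (u : ℝ) (n : ℕ) : 𝔏.kernel u * 𝔏.ω ^ (n + 1)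
    = (((𝔏.l - u) / 𝔏.l : ℝ) : ℂ) • 𝔏.P - 𝔏.B * 𝔏.ω ^ (n + 2) := by
  rw [kernel, sub_mul, smul_mul_assoc, 𝔏.P_mul_pow, mul_assoc, ← pow_succ' 𝔏.ω (n + 1)]

theorem tendsto_node_cpow {s v : ℂ} (hs : 1 < s.re) (hv : 0 < v.re) :
    Tendsto (fun n => 𝔏.node n v ^ (1 - s)) atTop (𝓝 0) := by
  have h1 : Tendsto (fun n : ℕ => ((n : ℝ) + 1) ^ (-(s.re - 1)) * Real.exp (π * |(s - 1).im|))
      atTop (𝓝 0) := by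
    rw [← zero_mul (Real.exp (π * |(s - 1).im|))]; refine Tendsto.mul_const _ ?_
    refine (tendsto_rpow_neg_atTop (by linarith)).comp ?_
    exact tendsto_atTop_add_const_right _ _ tendsto_natCast_atTop_atTop
  refine squeeze_zero_norm (fun n => ?_) h1
  have := norm_cpow_neg_le (s := s - 1) (σ := s.re - 1) (by linarith) (by simp) le_rfl
    (𝔏.le_re_node n hv)
  rwa [neg_sub] at this

theorem hasSum_integral_kernel [CompleteSpace A] {s v : ℂ} (hs : 1 < s.re) (hv : 0 < v.re) :
    HasSum (fun n => s • ∫ u in (0 : ℝ)..𝔏.l,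
    𝔏.kernel u * ((𝔏.node n v + u) ^ (-(s + 1)) • 𝔏.ω ^ (n + 1)))
    (s • ∫ u in (0 : ℝ)..𝔏.l, 𝔏.kernel u * 𝔏.series (s + 1) (v + u)) := by
  refine HasSum.const_smul s ?_; have hl := 𝔏.l_pos.le
  obtain ⟨C, hC⟩ := (isCompact_Icc (a := (0 : ℝ)) (b := 𝔏.l)).exists_bound_of_continuousOn
    𝔏.continuous_kernel.continuousOn
  have hu' : ∀ u : ℝ, u ∈ uIoc 0 𝔏.l → u ∈ Set.Icc 0 𝔏.l := fun u hu => by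
    rw [uIoc_of_le hl] at hu; exact ⟨hu.1.le, hu.2⟩
  have hb : ∀ n : ℕ, ∀ u ∈ Set.Icc (0 : ℝ) 𝔏.l,
      ‖𝔏.kernel u * ((𝔏.node n v + u) ^ (-(s + 1)) • 𝔏.ω ^ (n + 1))‖
        ≤ C * (((n : ℝ) + 1) ^ (-s.re) * Real.exp (π * |(s + 1).im|)) := fun n u hu => by
    refine (norm_mul_le _ _).trans (mul_le_mul (hC u hu) ?_ (norm_nonneg _)
      ((norm_nonneg _).trans (hC u hu)))
    rw [← node_add]; exact 𝔏.norm_term_le (by linarith) (by simp) le_rfl (re_add_pos hv hu.1) n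
  refine intervalIntegral.hasSum_integral_of_dominated_convergence
    (fun n _ => C * (((n : ℝ) + 1) ^ (-s.re) * Real.exp (π * |(s + 1).im|)))
    (fun n => ?_) (fun n => ?_) ?_ ?_ ?_
  · refine (ContinuousOn.mono ?_ fun u hu => hu' u hu).aestronglyMeasurable measurableSet_uIoc
    refine 𝔏.continuous_kernel.continuousOn.mul (ContinuousOn.smul (ContinuousOn.cpow (by fun_prop)
      continuousOn_const fun u hu => Or.inl ?_) continuousOn_const)
    rw [← node_add]; exact lt_of_lt_of_le (by positivity) (𝔏.le_re_node n (re_add_pos hv hu.1))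
  · exact Eventually.of_forall fun u hu => hb n u (hu' u hu)
  · exact Eventually.of_forall fun u _ => ((summable_succ_rpow hs).mul_right _).mul_left _
  · exact intervalIntegrable_const
  · refine Eventually.of_forall fun u hu => ?_; refine HasSum.mul_left _ ?_
    have := (𝔏.summable_term (s := s + 1) (by simp; linarith) (re_add_pos hv (hu' u hu).1)).hasSum
    simp only [node_add] at this; simpa only [series, node_add] using this

theorem integral_kernel_term [CompleteSpace A] {s v : ℂ} (hs : s ≠ 1) (hv : 0 < v.re) (n : ℕ) :
    s • ∫ u in (0 : ℝ)..𝔏.l, 𝔏.kernel u * ((𝔏.node n v + u) ^ (-(s + 1)) • 𝔏.ω ^ (n + 1))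
    = 𝔏.P * (𝔏.node n v ^ (-s) • 𝔏.ω ^ (n + 1))
    - ((𝔏.node n v ^ (1 - s) - 𝔏.node (n + 1) v ^ (1 - s)) / (𝔏.l * (s - 1))) • 𝔏.P
    - (𝔏.B * 𝔏.ω) * (𝔏.node n v ^ (-s) • 𝔏.ω ^ (n + 1))
    + 𝔏.B * (𝔏.node (n + 1) v ^ (-s) • 𝔏.ω ^ (n + 2)) := by
  have hl := 𝔏.l_pos
  have hx : 0 < (𝔏.node n v).re := lt_of_lt_of_le (by positivity) (𝔏.le_re_node n hv)
  have hcp := continuousOn_cpow_add hx hl.le (-(s + 1))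
  have h1 : ∀ u : ℝ, 𝔏.kernel u * ((𝔏.node n v + u) ^ (-(s + 1)) • 𝔏.ω ^ (n + 1))
      = (((𝔏.l - u : ℝ) : ℂ) * (𝔏.node n v + u) ^ (-(s + 1))) • ((𝔏.l : ℂ)⁻¹ • 𝔏.P)
        - ((𝔏.node n v + u) ^ (-(s + 1))) • (𝔏.B * 𝔏.ω ^ (n + 2)) := fun u => by
    rw [mul_smul_comm, kernel_mul_pow, smul_sub, smul_smul, smul_smul]; congr 2; push_cast; ring
  simp only [h1]
  rw [intervalIntegral.integral_sub, intervalIntegral.integral_smul_const,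
    intervalIntegral.integral_smul_const, smul_sub, smul_smul, smul_smul, smul_smul,
    integral_cpow_add hx hl.le, integral_sub_mul_cpow_add hx hl.le hs, ← node_succ,
    mul_smul_comm, mul_smul_comm, mul_smul_comm, P_mul_pow, mul_assoc,
    ← pow_succ' 𝔏.ω (n + 1)]
  · have hl0 : (𝔏.l : ℂ) ≠ 0 := ofReal_ne_zero.2 hl.ne'; have hs1 : s - 1 ≠ 0 := sub_ne_zero.2 hs
    rw [sub_mul, mul_right_comm, mul_inv_cancel₀ hl0, one_mul, ← div_eq_mul_inv, div_div,
      mul_comm (s - 1)]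
    module
  · exact (ContinuousOn.smul (ContinuousOn.mul (by fun_prop) hcp)
      continuousOn_const).intervalIntegrable
  · exact (hcp.smul continuousOn_const).intervalIntegrable

theorem series_eq [CompleteSpace A] {s v : ℂ} (hs : 1 < s.re) (hv : 0 < v.re) :
    𝔏.series s v = 𝔏.sing s v + 𝔏.node 0 v ^ (-s) • (𝔏.B * 𝔏.ω)
    + s • ∫ u in (0 : ℝ)..𝔏.l, 𝔏.kernel u * 𝔏.series (s + 1) (v + u) := by
  have hs1 : s ≠ 1 := by rintro rfl; simp at hs
  have h1 := (𝔏.hasSum_integral_kernel hs hv).tendsto_sum_nat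
  have hsum := (𝔏.summable_term hs hv).hasSum; have hH := hsum.tendsto_sum_nat
  have hH1 := ((hasSum_nat_add_iff' 1).2 hsum).tendsto_sum_nat
  have h2 := (((hH.const_mul 𝔏.P).sub (((tendsto_const_nhds (x := 𝔏.node 0 v ^ (1 - s))).sub
    (𝔏.tendsto_node_cpow hs hv)).div_const (𝔏.l * (s - 1)) |>.smul_const 𝔏.P)).sub
    (hH.const_mul (𝔏.B * 𝔏.ω))).add (hH1.const_mul 𝔏.B)
  have h3 := tendsto_nhds_unique (h1.congr fun N => ?_) h2
  · rw [h3]; simp only [Finset.range_one, Finset.sum_singleton, zero_add, pow_one, sub_zero]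
    have h4 : 𝔏.P * 𝔏.series s v - 𝔏.B * 𝔏.ω * 𝔏.series s v + 𝔏.B * 𝔏.series s v
        = 𝔏.series s v := calc
      _ = (𝔏.P + 𝔏.B * (1 - 𝔏.ω)) * 𝔏.series s v := by noncomm_ring
      _ = _ := by rw [𝔏.B_mul, add_sub_cancel, one_mul]
    conv_lhs => rw [← h4]
    change _ = _ + (𝔏.P * 𝔏.series s v - 𝔏.sing s v - 𝔏.B * 𝔏.ω * 𝔏.series s v
      + 𝔏.B * (𝔏.series s v - _))
    rw [mul_sub, mul_smul_comm]
    abel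
  · simp only [𝔏.integral_kernel_term hs1 hv, sum_add_distrib, sum_sub_distrib,
      ← mul_sum, ← Finset.sum_smul, ← sum_div,
      Finset.sum_range_sub' fun n => 𝔏.node n v ^ (1 - s)]

theorem reg_zero_eq [CompleteSpace A] {s v : ℂ} (hs : 1 < s.re) (hv : 0 < v.re) :
    𝔏.reg 0 s v = 𝔏.reg 1 s v := by
  have hl := 𝔏.l_pos; have hl0 : (𝔏.l : ℂ) ≠ 0 := ofReal_ne_zero.2 hl.ne'
  have hs0 : s ≠ 0 := by rintro rfl; simp at hs; linarith
  have hm : MapsTo (fun u : ℝ => (s + 1, v + (u : ℂ))) (Set.uIcc 0 𝔏.l)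
      ({s : ℂ | 1 < s.re} ×ˢ {v : ℂ | 0 < v.re}) := fun u hu => by
    rw [Set.uIcc_of_le hl.le] at hu; exact ⟨by simp; linarith, re_add_pos hv hu.1⟩
  have hi1 : IntervalIntegrable (fun u : ℝ => 𝔏.kernel u * 𝔏.series (s + 1) (v + u))
      MeasureTheory.volume 0 𝔏.l :=
    (𝔏.continuous_kernel.continuousOn.mul
      (𝔏.sepHol_series.cont.comp (by fun_prop) hm)).intervalIntegrable
  have hi2 : IntervalIntegrable (fun u : ℝ => 𝔏.kernel u * 𝔏.sing (s + 1) (v + u))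
      MeasureTheory.volume 0 𝔏.l := by
    refine (𝔏.continuous_kernel.continuousOn.mul
      (𝔏.sepHol_sing.cont.comp (by fun_prop) (t := {s : ℂ | s ≠ 1} ×ˢ {v : ℂ | 0 < v.re})
        fun u hu => ⟨?_, (hm hu).2⟩)).intervalIntegrable
    simpa using hs0
  have h1 : ∀ u : ℝ, (((𝔏.l - u) / 𝔏.l ^ 2 : ℝ) : ℂ) • 𝔏.P * (𝔏.node 0 (v + u) ^ (-s) • (1 : A))
      = s • (𝔏.kernel u * 𝔏.sing (s + 1) (v + u)) := fun u => by
    rw [sing, mul_smul_comm, mul_smul_comm, kernel_mul_P, mul_one, smul_smul, smul_smul, smul_smul,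
      show (1 : ℂ) - (s + 1) = -s by ring, add_sub_cancel_right]
    congr 1; push_cast; field_simp
  rw [reg, reg, source]; simp only [reg, mul_sub, h1]
  rw [intervalIntegral.integral_sub hi1 hi2, intervalIntegral.integral_smul, 𝔏.series_eq hs hv,
    smul_sub]
  abel

theorem reg_succ_eq [CompleteSpace A] (k : ℕ) {s v : ℂ} (hs : 1 - (k : ℝ) < s.re) (hv : 0 < v.re) :
    𝔏.reg (k + 1) s v = 𝔏.reg k s v := by
  induction k generalizing s v with
  | zero => exact (𝔏.reg_zero_eq (by simpa using hs) hv).symm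
  | succ k ih =>
    rw [reg, reg]; congr 2; refine intervalIntegral.integral_congr fun u hu => ?_
    rw [Set.uIcc_of_le 𝔏.l_pos.le] at hu; rw [ih]
    · simp only [add_re, one_re]; push_cast at hs; linarith
    · exact re_add_pos hv hu.1

theorem reg_eq_of_le [CompleteSpace A] {k k' : ℕ} (hk : k ≤ k') {s v : ℂ}
    (hs : 1 - (k : ℝ) < s.re) (hv : 0 < v.re) : 𝔏.reg k' s v = 𝔏.reg k s v := by
  induction k', hk using Nat.le_induction with
  | base => rfl
  | succ m hm ih =>
    rw [𝔏.reg_succ_eq m ?_ hv, ih]; have : (k : ℝ) ≤ m := by exact_mod_cast hm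
    linarith

/-- The regular part of the Hurwitz–Lerch series, continued to all `s`. -/
def regular (s v : ℂ) : A := 𝔏.reg (⌈1 - s.re⌉₊ + 1) s v

theorem regular_eq [CompleteSpace A] (k : ℕ) {s v : ℂ} (hs : 1 - (k : ℝ) < s.re) (hv : 0 < v.re) :
    𝔏.regular s v = 𝔏.reg k s v := by
  have h := Nat.le_ceil (1 - s.re); rw [regular]; rcases le_total k (⌈1 - s.re⌉₊ + 1) with hk | hk
  · exact 𝔏.reg_eq_of_le hk hs hv
  · refine (𝔏.reg_eq_of_le hk ?_ hv).symm; push_cast; linarith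

theorem sepHol_regular [CompleteSpace A] : SepHol 𝔏.regular Set.univ := by
  refine SepHol.of_local isOpen_univ fun s _ => ?_; have h := Nat.le_ceil (1 - s.re)
  refine ⟨_, isOpen_re_gt (1 - ((⌈1 - s.re⌉₊ + 1 : ℕ) : ℝ)), ?_, Set.subset_univ _,
    (𝔏.sepHol_reg (⌈1 - s.re⌉₊ + 1)).congr fun s hs v hv => 𝔏.regular_eq _ hs hv⟩
  simp only [mem_ofPred_eq]; push_cast; linarith

theorem series_eq_sing_add_regular [CompleteSpace A] {s v : ℂ} (hs : 1 < s.re) (hv : 0 < v.re) :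
    𝔏.series s v = 𝔏.sing s v + 𝔏.regular s v := by
  rw [𝔏.regular_eq 0 (by simpa using hs) hv, reg]
  abel

end LerchData

section DividedDifference

variable {V : Type*} [NormedAddCommGroup V] [InnerProductSpace ℂ V] [CompleteSpace V] {c r : ℝ}
  {p : ℂ}

theorem hp_pos (hp : p ∈ ball (c : ℂ) r) : 0 < r := (dist_nonneg).trans_lt (mem_ball.1 hp)

theorem differentiableAt_ext0 (f : DiscSpace V c r) {z : ℂ} (hz : z ∈ ball (c : ℂ) r) :
    DifferentiableAt ℂ (ext0 f.1) z :=
  DifferentiableOn.differentiableAt f.2 (isOpen_ball.mem_nhds hz)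

theorem continuousOn_dslope_ext0 (hp : p ∈ ball (c : ℂ) r) (f : DiscSpace V c r) :
    ContinuousOn (dslope (ext0 f.1) p) 𝔻(c, r) :=
  (continuousOn_dslope (mem_of_superset (isOpen_ball.mem_nhds hp)
    ball_subset_closedBall)).2 ⟨continuousOn_ext0 f.1, differentiableAt_ext0 f hp⟩

theorem differentiableOn_dslope_ext0 (hp : p ∈ ball (c : ℂ) r) (f : DiscSpace V c r) :
    DifferentiableOn ℂ (dslope (ext0 f.1) p) (ball (c : ℂ) r) :=
  (differentiableOn_dslope (isOpen_ball.mem_nhds hp)).2 f.2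

theorem norm_dslope_ext0_le (hp : p ∈ ball (c : ℂ) r) (f : DiscSpace V c r) {z : ℂ}
    (hz : z ∈ 𝔻(c, r)) : ‖dslope (ext0 f.1) p z‖ ≤ 2 / (r - ‖p - c‖) * ‖f‖ := by
  have hr := hp_pos hp; have hd : 0 < r - ‖p - c‖ := by rw [mem_ball_iff_norm] at hp; linarith
  have hcl : DiffContOnCl ℂ (dslope (ext0 f.1) p) (ball (c : ℂ) r) :=
    ⟨differentiableOn_dslope_ext0 hp f, by
      rw [closure_ball _ hr.ne']; exact continuousOn_dslope_ext0 hp f⟩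
  refine norm_le_of_forall_mem_frontier_norm_le isBounded_ball hcl (fun w hw => ?_)
    (by rwa [closure_ball _ hr.ne'])
  rw [frontier_ball _ hr.ne', mem_sphere_iff_norm] at hw
  have hwp : r - ‖p - c‖ ≤ ‖w - p‖ := by
    have := norm_sub_norm_le (w - c) (p - c); rw [sub_sub_sub_cancel_right] at this; linarith
  have hne : w ≠ p := fun h => by rw [h, sub_self, norm_zero] at hwp; linarith
  rw [dslope_of_ne _ hne, slope_def_module, norm_smul, norm_inv, div_mul_eq_mul_div, inv_mul_eq_div]
  refine div_le_div₀ (by positivity) ?_ hd hwp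
  have h1 := norm_sub_le (ext0 f.1 w) (ext0 f.1 p); have h2 := norm_ext0_le f.1 w
  have h3 := norm_ext0_le f.1 p; have h4 : ‖f.1‖ = ‖f‖ := rfl; linarith

/-- The divided difference `(f(z) - f(p)) / (z - p)` as an operator on the disc space. -/
def dslopeDisc (V : Type*) [NormedAddCommGroup V] [InnerProductSpace ℂ V] [CompleteSpace V]
    {c r : ℝ} {p : ℂ} (hp : p ∈ ball (c : ℂ) r) : DiscSpace V c r →L[ℂ] DiscSpace V c r :=
  have key : ∀ (f : DiscSpace V c r) (z : 𝔻(c, r)),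
      (toDisc V c r (dslope (ext0 f.1) p)).1 z = dslope (ext0 f.1) p z := fun f z =>
    toDisc_apply (continuousOn_dslope_ext0 hp f) (differentiableOn_dslope_ext0 hp f) z
  mkContinuous
    { toFun := fun f => toDisc V c r (dslope (ext0 f.1) p)
      map_add' := fun f g => discSpace_ext fun z => by
        have h : ext0 (f + g).1 = ext0 f.1 + ext0 g.1 := funext fun z => ext0_add f.1 g.1 z
        change _ = (toDisc V c r (dslope (ext0 f.1) p)).1 z + (toDisc V c r (dslope (ext0 g.1) p)).1 z
        rw [key, key, key, h]; rcases eq_or_ne (z : ℂ) p with hz | hz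
        · rw [hz, dslope_same, dslope_same, dslope_same,
            deriv_add (differentiableAt_ext0 f hp) (differentiableAt_ext0 g hp)]
        · rw [dslope_of_ne _ hz, dslope_of_ne _ hz, dslope_of_ne _ hz, slope_def_module,
            slope_def_module, slope_def_module, ← smul_add]
          congr 1; simp only [Pi.add_apply]
          abel
      map_smul' := fun a f => discSpace_ext fun z => by
        have h : ext0 (a • f).1 = a • ext0 f.1 := funext fun z => ext0_smul a f.1 z
        change _ = a • (toDisc V c r (dslope (ext0 f.1) p)).1 z; rw [key, key, h]
        rcases eq_or_ne (z : ℂ) p with hz | hz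
        · rw [hz, dslope_same, dslope_same, deriv_const_smul _ (differentiableAt_ext0 f hp)]
        · rw [dslope_of_ne _ hz, dslope_of_ne _ hz, slope_def_module, slope_def_module, smul_comm a]
          congr 1; simp only [Pi.smul_apply, smul_sub] }
    (2 / (r - ‖p - c‖)) fun f => by
      have hd : 0 < r - ‖p - c‖ := by rw [mem_ball_iff_norm] at hp; linarith
      exact norm_toDisc_le (by positivity) fun z hz => norm_dslope_ext0_le hp f hz

theorem ext0_eq_add_dslopeDisc (hp : p ∈ ball (c : ℂ) r) (f : DiscSpace V c r) {z : ℂ}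
    (hz : z ∈ 𝔻(c, r)) : ext0 f.1 z = ext0 f.1 p + (z - p) • ext0 (dslopeDisc V hp f).1 z := by
  have key : (dslopeDisc V hp f).1 ⟨z, hz⟩ = dslope (ext0 f.1) p z :=
    toDisc_apply (continuousOn_dslope_ext0 hp f) (differentiableOn_dslope_ext0 hp f) ⟨z, hz⟩
  rw [ext0_apply (dslopeDisc V hp f).1 hz, key, sub_smul_dslope]
  abel

/-- The Taylor coefficients at `p`. -/
def taylorAt (V : Type*) [NormedAddCommGroup V] [InnerProductSpace ℂ V] [CompleteSpace V] {c r : ℝ}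
    {p : ℂ} (hp : p ∈ ball (c : ℂ) r) (j : ℕ) : DiscSpace V c r →L[ℂ] V :=
  (evalDisc ⟨p, ball_subset_closedBall hp⟩).comp (dslopeDisc V hp ^ j)

theorem ext0_pow_dslopeDisc (hp : p ∈ ball (c : ℂ) r) (f : DiscSpace V c r) {z : ℂ}
    (hz : z ∈ 𝔻(c, r)) (j : ℕ) : ext0 ((dslopeDisc V hp ^ j) f).1 z
    = taylorAt V hp j f + (z - p) • ext0 ((dslopeDisc V hp ^ (j + 1)) f).1 z := by
  rw [ext0_eq_add_dslopeDisc hp _ hz, pow_succ' _ j]; congr 1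
  rw [ext0_apply _ (ball_subset_closedBall hp)]
  rfl

end DividedDifference

section Unitary

variable {V : Type*} [NormedAddCommGroup V] [InnerProductSpace ℂ V] [FiniteDimensional ℂ V]

/-- The continuous linear map underlying a unitary operator. -/
def unitaryCLM (u : V ≃ₗᵢ[ℂ] V) : V →L[ℂ] V := u.toContinuousLinearEquiv

@[simp] theorem unitaryCLM_apply (u : V ≃ₗᵢ[ℂ] V) (x : V) : unitaryCLM u x = u x := rfl

theorem unitaryCLM_pow_apply (u : V ≃ₗᵢ[ℂ] V) (n : ℕ) (x : V) :
    (unitaryCLM u ^ n) x = (u ^ n) x := by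
  induction n generalizing x with
  | zero => rfl
  | succ n ih =>
    rw [pow_succ, pow_succ]; exact ih (u x)

/-- The fixed space of a unitary operator. -/
def fixSpace (u : V ≃ₗᵢ[ℂ] V) : Submodule ℂ V :=
  LinearMap.ker ((u.toLinearEquiv : V →ₗ[ℂ] V) - (LinearMap.id : V →ₗ[ℂ] V))

theorem mem_fixSpace {u : V ≃ₗᵢ[ℂ] V} {x : V} : x ∈ fixSpace u ↔ u x = x := by
  simp [fixSpace, sub_eq_zero]

/-- The orthogonal projection to the fixed space. -/
def fixProj (u : V ≃ₗᵢ[ℂ] V) : V →L[ℂ] V := (fixSpace u).starProjection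

theorem fixProj_mem (u : V ≃ₗᵢ[ℂ] V) (x : V) : fixProj u x ∈ fixSpace u :=
  Submodule.starProjection_apply_mem _ _

theorem fixProj_of_mem {u : V ≃ₗᵢ[ℂ] V} {x : V} (hx : x ∈ fixSpace u) : fixProj u x = x :=
  Submodule.starProjection_eq_self_iff.2 hx

theorem fixProj_map (u : V ≃ₗᵢ[ℂ] V) (x : V) : fixProj u (u x) = fixProj u x := by
  rw [← sub_eq_zero, ← map_sub, fixProj, Submodule.starProjection_apply_eq_zero_iff]; intro y hy
  rw [mem_fixSpace] at hy; rw [inner_sub_right]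
  conv_lhs => rw [← hy]
  rw [u.inner_map_map, hy, sub_self]

theorem injective_one_sub_add_fixProj (u : V ≃ₗᵢ[ℂ] V) :
    Function.Injective ((1 : V →L[ℂ] V) - unitaryCLM u + fixProj u) := by
  rw [injective_iff_map_eq_zero]; intro x hx; have h1 : x - u x + fixProj u x = 0 := hx
  have h2 : fixProj u x = 0 := by
    have := congrArg (fixProj u) h1
    rwa [map_add, map_sub, fixProj_map, sub_self, zero_add, map_zero,
      fixProj_of_mem (fixProj_mem u x)] at this
  rw [h2, add_zero, sub_eq_zero] at h1; rw [← h2, fixProj_of_mem (mem_fixSpace.2 h1.symm)]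

/-- The spectral data of a unitary operator at the eigenvalue `1`. -/
def lerchData (l : ℝ) (hl : 1 ≤ l) (u : V ≃ₗᵢ[ℂ] V) : LerchData (V →L[ℂ] V) :=
  have : CompleteSpace V := FiniteDimensional.complete ℂ V
  let e : V ≃ₗ[ℂ] V := LinearEquiv.ofInjectiveEndo
    (((1 : V →L[ℂ] V) - unitaryCLM u + fixProj u : V →L[ℂ] V) : V →ₗ[ℂ] V)
    (injective_one_sub_add_fixProj u)
  have he : ∀ x, e.symm (x - u x + fixProj u x) = x := fun x => e.symm_apply_apply x
  { l := l
    one_le := hl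
    ω := unitaryCLM u
    P := fixProj u
    B := toContinuousLinearMap (e.symm : V →ₗ[ℂ] V) - fixProj u
    norm_pow_le := fun n => opNorm_le_bound _ zero_le_one fun x => by
      rw [unitaryCLM_pow_apply, LinearIsometryEquiv.norm_map, one_mul]
    P_mul := ContinuousLinearMap.ext fun x => fixProj_map u x
    mul_P := ContinuousLinearMap.ext fun x => mem_fixSpace.1 (fixProj_mem u x)
    P_mul_P := ContinuousLinearMap.ext fun x => fixProj_of_mem (fixProj_mem u x)
    B_mul := ContinuousLinearMap.ext fun x => by
      change e.symm (x - u x) - fixProj u (x - u x) = x - fixProj u x; have h1 := he x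
      have h2 := he (fixProj u x)
      rw [mem_fixSpace.1 (fixProj_mem u x), sub_self, zero_add,
        fixProj_of_mem (fixProj_mem u x)] at h2
      rw [map_add, h2] at h1
      rw [map_sub (fixProj u), fixProj_map, sub_self, sub_zero, eq_sub_iff_add_eq, h1]
    B_mul_P := ContinuousLinearMap.ext fun x => by
      change e.symm (fixProj u x) - fixProj u (fixProj u x) = 0; have h2 := he (fixProj u x)
      rw [mem_fixSpace.1 (fixProj_mem u x), sub_self, zero_add,
        fixProj_of_mem (fixProj_mem u x)] at h2
      rw [h2, fixProj_of_mem (fixProj_mem u x), sub_self] }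

end Unitary

theorem sl_mul_apply (A B : SL(2, ℝ)) (i j : Fin 2) :
    (A * B) i j = A i 0 * B 0 j + A i 1 * B 1 j := by
  rw [Matrix.SpecialLinearGroup.coe_mul, Matrix.mul_apply, Fin.sum_univ_two]

section Chebyshev

variable {q : ℕ}

/-- `sin (k π / q) / sin (π / q)`. -/
def sq (q k : ℕ) : ℝ := Real.sin (k * (π / q)) / Real.sin (π / q)

theorem pi_div_pos (hq : 3 ≤ q) : 0 < π / q := by
  have : (0 : ℝ) < q := by exact_mod_cast (by omega : 0 < q)
  positivity

theorem pi_div_le (hq : 3 ≤ q) : π / q ≤ π / 3 :=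
  div_le_div_of_nonneg_left pi_pos.le (by norm_num) (by exact_mod_cast hq)

theorem sin_pi_div_pos (hq : 3 ≤ q) : 0 < Real.sin (π / q) :=
  sin_pos_of_pos_of_lt_pi (pi_div_pos hq) (by linarith [pi_div_le hq, pi_pos])

theorem one_le_lam (hq : 3 ≤ q) : 1 ≤ lam q := by
  have h := cos_le_cos_of_nonneg_of_le_pi (pi_div_pos hq).le
    (by linarith [pi_pos]) (pi_div_le hq)
  rw [cos_pi_div_three] at h; rw [lam]; linarith

theorem lam_lt_two (hq : 3 ≤ q) : lam q < 2 := by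
  have h := cos_lt_cos_of_nonneg_of_le_pi (x := 0) le_rfl
    (by linarith [pi_div_le hq, pi_pos]) (pi_div_pos hq)
  rw [Real.cos_zero] at h; rw [lam]; linarith

theorem sq_zero : sq q 0 = 0 := by simp [sq]

theorem sq_one (hq : 3 ≤ q) : sq q 1 = 1 := by simp [sq, (sin_pi_div_pos hq).ne']

theorem sq_succ_succ (k : ℕ) : sq q (k + 2) = lam q * sq q (k + 1) - sq q k := by
  have h1 : ((k + 2 : ℕ) : ℝ) * (π / q)
      = ((k + 1 : ℕ) : ℝ) * (π / q) + π / q := by push_cast; ring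
  have h2 : (k : ℝ) * (π / q)
      = ((k + 1 : ℕ) : ℝ) * (π / q) - π / q := by push_cast; ring
  rw [sq, sq, sq, h1, h2, Real.sin_add, Real.sin_sub, lam]; ring

theorem sq_add (k : ℕ) : sq q (k + 2) + sq q k = lam q * sq q (k + 1) := by rw [sq_succ_succ]; ring

theorem sq_two (hq : 3 ≤ q) : sq q 2 = lam q := by rw [sq_succ_succ, sq_zero, sq_one hq]; ring

theorem sq_pos (hq : 3 ≤ q) {k : ℕ} (h0 : 0 < k) (hk : k < q) : 0 < sq q k := by
  have hq0 : (0 : ℝ) < q := by exact_mod_cast (by omega : 0 < q)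
  refine div_pos (sin_pos_of_pos_of_lt_pi ?_ ?_) (sin_pi_div_pos hq)
  · have := pi_div_pos hq; have : (0 : ℝ) < k := by exact_mod_cast h0
    positivity
  · have h : (k : ℝ) < q := by exact_mod_cast hk
    calc (k : ℝ) * (π / q) < q * (π / q) := mul_lt_mul_of_pos_right h (pi_div_pos hq)
      _ = π := by field_simp

theorem sq_sub (hq : 3 ≤ q) {k : ℕ} (hk : k ≤ q) : sq q (q - k) = sq q k := by
  have hq0 : (q : ℝ) ≠ 0 := by exact_mod_cast (by omega : q ≠ 0)
  rw [sq, sq, Nat.cast_sub hk, sub_mul, mul_div_cancel₀ _ hq0, Real.sin_pi_sub]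

theorem sq_self (hq : 3 ≤ q) : sq q q = 0 := by
  rw [← sq_zero (q := q), ← sq_sub hq (Nat.zero_le q), Nat.sub_zero]

theorem sq_nonneg' (hq : 3 ≤ q) {k : ℕ} (hk : k ≤ q) : 0 ≤ sq q k := by
  rcases Nat.eq_zero_or_pos k with rfl | h0
  · exact sq_zero.ge
  rcases hk.eq_or_lt with rfl | h
  · exact (sq_self hq).ge
  · exact (sq_pos hq h0 h).le

/-- The determinant identity. -/
theorem sq_mul_self (hq : 3 ≤ q) (k : ℕ) :
    sq q (k + 1) * sq q (k + 1) - sq q (k + 2) * sq q k = 1 := by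
  induction k with
  | zero => rw [sq_zero, sq_one hq]; ring
  | succ k ih =>
    have h1 := sq_succ_succ (q := q) (k + 1); have h2 := sq_succ_succ (q := q) k; rw [h1]
    have : sq q k = lam q * sq q (k + 1) - sq q (k + 2) := by rw [h2]; ring
    rw [this] at ih; linarith

end Chebyshev

section Matrices

variable {q : ℕ}

/-- `A = ± 𝒯 (a, b; c, d) 𝒯⁻¹`. -/
def IsConj (A : SL(2, ℝ)) (a b c d : ℝ) : Prop :=
  ∃ σ : ℝ, σ * σ = 1 ∧ A 0 0 = σ * (((a - c) - (b - d)) / 2) ∧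
    A 0 1 = σ * (((a - c) + (b - d)) / 2) ∧ A 1 0 = σ * (((a + c) - (b + d)) / 2) ∧
    A 1 1 = σ * (((a + c) + (b + d)) / 2)

theorem isConj_conj (B : SL(2, ℝ)) {a b c d σ : ℝ} (hσ : σ * σ = 1) (h00 : B 0 0 = σ * a)
    (h01 : B 0 1 = σ * b) (h10 : B 1 0 = σ * c) (h11 : B 1 1 = σ * d) :
    IsConj (matC * B * matC⁻¹) a b c d := by
  have h2 : (√2 : ℝ) * √2 = 2 := mul_self_sqrt (by norm_num)
  have h3 : (√2 : ℝ)⁻¹ * (√2)⁻¹ = 1 / 2 := by rw [← mul_inv, h2]; norm_num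
  have hC : ∀ i j, matC i j = (!![1 / √2, -(1 / √2); 1 / √2, 1 / √2] : Matrix _ _ ℝ) i j :=
    fun i j => rfl
  have hD : ∀ i j, (matC⁻¹) i j = (!![1 / √2, (1 / √2); -(1 / √2), 1 / √2] : Matrix _ _ ℝ) i j := by
    intro i j; rw [SL2_inv_expl]
    fin_cases i <;> fin_cases j <;> simp [hC]
  refine ⟨σ, hσ, ?_, ?_, ?_, ?_⟩
  all_goals
    simp only [sl_mul_apply, hC, hD, h00,
      h01, h10, h11]
    simp
  · linear_combination (σ * (a - c - b + d)) * h3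
  · linear_combination (σ * (a - c + b - d)) * h3
  · linear_combination (σ * (a + c - b - d)) * h3
  · linear_combination (σ * (a + c + b + d)) * h3

namespace IsConj

variable {A : SL(2, ℝ)} {a b c d : ℝ}

theorem exists_denom (h : IsConj A a b c d) : ∃ σ : ℝ, σ * σ = 1 ∧ ∀ z : ℂ,
    denom A z = σ * (((a + c) * (1 + z) + (b + d) * (1 - z)) / 2) := by
  obtain ⟨σ, hσ, -, -, h10, h11⟩ := h; refine ⟨σ, hσ, fun z => ?_⟩; rw [denom, h10, h11]; push_cast
  ring

theorem moebius_eq (h : IsConj A a b c d) (z : ℂ) : moebius A z =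
    ((a - c) * (1 + z) + (b - d) * (1 - z)) / ((a + c) * (1 + z) + (b + d) * (1 - z)) := by
  obtain ⟨σ, hσ, h00, h01, h10, h11⟩ := h
  have hσ0 : (σ : ℂ) ≠ 0 := by rintro h; rw [ofReal_eq_zero] at h; simp [h] at hσ
  have h2 : ((σ : ℂ) / 2) ≠ 0 := by simpa using hσ0
  rw [moebius, denom, h00, h01, h10, h11]; push_cast
  conv_rhs => rw [← mul_div_mul_left _ _ h2]
  congr 1 <;> ring

theorem jfac_eq (h : IsConj A a b c d) (s z : ℂ) : jfac s A z =
    (((((a + c) * (1 + z) + (b + d) * (1 - z)) / 2) ^ 2)⁻¹) ^ s := by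
  obtain ⟨σ, hσ, h⟩ := h.exists_denom
  have hσ' : (σ : ℂ) ^ 2 = 1 := by rw [pow_two]; exact_mod_cast hσ
  rw [jfac, h, mul_pow, hσ', one_mul]

theorem denom_ne_zero_iff (h : IsConj A a b c d) (z : ℂ) :
    denom A z ≠ 0 ↔ (a + c) * (1 + z) + (b + d) * (1 - z) ≠ 0 := by
  obtain ⟨σ, hσ, h⟩ := h.exists_denom
  have hσ0 : (σ : ℂ) ≠ 0 := by rintro h; rw [ofReal_eq_zero] at h; simp [h] at hσ
  rw [h]; simp [hσ0]

end IsConj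

/-- `(T S)^k S`. -/
def matX (q k : ℕ) : SL(2, ℝ) := (matT q * matS) ^ k * matS

theorem matH_pow_inv (k n : ℕ) : ((matH q k) ^ n)⁻¹ = matC * matX q k ^ n * matC⁻¹ := by
  rw [matH, conj_pow, matG]; change (matC * ((matX q k)⁻¹) ^ n * matC⁻¹)⁻¹ = _; rw [inv_pow]
  group

theorem matTS_entries : (matT q * matS) 0 0 = -lam q ∧ (matT q * matS) 0 1 = 1 ∧
    (matT q * matS) 1 0 = -1 ∧ (matT q * matS) 1 1 = 0 := by
  have h1 : ∀ i j, matT q i j = (!![1, lam q; 0, 1] : Matrix _ _ ℝ) i j := fun i j => rfl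
  have h2 : ∀ i j, matS i j = (!![0, 1; -1, 0] : Matrix _ _ ℝ) i j := fun i j => rfl
  simp [sl_mul_apply, h1, h2]

theorem matTS_pow_entries (hq : 3 ≤ q) (k : ℕ) :
    ((matT q * matS) ^ (k + 1)) 0 0 = (-1) ^ (k + 1) * sq q (k + 2) ∧
    ((matT q * matS) ^ (k + 1)) 0 1 = -((-1) ^ (k + 1) * sq q (k + 1)) ∧
    ((matT q * matS) ^ (k + 1)) 1 0 = (-1) ^ (k + 1) * sq q (k + 1) ∧
    ((matT q * matS) ^ (k + 1)) 1 1 = -((-1) ^ (k + 1) * sq q k) := by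
  obtain ⟨t1, t2, t3, t4⟩ := matTS_entries (q := q); induction k with
  | zero =>
    rw [zero_add, pow_one, t1, t2, t3, t4, sq_two hq, sq_one hq, sq_zero]; simp
  | succ k ih =>
    obtain ⟨h1, h2, h3, h4⟩ := ih; have h := sq_succ_succ (q := q) (k + 1)
    have h' := sq_succ_succ (q := q) k; rw [pow_succ (matT q * matS) (k + 1)]
    simp only [sl_mul_apply _ (matT q * matS), h1, h2, h3, h4]; rw [t1, t2, t3, t4]
    rw [show k + 1 + 2 = k + 3 from rfl, show k + 1 + 1 = k + 2 from rfl] at *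
    rw [h, h', pow_succ (-1 : ℝ) (k + 1)]; refine ⟨?_, ?_, ?_, ?_⟩ <;> ring

theorem matX_entries (hq : 3 ≤ q) (k : ℕ) : matX q (k + 1) 0 0 = (-1) ^ (k + 1) * sq q (k + 1) ∧
    matX q (k + 1) 0 1 = (-1) ^ (k + 1) * sq q (k + 2) ∧
    matX q (k + 1) 1 0 = (-1) ^ (k + 1) * sq q k ∧
    matX q (k + 1) 1 1 = (-1) ^ (k + 1) * sq q (k + 1) := by
  obtain ⟨h1, h2, h3, h4⟩ := matTS_pow_entries hq k
  have h5 : ∀ i j, matS i j = (!![0, 1; -1, 0] : Matrix _ _ ℝ) i j := fun i j => rfl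
  simp only [matX, sl_mul_apply _ matS,
    h1, h2, h3, h4, h5]
  simp

theorem neg_one_pow_mul_self (n : ℕ) : (-1 : ℝ) ^ n * (-1) ^ n = 1 := by rw [← mul_pow]; simp

theorem isConj_matH_inv (hq : 3 ≤ q) (k : ℕ) :
    IsConj (matH q (k + 1))⁻¹ (sq q (k + 1)) (sq q (k + 2)) (sq q k) (sq q (k + 1)) := by
  obtain ⟨h1, h2, h3, h4⟩ := matX_entries hq k
  rw [← pow_one (matH q (k + 1)), matH_pow_inv, pow_one]
  exact isConj_conj _ (neg_one_pow_mul_self _) h1 h2 h3 h4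

theorem matX_one_pow_entries (hq : 3 ≤ q) (n : ℕ) :
    (matX q 1 ^ n) 0 0 = (-1) ^ n * 1 ∧ (matX q 1 ^ n) 0 1 = (-1) ^ n * (n * lam q) ∧
    (matX q 1 ^ n) 1 0 = (-1) ^ n * 0 ∧ (matX q 1 ^ n) 1 1 = (-1) ^ n * 1 := by
  obtain ⟨t1, t2, t3, t4⟩ := matX_entries hq 0
  rw [zero_add, zero_add, sq_two hq, sq_one hq, sq_zero] at *
  induction n with
  | zero => simp
  | succ n ih =>
    obtain ⟨h1, h2, h3, h4⟩ := ih
    simp only [pow_succ (matX q 1) n, sl_mul_apply _ (matX q 1), h1, h2, h3, h4, t1, t2, t3, t4]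
    push_cast; refine ⟨?_, ?_, ?_, ?_⟩ <;> ring

theorem isConj_matH_one_pow_inv (hq : 3 ≤ q) (n : ℕ) :
    IsConj ((matH q 1) ^ n)⁻¹ 1 (n * lam q) 0 1 := by
  obtain ⟨h1, h2, h3, h4⟩ := matX_one_pow_entries hq n; rw [matH_pow_inv]
  exact isConj_conj _ (neg_one_pow_mul_self _) h1 h2 h3 h4

theorem matX_last_pow_entries (hq : 3 ≤ q) (n : ℕ) : ∃ σ : ℝ, σ * σ = 1 ∧
    (matX q (q - 1) ^ n) 0 0 = σ * 1 ∧ (matX q (q - 1) ^ n) 0 1 = σ * 0 ∧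
    (matX q (q - 1) ^ n) 1 0 = σ * (n * lam q) ∧ (matX q (q - 1) ^ n) 1 1 = σ * 1 := by
  obtain ⟨t1, t2, t3, t4⟩ := matX_entries hq (q - 2)
  simp only [show q - 2 + 1 = q - 1 by omega, show q - 2 + 2 = q by omega, sq_self hq,
    sq_sub hq (show 1 ≤ q by omega), sq_sub hq (show 2 ≤ q by omega), sq_two hq, sq_one hq]
    at t1 t2 t3 t4
  refine ⟨((-1) ^ (q - 1)) ^ n, ?_, ?_⟩
  · rw [← mul_pow, neg_one_pow_mul_self, one_pow]
  induction n with
  | zero => simp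
  | succ n ih =>
    obtain ⟨h1, h2, h3, h4⟩ := ih
    simp only [pow_succ (matX q (q - 1)) n, sl_mul_apply _ (matX q (q - 1)), h1, h2, h3, h4, t1, t2, t3, t4]
    push_cast; refine ⟨?_, ?_, ?_, ?_⟩ <;> ring

theorem isConj_matH_last_pow_inv (hq : 3 ≤ q) (n : ℕ) :
    IsConj ((matH q (q - 1)) ^ n)⁻¹ 1 0 (n * lam q) 1 := by
  obtain ⟨σ, hσ, h1, h2, h3, h4⟩ := matX_last_pow_entries hq n; rw [matH_pow_inv]
  exact isConj_conj _ hσ h1 h2 h3 h4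

end Matrices

section Thales

/-- A real affine image of the closed disc with diameter `[α, β]`. -/
theorem re_mul_conj_neg {p₀ p₁ q₀ q₁ α β : ℝ} (hαβ : α < β) (hP1 : 0 < p₀ + p₁ * α)
    (hP2 : 0 < p₀ + p₁ * β) (hQ1 : 0 < q₀ + q₁ * α) (hQ2 : 0 < q₀ + q₁ * β) {z : ℂ}
    (hz : z ∈ closedBall (((α + β) / 2 : ℝ) : ℂ) ((β - α) / 2)) :
    0 < (((p₀ : ℂ) + p₁ * z) * (starRingEnd ℂ) ((q₀ : ℂ) + q₁ * z)).re := by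
  rw [mem_closedBall_iff_norm] at hz
  have h1 : (z.re - (α + β) / 2) ^ 2 + z.im ^ 2 ≤ ((β - α) / 2) ^ 2 := by
    have h2 : ‖z - ((α + β) / 2 : ℝ)‖ ^ 2 = (z.re - (α + β) / 2) ^ 2 + z.im ^ 2 := by
      rw [Complex.sq_norm, normSq_apply]; simp; ring
    rw [← h2]; exact pow_le_pow_left₀ (norm_nonneg _) hz 2
  have hy : z.im ^ 2 ≤ (z.re - α) * (β - z.re) := by nlinarith
  have hb : 0 ≤ (z.re - α) * (β - z.re) := (_root_.sq_nonneg _).trans hy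
  have hα : α ≤ z.re := by by_contra! h; nlinarith
  have hβ : z.re ≤ β := by by_contra! h; nlinarith
  have hre : (((p₀ : ℂ) + p₁ * z) * (starRingEnd ℂ) ((q₀ : ℂ) + q₁ * z)).re
      = (p₀ + p₁ * z.re) * (q₀ + q₁ * z.re) + p₁ * q₁ * z.im ^ 2 := by
    simp; ring
  rw [hre]; have hd : 0 < β - α := sub_pos.2 hαβ
  have hlin : ∀ u v : ℝ, 0 < u + v * α → 0 < u + v * β → 0 < u + v * z.re := fun u v h1 h2 => by
    rcases le_total 0 v with hv | hv
    · nlinarith [mul_le_mul_of_nonneg_left hα hv]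
    · nlinarith [mul_le_mul_of_nonpos_left hβ hv]
  rcases le_total 0 (p₁ * q₁) with h | h
  · nlinarith [mul_pos (hlin _ _ hP1 hP2) (hlin _ _ hQ1 hQ2), mul_nonneg h (_root_.sq_nonneg z.im)]
  · have h3 : p₁ * q₁ * ((z.re - α) * (β - z.re)) ≤ p₁ * q₁ * z.im ^ 2 :=
      mul_le_mul_of_nonpos_left hy h
    have h4 : (β - α) * ((p₀ + p₁ * z.re) * (q₀ + q₁ * z.re) + p₁ * q₁ * ((z.re - α) * (β - z.re)))
        = (β - z.re) * ((p₀ + p₁ * α) * (q₀ + q₁ * α))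
          + (z.re - α) * ((p₀ + p₁ * β) * (q₀ + q₁ * β)) := by ring
    have h5 : 0 < (β - z.re) * ((p₀ + p₁ * α) * (q₀ + q₁ * α))
          + (z.re - α) * ((p₀ + p₁ * β) * (q₀ + q₁ * β)) := by
      rcases hα.eq_or_lt with h6 | h6
      · rw [← h6]; nlinarith [mul_pos hP1 hQ1]
      · have := mul_pos (sub_pos.2 h6) (mul_pos hP2 hQ2)
        have := mul_nonneg (sub_nonneg.2 hβ) (mul_pos hP1 hQ1).le; linarith
    rw [← h4] at h5; have := pos_of_mul_pos_right h5 hd.le; linarith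

theorem mem_ball_of_re_mul_conj {α β : ℝ} (hαβ : α < β) {w : ℂ}
    (h : 0 < ((w - α) * (starRingEnd ℂ) (β - w)).re) :
    w ∈ ball (((α + β) / 2 : ℝ) : ℂ) ((β - α) / 2) := by
  rw [mem_ball_iff_norm]; refine lt_of_pow_lt_pow_left₀ 2 (by linarith) ?_
  have h2 : ‖w - ((α + β) / 2 : ℝ)‖ ^ 2 = (w.re - (α + β) / 2) ^ 2 + w.im ^ 2 := by
    rw [Complex.sq_norm, normSq_apply]; simp; ring
  have h3 : ((w - α) * (starRingEnd ℂ) (β - w)).re = (w.re - α) * (β - w.re) - w.im ^ 2 := by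
    simp; ring
  rw [h2]; rw [h3] at h; nlinarith

/-- A conjugate of a real matrix maps a closed disc with real diameter into an open one as soon as
it maps the end points of the diameter there. -/
theorem IsConj.mapsInto {A : SL(2, ℝ)} {a b c d : ℝ} (h : IsConj A a b c d) {α β α' β' : ℝ}
    (hαβ : α < β) (hαβ' : α' < β')
    (h1 : ∀ x : ℝ, x = α ∨ x = β → 0 < (1 - α') * (a * (1 + x) + b * (1 - x)) - (1 + α') * (c * (1 + x) + d * (1 - x)))
    (h2 : ∀ x : ℝ, x = α ∨ x = β → 0 < (1 + β') * (c * (1 + x) + d * (1 - x)) - (1 - β') * (a * (1 + x) + b * (1 - x))) :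
    MapsInto A (closedBall (((α + β) / 2 : ℝ) : ℂ) ((β - α) / 2))
    (ball (((α' + β') / 2 : ℝ) : ℂ) ((β' - α') / 2)) := by
  intro z hz
  have key := re_mul_conj_neg (p₀ := (1 - α') * (a + b) - (1 + α') * (c + d))
    (p₁ := (1 - α') * (a - b) - (1 + α') * (c - d))
    (q₀ := (1 + β') * (c + d) - (1 - β') * (a + b))
    (q₁ := (1 + β') * (c - d) - (1 - β') * (a - b)) hαβ
    (by linarith [h1 α (Or.inl rfl)]) (by linarith [h1 β (Or.inr rfl)])
    (by linarith [h2 α (Or.inl rfl)]) (by linarith [h2 β (Or.inr rfl)]) hz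
  set N : ℂ := (a - c) * (1 + z) + (b - d) * (1 - z) with hN
  set D : ℂ := (a + c) * (1 + z) + (b + d) * (1 - z) with hD
  have e1 : (((1 - α') * (a + b) - (1 + α') * (c + d) : ℝ) : ℂ)
      + ((1 - α') * (a - b) - (1 + α') * (c - d) : ℝ) * z = N - α' * D := by
    rw [hN, hD]; push_cast; ring
  have e2 : (((1 + β') * (c + d) - (1 - β') * (a + b) : ℝ) : ℂ)
      + ((1 + β') * (c - d) - (1 - β') * (a - b) : ℝ) * z = β' * D - N := by
    rw [hN, hD]; push_cast; ring
  rw [e1, e2] at key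
  have hD0 : D ≠ 0 := by
    intro h0; rw [h0] at key; simp at key; nlinarith [mul_self_nonneg N.re, mul_self_nonneg N.im]
  refine ⟨(h.denom_ne_zero_iff z).2 hD0, ?_⟩; rw [h.moebius_eq]
  refine mem_ball_of_re_mul_conj hαβ' ?_
  change 0 < ((N / D - α') * (starRingEnd ℂ) (β' - N / D)).re
  have e3 : N / D - α' = (N - α' * D) / D := by field_simp
  have e4 : β' - N / D = (β' * D - N) / D := by field_simp
  rw [e3, e4, map_div₀, div_mul_div_comm, mul_conj, div_ofReal_re]
  exact div_pos key (normSq_pos.2 hD0)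

end Thales

section Existence

variable {q : ℕ}

theorem image_neg_conj_ball (c r : ℝ) :
    (fun z : ℂ => -(starRingEnd ℂ) z) '' ball (c : ℂ) r = ball ((-c : ℝ) : ℂ) r := by
  have key : ∀ (c : ℝ) (z : ℂ), ‖-(starRingEnd ℂ) z - ((-c : ℝ) : ℂ)‖ = ‖z - c‖ := fun c z => by
    rw [← norm_conj, ← norm_neg]; congr 1; simp; ring
  ext z; simp only [Set.mem_image, mem_ball_iff_norm]; constructor
  · rintro ⟨w, hw, rfl⟩; rwa [key]
  · intro hz; refine ⟨-(starRingEnd ℂ) z, ?_, by simp⟩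
    have := key (-c) z; rw [neg_neg] at this; rwa [this]

theorem ofReal_mem_ball_iff {a b x : ℝ} :
    (x : ℂ) ∈ ball (((a + b) / 2 : ℝ) : ℂ) ((b - a) / 2) ↔ a < x ∧ x < b := by
  rw [mem_ball_iff_norm, ← ofReal_sub, norm_real, norm_eq_abs, abs_lt]
  constructor <;> rintro ⟨h1, h2⟩ <;> constructor <;> linarith

theorem re_mem_of_mem_closedBall {a b : ℝ} {z : ℂ}
    (hz : z ∈ closedBall (((a + b) / 2 : ℝ) : ℂ) ((b - a) / 2)) : a ≤ z.re ∧ z.re ≤ b := by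
  rw [mem_closedBall_iff_norm] at hz; have h := (abs_re_le_norm _).trans hz
  rw [sub_re, ofReal_re, abs_le] at h; constructor <;> linarith

theorem affine_pos {u v x : ℝ} (hu : 0 < u) (hv : 0 < v) (hx : -1 ≤ x) (hx' : x ≤ 1) :
    0 < u * (1 + x) + v * (1 - x) := by
  rcases le_total 0 x with h | h
  · nlinarith [mul_nonneg hv.le (sub_nonneg.2 hx'), mul_nonneg hu.le h]
  · nlinarith [mul_nonneg hu.le (neg_le_iff_add_nonneg'.1 hx), mul_nonneg hv.le (neg_nonneg.2 h)]

theorem norm_deriv_moebius_lt_one {A : SL(2, ℝ)} {z : ℂ} (h : 1 < ‖denom A z‖) :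
    ‖deriv (moebius A) z‖ < 1 := by
  have h0 : denom A z ≠ 0 := fun h0 => by rw [h0, norm_zero] at h; linarith
  have hdet : (A 0 0 : ℂ) * A 1 1 - A 0 1 * A 1 0 = 1 := by
    have := A.det_coe; rw [det_fin_two] at this; exact_mod_cast this
  have h1 : HasDerivAt (fun z => (A 0 0 : ℂ) * z + (A 0 1 : ℂ)) (A 0 0) z := by
    simpa using ((hasDerivAt_id z).const_mul (A 0 0 : ℂ)).add_const (A 0 1 : ℂ)
  have h2 : HasDerivAt (fun z => (A 1 0 : ℂ) * z + (A 1 1 : ℂ)) (A 1 0) z := by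
    simpa using ((hasDerivAt_id z).const_mul (A 1 0 : ℂ)).add_const (A 1 1 : ℂ)
  have h3 := h1.div (h2 : HasDerivAt (denom A) (A 1 0) z) h0
  have h4 : deriv (moebius A) z = 1 / denom A z ^ 2 := by
    refine h3.deriv.trans ?_; congr 1
    change (A 0 0 : ℂ) * (A 1 0 * z + A 1 1) - (A 0 0 * z + A 0 1) * A 1 0 = 1
    linear_combination hdet
  rw [h4, norm_div, norm_one, norm_pow, div_lt_one (by positivity)]
  nlinarith

theorem norm_denom_of_isConj {A : SL(2, ℝ)} {a b c d : ℝ} (h : IsConj A a b c d) (z : ℂ) :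
    ‖denom A z‖ = ‖((a + c) * (1 + z) + (b + d) * (1 - z)) / 2‖ := by
  obtain ⟨σ, hσ, h⟩ := h.exists_denom
  have : |σ| = 1 := by rcases mul_self_eq_one_iff.1 hσ with rfl | rfl <;> simp
  rw [h, norm_mul, norm_real, norm_eq_abs, this, one_mul]

set_option maxHeartbeats 1000000 in
theorem exists_admissibleDiscs (hq : 3 ≤ q) : ∃ c r : Fin 3 → ℝ, AdmissibleDiscs q c r := by
  have hl1 := one_le_lam hq; have hl2 := lam_lt_two hq; set l := lam q with hl
  set μ := (l - 1) / (l + 1) with hμ; have hμ0 : 0 ≤ μ := div_nonneg (by linarith) (by linarith)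
  have hμ1 : μ < 1 := by rw [hμ, div_lt_one (by linarith)]; linarith
  have hμl : μ * (l + 1) = l - 1 := by rw [hμ]; field_simp
  have hRl : (1 + μ) * (l + 1) = 2 * l := by linarith
  have hRl' : (1 - μ) * (l + 1) = 2 := by linarith
  set R := (1 + μ) / 2 with hR; have hR1 : (1 + R) = (1 - R) * (2 * l + 1) := by rw [hR]; linarith
  have hR0 : 0 < 1 - R := by rw [hR]; linarith
  let f (k : ℕ) (x : ℝ) := (2 * l + 1) * (sq q k * (1 + x) + sq q (k + 1) * (1 - x))
    - (sq q (k - 1) * (1 + x) + sq q k * (1 - x))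
  let g (k : ℕ) (x : ℝ) := (2 * l + 1) * (sq q (k - 1) * (1 + x) + sq q k * (1 - x))
    - (sq q k * (1 + x) + sq q (k + 1) * (1 - x))
  -- positivity at the end points `±1`
  have hmid : ∀ k ∈ Finset.Icc 2 (q - 2), (0 < f k 1 ∧ 0 < g k 1) ∧ 0 < f k (-1) ∧ 0 < g k (-1) := by
    intro k hk; rw [Finset.mem_Icc] at hk; obtain ⟨m, rfl⟩ : ∃ m, k = m + 2 := ⟨k - 2, by omega⟩
    have e1 := sq_add (q := q) m; have e2 := sq_add (q := q) (m + 1)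
    have e3 := sq_add (q := q) (m + 2); have p0 := sq_nonneg' hq (show m ≤ q by omega)
    have p1 := sq_pos hq (show 0 < m + 1 by omega) (by omega)
    have p2 := sq_pos hq (show 0 < m + 2 by omega) (by omega)
    have p3 := sq_pos hq (show 0 < m + 3 by omega) (by omega)
    have p4 := sq_nonneg' hq (show m + 4 ≤ q by omega)
    simp only [f, g, show m + 2 - 1 = m + 1 by omega]
    rw [show m + 2 + 1 = m + 3 from rfl, show m + 1 + 2 = m + 3 from rfl,
      show m + 2 + 2 = m + 4 from rfl, show m + 1 + 1 = m + 2 from rfl, ← hl] at *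
    refine ⟨⟨?_, ?_⟩, ?_, ?_⟩ <;> nlinarith
  have hev : ∀ k ∈ Finset.Icc 2 (q - 2), ∀ᶠ b in 𝓝 (1 : ℝ),
      (0 < f k b ∧ 0 < g k b) ∧ 0 < f k (-b) ∧ 0 < g k (-b) := fun k hk =>
    have aux : ∀ {f : ℝ → ℝ}, Continuous f → 0 < f 1 → ∀ᶠ b in 𝓝 (1 : ℝ), 0 < f b :=
      fun hf h => hf.continuousAt.eventually (lt_mem_nhds h)
    have ⟨⟨h1, h2⟩, h3, h4⟩ := hmid k hk
    ((aux (by fun_prop) h1).and (aux (by fun_prop) h2)).and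
      ((aux (f := fun b => f k (-b)) (by fun_prop) h3).and
        (aux (f := fun b => g k (-b)) (by fun_prop) h4))
  have hev' := (Finset.eventually_all (Finset.Icc 2 (q - 2))).2 hev
  obtain ⟨b, hb, hb1, hb2⟩ := ((hev'.filter_mono nhdsWithin_le_nhds).and
    (Ioo_mem_nhdsGT (show (1 : ℝ) < 2 by norm_num))).exists
  set a := (μ - 1) / 2 with ha; have ha0 : -1 < a := by rw [ha]; linarith
  have ha1 : a < 0 := by rw [ha]; linarith
  have haR : (1 + a) * (l + 2) = (1 - a) * l := by rw [ha]; linarith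
  have ha2 : 1 + a = (1 - a) * (l / (l + 2)) := by field_simp; linarith
  have hin : ∀ k ∈ Finset.Icc 2 (q - 2), ∀ x : ℝ, (-1 ≤ x ∧ x ≤ 1) ∨ x = b ∨ x = -b →
      0 < f k x ∧ 0 < g k x := by
    rintro k hk x (hx | rfl | rfl)
    · obtain ⟨⟨h1, h2⟩, h3, h4⟩ := hmid k hk; simp only [f, g] at *
      exact ⟨by linarith [affine_pos h1 h3 hx.1 hx.2], by linarith [affine_pos h2 h4 hx.1 hx.2]⟩
    · exact (hb k hk).1
    · exact (hb k hk).2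
  let lo : Fin 3 → ℝ := ![a, -R, -b]; let hi : Fin 3 → ℝ := ![b, R, -a]
  have hRlt : R < 1 := by linarith
  have hR0' : 0 < R := by rw [hR]; linarith
  have hlohi : ∀ i, lo i < hi i := by intro i; fin_cases i <;> simp [lo, hi] <;> linarith
  have hcase : ∀ i, ∀ x : ℝ, x = lo i ∨ x = hi i → (-1 ≤ x ∧ x ≤ 1) ∨ x = b ∨ x = -b := by
    intro i x hx
    fin_cases i <;> rcases hx with rfl | rfl <;> simp [lo, hi] <;>
      (left; constructor <;> linarith)
  have hout : ∀ n : ℕ, 1 ≤ n → ∀ x : ℝ, x = -b ∨ (-1 < x ∧ x < 1) →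
      0 < (1 - a) * (1 * (1 + x) + n * l * (1 - x)) - (1 + a) * (0 * (1 + x) + 1 * (1 - x)) ∧
      0 < (1 + b) * (0 * (1 + x) + 1 * (1 - x)) - (1 - b) * (1 * (1 + x) + n * l * (1 - x)) := by
    intro n hn x hx
    have hn' : l ≤ n * l := le_mul_of_one_le_left (by linarith) (by exact_mod_cast hn)
    have hfr : l / (l + 2) ≤ 1 / 2 := by rw [div_le_div_iff₀ (by linarith) (by norm_num)]; linarith
    have hx1 : 0 < 1 - x := by rcases hx with rfl | hx <;> linarith
    constructor
    · rw [ha2]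
      have : 0 < (1 + x) + (n * l - l / (l + 2)) * (1 - x) := by
        have h5 : 1 / 2 * (1 - x) ≤ (n * l - l / (l + 2)) * (1 - x) :=
          mul_le_mul_of_nonneg_right (by linarith) hx1.le
        rcases hx with rfl | hx <;> linarith
      nlinarith [mul_pos (show 0 < 1 - a by linarith) this]
    · have h6 : 0 ≤ (b - 1) * (n * l * (1 - x)) := by
        have : 0 < b - 1 := by linarith
        have : 0 ≤ (n : ℝ) * l := by linarith
        positivity
      rcases hx with rfl | hx
      · nlinarith
      · nlinarith [mul_pos (show 0 < b - 1 by linarith) (show 0 < 1 + x by linarith)]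
  have hlast : ∀ n : ℕ, 1 ≤ n → ∀ x : ℝ, x = b ∨ (-1 < x ∧ x < 1) →
      0 < (1 - -b) * (1 * (1 + x) + 0 * (1 - x)) - (1 + -b) * (n * l * (1 + x) + 1 * (1 - x)) ∧
      0 < (1 + -a) * (n * l * (1 + x) + 1 * (1 - x)) - (1 - -a) * (1 * (1 + x) + 0 * (1 - x)) := by
    intro n hn x hx
    obtain ⟨h1, h2⟩ := hout n hn (-x) (by
      rcases hx with rfl | hx
      · exact .inl rfl
      · right; constructor <;> linarith)
    constructor <;> linarith
  refine ⟨fun i => (lo i + hi i) / 2, fun i => (hi i - lo i) / 2, ?_⟩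
  have hcd : ∀ i, ∀ z ∈ cdisc (fun i => (lo i + hi i) / 2) (fun i => (hi i - lo i) / 2) i,
      lo i ≤ z.re ∧ z.re ≤ hi i := fun i z hz => re_mem_of_mem_closedBall hz
  refine ⟨fun i => by linarith [hlohi i], fun i x hx => ?_, ?_, ?_, fun k hk i => ?_,
    fun n hn i hi0 => ?_, fun n hn i hi2 => ?_, fun z hz => ?_, fun z hz => ?_, fun z hz => ?_,
    fun z hz => ?_, fun z hz => ?_⟩
  · refine ofReal_mem_ball_iff.2 ?_
    fin_cases i
    · have h1 := closure_minimal (t := Set.Icc μ 1) Set.Ioo_subset_Icc_self isClosed_Icc hx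
      simp only [lo, hi]; exact ⟨show a < x by linarith [h1.1], show x < b by linarith [h1.2]⟩
    · have h1 := closure_minimal (t := Set.Icc (-μ) μ) Set.Ioo_subset_Icc_self isClosed_Icc hx
      exact ⟨show -R < x by rw [hR]; linarith [h1.1], show x < R by rw [hR]; linarith [h1.2]⟩
    · have h1 := closure_minimal (t := Set.Icc (-1) (-μ)) Set.Ioo_subset_Icc_self isClosed_Icc hx
      exact ⟨show -b < x by linarith [h1.1], show x < -a by linarith [h1.2]⟩
  · simp only [disc]; rw [image_neg_conj_ball]; congr 2; simp [lo, hi]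
  · simp only [disc]; rw [image_neg_conj_ball]; congr 2
    · simp [lo, hi]; ring
    · simp [lo, hi]; ring
  · have hk' := Finset.mem_Icc.1 hk; have h := isConj_matH_inv hq (k - 1)
    rw [show k - 1 + 1 = k by omega, show k - 1 + 2 = k + 1 by omega] at h
    refine h.mapsInto (hlohi i) (hlohi 1) (fun x hx => ?_) fun x hx => ?_
    · have := (hin k hk x (hcase i x hx)).1; change 0 < (1 - -R) * _ - (1 + -R) * _
      rw [sub_neg_eq_add, hR1, ← sub_eq_add_neg, mul_assoc, ← mul_sub]; exact mul_pos hR0 this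
    · have := (hin k hk x (hcase i x hx)).2; change 0 < (1 + R) * _ - (1 - R) * _
      rw [hR1, mul_assoc, ← mul_sub]; exact mul_pos hR0 this
  · have hx' : ∀ x : ℝ, x = lo i ∨ x = hi i → x = -b ∨ (-1 < x ∧ x < 1) := by
      intro x hx
      fin_cases i <;> rcases hx with rfl | rfl <;> simp [lo, hi] at hi0 ⊢ <;>
        (right; constructor <;> linarith)
    exact (isConj_matH_one_pow_inv hq n).mapsInto (hlohi i) (hlohi 0)
      (fun x hx => (hout n hn x (hx' x hx)).1) fun x hx => (hout n hn x (hx' x hx)).2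
  · have hx' : ∀ x : ℝ, x = lo i ∨ x = hi i → x = b ∨ (-1 < x ∧ x < 1) := by
      intro x hx
      fin_cases i <;> rcases hx with rfl | rfl <;> simp [lo, hi] at hi2 ⊢ <;>
        (right; constructor <;> linarith)
    exact (isConj_matH_last_pow_inv hq n).mapsInto (hlohi i) (hlohi 2)
      (fun x hx => (hlast n hn x (hx' x hx)).1) fun x hx => (hlast n hn x (hx' x hx)).2
  · refine norm_deriv_moebius_lt_one ?_
    rw [norm_denom_of_isConj (by simpa using isConj_matH_one_pow_inv hq 1)]
    refine lt_of_lt_of_le ?_ (re_le_norm _)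
    have h2 : z.re ≤ -a := (hcd 2 z (ball_subset_closedBall hz)).2; simp; rw [← hl]; nlinarith
  · refine norm_deriv_moebius_lt_one ?_
    rw [norm_denom_of_isConj (by simpa using isConj_matH_last_pow_inv hq 1)]
    refine lt_of_lt_of_le ?_ (re_le_norm _)
    have h2 : a ≤ z.re := (hcd 0 z (ball_subset_closedBall hz)).1; simp; rw [← hl]; nlinarith
  · have h2 : a ≤ z.re := (hcd 0 z hz).1; linarith
  · have h2 : z.re ≤ -a := (hcd 2 z hz).2; linarith
  · have h2 : -R ≤ z.re := (hcd 1 z hz).1; have h3 : z.re ≤ R := (hcd 1 z hz).2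
    constructor <;> linarith

end Existence

section Branches

theorem log_inv_sq {w : ℂ} (hw : 0 < w.re) : Complex.log ((w ^ 2)⁻¹) = -(2 * Complex.log w) := by
  have h0 : w ≠ 0 := by rintro rfl; simp at hw
  have harg := (abs_arg_lt_pi_div_two_iff (z := w)).2 (Or.inl hw); rw [abs_lt] at harg
  have h1 : (w ^ 2)⁻¹ = Complex.exp (-(2 * Complex.log w)) := by
    rw [Complex.exp_neg, two_mul, Complex.exp_add, Complex.exp_log h0, pow_two]
  rw [h1, Complex.log_exp] <;> simp [log_im] <;> linarith [harg.1, harg.2]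

theorem log_div_of_re_pos {a b : ℂ} (ha : 0 < a.re) (hb : 0 < b.re) :
    Complex.log (a / b) = Complex.log a - Complex.log b := by
  have ha0 := ne_zero_of_re_pos ha; have hb0 := ne_zero_of_re_pos hb
  have h1 := (abs_arg_lt_pi_div_two_iff (z := a)).2 (Or.inl ha)
  have h2 := (abs_arg_lt_pi_div_two_iff (z := b)).2 (Or.inl hb); rw [abs_lt] at h1 h2
  have h3 : a / b = Complex.exp (Complex.log a - Complex.log b) := by
    rw [Complex.exp_sub, Complex.exp_log ha0, Complex.exp_log hb0]
  rw [h3, Complex.log_exp] <;> simp [log_im] <;> linarith [h1.1, h1.2, h2.1, h2.2]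

theorem inv_sq_cpow {a b : ℂ} (ha : 0 < a.re) (hb : 0 < b.re) (hab : 0 < (a / b).re) (s : ℂ) :
    (((a / b) ^ 2)⁻¹) ^ s = b ^ (2 * s) * a ^ (-(2 * s)) := by
  have ha0 := ne_zero_of_re_pos ha; have hb0 := ne_zero_of_re_pos hb
  have h0 : ((a / b) ^ 2)⁻¹ ≠ 0 := inv_ne_zero (pow_ne_zero 2 (div_ne_zero ha0 hb0))
  rw [cpow_def_of_ne_zero h0, cpow_def_of_ne_zero ha0,
    cpow_def_of_ne_zero hb0, ← Complex.exp_add, log_inv_sq hab, log_div_of_re_pos ha hb]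
  congr 1; ring

theorem inv_sq_mem_slitPlane {w : ℂ} (hw : w.re ≠ 0) : (w ^ 2)⁻¹ ∈ slitPlane := by
  have key : ∀ w : ℂ, w.re ≠ 0 → w ^ 2 ∈ slitPlane := by
    intro w hw; rw [mem_slitPlane_iff]; by_cases h : w.im = 0
    · left; have := mul_self_pos.2 hw; simpa [pow_two, h] using this
    · right; have := mul_ne_zero hw h; simp only [pow_two, mul_im]; intro h'; apply this; linarith
  rw [← inv_pow]; refine key _ ?_; rw [inv_re]; refine div_ne_zero hw fun h => hw ?_
  rw [normSq_eq_zero.1 h, zero_re]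

theorem ofReal_re_mem_closedBall {c r : ℝ} {z : ℂ} (hz : z ∈ 𝔻(c, r)) : (z.re : ℂ) ∈ 𝔻(c, r) := by
  rw [mem_closedBall_iff_norm] at hz ⊢; rw [← ofReal_sub, norm_real]
  have h := abs_re_le_norm (z - c); simp only [sub_re, ofReal_re] at h; exact h.trans hz

theorem denom_re (A : SL(2, ℝ)) (z : ℂ) : (denom A z).re = A 1 0 * z.re + A 1 1 := by simp [denom]

theorem denom_re_ne_zero {A : SL(2, ℝ)} {c r : ℝ} {U : Set ℂ} (h : MapsInto A 𝔻(c, r) U) {z : ℂ}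
    (hz : z ∈ 𝔻(c, r)) : (denom A z).re ≠ 0 := by
  have h1 := (h _ (ofReal_re_mem_closedBall hz)).1; intro h2; apply h1; rw [denom_re] at h2
  rw [denom]; exact_mod_cast h2

theorem continuousOn_moebius {A : SL(2, ℝ)} {K U : Set ℂ} (h : MapsInto A K U) :
    ContinuousOn (moebius A) K :=
  ContinuousOn.div (by fun_prop) (by unfold denom; fun_prop) fun z hz => (h z hz).1

theorem differentiableOn_moebius {A : SL(2, ℝ)} {K U : Set ℂ} (h : MapsInto A K U) :
    DifferentiableOn ℂ (moebius A) K :=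
  DifferentiableOn.div (by fun_prop) (by unfold denom; fun_prop) fun z hz => (h z hz).1

theorem continuousOn_jfac {A : SL(2, ℝ)} {c r : ℝ} {U : Set ℂ} (h : MapsInto A 𝔻(c, r) U) :
    ContinuousOn (fun p : ℂ × ℂ => jfac p.1 A p.2) (Set.univ ×ˢ 𝔻(c, r)) := by
  refine ContinuousOn.cpow (ContinuousOn.inv₀ (by unfold denom; fun_prop) fun p hp => ?_)
    (by fun_prop) fun p hp => inv_sq_mem_slitPlane (denom_re_ne_zero h hp.2)
  exact pow_ne_zero 2 (h _ hp.2).1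

theorem differentiable_jfac {A : SL(2, ℝ)} {z : ℂ} (h : denom A z ≠ 0) :
    Differentiable ℂ fun s => jfac s A z :=
  Differentiable.const_cpow differentiable_id (Or.inl (inv_ne_zero (pow_ne_zero 2 h)))

theorem differentiableOn_jfac {A : SL(2, ℝ)} {c r : ℝ} {U : Set ℂ} (h : MapsInto A 𝔻(c, r) U)
    (s : ℂ) : DifferentiableOn ℂ (jfac s A) 𝔻(c, r) := by
  refine DifferentiableOn.cpow (DifferentiableOn.inv (by unfold denom; fun_prop) fun z hz => ?_)
    (by fun_prop) fun z hz => inv_sq_mem_slitPlane (denom_re_ne_zero h hz)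
  exact pow_ne_zero 2 (h _ hz).1

end Branches

/-- The fixed points `1` and `-1` of `h_1` and `h_{q-1}`. -/
def sgn : Fin 3 → ℝ := ![1, 0, -1]

/-- The parabolic letters `h_1` and `h_{q-1}`. -/
def parIdx (q : ℕ) : Fin 3 → ℕ := ![1, 0, q - 1]

/-- The coordinate `2 / (1 - ε z)`. -/
def cuspCoord (ε : ℝ) (z : ℂ) : ℂ := 2 / (1 - ε * z)

/-- The inverse coordinate change. -/
def cuspPoint (ε : ℝ) (x : ℂ) : ℂ := ε * (1 - 2 / x)

theorem cuspCoord_re_pos {ε : ℝ} {z : ℂ} (h : ((ε : ℂ) * z).re < 1) : 0 < (cuspCoord ε z).re := by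
  have h1 : 0 < (1 - (ε : ℂ) * z).re := by rw [sub_re, one_re]; linarith
  rw [cuspCoord, div_re]; simp only [re_ofNat, im_ofNat, zero_mul, zero_div, add_zero]
  exact div_pos (mul_pos two_pos h1) (normSq_pos.2 (ne_zero_of_re_pos h1))

theorem cuspCoord_inv {ε : ℝ} (z : ℂ) : (cuspCoord ε z)⁻¹ = (1 - ε * z) / 2 := by
  rw [cuspCoord, inv_div]

section Admissible

variable {q : ℕ} {c r : Fin 3 → ℝ}

theorem sgn_mul_self {j : Fin 3} (hj : j ≠ 1) : sgn j * sgn j = 1 := by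
  fin_cases j <;> simp [sgn] at hj ⊢

theorem AdmissibleDiscs.sgn_mem (hq : 3 ≤ q) (h : AdmissibleDiscs q c r) {j : Fin 3} (hj : j ≠ 1) :
    (sgn j : ℂ) ∈ ball (c j : ℂ) (r j) := by
  have hl1 := one_le_lam hq
  have hμ1 : (lam q - 1) / (lam q + 1) < 1 := by rw [div_lt_one (by linarith)]; linarith
  refine h.interval_subset j _ ?_
  fin_cases j
  · change (1 : ℝ) ∈ closure (Set.Ioo ((lam q - 1) / (lam q + 1)) 1); rw [closure_Ioo hμ1.ne]
    exact ⟨hμ1.le, le_rfl⟩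
  · exact absurd rfl hj
  · change (-1 : ℝ) ∈ closure (Set.Ioo (-1) (-((lam q - 1) / (lam q + 1))))
    rw [closure_Ioo (by linarith)]
    exact ⟨le_rfl, by linarith⟩

theorem AdmissibleDiscs.re_lt (h : AdmissibleDiscs q c r) {i j : Fin 3} (hj : j ≠ 1) (hij : i ≠ j)
    {z : ℂ} (hz : z ∈ 𝔻(c i, r i)) : ((sgn j : ℂ) * z).re < 1 := by
  have h0 := h.re_first z; have h1 := h.re_mid z; have h2 := h.re_last z
  fin_cases j
  · fin_cases i
    · exact absurd rfl hij
    · simpa [sgn] using (h1 hz).2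
    · simpa [sgn] using h2 hz
  · exact absurd rfl hj
  · fin_cases i
    · simpa [sgn, neg_lt] using h0 hz
    · simpa [sgn, neg_lt] using (h1 hz).1
    · exact absurd rfl hij

theorem isConj_parIdx (hq : 3 ≤ q) {j : Fin 3} (hj : j ≠ 1) (n : ℕ) :
    IsConj ((matH q (parIdx q j)) ^ n)⁻¹ 1 ((1 + sgn j) / 2 * (n * lam q))
    ((1 - sgn j) / 2 * (n * lam q)) 1 := by
  fin_cases j
  · simpa [sgn, parIdx] using isConj_matH_one_pow_inv hq n
  · exact absurd rfl hj
  · have := isConj_matH_last_pow_inv hq n; simp only [sgn, parIdx]; convert this using 1 <;> simp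

theorem AdmissibleDiscs.mapsInto_par (h : AdmissibleDiscs q c r) {i j : Fin 3} (hj : j ≠ 1)
    (hij : i ≠ j) {n : ℕ} (hn : 1 ≤ n) :
    MapsInto ((matH q (parIdx q j)) ^ n)⁻¹ (cdisc c r i) (disc c r j) := by
  fin_cases j
  · exact h.maps_first n hn i hij
  · exact absurd rfl hj
  · exact h.maps_last n hn i hij

theorem par_denom {ε L : ℝ} {z : ℂ} (hz : ((ε : ℂ) * z).re < 1) :
    ((((1 : ℝ) : ℂ) + ((1 - ε) / 2 * L : ℝ)) * (1 + z)
    + (((1 + ε) / 2 * L : ℝ) + ((1 : ℝ) : ℂ)) * (1 - z)) / 2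
    = (cuspCoord ε z + L) / cuspCoord ε z := by
  have h0 := ne_zero_of_re_pos (cuspCoord_re_pos hz)
  have h1 : (cuspCoord ε z + L) / cuspCoord ε z = 1 + L * (1 - ε * z) / 2 := by
    rw [add_div, div_self h0, div_eq_mul_inv, cuspCoord_inv, mul_div_assoc]
  rw [h1]; push_cast; ring

theorem par_moebius (hq : 3 ≤ q) {j : Fin 3} (hj : j ≠ 1) (n : ℕ) {z : ℂ}
    (hz : ((sgn j : ℂ) * z).re < 1) : moebius ((matH q (parIdx q j)) ^ n)⁻¹ z
    = cuspPoint (sgn j) (cuspCoord (sgn j) z + (n * lam q : ℝ)) := by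
  have hε := sgn_mul_self hj; have hv := cuspCoord_re_pos hz
  have h0 := ne_zero_of_re_pos hv
  have hL : 0 ≤ n * lam q := mul_nonneg (Nat.cast_nonneg _) (by linarith [one_le_lam hq])
  have hx0 : cuspCoord (sgn j) z + (n * lam q : ℝ) ≠ 0 :=
    ne_zero_of_re_pos (by rw [add_re, ofReal_re]; linarith)
  have h3 := par_denom (L := n * lam q) hz
  rw [(isConj_parIdx hq hj n).moebius_eq, ← mul_div_mul_left _ _ (two_ne_zero (α := ℂ)),
    ← div_div_div_cancel_right₀ (c := (4 : ℂ)) (by norm_num)]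
  rw [show ∀ x : ℂ, 2 * x / 4 = x / 2 from fun x => by ring, show ∀ x : ℂ, 2 * x / 4 = x / 2 from fun x => by ring, h3, cuspPoint]
  have hε' : (sgn j : ℂ) * sgn j = 1 := by exact_mod_cast hε
  have h4 : z = sgn j * (1 - 2 / cuspCoord (sgn j) z) := by
    have : 2 / cuspCoord (sgn j) z = 1 - sgn j * z := by rw [div_eq_mul_inv, cuspCoord_inv]; ring
    rw [this]
    linear_combination (-z) * hε'
  set v := cuspCoord (sgn j) z; rw [div_div_eq_mul_div, div_eq_iff hx0]
  have h5 : z * v = sgn j * (v - 2) := by nth_rw 1 [h4]; field_simp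
  rw [mul_assoc, one_sub_div hx0, div_mul_cancel₀ _ hx0]; push_cast
  linear_combination (1 - (n * lam q) / 2 : ℂ) * h5

theorem par_jfac (hq : 3 ≤ q) {j : Fin 3} (hj : j ≠ 1) (n : ℕ) {z : ℂ}
    (hz : ((sgn j : ℂ) * z).re < 1) (s : ℂ) :
    jfac s ((matH q (parIdx q j)) ^ n)⁻¹ z = cuspCoord (sgn j) z ^ (2 * s)
    * (cuspCoord (sgn j) z + (n * lam q : ℝ)) ^ (-(2 * s)) := by
  have hv := cuspCoord_re_pos hz
  have hL : 0 ≤ n * lam q := mul_nonneg (Nat.cast_nonneg _) (by linarith [one_le_lam hq])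
  have h0 := ne_zero_of_re_pos hv
  rw [(isConj_parIdx hq hj n).jfac_eq, par_denom hz, inv_sq_cpow _ hv]
  · rw [add_div, div_self h0, div_eq_mul_inv, cuspCoord_inv, add_re, one_re,
      re_ofReal_mul]
    have := mul_nonneg hL (show 0 ≤ ((1 - (sgn j : ℂ) * z) / 2).re by
      rw [div_ofNat_re, sub_re, one_re]; linarith)
    linarith
  · rw [add_re, ofReal_re]; linarith

theorem eventually_mapsInto {A : SL(2, ℝ)} {c r c' r' : ℝ} (hr : 0 < r')
    (h : MapsInto A 𝔻(c, r) (ball (c' : ℂ) r')) : ∀ᶠ ρ : ℝ in 𝓝[<] 1, ∀ z ∈ 𝔻(c, r),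
    moebius A z ∈ 𝔻(c', ρ * r') := by
  rcases 𝔻(c, r).eq_empty_or_nonempty with he | hne
  · simp [he]
  obtain ⟨z₀, hz₀, hmax⟩ := (isCompact_closedBall _ _).exists_isMaxOn hne
    (((continuousOn_moebius h).sub continuousOn_const).norm (f := fun z => moebius A z - c'))
  have h1 := (h z₀ hz₀).2; rw [mem_ball_iff_norm] at h1
  have h2 : ‖moebius A z₀ - c'‖ / r' < 1 := by rwa [div_lt_one hr]
  filter_upwards [Ioo_mem_nhdsLT h2] with ρ hρ z hz; rw [mem_closedBall_iff_norm]
  refine (isMaxOn_iff.1 hmax z hz).trans ?_; rw [← div_le_iff₀ hr]; exact hρ.1.le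

theorem norm_cuspPoint_sub_le {ε : ℝ} (hε : ε * ε = 1) {x : ℂ} {a : ℝ} (ha : 0 < a)
    (hx : a ≤ x.re) : ‖cuspPoint ε x - ε‖ ≤ 2 / a := by
  have h1 : cuspPoint ε x - ε = -(ε * (2 / x)) := by rw [cuspPoint]; ring
  have h2 : |ε| = 1 := by rcases mul_self_eq_one_iff.1 hε with rfl | rfl <;> simp
  rw [h1, norm_neg, norm_mul, norm_real, norm_eq_abs, h2, one_mul, norm_div]
  simp only [Complex.norm_ofNat]
  exact div_le_div_of_nonneg_left (by norm_num) ha (hx.trans (re_le_norm x))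

/-- A common contraction ratio for all the letters. -/
structure IsContraction (q : ℕ) (c r : Fin 3 → ℝ) (ρ : ℝ) : Prop where
  pos : 0 < ρ
  lt_one : ρ < 1
  par : ∀ j : Fin 3, j ≠ 1 → ∀ i, i ≠ j → ∀ z ∈ 𝔻(c i, r i), ∀ n : ℕ,
    cuspPoint (sgn j) (cuspCoord (sgn j) z + (((n : ℝ) + 1) * lam q : ℝ)) ∈ 𝔻(c j, ρ * r j)
  mid : ∀ k ∈ Finset.Icc 2 (q - 2), ∀ i, ∀ z ∈ 𝔻(c i, r i),
    moebius (matH q k)⁻¹ z ∈ 𝔻(c 1, ρ * r 1)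

theorem AdmissibleDiscs.exists_contraction (hq : 3 ≤ q) (h : AdmissibleDiscs q c r) :
    ∃ ρ, IsContraction q c r ρ := by
  have hl := one_le_lam hq
  have hpar : ∀ j : Fin 3, ∀ᶠ ρ : ℝ in 𝓝[<] 1, j ≠ 1 → ∀ i, i ≠ j → ∀ z ∈ 𝔻(c i, r i), ∀ n : ℕ,
      cuspPoint (sgn j) (cuspCoord (sgn j) z + (((n : ℝ) + 1) * lam q : ℝ)) ∈ 𝔻(c j, ρ * r j) := by
    intro j; by_cases hj : j = 1
    · exact Eventually.of_forall fun ρ h => absurd hj h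
    have hmem := h.sgn_mem hq hj; have hrj := h.radius_pos j; rw [mem_ball_iff_norm] at hmem
    obtain ⟨N, hN⟩ := exists_nat_gt (2 / ((r j - ‖(sgn j : ℂ) - c j‖) / 2))
    have hd : 0 < (r j - ‖(sgn j : ℂ) - c j‖) / 2 := by linarith
    have hfin : ∀ᶠ ρ : ℝ in 𝓝[<] 1, ∀ i, i ≠ j → ∀ n ∈ Finset.range N, ∀ z ∈ 𝔻(c i, r i),
        cuspPoint (sgn j) (cuspCoord (sgn j) z + (((n : ℝ) + 1) * lam q : ℝ)) ∈ 𝔻(c j, ρ * r j) := by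
      refine eventually_all.2 fun i => ?_; by_cases hij : i = j
      · exact Eventually.of_forall fun ρ h => absurd hij h
      refine ((Finset.eventually_all _).2 fun n _ => ?_).mono fun ρ hρ _ => hρ
      filter_upwards [eventually_mapsInto hrj (h.mapsInto_par hj hij (Nat.le_add_left 1 n))]
        with ρ hρ z hz
      simpa [par_moebius hq hj _ (h.re_lt hj hij hz)] using hρ z hz
    have h1 : ((r j + ‖(sgn j : ℂ) - c j‖) / 2) / r j < 1 := by rw [div_lt_one hrj]; linarith
    filter_upwards [hfin, Ioo_mem_nhdsLT h1] with ρ hρ hρ' _ i hij z hz n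
    rcases lt_or_ge n N with hn | hn
    · exact hρ i hij n (Finset.mem_range.2 hn) z hz
    · rw [mem_closedBall_iff_norm]; have hv := cuspCoord_re_pos (h.re_lt hj hij hz)
      have hre : (n : ℝ) + 1 ≤ (cuspCoord (sgn j) z + (((n : ℝ) + 1) * lam q : ℝ)).re := by
        rw [add_re, ofReal_re]
        have : (n : ℝ) + 1 ≤ ((n : ℝ) + 1) * lam q := le_mul_of_one_le_right (by positivity) hl
        linarith
      have h2 := norm_cuspPoint_sub_le (sgn_mul_self hj) (by positivity) hre
      have h3 : 2 / ((n : ℝ) + 1) ≤ (r j - ‖(sgn j : ℂ) - c j‖) / 2 := by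
        rw [div_le_iff₀ (by positivity)]
        rw [div_lt_iff₀ hd] at hN; have : (N : ℝ) ≤ n := by exact_mod_cast hn
        nlinarith
      have h4 := norm_sub_le_norm_sub_add_norm_sub
        (cuspPoint (sgn j) (cuspCoord (sgn j) z + (((n : ℝ) + 1) * lam q : ℝ))) (sgn j) (c j : ℂ)
      have h5 := (div_lt_iff₀ hrj).1 hρ'.1; linarith
  have hmid := (Finset.eventually_all (Finset.Icc 2 (q - 2))).2 fun k hk =>
    eventually_all.2 fun i => eventually_mapsInto (h.radius_pos 1) (h.maps_mid k hk i)
  obtain ⟨ρ, h1, h2, h3, h4⟩ := ((eventually_all.2 hpar).and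
    (hmid.and (Ioo_mem_nhdsLT (zero_lt_one' ℝ)))).exists
  exact ⟨ρ, h3, h4, h1, h2⟩

end Admissible

/-- A family `∑ φ_b ⊗ e_b(s)`, the vectors `e_b` being holomorphic on `U` and locally uniformly
bounded by a rapidly decreasing sequence. -/
structure NuclearFamily (X : Type*) [NormedAddCommGroup X] [NormedSpace ℂ X] (β : Type*)
    (U : Set ℂ) where
  φ : β → X →L[ℂ] ℂ
  e : β → ℂ → X
  bound : ℝ
  norm_φ_le : ∀ b, ‖φ b‖ ≤ bound
  w : β → ℝ
  w_nonneg : ∀ b, 0 ≤ w b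
  summable_w : ∀ p : ℝ, 0 < p → Summable fun b => w b ^ p
  diff : ∀ b, DifferentiableOn ℂ (e b) U
  local_bound : ∀ s ∈ U, ∃ W, IsOpen W ∧ s ∈ W ∧ W ⊆ U ∧ ∃ C : ℝ, 0 ≤ C ∧
    ∀ s' ∈ W, ∀ b, ‖e b s'‖ ≤ C * w b

namespace NuclearFamily

variable {X : Type*} [NormedAddCommGroup X] [NormedSpace ℂ X] {β : Type*} {U : Set ℂ}
  (F : NuclearFamily X β U)

theorem summable_const_mul (C : ℝ) (hC : 0 ≤ C) {p : ℝ} (hp : 0 < p) :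
    Summable fun b => (C * F.w b) ^ p := by
  simp only [fun b => mul_rpow hC (F.w_nonneg b) (z := p)]; exact (F.summable_w p hp).mul_left _

theorem norm_mul_norm_le {C : ℝ} (hC : 0 ≤ C) {b : β} {x : X} (hx : ‖x‖ ≤ C * F.w b) :
    ‖F.φ b‖ * ‖x‖ ≤ (|F.bound| * C) * F.w b := by
  have h := F.norm_φ_le b; have h2 := F.w_nonneg b; rw [mul_assoc]
  exact mul_le_mul (h.trans (le_abs_self _)) hx (norm_nonneg _) (abs_nonneg _)

theorem summable_rpow {C : ℝ} (hC : 0 ≤ C) {x : β → X} (hx : ∀ b, ‖x b‖ ≤ C * F.w b) {p : ℝ}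
    (hp : 0 < p) : Summable fun b => (‖F.φ b‖ * ‖x b‖) ^ p :=
  (F.summable_const_mul (|F.bound| * C) (by positivity) hp).of_nonneg_of_le
    (fun b => by positivity) fun b =>
      rpow_le_rpow (by positivity) (F.norm_mul_norm_le hC (hx b)) hp.le

theorem isNuclearOrderZero [Countable β] {C : ℝ} (hC : 0 ≤ C) {x : β → X}
    (hx : ∀ b, ‖x b‖ ≤ C * F.w b) {L : X →L[ℂ] X}
    (hL : ∀ y, HasSum (fun b => F.φ b y • x b) (L y)) : IsNuclearOrderZero L :=
  isNuclearOrderZero_of_countable (fun _ hp => F.summable_rpow hC hx hp) hL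

theorem fredholmDet_eq [Countable β] {ι : Type*} (𝔅 : AbelBasis X ι) {C : ℝ} (hC : 0 ≤ C)
    {x : β → X} (hx : ∀ b, ‖x b‖ ≤ C * F.w b) {L : X →L[ℂ] X}
    (hL : ∀ y, HasSum (fun b => F.φ b y • x b) (L y)) :
    fredholmDet L = fdet fun i j => F.φ i (x j) := by
  refine 𝔅.fredholmDet_eq (F.isNuclearOrderZero hC hx hL) ?_ hL
  simpa only [sqrt_eq_rpow] using F.summable_rpow hC hx (p := 1 / 2) (by norm_num)

/-- The sum of the family. -/
def sum (s : ℂ) : X →L[ℂ] X := ∑' b, (F.φ b).smulRight (F.e b s)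

theorem summable_smulRight [CompleteSpace X] {C : ℝ} (hC : 0 ≤ C) {x : β → X}
    (hx : ∀ b, ‖x b‖ ≤ C * F.w b) : Summable fun b => (F.φ b).smulRight (x b) := by
  refine Summable.of_norm ?_; simp only [norm_smulRight_apply]
  simpa using F.summable_rpow hC hx zero_lt_one

theorem hasSum_sum [CompleteSpace X] {s : ℂ} (hs : s ∈ U) (y : X) :
    HasSum (fun b => F.φ b y • F.e b s) (F.sum s y) := by
  obtain ⟨W, -, hsW, -, C, hC, h⟩ := F.local_bound s hs
  have h1 := (F.summable_smulRight hC (h s hsW)).hasSum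
  exact h1.mapL (ContinuousLinearMap.apply ℂ X y)

theorem differentiableOn_sum [CompleteSpace X] : DifferentiableOn ℂ F.sum U := by
  intro s hs; obtain ⟨W, hW, hsW, hWU, C, hC, h⟩ := F.local_bound s hs
  refine DifferentiableAt.differentiableWithinAt ?_
  refine DifferentiableOn.differentiableAt ?_ (hW.mem_nhds hsW)
  refine differentiableOn_tsum_of_summable_norm
    (u := fun b => (|F.bound| * C) * F.w b) ?_ (fun b => ?_) hW fun b s' hs' => ?_
  · simpa using F.summable_const_mul (|F.bound| * C) (by positivity) zero_lt_one
  · exact ((smulRightL ℂ X X (F.φ b)).differentiable.comp_differentiableOn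
      (F.diff b)).mono hWU
  · rw [norm_smulRight_apply]; exact F.norm_mul_norm_le hC (h s' hs' b)

/-- The part of the family with index in a component of a disjoint union. -/
def comap {γ : Type*} (i : γ → β) (hi : Function.Injective i) : NuclearFamily X γ U where
  φ := F.φ ∘ i
  e := F.e ∘ i
  bound := F.bound
  norm_φ_le b := F.norm_φ_le _
  w := F.w ∘ i
  w_nonneg b := F.w_nonneg _
  summable_w p hp := (F.summable_w p hp).comp_injective hi
  diff b := F.diff _
  local_bound s hs := by
    obtain ⟨W, hW, hsW, hWU, C, hC, h⟩ := F.local_bound s hs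
    exact ⟨W, hW, hsW, hWU, C, hC, fun s' hs' b => h s' hs' _⟩

variable {κ α : Type*}

/-- The factor `1 / t` on the singular part of the index set. -/
def scale (t : ℂ) : κ ⊕ α → ℂ := Sum.elim (fun _ => t⁻¹) fun _ => 1

theorem norm_scale_le {t : ℂ} (b : κ ⊕ α) : ‖scale t b‖ ≤ ‖t⁻¹‖ + 1 := by
  rcases b with b | b
  · exact le_add_of_nonneg_right zero_le_one
  · simp [scale]

section Pole

variable [Fintype κ] [CompleteSpace X] (G : NuclearFamily X (κ ⊕ α) U) {L : ℂ → X →L[ℂ] X} {s₀ : ℂ}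

theorem eq_smul_add
    (hL : ∀ s ∈ U, s ≠ s₀ → ∀ y, HasSum (fun b => G.φ b y • scale (s - s₀) b • G.e b s) (L s y))
    {s : ℂ} (hs : s ∈ U) (hs₀ : s ≠ s₀) :
    L s = (s - s₀)⁻¹ • (G.comap Sum.inl Sum.inl_injective).sum s
    + (G.comap Sum.inr Sum.inr_injective).sum s := by
  refine ContinuousLinearMap.ext fun y => ?_; refine (hL s hs hs₀ y).unique ?_
  have h1 := ((G.comap Sum.inl Sum.inl_injective).hasSum_sum hs y).const_smul (s - s₀)⁻¹
  have h2 := (G.comap Sum.inr Sum.inr_injective).hasSum_sum hs y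
  refine HasSum.sum (f := fun b => G.φ b y • scale (s - s₀) b • G.e b s) ?_ ?_
  · refine h1.congr_fun fun b => ?_; exact smul_comm _ _ _
  · refine h2.congr_fun fun b => ?_
    change G.φ (Sum.inr b) y • (1 : ℂ) • G.e (Sum.inr b) s = G.φ (Sum.inr b) y • G.e (Sum.inr b) s
    rw [one_smul]

theorem differentiableOn_of_hasSum
    (hL : ∀ s ∈ U, s ≠ s₀ → ∀ y, HasSum (fun b => G.φ b y • scale (s - s₀) b • G.e b s) (L s y)) :
    DifferentiableOn ℂ L (U \ {s₀}) := by
  have h1 : DifferentiableOn ℂ (fun s => (s - s₀)⁻¹) (U \ {s₀}) :=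
    DifferentiableOn.inv (by fun_prop) fun s hs => sub_ne_zero.2 hs.2
  refine DifferentiableOn.congr (DifferentiableOn.add
    (h1.smul ((G.comap Sum.inl Sum.inl_injective).differentiableOn_sum.mono Set.sdiff_subset))
    ((G.comap Sum.inr Sum.inr_injective).differentiableOn_sum.mono Set.sdiff_subset))
    fun s hs => G.eq_smul_add hL hs.1 hs.2

theorem meromorphicAt_of_hasSum (hU : IsOpen U) (hs₀ : s₀ ∈ U)
    (hL : ∀ s ∈ U, s ≠ s₀ → ∀ y, HasSum (fun b => G.φ b y • scale (s - s₀) b • G.e b s) (L s y)) :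
    MeromorphicAt L s₀ := by
  have h1 := ((G.comap Sum.inl Sum.inl_injective).differentiableOn_sum.analyticAt
    (hU.mem_nhds hs₀)).meromorphicAt
  have h2 := ((G.comap Sum.inr Sum.inr_injective).differentiableOn_sum.analyticAt
    (hU.mem_nhds hs₀)).meromorphicAt
  have h3 : MeromorphicAt (fun s => (s - s₀)⁻¹) s₀ :=
    ((MeromorphicAt.id s₀).sub (MeromorphicAt.const s₀ s₀)).inv
  refine ((h3.smul h1).add h2).congr ?_
  filter_upwards [self_mem_nhdsWithin, nhdsWithin_le_nhds (hU.mem_nhds hs₀)] with s h1 h2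
  exact (G.eq_smul_add hL h2 h1).symm

theorem norm_scaled_le {C : ℝ} {s t : ℂ} {b : κ ⊕ α} (h : ‖G.e b s‖ ≤ C * G.w b) :
    ‖scale t b • G.e b s‖ ≤ ((‖t⁻¹‖ + 1) * C) * G.w b := by
  rw [norm_smul, mul_assoc]; exact mul_le_mul (norm_scale_le b) h (norm_nonneg _) (by positivity)

theorem isNuclearOrderZero_of_hasSum [Countable α]
    (hL : ∀ s ∈ U, s ≠ s₀ → ∀ y, HasSum (fun b => G.φ b y • scale (s - s₀) b • G.e b s) (L s y))
    {s : ℂ} (hs : s ∈ U) (hs₀ : s ≠ s₀) : IsNuclearOrderZero (L s) := by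
  obtain ⟨W, hW, hsW, hWU, C, hC, h⟩ := G.local_bound s hs
  have : Countable κ := Finite.to_countable
  exact G.isNuclearOrderZero (by positivity) (fun b => G.norm_scaled_le (h s hsW b)) (hL s hs hs₀)

theorem fredholmDet_eq_scaledDet [Countable α] {ι : Type*} (𝔅 : AbelBasis X ι)
    (hL : ∀ s ∈ U, s ≠ s₀ → ∀ y, HasSum (fun b => G.φ b y • scale (s - s₀) b • G.e b s) (L s y))
    {s : ℂ} (hs : s ∈ U) (hs₀ : s ≠ s₀) : fredholmDet (L s)
    = ((s - s₀) ^ Fintype.card κ)⁻¹ * scaledDet (fun i j => G.φ i (G.e j s)) (s - s₀) := by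
  obtain ⟨W, hW, hsW, hWU, C, hC, h⟩ := G.local_bound s hs
  have : Countable κ := Finite.to_countable
  rw [G.fredholmDet_eq 𝔅 (by positivity) (fun b => G.norm_scaled_le (h s hsW b)) (hL s hs hs₀),
    scaledDet_eq _ (sub_ne_zero.2 hs₀),
    inv_mul_cancel_left₀ (pow_ne_zero _ (sub_ne_zero.2 hs₀))]
  simp only [map_smul, smul_eq_mul, scale]

theorem differentiableAt_scaledDet {s₁ : ℂ} (hs₁ : s₁ ∈ U) (hd : ‖s₁ - s₀‖ < 1) :
    DifferentiableAt ℂ (fun s => scaledDet (fun i j => G.φ i (G.e j s)) (s - s₀)) s₁ := by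
  obtain ⟨W, hW, hsW, hWU, C, hC, h⟩ := G.local_bound s₁ hs₁
  have hop : IsOpen (W ∩ ball s₀ 1) := hW.inter isOpen_ball
  refine DifferentiableOn.differentiableAt (s := W ∩ ball s₀ 1) ?_
    (hop.mem_nhds ⟨hsW, by rwa [mem_ball_iff_norm]⟩)
  refine differentiableOn_scaledDet hop (a := fun _ => 1) (b := fun b => (|G.bound| * C) * G.w b)
    (fun s hs => (mem_ball_iff_norm.1 hs.2).le) (fun _ => zero_le_one)
    (fun b => mul_nonneg (by positivity) (G.w_nonneg b)) ?_ (fun s hs i j => ?_) fun i j => ?_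
  · simpa only [one_mul, sqrt_eq_rpow] using
      G.summable_const_mul (|G.bound| * C) (by positivity) (p := 1 / 2) (by norm_num)
  · rw [one_mul, mul_assoc]
    exact ((G.φ i).le_opNorm _).trans (mul_le_mul ((G.norm_φ_le i).trans (le_abs_self _))
      (h s hs.1 j) (norm_nonneg _) (abs_nonneg _))
  · exact ((G.φ i).differentiable.comp_differentiableOn (G.diff j)).mono
      (Set.inter_subset_left.trans hWU)

theorem differentiableOn_fredholmDet [Countable α] {ι : Type*} (𝔅 : AbelBasis X ι)
    (hL : ∀ s ∈ U, s ≠ s₀ → ∀ y, HasSum (fun b => G.φ b y • scale (s - s₀) b • G.e b s) (L s y)) :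
    DifferentiableOn ℂ (fun s => fredholmDet (L s)) (U \ {s₀}) := by
  rintro s₁ ⟨hs₁, hne⟩; rw [mem_singleton_iff] at hne
  obtain ⟨W, hW, hsW, hWU, C, hC, h⟩ := G.local_bound s₁ hs₁
  have : Countable κ := Finite.to_countable
  obtain ⟨δ, hδ0, hδ⟩ := exists_between (norm_pos_iff.2 (sub_ne_zero.2 hne))
  have hop : IsOpen (W ∩ {s | δ < ‖s - s₀‖}) := hW.inter (isOpen_lt continuous_const (by fun_prop))
  have hmem : ∀ s ∈ W ∩ {s | δ < ‖s - s₀‖}, s ≠ s₀ := by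
    rintro s ⟨-, hs⟩ rfl; simp only [sub_self, norm_zero, mem_ofPred_eq] at hs; linarith
  have hsc : ∀ s ∈ W ∩ {s | δ < ‖s - s₀‖}, ∀ b,
      ‖scale (s - s₀) b • G.e b s‖ ≤ ((δ⁻¹ + 1) * C) * G.w b := fun s hs b => by
    refine (G.norm_scaled_le (h s hs.1 b)).trans ?_
    refine mul_le_mul_of_nonneg_right (mul_le_mul_of_nonneg_right ?_ hC) (G.w_nonneg b)
    rw [norm_inv]; have := inv_anti₀ hδ0 (le_of_lt hs.2); linarith
  refine DifferentiableAt.differentiableWithinAt (DifferentiableOn.differentiableAt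
    (s := W ∩ {s | δ < ‖s - s₀‖}) ?_ (hop.mem_nhds ⟨hsW, hδ⟩))
  have hC' : 0 ≤ (δ⁻¹ + 1) * C := by positivity
  refine (differentiableOn_fdet hop (a := fun _ => 1)
    (b := fun b => (|G.bound| * ((δ⁻¹ + 1) * C)) * G.w b)
    (N := fun s i j => G.φ i (scale (s - s₀) j • G.e j s)) (fun _ => zero_le_one)
    (fun b => mul_nonneg (by positivity) (G.w_nonneg b)) ?_ (fun s hs i j => ?_)
    fun i j => ?_).congr fun s hs => ?_
  · simpa only [one_mul, sqrt_eq_rpow] using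
      G.summable_const_mul (|G.bound| * ((δ⁻¹ + 1) * C)) (by positivity) (p := 1 / 2) (by norm_num)
  · rw [one_mul, mul_assoc]
    exact ((G.φ i).le_opNorm _).trans (mul_le_mul ((G.norm_φ_le i).trans (le_abs_self _))
      (hsc s hs j) (norm_nonneg _) (abs_nonneg _))
  · refine (G.φ i).differentiable.comp_differentiableOn (DifferentiableOn.smul ?_
      ((G.diff j).mono (Set.inter_subset_left.trans hWU)))
    rcases j with j | j
    · exact DifferentiableOn.inv (by fun_prop) fun s hs => sub_ne_zero.2 (hmem s hs)
    · exact differentiableOn_const _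
  · exact G.fredholmDet_eq 𝔅 hC' (hsc s hs) (hL s (hWU hs.1) (hmem s hs))

theorem meromorphicAt_fredholmDet [Countable α] (hU : IsOpen U) {ι : Type*} (𝔅 : AbelBasis X ι)
    (hs₀ : s₀ ∈ U)
    (hL : ∀ s ∈ U, s ≠ s₀ → ∀ y, HasSum (fun b => G.φ b y • scale (s - s₀) b • G.e b s) (L s y)) :
    MeromorphicAt (fun s => fredholmDet (L s)) s₀ ∧ ((-(Fintype.card κ : ℤ) : ℤ) : WithTop ℤ)
    ≤ meromorphicOrderAt (fun s => fredholmDet (L s)) s₀ := by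
  set f := fun s => scaledDet (fun i j => G.φ i (G.e j s)) (s - s₀)
  have hf : AnalyticAt ℂ f s₀ := by
    have hop : IsOpen (U ∩ ball s₀ 1) := hU.inter isOpen_ball
    refine DifferentiableOn.analyticAt (s := U ∩ ball s₀ 1) (fun s hs => ?_)
      (hop.mem_nhds ⟨hs₀, mem_ball_self zero_lt_one⟩)
    exact (G.differentiableAt_scaledDet hs.1 (mem_ball_iff_norm.1 hs.2)).differentiableWithinAt
  have hp : MeromorphicAt (fun s : ℂ => ((s - s₀) ^ Fintype.card κ)⁻¹) s₀ :=
    (((MeromorphicAt.id s₀).sub (MeromorphicAt.const s₀ s₀)).pow _).inv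
  have heq : (fun s => fredholmDet (L s)) =ᶠ[𝓝[≠] s₀]
      (fun s : ℂ => ((s - s₀) ^ Fintype.card κ)⁻¹) * f := by
    filter_upwards [self_mem_nhdsWithin, nhdsWithin_le_nhds (hU.mem_nhds hs₀)] with s h1 h2
    exact G.fredholmDet_eq_scaledDet 𝔅 hL h2 h1
  refine ⟨(hp.mul hf.meromorphicAt).congr heq.symm, ?_⟩
  rw [meromorphicOrderAt_congr heq, meromorphicOrderAt_mul hp hf.meromorphicAt]
  have h1 : meromorphicOrderAt (fun s : ℂ => ((s - s₀) ^ Fintype.card κ)⁻¹) s₀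
      = ((-(Fintype.card κ : ℤ) : ℤ) : WithTop ℤ) := by
    rw [meromorphicOrderAt_eq_int_iff hp]
    refine ⟨fun _ => 1, analyticAt_const, one_ne_zero, Eventually.of_forall fun s => ?_⟩
    rw [_root_.zpow_neg, zpow_natCast, smul_eq_mul, mul_one]
  rw [h1]; have h2 := hf.meromorphicOrderAt_nonneg; exact le_add_of_nonneg_right h2

end Pole

end NuclearFamily

theorem SepHol.smul₂ {A : Type*} [NormedRing A] [NormedAlgebra ℂ A] {U : Set ℂ} {f : ℂ → ℂ → ℂ}
    {F : ℂ → ℂ → A} (hf : SepHol f U) (hF : SepHol F U) : SepHol (fun s v => f s v • F s v) U :=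
  ⟨hf.cont.smul hF.cont, fun v hv => (hf.diff_left v hv).smul (hF.diff_left v hv),
    fun s hs => (hf.diff_right s hs).smul (hF.diff_right s hs)⟩

section HalfPlane

variable {A : Type*} [NormedRing A] [NormedAlgebra ℂ A] (𝔏 : LerchData A) (ε : ℝ) (K m : ℕ)

/-- The factor `v^(2s) (-2ε)^K`. -/
def prefac (ε : ℝ) (K : ℕ) (s v : ℂ) : ℂ := v ^ (2 * s) * (-2 * ε) ^ K

theorem sepHol_prefac : SepHol (prefac ε K) Set.univ := by
  have h := SepHol.cpow (a := 0) le_rfl (f := fun s => 2 * s) (by fun_prop)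
  refine (h.smul_const ((-2 * (ε : ℂ)) ^ K)).congr fun s _ v _ => ?_; simp [prefac]

/-- The regular part of the `K`-th Taylor mode. -/
def modeReg (s v : ℂ) : A := prefac ε K s v • 𝔏.regular (2 * s + K) v

/-- The singular part of the `K`-th Taylor mode. -/
def modeSing (s v : ℂ) : A := prefac ε K s v • 𝔏.sing (2 * s + K) v

/-- The coefficient of the singular part. -/
def modePolar (s v : ℂ) : A :=
  (prefac ε K s v * 𝔏.node 0 v ^ (1 - (2 * s + K)) / (2 * 𝔏.l)) • (1 : A)

theorem sepHol_modeReg [CompleteSpace A] : SepHol (modeReg 𝔏 ε K) Set.univ :=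
  (sepHol_prefac ε K).smul₂ (𝔏.sepHol_regular.comp (φ := fun s => 2 * s + K) (ψ := fun v => v)
    (by fun_prop) (fun _ _ => Set.mem_univ _) (by fun_prop) fun _ hv => hv)

theorem sepHol_modeSing : SepHol (modeSing 𝔏 ε K) {s | 2 * s + K ≠ 1} :=
  ((sepHol_prefac ε K).mono (Set.subset_univ _)).smul₂
    (𝔏.sepHol_sing.comp (φ := fun s => 2 * s + K) (ψ := fun v => v)
      (by fun_prop) (fun _ h => h) (by fun_prop) fun _ hv => hv)

theorem sepHol_modePolar : SepHol (modePolar 𝔏 ε K) Set.univ := by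
  have h : SepHol (A := ℂ) (fun s v => 𝔏.node 0 v ^ (1 - (2 * s + K))) Set.univ :=
    SepHol.cpow (by have := 𝔏.l_pos; positivity) (f := fun s => 1 - (2 * s + K)) (by fun_prop)
  have h2 := ((sepHol_prefac ε K).smul₂ h).smul_const (((2 * 𝔏.l : ℂ))⁻¹ • (1 : A))
  refine h2.congr fun s _ v _ => ?_; rw [modePolar, smul_smul, smul_eq_mul, div_eq_mul_inv]

theorem modeSing_eq {s s₀ : ℂ} (hs₀ : 2 * s₀ + K = 1) (v : ℂ) :
    modeSing 𝔏 ε K s v = (s - s₀)⁻¹ • (modePolar 𝔏 ε K s v * 𝔏.P) := by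
  have h : 2 * s + K - 1 = 2 * (s - s₀) := by linear_combination hs₀
  rw [modeSing, modePolar, LerchData.sing, smul_mul_assoc, one_mul, smul_smul, smul_smul, h]
  congr 1; simp only [div_eq_mul_inv, mul_inv]; ring

/-- The images of the `m`-th monomial under the remainder of order `K`. -/
def modeTail (c r : ℝ) (s v : ℂ) : A :=
  prefac ε K s v • ∑' n : ℕ, 𝔏.node n v ^ (-(2 * s + K)) •
    (((cuspPoint ε (𝔏.node n v) - c) / r) ^ m • 𝔏.ω ^ (n + 1))

theorem LerchData.node_re_pos (n : ℕ) {v : ℂ} (hv : 0 < v.re) : 0 < (𝔏.node n v).re :=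
  lt_of_lt_of_le (by positivity) (𝔏.le_re_node n hv)

theorem sepHol_modeTail [CompleteSpace A] (hε : ε * ε = 1) (c r : ℝ) :
    SepHol (modeTail 𝔏 ε K m c r) {s | 1 - (K : ℝ) < 2 * s.re} := by
  refine ((sepHol_prefac ε K).mono (Set.subset_univ _)).smul₂ ?_
  have hop : IsOpen {s : ℂ | 1 - (K : ℝ) < 2 * s.re} := isOpen_lt continuous_const (by fun_prop)
  refine SepHol.of_local hop fun s hs => ?_
  have hs' : 1 < (2 * s + K : ℂ).re := by simp only [mem_ofPred_eq] at hs; simp; linarith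
  obtain ⟨σ, T, h1, hmem, hop'⟩ := LerchData.exists_strip hs'
  have hpre : Continuous fun s : ℂ => 2 * s + (K : ℂ) := by fun_prop
  refine ⟨_, hop'.preimage hpre, hmem, fun s hs => ?_, ?_⟩
  · have := hs.1; simp at this; simp only [mem_ofPred_eq]; linarith
  refine SepHol.tsum (hop'.preimage hpre) (fun n => ?_)
    ((summable_succ_rpow h1).mul_right (Real.exp (π * T) * ((2 + ‖(ε - c : ℂ)‖) / ‖(r : ℂ)‖) ^ m))
      fun n s hs v hv => ?_
  · have e1 : SepHol (A := ℂ) (fun s v => 𝔏.node n v ^ (-(2 * s + K))) Set.univ :=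
      (𝔏.sepHol_cpow_node n).comp (φ := fun s => 2 * s + K) (ψ := fun v => v)
        (by fun_prop) (fun _ _ => Set.mem_univ _) (by fun_prop) fun _ hv => hv
    have hd : DifferentiableOn ℂ (fun v => ((cuspPoint ε (𝔏.node n v) - c) / r) ^ m)
        {v : ℂ | 0 < v.re} := by
      have hne : ∀ v ∈ {v : ℂ | 0 < v.re}, 𝔏.node n v ≠ 0 := fun v hv h0 => by
        have := 𝔏.node_re_pos n hv; rw [h0] at this; simp at this
      unfold cuspPoint
      have h2 : DifferentiableOn ℂ (fun v => 2 / 𝔏.node n v) {v : ℂ | 0 < v.re} :=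
        (differentiableOn_const 2).div (by unfold LerchData.node; fun_prop) hne
      fun_prop
    have e2 : SepHol (A := ℂ) (fun _ v => ((cuspPoint ε (𝔏.node n v) - c) / r) ^ m) Set.univ :=
      ⟨hd.continuousOn.comp (by fun_prop) fun p hp => hp.2, fun _ _ => differentiableOn_const _,
        fun _ _ => hd⟩
    exact ((e1.smul₂ (e2.smul_const _)).mono (Set.subset_univ _))
  · rw [smul_comm, norm_smul, norm_pow, norm_div, ← mul_assoc, mul_comm]
    refine mul_le_mul (𝔏.norm_term_le (by linarith) hs.1.le hs.2.le hv n) ?_ (by positivity)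
      (by positivity)
    refine pow_le_pow_left₀ (by positivity) (div_le_div_of_nonneg_right ?_ (norm_nonneg _)) m
    have h3 := norm_cuspPoint_sub_le hε (zero_lt_one)
      ((by linarith [n.cast_nonneg (α := ℝ)] : (1 : ℝ) ≤ n + 1).trans (𝔏.le_re_node n hv))
    rw [div_one] at h3
    calc ‖cuspPoint ε (𝔏.node n v) - c‖ = ‖(cuspPoint ε (𝔏.node n v) - ε) + (ε - c)‖ := by
          rw [sub_add_sub_cancel]
      _ ≤ _ := (norm_add_le _ _).trans (by linarith)

end HalfPlane

section Columns

variable {q : ℕ} {V : Type*} [NormedAddCommGroup V] [InnerProductSpace ℂ V] [CompleteSpace V]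
  {c r : Fin 3 → ℝ}

theorem differentiableOn_cuspCoord {ε : ℝ} {S : Set ℂ} (hS : ∀ z ∈ S, ((ε : ℂ) * z).re < 1) :
    DifferentiableOn ℂ (cuspCoord ε) S := by
  refine (differentiableOn_const 2).div (by fun_prop) fun z hz h0 => ?_
  have := congrArg Complex.re h0; simp only [sub_re, one_re, zero_re] at this; linarith [hS z hz]

/-- The element of `B(𝓔; V)` given by a function of the cusp coordinate on the discs other than
the `j`-th. -/
def colVec (c r : Fin 3 → ℝ) (j : Fin 3) (F : ℂ → V →L[ℂ] V) (w : V) : BSpace V c r := fun i =>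
  if i = j then 0 else toDisc V (c i) (r i) fun z => F (cuspCoord (sgn j) z) w

theorem norm_colVec_le {j : Fin 3} {F : ℂ → V →L[ℂ] V} {w : V} {C : ℝ} (hC : 0 ≤ C)
    (h : ∀ i, i ≠ j → ∀ z ∈ 𝔻(c i, r i), ‖F (cuspCoord (sgn j) z) w‖ ≤ C) :
    ‖colVec c r j F w‖ ≤ C := by
  refine (pi_norm_le_iff_of_nonneg hC).2 fun i => ?_; rw [colVec]
  split_ifs with hi
  · simpa using hC
  · exact norm_toDisc_le hC (h i hi)

variable {U : Set ℂ} {F : ℂ → ℂ → V →L[ℂ] V}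

theorem continuousOn_sepHol_cusp (h : AdmissibleDiscs q c r) {i j : Fin 3} (hj : j ≠ 1)
    (hij : i ≠ j) (hF : SepHol F U) (w : V) :
    ContinuousOn (fun p : ℂ × ℂ => F p.1 (cuspCoord (sgn j) p.2) w) (U ×ˢ 𝔻(c i, r i)) := by
  have h1 := fun z (hz : z ∈ 𝔻(c i, r i)) => h.re_lt hj hij hz
  have h2 := (differentiableOn_cuspCoord h1).continuousOn
  have h3 : ContinuousOn (fun p : ℂ × ℂ => F p.1 (cuspCoord (sgn j) p.2))
      (U ×ˢ 𝔻(c i, r i)) :=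
    hF.cont.comp (f := fun p : ℂ × ℂ => (p.1, cuspCoord (sgn j) p.2))
      (continuousOn_fst.prodMk (h2.comp continuousOn_snd fun p hp => hp.2))
      fun p hp => ⟨hp.1, cuspCoord_re_pos (h1 _ hp.2)⟩
  exact h3.clm_apply continuousOn_const

theorem differentiableOn_sepHol_cusp (h : AdmissibleDiscs q c r) {i j : Fin 3} (hj : j ≠ 1)
    (hij : i ≠ j) (hF : SepHol F U) (w : V) {s : ℂ} (hs : s ∈ U) :
    DifferentiableOn ℂ (fun z => F s (cuspCoord (sgn j) z) w) (ball (c i : ℂ) (r i)) := by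
  have h1 := fun z (hz : z ∈ ball (c i : ℂ) (r i)) => h.re_lt hj hij (ball_subset_closedBall hz)
  exact ((hF.diff_right s hs).comp (differentiableOn_cuspCoord h1)
    fun z hz => cuspCoord_re_pos (h1 z hz)).clm_apply (differentiableOn_const w)

theorem colVec_apply (h : AdmissibleDiscs q c r) {j : Fin 3} (hj : j ≠ 1) (hF : SepHol F U)
    (w : V) {s : ℂ} (hs : s ∈ U) (i : Fin 3) (z : 𝔻(c i, r i)) :
    (colVec c r j (F s) w i).1 z = if i = j then 0 else F s (cuspCoord (sgn j) z) w := by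
  rw [colVec]
  split_ifs with hi
  · rfl
  · exact toDisc_apply (g := fun z => F s (cuspCoord (sgn j) z) w)
      ((continuousOn_sepHol_cusp h hj hi hF w).comp (f := fun z => (s, z)) (by fun_prop)
        fun z hz => ⟨hs, hz⟩) (differentiableOn_sepHol_cusp h hj hi hF w hs) z

theorem differentiableOn_colVec (h : AdmissibleDiscs q c r) (hU : IsOpen U) {j : Fin 3} (hj : j ≠ 1)
    (hF : SepHol F U) (w : V) : DifferentiableOn ℂ (fun s => colVec c r j (F s) w) U := by
  refine differentiableOn_pi.2 fun i => ?_; by_cases hij : i = j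
  · simp only [colVec, if_pos hij]; exact differentiableOn_const _
  · simp only [colVec, if_neg hij]
    refine differentiableOn_toDisc (F := fun s z => F s (cuspCoord (sgn j) z) w) hU
      (continuousOn_sepHol_cusp h hj hij hF w) (fun z hz => ?_)
      fun s hs => differentiableOn_sepHol_cusp h hj hij hF w hs
    exact (hF.diff_left _ (cuspCoord_re_pos (h.re_lt hj hij hz))).clm_apply
      (differentiableOn_const w)

end Columns

section Middle

variable {q : ℕ} {V : Type*} [NormedAddCommGroup V] [InnerProductSpace ℂ V] [CompleteSpace V]
  {c r : Fin 3 → ℝ}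

/-- The image of the `m`-th monomial under the elliptic letters. -/
def midFun (η : Lam q →* (V ≃ₗᵢ[ℂ] V)) (c r : Fin 3 → ℝ) (m : ℕ) (w : V) (s z : ℂ) : V :=
  ∑ k ∈ Finset.Icc 2 (q - 2), jfac s (matH q k)⁻¹ z •
    (((moebius (matH q k)⁻¹ z - c 1) / r 1) ^ m • η (eltH q k) w)

/-- The corresponding element of `B(𝓔; V)`. -/
def midVec (η : Lam q →* (V ≃ₗᵢ[ℂ] V)) (c r : Fin 3 → ℝ) (m : ℕ) (w : V) (s : ℂ) :
    BSpace V c r := fun i => toDisc V (c i) (r i) (midFun η c r m w s)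

variable (η : Lam q →* (V ≃ₗᵢ[ℂ] V))

theorem continuousOn_midFun (h : AdmissibleDiscs q c r) (m : ℕ) (w : V) (i : Fin 3) :
    ContinuousOn (fun p : ℂ × ℂ => midFun η c r m w p.1 p.2) (Set.univ ×ˢ 𝔻(c i, r i)) := by
  refine continuousOn_finsetSum _ fun k hk => ?_; have h1 := h.maps_mid k hk i
  refine (continuousOn_jfac h1).smul (ContinuousOn.smul (ContinuousOn.pow (ContinuousOn.div_const
    (ContinuousOn.sub ?_ continuousOn_const) _) _) continuousOn_const)
  exact (continuousOn_moebius h1).comp continuousOn_snd fun p hp => hp.2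

theorem differentiableOn_midFun (h : AdmissibleDiscs q c r) (m : ℕ) (w : V) (i : Fin 3) (s : ℂ) :
    DifferentiableOn ℂ (midFun η c r m w s) (ball (c i : ℂ) (r i)) := by
  refine DifferentiableOn.fun_sum fun k hk => ?_; have h1 := h.maps_mid k hk i
  refine ((differentiableOn_jfac h1 s).smul (DifferentiableOn.smul (DifferentiableOn.pow
    (DifferentiableOn.div_const (DifferentiableOn.sub ?_ (differentiableOn_const _)) _) _)
    (differentiableOn_const _))).mono ball_subset_closedBall
  exact differentiableOn_moebius h1

theorem midVec_apply (h : AdmissibleDiscs q c r) (m : ℕ) (w : V) (s : ℂ) (i : Fin 3)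
    (z : 𝔻(c i, r i)) : (midVec η c r m w s i).1 z = midFun η c r m w s z :=
  toDisc_apply ((continuousOn_midFun η h m w i).comp (f := fun z => (s, z)) (by fun_prop)
    fun _ hz => ⟨Set.mem_univ _, hz⟩) (differentiableOn_midFun η h m w i s) z

theorem differentiable_midVec (h : AdmissibleDiscs q c r) (m : ℕ) (w : V) :
    Differentiable ℂ (midVec η c r m w) := by
  rw [← differentiableOn_univ]; refine differentiableOn_pi.2 fun i => ?_
  refine differentiableOn_toDisc isOpen_univ (continuousOn_midFun η h m w i) (fun z hz => ?_)
    fun s _ => differentiableOn_midFun η h m w i s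
  refine (Differentiable.fun_sum fun k hk => ?_).differentiableOn
  exact (differentiable_jfac ((h.maps_mid k hk i) z hz).1).smul_const _

end Middle

section Letters

variable {V : Type*} [NormedAddCommGroup V] [InnerProductSpace ℂ V] [FiniteDimensional ℂ V]
  [CompleteSpace V] {c r : Fin 3 → ℝ}

theorem norm_div_le_of_mem {c r ρ : ℝ} (hr : 0 < r) {w : ℂ}
    (hw : w ∈ 𝔻(c, ρ * r)) : ‖(w - c) / r‖ ≤ ρ := by
  rw [mem_closedBall_iff_norm] at hw; rw [norm_div, norm_real, norm_of_nonneg hr.le, div_le_iff₀ hr]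
  exact hw

theorem mem_ball_of_mem_closedBall_mul {c r ρ : ℝ} (hr : 0 < r) (hρ : ρ < 1) {w : ℂ}
    (hw : w ∈ 𝔻(c, ρ * r)) : w ∈ ball (c : ℂ) r :=
  closedBall_subset_ball (by nlinarith) hw

theorem norm_coeffB_apply_le (hr : ∀ i, 0 < r i) (j : Idx V) (f : BSpace V c r) :
    ‖coeffB hr j f‖ ≤ ‖f‖ :=
  ((coeffB hr j).le_opNorm f).trans (mul_le_of_le_one_left (norm_nonneg _) (norm_coeffB_le hr j))

/-- The expansion of `∑ g_n (f (z_n))` in the coefficients of `f`, for points `z_n` in a smaller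
disc. -/
theorem hasSum_coeffB_letters (hr : ∀ i, 0 < r i) {ρ : ℝ} (h0 : 0 ≤ ρ) (h1 : ρ < 1) {N : Type*}
    (f : BSpace V c r) (j : Fin 3) {g : N → V →L[ℂ] V} {z : N → ℂ} (hz : ∀ n, z n ∈ 𝔻(c j, ρ * r j))
    (hg : Summable fun n => ‖g n‖) : HasSum (fun b : Idx V => coeffB hr b f • (if b.2.1 = j then
    ∑' n, ((z n - c j) / r j) ^ b.1 • g n (𝔟 V b.2.2) else 0))
    (∑' n, g n (ext0 (f j).1 (z n))) := by
  set T : N × Idx V → V := fun p => coeffB hr p.2 f • (if p.2.2.1 = j then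
    ((z p.1 - c j) / r j) ^ p.2.1 • g p.1 (𝔟 V p.2.2.2) else 0) with hT
  have hsum : Summable T := by
    refine ((hg.mul_of_nonneg (summable_pow_deg (V := V) h0 h1) (fun _ => norm_nonneg _)
      fun _ => pow_nonneg h0 _).mul_left ‖f‖).of_norm_bounded fun p => ?_
    rw [hT, norm_smul]
    refine mul_le_mul (norm_coeffB_apply_le hr _ f) ?_ (norm_nonneg _) (norm_nonneg _)
    split_ifs
    · rw [norm_smul, norm_pow, mul_comm]
      refine mul_le_mul ?_ (pow_le_pow_left₀ (norm_nonneg _) (norm_div_le_of_mem (hr j) (hz _)) _)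
        (by positivity) (norm_nonneg _)
      exact ((g p.1).le_opNorm _).trans (by rw [OrthonormalBasis.norm_eq_one, mul_one])
    · rw [norm_zero]; positivity
  have hrow : ∀ n, HasSum (fun b => T (n, b)) (g n (ext0 (f j).1 (z n))) := fun n => by
    have hs : Summable fun b => T (n, b) := hsum.comp_injective fun _ _ h => (Prod.ext_iff.1 h).2
    have := hasSum_coeffB hr f j (z := z n) (w := z n)
      (mem_ball_of_mem_closedBall_mul (hr j) h1 (hz n)) (g n) (t := 1) (by rw [one_mul])
      (by simpa only [one_pow, one_mul] using hs)
    simpa only [one_pow, one_mul] using this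
  have h2 := hsum.hasSum.prod_fiberwise hrow
  have h3 := ((Equiv.prodComm (Idx V) N).hasSum_iff (f := T)).2 hsum.hasSum
  have h4 := h3.prod_fiberwise fun b =>
    (((Equiv.prodComm (Idx V) N).summable_iff (f := T)).2 hsum).prod_factor b |>.hasSum
  rw [h2.tsum_eq]; refine h4.congr_fun fun b => ?_; change _ = ∑' n, T (n, b); simp only [hT]
  by_cases hb : b.2.1 = j
  · simp only [if_pos hb]; exact (tsum_const_smul'' _).symm
  · simp [hb]

end Letters

section Tail

variable {q : ℕ} {V : Type*} [NormedAddCommGroup V] [InnerProductSpace ℂ V]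
  [FiniteDimensional ℂ V] [CompleteSpace V] {c r : Fin 3 → ℝ}

variable (hq : 3 ≤ q) (η : Lam q →* (V ≃ₗᵢ[ℂ] V))

/-- The Lerch data of the parabolic letter of the `j`-th column. -/
def parData (j : Fin 3) : LerchData (V →L[ℂ] V) :=
  lerchData (lam q) (one_le_lam hq) (η (eltH q (parIdx q j)))

theorem parData_node (j : Fin 3) (n : ℕ) (v : ℂ) :
    (parData hq η j).node n v = v + (((n : ℝ) + 1) * lam q : ℝ) := rfl

/-- The images of the monomials under the remainder of order `K`. -/
def tailVec (c r : Fin 3 → ℝ) (K : ℕ) (s : ℂ) (b : Idx V) : BSpace V c r :=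
  if b.2.1 = 1 then midVec η c r b.1 (𝔟 V b.2.2) s
  else colVec c r b.2.1 (modeTail (parData hq η b.2.1) (sgn b.2.1) K b.1 (c b.2.1) (r b.2.1) s)
    (𝔟 V b.2.2)

/-- The contribution of the `j`-th column to the remainder of order `K`. -/
def tailVal (K : ℕ) (s : ℂ) (f : BSpace V c r) (i : Fin 3) (z : ℂ) (j : Fin 3) : V :=
  if j = 1 then ∑ k ∈ Finset.Icc 2 (q - 2), jfac s (matH q k)⁻¹ z •
      η (eltH q k) (ext0 (f 1).1 (moebius (matH q k)⁻¹ z))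
  else if i = j then 0 else prefac (sgn j) K s (cuspCoord (sgn j) z) •
    ∑' n : ℕ, (parData hq η j).node n (cuspCoord (sgn j) z) ^ (-(2 * s + K)) •
      ((parData hq η j).ω ^ (n + 1)) (ext0 (f j).1
        (cuspPoint (sgn j) ((parData hq η j).node n (cuspCoord (sgn j) z))))

/-- The half-plane of convergence of the remainder of order `K`. -/
def tailDom (K : ℕ) : Set ℂ := {s | 1 - (K : ℝ) < 2 * s.re}

theorem isOpen_tailDom (K : ℕ) : IsOpen (tailDom K) := isOpen_lt continuous_const (by fun_prop)

theorem one_lt_re_of_mem_tailDom {K : ℕ} {s : ℂ} (hs : s ∈ tailDom K) : 1 < (2 * s + K : ℂ).re := by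
  have : 1 - (K : ℝ) < 2 * s.re := hs; simp; linarith

theorem differentiableOn_tailVec (h : AdmissibleDiscs q c r) (K : ℕ) (b : Idx V) :
    DifferentiableOn ℂ (fun s => tailVec hq η c r K s b) (tailDom K) := by
  by_cases hb : b.2.1 = 1
  · simp only [tailVec, if_pos hb]; exact (differentiable_midVec η h _ _).differentiableOn
  · simp only [tailVec, if_neg hb]
    exact differentiableOn_colVec h (isOpen_tailDom K) hb
      (sepHol_modeTail _ _ K b.1 (sgn_mul_self hb) _ _) _

theorem summable_node_smul (j : Fin 3) {s v : ℂ} (hs : 1 < s.re) (hv : 0 < v.re) :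
    Summable fun n : ℕ => ‖(parData hq η j).node n v ^ (-s) • (parData hq η j).ω ^ (n + 1)‖ :=
  ((summable_succ_rpow hs).mul_right _).of_nonneg_of_le (fun _ => norm_nonneg _) fun n =>
    (parData hq η j).norm_term_le (by linarith) le_rfl le_rfl hv n

theorem modeTail_apply (j : Fin 3) {ε : ℝ} {K m : ℕ} {c r : ℝ} {s v : ℂ} {ρ : ℝ} (hρ : ρ < 1)
    (hr : 0 < r) (hs : s ∈ tailDom K) (hv : 0 < v.re)
    (hz : ∀ n, cuspPoint ε ((parData hq η j).node n v) ∈ 𝔻(c, ρ * r)) (w : V) :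
    modeTail (parData hq η j) ε K m c r s v w = prefac ε K s v •
    ∑' n : ℕ, ((cuspPoint ε ((parData hq η j).node n v) - c) / r) ^ m •
    (((parData hq η j).node n v ^ (-(2 * s + K)) • (parData hq η j).ω ^ (n + 1) : V →L[ℂ] V) w) := by
  have hsum : Summable fun n : ℕ => (parData hq η j).node n v ^ (-(2 * s + K)) •
      (((cuspPoint ε ((parData hq η j).node n v) - c) / r) ^ m • (parData hq η j).ω ^ (n + 1)) := by
    refine Summable.of_norm_bounded
      (summable_node_smul hq η j (one_lt_re_of_mem_tailDom hs) hv) fun n => ?_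
    rw [smul_comm, norm_smul, norm_pow]
    refine mul_le_of_le_one_left (norm_nonneg _) (pow_le_one₀ (norm_nonneg _) ?_)
    exact (norm_div_le_of_mem hr (hz n)).trans hρ.le
  rw [modeTail, _root_.smul_apply]; congr 1
  have h2 := hsum.hasSum.mapL (ContinuousLinearMap.apply ℂ V w)
  refine h2.tsum_eq.symm.trans (tsum_congr fun n => ?_); simp only [apply_apply, _root_.smul_apply]
  rw [smul_comm]

theorem norm_modeTail_apply_le (j : Fin 3) {ε : ℝ} {K m : ℕ} {c r : ℝ} {s v : ℂ} {ρ σ T : ℝ}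
    (hρ : ρ < 1) (hr : 0 < r) (hs : s ∈ tailDom K) (hv : 0 < v.re)
    (hz : ∀ n, cuspPoint ε ((parData hq η j).node n v) ∈ 𝔻(c, ρ * r)) (hσ : 1 < σ)
    (hsσ : σ ≤ (2 * s + K : ℂ).re) (hT : |(2 * s + K : ℂ).im| ≤ T) {w : V} (hw : ‖w‖ ≤ 1) :
    ‖modeTail (parData hq η j) ε K m c r s v w‖ ≤ ‖prefac ε K s v‖ *
    (∑' n : ℕ, ((n : ℝ) + 1) ^ (-σ) * Real.exp (π * T)) * ρ ^ m := by
  rw [modeTail_apply hq η j hρ hr hs hv hz, norm_smul, mul_assoc]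
  refine mul_le_mul_of_nonneg_left ?_ (norm_nonneg _); rw [← tsum_mul_right]
  refine tsum_of_norm_bounded (((summable_succ_rpow hσ).mul_right _).mul_right _).hasSum fun n => ?_
  rw [norm_smul, norm_pow, mul_comm]
  refine mul_le_mul ?_ (pow_le_pow_left₀ (norm_nonneg _) (norm_div_le_of_mem hr (hz n)) _)
    (by positivity) (by positivity)
  refine (le_opNorm _ w).trans ((mul_le_of_le_one_right (norm_nonneg _) hw).trans
    ((parData hq η j).norm_term_le (by linarith) hsσ hT hv n))

theorem exists_bound_prefac (h : AdmissibleDiscs q c r) (K : ℕ) {i j : Fin 3} (hj : j ≠ 1)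
    (hij : i ≠ j) (s : ℂ) : ∃ C : ℝ, ∀ s' ∈ closedBall s 1,
    ∀ z ∈ 𝔻(c i, r i), ‖prefac (sgn j) K s' (cuspCoord (sgn j) z)‖ ≤ C := by
  have h1 := fun z (hz : z ∈ 𝔻(c i, r i)) => h.re_lt hj hij hz
  have h2 := (differentiableOn_cuspCoord h1).continuousOn
  obtain ⟨C, hC⟩ := ((isCompact_closedBall s 1).prod
    (isCompact_closedBall _ _)).exists_bound_of_continuousOn
    ((sepHol_prefac (sgn j) K).cont.comp (f := fun p : ℂ × ℂ => (p.1, cuspCoord (sgn j) p.2))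
      (continuousOn_fst.prodMk (h2.comp continuousOn_snd fun p hp => hp.2))
      fun p hp => ⟨Set.mem_univ _, cuspCoord_re_pos (h1 _ hp.2)⟩)
  exact ⟨C, fun s' hs' z hz => hC (s', z) ⟨hs', hz⟩⟩

theorem exists_bound_jfac (h : AdmissibleDiscs q c r) {k : ℕ} (hk : k ∈ Finset.Icc 2 (q - 2))
    (i : Fin 3) (s : ℂ) : ∃ C : ℝ, ∀ s' ∈ closedBall s 1,
    ∀ z ∈ 𝔻(c i, r i), ‖jfac s' (matH q k)⁻¹ z‖ ≤ C := by
  obtain ⟨C, hC⟩ := ((isCompact_closedBall s 1).prod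
    (isCompact_closedBall _ _)).exists_bound_of_continuousOn
    ((continuousOn_jfac (h.maps_mid k hk i)).mono (Set.prod_mono (Set.subset_univ _) le_rfl))
  exact ⟨C, fun s' hs' z hz => hC (s', z) ⟨hs', hz⟩⟩

theorem norm_midVec_le (h : AdmissibleDiscs q c r) {ρ : ℝ} (hρ : IsContraction q c r ρ) (s : ℂ) :
    ∃ C : ℝ, 0 ≤ C ∧ ∀ s' ∈ closedBall s 1, ∀ (m : ℕ) (w : V), ‖w‖ ≤ 1 →
    ‖midVec η c r m w s'‖ ≤ C * ρ ^ m := by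
  have h1 : ∀ (k : Finset.Icc 2 (q - 2)) (i : Fin 3), ∃ C : ℝ, ∀ s' ∈ closedBall s 1,
      ∀ z ∈ 𝔻(c i, r i), ‖jfac s' (matH q k)⁻¹ z‖ ≤ C :=
    fun k i => exists_bound_jfac h k.2 i s
  choose C hC using h1
  have h2 : 0 ≤ ∑ k, ∑ i, |C k i| := Finset.sum_nonneg fun k _ => Finset.sum_nonneg fun i _ =>
    abs_nonneg _
  have hp := hρ.pos; refine ⟨∑ k, ∑ i, |C k i|, h2, fun s' hs' m w hw => ?_⟩
  refine (pi_norm_le_iff_of_nonneg (by positivity)).2 fun i => ?_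
  refine norm_toDisc_le (by positivity) fun z hz => ?_
  rw [midFun, ← sum_coe_sort, sum_mul]; refine norm_sum_le_of_le _ fun k _ => ?_
  rw [norm_smul, norm_smul, norm_pow, LinearIsometryEquiv.norm_map, ← mul_assoc]
  refine (mul_le_of_le_one_right (by positivity) hw).trans (mul_le_mul ?_ ?_ (by positivity) ?_)
  · refine (hC k i s' hs' z hz).trans ((le_abs_self _).trans ?_)
    exact Finset.single_le_sum (f := fun i => |C k i|) (fun _ _ => abs_nonneg _) (Finset.mem_univ i)
  · exact pow_le_pow_left₀ (norm_nonneg _)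
      (norm_div_le_of_mem (h.radius_pos 1) (hρ.mid k k.2 i z hz)) _
  · exact Finset.sum_nonneg fun i _ => abs_nonneg _

theorem norm_colVec_modeTail_le (h : AdmissibleDiscs q c r) {ρ : ℝ} (hρ : IsContraction q c r ρ)
    {K : ℕ} {s : ℂ} (hs : s ∈ tailDom K) {j : Fin 3} (hj : j ≠ 1) :
    ∃ W, IsOpen W ∧ s ∈ W ∧ ∃ C : ℝ, 0 ≤ C ∧ ∀ s' ∈ W, ∀ (m : ℕ) (w : V), ‖w‖ ≤ 1 →
    ‖colVec c r j (modeTail (parData hq η j) (sgn j) K m (c j) (r j) s') w‖ ≤ C * ρ ^ m := by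
  obtain ⟨σ, T, h1, hmem, hop⟩ := LerchData.exists_strip (one_lt_re_of_mem_tailDom hs)
  have hpre : Continuous fun s : ℂ => 2 * s + (K : ℂ) := by fun_prop
  have h2 : ∀ i : Fin 3, ∃ C : ℝ, i ≠ j → ∀ s' ∈ closedBall s 1,
      ∀ z ∈ 𝔻(c i, r i),
      ‖prefac (sgn j) K s' (cuspCoord (sgn j) z)‖ ≤ C := fun i => by
    by_cases hij : i = j
    · exact ⟨0, fun h => absurd hij h⟩
    · obtain ⟨C, hC⟩ := exists_bound_prefac h K hj hij s; exact ⟨C, fun _ => hC⟩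
  choose C hC using h2; have hp := hρ.pos
  have hB : 0 ≤ ∑' n : ℕ, ((n : ℝ) + 1) ^ (-σ) * Real.exp (π * T) :=
    tsum_nonneg fun n => by positivity
  have hCs : 0 ≤ ∑ i, |C i| := Finset.sum_nonneg fun i _ => abs_nonneg _
  refine ⟨_ ∩ ball s 1, (hop.preimage hpre).inter isOpen_ball,
    ⟨hmem, mem_ball_self zero_lt_one⟩,
    (∑ i, |C i|) * (∑' n : ℕ, ((n : ℝ) + 1) ^ (-σ) * Real.exp (π * T)), by positivity,
    fun s' hs' m w hw => ?_⟩
  refine norm_colVec_le (by positivity) fun i hij z hz => ?_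
  have hs'' : s' ∈ tailDom K := by
    have := hs'.1.1; simp at this; change 1 - (K : ℝ) < 2 * s'.re; linarith
  refine (norm_modeTail_apply_le hq η j hρ.lt_one (h.radius_pos j) hs''
    (cuspCoord_re_pos (h.re_lt hj hij hz)) (hρ.par j hj i hij z hz) h1 hs'.1.1.le hs'.1.2.le
    hw).trans ?_
  refine mul_le_mul_of_nonneg_right (mul_le_mul_of_nonneg_right ?_ hB) (by positivity)
  refine (hC i hij s' (ball_subset_closedBall hs'.2) z hz).trans ((le_abs_self _).trans ?_)
  exact Finset.single_le_sum (f := fun i => |C i|) (fun _ _ => abs_nonneg _) (Finset.mem_univ i)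

theorem exists_bound_tailVec (h : AdmissibleDiscs q c r) {ρ : ℝ} (hρ : IsContraction q c r ρ)
    {K : ℕ} {s : ℂ} (hs : s ∈ tailDom K) : ∃ W, IsOpen W ∧ s ∈ W ∧ ∃ C : ℝ, 0 ≤ C ∧
    ∀ s' ∈ W, ∀ b, ‖tailVec hq η c r K s' b‖ ≤ C * ρ ^ b.1 := by
  obtain ⟨C₁, hC₁, H₁⟩ := norm_midVec_le η h hρ s
  obtain ⟨W₀, hW₀, hs₀, C₀, hC₀, H₀⟩ := norm_colVec_modeTail_le hq η h hρ hs (j := 0) (by decide)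
  obtain ⟨W₂, hW₂, hs₂, C₂, hC₂, H₂⟩ := norm_colVec_modeTail_le hq η h hρ hs (j := 2) (by decide)
  have hp := hρ.pos
  refine ⟨ball s 1 ∩ (W₀ ∩ W₂), isOpen_ball.inter (hW₀.inter hW₂),
    ⟨mem_ball_self zero_lt_one, hs₀, hs₂⟩, C₀ + C₁ + C₂, by positivity, ?_⟩
  rintro s' ⟨hs', hs'₀, hs'₂⟩ ⟨m, j, l⟩
  have hw : ‖𝔟 V l‖ ≤ 1 := by rw [OrthonormalBasis.norm_eq_one]
  have hmono : ∀ C, C ≤ C₀ + C₁ + C₂ → C * ρ ^ m ≤ (C₀ + C₁ + C₂) * ρ ^ m := fun C hC =>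
    mul_le_mul_of_nonneg_right hC (by positivity)
  fin_cases j
  · exact (H₀ s' hs'₀ m _ hw).trans (hmono _ (by linarith))
  · exact (H₁ s' (ball_subset_closedBall hs') m _ hw).trans (hmono _ (by linarith))
  · exact (H₂ s' hs'₂ m _ hw).trans (hmono _ (by linarith))

theorem hasSum_tailVec (h : AdmissibleDiscs q c r) {ρ : ℝ} (hρ : IsContraction q c r ρ) {K : ℕ}
    {s : ℂ} (hs : s ∈ tailDom K) (f : BSpace V c r) (i : Fin 3) (z : 𝔻(c i, r i)) :
    HasSum (fun b => coeffB h.radius_pos b f • (tailVec hq η c r K s b i).1 z)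
    (∑ j, tailVal hq η K s f i z j) := by
  have hr := h.radius_pos
  have hcol : ∀ j : Fin 3, HasSum (fun b : Idx V => if b.2.1 = j then
      coeffB hr b f • (tailVec hq η c r K s b i).1 z else 0) (tailVal hq η K s f i z j) := by
    intro j; by_cases hj : j = 1
    · subst hj; rw [tailVal, if_pos rfl]
      have h1 : ∀ k ∈ Finset.Icc 2 (q - 2), HasSum (fun b : Idx V => coeffB hr b f •
          (if b.2.1 = 1 then (jfac s (matH q k)⁻¹ z •
            (((moebius (matH q k)⁻¹ z - c 1) / r 1) ^ b.1 •
              η (eltH q k) (𝔟 V b.2.2))) else 0))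
          (jfac s (matH q k)⁻¹ z • η (eltH q k) (ext0 (f 1).1 (moebius (matH q k)⁻¹ z))) := by
        intro k hk
        have h2 := hasSum_coeffB_letters hr hρ.pos.le hρ.lt_one (N := Unit) f 1
          (g := fun _ => jfac s (matH q k)⁻¹ z • unitaryCLM (η (eltH q k)))
          (z := fun _ => moebius (matH q k)⁻¹ z) (fun _ => hρ.mid k hk i z z.2) Summable.of_finite
        simp only [tsum_fintype, Finset.univ_unique, Finset.sum_singleton,
          _root_.smul_apply, unitaryCLM_apply] at h2
        refine h2.congr_fun fun b => ?_; congr 1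
        split_ifs
        · rw [smul_comm]
        · rfl
      refine (hasSum_sum h1).congr_fun fun b => ?_
      split_ifs with hb
      · rw [tailVec, if_pos hb, midVec_apply η h, midFun, Finset.smul_sum]
      · simp
    · by_cases hij : i = j
      · rw [tailVal, if_neg hj, if_pos hij]; refine hasSum_zero.congr_fun fun b => ?_
        split_ifs with hb
        · have hb1 : b.2.1 ≠ 1 := by rwa [hb]
          rw [tailVec, if_neg hb1, colVec, if_pos (hij.trans hb.symm)]; exact smul_zero _
        · rfl
      · rw [tailVal, if_neg hj, if_neg hij]; have hv := cuspCoord_re_pos (h.re_lt hj hij z.2)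
        have h2 := (hasSum_coeffB_letters hr hρ.pos.le hρ.lt_one (N := ℕ) f j
          (g := fun n => (parData hq η j).node n (cuspCoord (sgn j) z) ^ (-(2 * s + K)) •
            (parData hq η j).ω ^ (n + 1))
          (z := fun n => cuspPoint (sgn j) ((parData hq η j).node n (cuspCoord (sgn j) z)))
          (hρ.par j hj i hij z z.2)
          (summable_node_smul hq η j (one_lt_re_of_mem_tailDom hs) hv)).const_smul
            (prefac (sgn j) K s (cuspCoord (sgn j) z))
        refine h2.congr_fun fun b => ?_
        split_ifs with hb
        · obtain ⟨m, j', l⟩ := b; dsimp only at hb; subst hb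
          rw [tailVec, if_neg hj, colVec_apply h hj
            (sepHol_modeTail (parData hq η j') (sgn j') K m (sgn_mul_self hj) (c j') (r j')) _ hs,
            if_neg hij,
            modeTail_apply hq η j' hρ.lt_one (hr j') hs hv (hρ.par j' hj i hij z z.2), smul_comm]
        · simp
  refine (hasSum_sum fun j (_ : j ∈ Finset.univ) => hcol j).congr_fun fun b => ?_; simp

end Tail

namespace NuclearFamily

variable {X : Type*} [NormedAddCommGroup X] [NormedSpace ℂ X] [CompleteSpace X] {U : Set ℂ}
  {κ α : Type*} (G : NuclearFamily X (κ ⊕ α) U)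

/-- The sum of a family with a simple pole of its singular part at `s₀`. -/
def scaledSum (s₀ s : ℂ) : X →L[ℂ] X :=
  (s - s₀)⁻¹ • (G.comap Sum.inl Sum.inl_injective).sum s + (G.comap Sum.inr Sum.inr_injective).sum s

theorem hasSum_scaledSum {s₀ s : ℂ} (hs : s ∈ U) (y : X) :
    HasSum (fun b => G.φ b y • scale (s - s₀) b • G.e b s) (G.scaledSum s₀ s y) := by
  have h1 := ((G.comap Sum.inl Sum.inl_injective).hasSum_sum hs y).const_smul (s - s₀)⁻¹
  have h2 := (G.comap Sum.inr Sum.inr_injective).hasSum_sum hs y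
  refine HasSum.sum (f := fun b => G.φ b y • scale (s - s₀) b • G.e b s) ?_ ?_
  · refine h1.congr_fun fun b => ?_; exact smul_comm _ _ _
  · refine h2.congr_fun fun b => ?_
    change G.φ (Sum.inr b) y • (1 : ℂ) • G.e (Sum.inr b) s = G.φ (Sum.inr b) y • G.e (Sum.inr b) s
    rw [one_smul]

end NuclearFamily

theorem exists_bound_of_finite {X γ : Type*} [NormedAddCommGroup X] [Finite γ] {U : Set ℂ}
    (hU : IsOpen U) {e : γ → ℂ → X} (he : ∀ b, ContinuousOn (e b) U) {s : ℂ} (hs : s ∈ U) :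
    ∃ W, IsOpen W ∧ s ∈ W ∧ ∃ C : ℝ, 0 ≤ C ∧ ∀ s' ∈ W, ∀ b, ‖e b s'‖ ≤ C := by
  have : Fintype γ := ofFinite γ
  have h : ∀ᶠ s' in 𝓝 s, ∀ b, ‖e b s'‖ < ‖e b s‖ + 1 := eventually_all.2 fun b =>
    ((he b).continuousAt (hU.mem_nhds hs)).norm.eventually (gt_mem_nhds (lt_add_one _))
  obtain ⟨W, hW, hop, hsW⟩ := _root_.mem_nhds_iff.1 h
  refine ⟨W, hop, hsW, ∑ b, (‖e b s‖ + 1), Finset.sum_nonneg fun b _ => by positivity,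
    fun s' hs' b => (hW hs' b).le.trans ?_⟩
  exact Finset.single_le_sum (f := fun b => ‖e b s‖ + 1) (fun _ _ => by positivity)
    (Finset.mem_univ b)

/-- The two parabolic columns. -/
def outer : Fin 2 → Fin 3 := ![0, 2]

theorem outer_ne_one (a : Fin 2) : outer a ≠ 1 := by fin_cases a <;> simp [outer]

section Continuation

variable {q : ℕ} {V : Type*} [NormedAddCommGroup V] [InnerProductSpace ℂ V]
  [FiniteDimensional ℂ V] [CompleteSpace V] {c r : Fin 3 → ℝ}
  (hq : 3 ≤ q) (η : Lam q →* (V ≃ₗᵢ[ℂ] V)) (h : AdmissibleDiscs q c r)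

variable (V) in
/-- The `K`-fold divided difference at the cusp, on the `j`-th disc. -/
def cuspDiff (K : ℕ) (j : Fin 3) :
    DiscSpace V (c j) (r j) →L[ℂ] DiscSpace V (c j) (r j) :=
  if hj : j = 1 then ContinuousLinearMap.id ℂ _ else dslopeDisc V (h.sgn_mem hq hj) ^ K

variable (V) in
/-- The remainders of order `K` at the cusps. -/
def remOp (K : ℕ) : BSpace V c r →L[ℂ] BSpace V c r :=
  ContinuousLinearMap.pi fun j => (cuspDiff V hq h K j).comp
    (ContinuousLinearMap.proj (R := ℂ) (φ := fun i => DiscSpace V (c i) (r i)) j)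

theorem remOp_apply_mid (K : ℕ) (f : BSpace V c r) : remOp V hq h K f 1 = f 1 := by
  change cuspDiff V hq h K 1 (f 1) = f 1; rw [cuspDiff, dif_pos rfl]
  rfl

theorem remOp_apply (K : ℕ) (f : BSpace V c r) {j : Fin 3} (hj : j ≠ 1) :
    remOp V hq h K f j = (dslopeDisc V (h.sgn_mem hq hj) ^ K) (f j) := by
  change cuspDiff V hq h K j (f j) = _; rw [cuspDiff, dif_neg hj]

theorem remOp_zero (f : BSpace V c r) : remOp V hq h 0 f = f := by
  funext j; by_cases hj : j = 1
  · subst hj; exact remOp_apply_mid hq h 0 f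
  · rw [remOp_apply hq h 0 f hj, pow_zero]; rfl

variable (V) in
/-- The Taylor coefficients at the cusps. -/
def cuspCoeff (k : ℕ) (a : Fin 2) : BSpace V c r →L[ℂ] V :=
  (taylorAt V (h.sgn_mem hq (outer_ne_one a)) k).comp
    (ContinuousLinearMap.proj (R := ℂ) (φ := fun i => DiscSpace V (c i) (r i)) (outer a))

/-- The continued `k`-th mode. -/
def mode (a : Fin 2) (k : ℕ) (s v : ℂ) : V →L[ℂ] V :=
  modeSing (parData hq η (outer a)) (sgn (outer a)) k s v
    + modeReg (parData hq η (outer a)) (sgn (outer a)) k s v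

theorem tailVal_eq_add {K : ℕ} {s : ℂ} (hs : s ∈ tailDom K) (f : BSpace V c r) (a : Fin 2)
    {i : Fin 3} {z : ℂ} (hz : z ∈ 𝔻(c i, r i)) {ρ : ℝ} (hρ : IsContraction q c r ρ) :
    tailVal hq η K s (remOp V hq h K f) i z (outer a) = (if i = outer a then 0 else
    mode hq η a K s (cuspCoord (sgn (outer a)) z) (cuspCoeff V hq h K a f))
    + tailVal hq η (K + 1) s (remOp V hq h (K + 1) f) i z (outer a) := by
  have hj := outer_ne_one a; set j := outer a with hja; by_cases hij : i = j
  · simp [tailVal, hj, hij]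
  have hv := cuspCoord_re_pos (h.re_lt hj hij hz); set v := cuspCoord (sgn j) z with hvdef
  set 𝔏 := parData hq η j with h𝔏; have hs1 := one_lt_re_of_mem_tailDom hs
  have hpt : ∀ n, cuspPoint (sgn j) (𝔏.node n v) ∈ 𝔻(c j, ρ * r j) := hρ.par j hj i hij z hz
  have hpt' : ∀ n, cuspPoint (sgn j) (𝔏.node n v) ∈ 𝔻(c j, r j) :=
    fun n => ball_subset_closedBall
      (mem_ball_of_mem_closedBall_mul (h.radius_pos j) hρ.lt_one (hpt n))
  have hx0 := fun n => ne_zero_of_re_pos (𝔏.node_re_pos n hv)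
  have hS := summable_node_smul hq η j hs1 hv
  set g₁ := (dslopeDisc V (h.sgn_mem hq hj) ^ (K + 1)) (f j) with hg₁
  have hS' : Summable fun n : ℕ => ‖𝔏.node n v ^ (-(2 * s + ((K + 1 : ℕ) : ℂ))) • 𝔏.ω ^ (n + 1)‖ :=
    summable_node_smul hq η j (by push_cast; rw [← add_assoc, add_re]; simp at hs1 ⊢; linarith) hv
  set w := cuspCoeff V hq h K a f
  have hsum1 : HasSum (fun n => 𝔏.node n v ^ (-(2 * s + K)) • (𝔏.ω ^ (n + 1)) w)
      (𝔏.series (2 * s + K) v w) := hS.of_norm.hasSum.mapL (ContinuousLinearMap.apply ℂ V w)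
  have hsum2 : Summable fun n : ℕ => 𝔏.node n v ^ (-(2 * s + ((K + 1 : ℕ) : ℂ))) •
      (𝔏.ω ^ (n + 1)) (ext0 g₁.1 (cuspPoint (sgn j) (𝔏.node n v))) := by
    refine Summable.of_norm_bounded (hS'.mul_right ‖g₁.1‖) fun n => ?_
    have h1 := le_opNorm
      (𝔏.node n v ^ (-(2 * s + ((K + 1 : ℕ) : ℂ))) • 𝔏.ω ^ (n + 1))
      (ext0 g₁.1 (cuspPoint (sgn j) (𝔏.node n v)))
    exact h1.trans (mul_le_mul_of_nonneg_left (norm_ext0_le _ _) (norm_nonneg _))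
  have hterm : ∀ n : ℕ, 𝔏.node n v ^ (-(2 * s + K)) • (𝔏.ω ^ (n + 1))
      (ext0 ((dslopeDisc V (h.sgn_mem hq hj) ^ K) (f j)).1 (cuspPoint (sgn j) (𝔏.node n v)))
      = 𝔏.node n v ^ (-(2 * s + K)) • (𝔏.ω ^ (n + 1)) w
        + (-2 * sgn j : ℂ) • (𝔏.node n v ^ (-(2 * s + ((K + 1 : ℕ) : ℂ))) •
          (𝔏.ω ^ (n + 1)) (ext0 g₁.1 (cuspPoint (sgn j) (𝔏.node n v)))) := fun n => by
    rw [ext0_pow_dslopeDisc (h.sgn_mem hq hj) (f j) (hpt' n) K, map_add, smul_add]; congr 1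
    rw [map_smul, smul_smul, smul_smul]; congr 1
    have e1 : cuspPoint (sgn j) (𝔏.node n v) - sgn j = -2 * sgn j * (𝔏.node n v)⁻¹ := by
      rw [cuspPoint]; ring
    have e2 : -(2 * s + ((K + 1 : ℕ) : ℂ)) = -(2 * s + K) - 1 := by push_cast; ring
    rw [e1, e2, cpow_sub _ _ (hx0 n), cpow_one]; ring
  rw [tailVal, tailVal, if_neg hj, if_neg hij, if_neg hij, if_neg hj, if_neg hij,
    remOp_apply hq h K f hj, remOp_apply hq h (K + 1) f hj]
  rw [tsum_congr hterm, (hsum1.add (hsum2.hasSum.const_smul (-2 * sgn j : ℂ))).tsum_eq,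
    smul_add]
  congr 1
  · rw [𝔏.series_eq_sing_add_regular hs1 hv, mode, modeSing, modeReg, ← smul_add]
    rfl
  · rw [smul_smul]; congr 1; rw [prefac, prefac, pow_succ]; ring

/-- The value of the continued operator, the first `K` Taylor modes being treated separately. -/
def opVal (K : ℕ) (s : ℂ) (f : BSpace V c r) (i : Fin 3) (z : ℂ) : V :=
  (∑ a, if i = outer a then 0 else ∑ k ∈ Finset.range K,
      mode hq η a k s (cuspCoord (sgn (outer a)) z) (cuspCoeff V hq h k a f))
    + ∑ j, tailVal hq η K s (remOp V hq h K f) i z j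

theorem opVal_succ {K : ℕ} {s : ℂ} (hs : s ∈ tailDom K) (f : BSpace V c r) {i : Fin 3} {z : ℂ}
    (hz : z ∈ 𝔻(c i, r i)) {ρ : ℝ} (hρ : IsContraction q c r ρ) :
    opVal hq η h (K + 1) s f i z = opVal hq η h K s f i z := by
  have h0 := tailVal_eq_add hq η h hs f 0 hz hρ; have h2 := tailVal_eq_add hq η h hs f 1 hz hρ
  have e0 : outer 0 = 0 := rfl; have e1 : outer 1 = 2 := rfl
  have h1 : tailVal hq η K s (remOp V hq h K f) i z 1
      = tailVal hq η (K + 1) s (remOp V hq h (K + 1) f) i z 1 := by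
    simp only [tailVal, if_true, remOp_apply_mid]
  rw [opVal, opVal, Fin.sum_univ_two, Fin.sum_univ_two, Fin.sum_univ_three, Fin.sum_univ_three]
  rw [e0] at h0; rw [e1] at h2; rw [h0, h1, h2, e0, e1]
  split_ifs <;> (try simp only [Finset.sum_range_succ]) <;> abel

theorem opVal_eq_of_le {K K' : ℕ} (hK : K ≤ K') {s : ℂ} (hs : s ∈ tailDom K) (f : BSpace V c r)
    {i : Fin 3} {z : ℂ} (hz : z ∈ 𝔻(c i, r i)) {ρ : ℝ} (hρ : IsContraction q c r ρ) :
    opVal hq η h K' s f i z = opVal hq η h K s f i z := by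
  induction K', hK using Nat.le_induction with
  | base => rfl
  | succ m hm ih =>
    rw [opVal_succ hq η h ?_ f hz hρ, ih]; have h1 : 1 - (K : ℝ) < 2 * s.re := hs
    have : (K : ℝ) ≤ m := by exact_mod_cast hm
    change 1 - (m : ℝ) < 2 * s.re; linarith

/-- The points of the domain of the remainder of order `k₀ + 1` at which the modes of order less
than `k₀` are regular. -/
def polDom (k₀ : ℕ) : Set ℂ := tailDom (k₀ + 1) ∩ {s | ∀ k ∈ Finset.range k₀, 2 * s + k ≠ 1}

theorem isOpen_polDom (k₀ : ℕ) : IsOpen (polDom k₀) := by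
  refine (isOpen_tailDom _).inter ?_
  have : {s : ℂ | ∀ k ∈ Finset.range k₀, 2 * s + k ≠ 1}
      = ⋂ k ∈ Finset.range k₀, {s : ℂ | 2 * s + k ≠ 1} := by
    ext s; simp
  rw [this]; exact isOpen_biInter_finset fun k _ => isOpen_ne_fun (by fun_prop) (by fun_prop)

/-- The index set of the singular part. -/
abbrev PolarIdx (η : Lam q →* (V ≃ₗᵢ[ℂ] V)) : Type :=
  (a : Fin 2) × Fin (finrank ℂ (fixSpace (η (eltH q (parIdx q (outer a))))))

/-- The index set of the finite part of the regular part. -/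
abbrev ModeIdx (V : Type*) [NormedAddCommGroup V] [InnerProductSpace ℂ V] (k₀ : ℕ) : Type :=
  Fin 2 × Fin (k₀ + 1) × Fin (finrank ℂ V)

/-- The modes without the singular part of order `k₀`. -/
def modeRed (k₀ : ℕ) (a : Fin 2) (k : ℕ) (s v : ℂ) : V →L[ℂ] V :=
  (if k = k₀ then 0 else modeSing (parData hq η (outer a)) (sgn (outer a)) k s v)
    + modeReg (parData hq η (outer a)) (sgn (outer a)) k s v

theorem sepHol_modeRed (k₀ : ℕ) (a : Fin 2) {k : ℕ} (hk : k ≤ k₀) :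
    SepHol (modeRed hq η k₀ a k) (polDom k₀) := by
  refine SepHol.add (F := fun s v => if k = k₀ then 0 else
    modeSing (parData hq η (outer a)) (sgn (outer a)) k s v) ?_
    ((sepHol_modeReg _ _ _).mono (Set.subset_univ _))
  by_cases hkk : k = k₀
  · simp only [if_pos hkk]
    exact ⟨continuousOn_const, fun _ _ => differentiableOn_const _,
      fun _ _ => differentiableOn_const _⟩
  · simp only [if_neg hkk]
    exact (sepHol_modeSing _ _ _).mono fun s hs => hs.2 k (Finset.mem_range.2 (by omega))

/-- The functionals of the family representing the operator near `(1 - k₀) / 2`. -/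
def famφ (k₀ : ℕ) :
    PolarIdx η ⊕ (ModeIdx V k₀ ⊕ Idx V) → BSpace V c r →L[ℂ] ℂ
  | Sum.inl b => (innerSL ℂ ((𝔟 (fixSpace (η (eltH q (parIdx q (outer b.1)))))
      b.2 : V))).comp (cuspCoeff V hq h k₀ b.1)
  | Sum.inr (Sum.inl b) => (innerSL ℂ (𝔟 V b.2.2)).comp (cuspCoeff V hq h b.2.1 b.1)
  | Sum.inr (Sum.inr b) => (coeffB h.radius_pos b).comp (remOp V hq h (k₀ + 1))

/-- The vectors of this family. -/
def famE (c r : Fin 3 → ℝ) (k₀ : ℕ) :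
    PolarIdx η ⊕ (ModeIdx V k₀ ⊕ Idx V) → ℂ → BSpace V c r
  | Sum.inl b, s => colVec c r (outer b.1)
      (modePolar (parData hq η (outer b.1)) (sgn (outer b.1)) k₀ s)
      (𝔟 (fixSpace (η (eltH q (parIdx q (outer b.1))))) b.2 : V)
  | Sum.inr (Sum.inl b), s => colVec c r (outer b.1) (modeRed hq η k₀ b.1 b.2.1 s)
      (𝔟 V b.2.2)
  | Sum.inr (Sum.inr b), s => tailVec hq η c r (k₀ + 1) s b

/-- The weights of this family. -/
def famW (ρ : ℝ) (k₀ : ℕ) : PolarIdx η ⊕ (ModeIdx V k₀ ⊕ Idx V) → ℝ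
  | Sum.inl _ => 1
  | Sum.inr (Sum.inl _) => 1
  | Sum.inr (Sum.inr b) => ρ ^ b.1

theorem differentiableOn_famE (h : AdmissibleDiscs q c r) (k₀ : ℕ) (b : PolarIdx η ⊕ (ModeIdx V k₀ ⊕ Idx V)) :
    DifferentiableOn ℂ (famE hq η c r k₀ b) (polDom k₀) := by
  rcases b with b | b | b
  · exact (differentiableOn_colVec h isOpen_univ (outer_ne_one _)
      (sepHol_modePolar (parData hq η (outer b.1)) (sgn (outer b.1)) k₀) _).mono (Set.subset_univ _)
  · exact differentiableOn_colVec h (isOpen_polDom k₀) (outer_ne_one _)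
      (sepHol_modeRed hq η k₀ b.1 (Nat.lt_succ_iff.1 b.2.1.2)) _
  · exact (differentiableOn_tailVec hq η h (k₀ + 1) b).mono Set.inter_subset_left

/-- The family representing the operator near `(1 - k₀) / 2`. -/
def family {ρ : ℝ} (hρ : IsContraction q c r ρ) (k₀ : ℕ) :
    NuclearFamily (BSpace V c r) (PolarIdx η ⊕ (ModeIdx V k₀ ⊕ Idx V)) (polDom k₀) where
  φ := famφ hq η h k₀
  e := famE hq η c r k₀
  bound := (∑ b, ‖famφ hq η h k₀ (Sum.map _root_.id Sum.inl b)‖) + ‖remOp V hq h (k₀ + 1)‖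
  norm_φ_le b := by
    have hsingle := fun b => Finset.single_le_sum (f := fun b => ‖famφ hq η h k₀
      (Sum.map _root_.id Sum.inl b)‖) (fun _ _ => opNorm_nonneg _) (Finset.mem_univ b)
    rcases b with b | b | b
    · exact (hsingle (Sum.inl b)).trans (le_add_of_nonneg_right (opNorm_nonneg _))
    · exact (hsingle (Sum.inr b)).trans (le_add_of_nonneg_right (opNorm_nonneg _))
    · refine le_add_of_nonneg_of_le (Finset.sum_nonneg fun _ _ => opNorm_nonneg _) ?_
      exact (opNorm_comp_le _ _).trans
        (mul_le_of_le_one_left (norm_nonneg _) (norm_coeffB_le _ _))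
  w := famW η ρ k₀
  w_nonneg b := by
    rcases b with b | b | b
    exacts [zero_le_one, zero_le_one, pow_nonneg hρ.pos.le _]
  summable_w p hp := by
    refine Summable.sum (f := fun b => famW η ρ k₀ b ^ p) Summable.of_finite
      (Summable.sum (f := fun b => famW η ρ k₀ (Sum.inr b) ^ p) Summable.of_finite ?_)
    have h1 := summable_pow_deg (V := V) (t := ρ ^ p) (rpow_nonneg hρ.pos.le p)
      (rpow_lt_one hρ.pos.le hρ.lt_one hp)
    refine h1.congr fun b => ?_; change (ρ ^ p) ^ b.1 = (ρ ^ b.1) ^ p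
    rw [← rpow_natCast, ← rpow_natCast, ← rpow_mul hρ.pos.le,
      ← rpow_mul hρ.pos.le, mul_comm]
  diff := differentiableOn_famE hq η h k₀
  local_bound s hs := by
    obtain ⟨W₁, hW₁, hs₁, C₁, hC₁, H₁⟩ := exists_bound_of_finite (isOpen_polDom k₀)
      (e := fun b : PolarIdx η ⊕ ModeIdx V k₀ =>
        famE hq η c r k₀ (Sum.map _root_.id Sum.inl b))
      (fun b => (differentiableOn_famE hq η h k₀ _).continuousOn) hs
    obtain ⟨W₂, hW₂, hs₂, C₂, hC₂, H₂⟩ := exists_bound_tailVec hq η h hρ hs.1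
    refine ⟨(W₁ ∩ W₂) ∩ polDom k₀, (hW₁.inter hW₂).inter (isOpen_polDom k₀), ⟨⟨hs₁, hs₂⟩, hs⟩,
      Set.inter_subset_right, C₁ + C₂, by positivity, fun s' hs' b => ?_⟩
    rcases b with b | b | b
    · exact (H₁ s' hs'.1.1 (Sum.inl b)).trans (by simp [famW, hC₂])
    · exact (H₁ s' hs'.1.1 (Sum.inr b)).trans (by simp [famW, hC₂])
    · refine (H₂ s' hs'.1.2 b).trans (mul_le_mul_of_nonneg_right (by linarith) ?_)
      exact pow_nonneg hρ.pos.le _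

end Continuation

section Operator

variable {q : ℕ} {V : Type*} [NormedAddCommGroup V] [InnerProductSpace ℂ V]
  [FiniteDimensional ℂ V] [CompleteSpace V] {c r : Fin 3 → ℝ}
  (hq : 3 ≤ q) (η : Lam q →* (V ≃ₗᵢ[ℂ] V)) (h : AdmissibleDiscs q c r) {ρ : ℝ}
  (hρ : IsContraction q c r ρ)

/-- The point `(1 - k₀) / 2`. -/
def polePt (k₀ : ℕ) : ℂ := (1 - (k₀ : ℂ)) / 2

theorem two_mul_polePt (k₀ : ℕ) : 2 * polePt k₀ + k₀ = 1 := by rw [polePt]; ring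

theorem sum_inner_fixSpace (u : V ≃ₗᵢ[ℂ] V) (x : V) : ∑ l, inner ℂ (𝔟 (fixSpace u) l : V) x •
    (𝔟 (fixSpace u) l : V) = fixProj u x := by
  have h1 := (𝔟 (fixSpace u)).orthogonalProjectionOnto_apply_eq_sum x
  have h2 : fixProj u x = ((fixSpace u).orthogonalProjectionOnto x : V) := rfl; rw [h2, h1]; simp

/-- The operator, represented by the family for `(1 - k₀) / 2`. -/
def opAt (k₀ : ℕ) (s : ℂ) : BSpace V c r →L[ℂ] BSpace V c r :=
  (family hq η h hρ k₀).scaledSum (polePt k₀) s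

/-- Evaluation at a point of one of the discs. -/
def evalAt (V : Type*) [NormedAddCommGroup V] [InnerProductSpace ℂ V] (c r : Fin 3 → ℝ) {i : Fin 3}
    (z : 𝔻(c i, r i)) : BSpace V c r →L[ℂ] V :=
  (evalDisc z).comp (ContinuousLinearMap.proj (R := ℂ) (φ := fun i => DiscSpace V (c i) (r i)) i)

theorem opAt_apply {k₀ : ℕ} {s : ℂ} (hs : s ∈ polDom k₀) (hs₀ : s ≠ polePt k₀)
    (f : BSpace V c r) (i : Fin 3) (z : 𝔻(c i, r i)) :
    (opAt hq η h hρ k₀ s f i).1 z = opVal hq η h (k₀ + 1) s f i z := by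
  have hD : ∀ (x y : ℂ) (g : BSpace V c r), evalAt V c r z (x • y • g) = x • y • (g i).1 z :=
    fun x y g => by rw [map_smul, map_smul]; rfl
  refine (((family hq η h hρ k₀).hasSum_scaledSum (s₀ := polePt k₀) hs f).mapL
    (evalAt V c r z)).unique ?_
  set A : Fin 2 → V := fun a => if i = outer a then 0 else
    modeSing (parData hq η (outer a)) (sgn (outer a)) k₀ s (cuspCoord (sgn (outer a)) z)
      (cuspCoeff V hq h k₀ a f) with hA
  set B : Fin 2 → V := fun a => if i = outer a then 0 else ∑ k ∈ Finset.range (k₀ + 1),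
    modeRed hq η k₀ a k s (cuspCoord (sgn (outer a)) z) (cuspCoeff V hq h k a f) with hB
  have hval : opVal hq η h (k₀ + 1) s f i z = (∑ a, A a)
      + ((∑ a, B a) + ∑ j, tailVal hq η (k₀ + 1) s (remOp V hq h (k₀ + 1) f) i z j) := by
    rw [opVal, ← add_assoc, ← sum_add_distrib]; congr 1; refine Finset.sum_congr rfl fun a _ => ?_
    simp only [hA, hB]
    split_ifs with hi
    · rw [add_zero]
    · have e1 : ∀ k ∈ Finset.range k₀, mode hq η a k s = modeRed hq η k₀ a k s := fun k hk => by
        funext v; rw [mode, modeRed, if_neg (Finset.mem_range.1 hk).ne]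
      rw [Finset.sum_range_succ, Finset.sum_range_succ, mode, modeRed, if_pos rfl, zero_add,
        Finset.sum_congr rfl fun k hk => by rw [e1 k hk], _root_.add_apply]
      abel
  rw [hval]; refine HasSum.sum ?_ (HasSum.sum ?_ ?_)
  · convert hasSum_fintype _ using 1; rw [Fintype.sum_sigma]
    refine Finset.sum_congr rfl fun a _ => ?_
    have e1 : ∀ l, ((family hq η h hρ k₀).e (Sum.inl ⟨a, l⟩) s i).1 z = _ := fun l =>
      colVec_apply h (outer_ne_one a) (sepHol_modePolar _ _ _) _ (Set.mem_univ s) i z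
    simp only [Function.comp_apply, hD, e1, hA]
    split_ifs
    · simp
    · rw [modeSing_eq _ _ _ (two_mul_polePt k₀)]
      change (_ : ℂ) • (modePolar _ _ _ _ _ : V →L[ℂ] V) (fixProj _ _) = _
      rw [← sum_inner_fixSpace, map_sum, Finset.smul_sum]
      exact Finset.sum_congr rfl fun l _ => by rw [map_smul, smul_comm]; rfl
  · convert hasSum_fintype _ using 1; rw [sum_prod_type]; refine Finset.sum_congr rfl fun a _ => ?_
    rw [sum_prod_type]
    have e1 : ∀ k l, ((family hq η h hρ k₀).e (Sum.inr (Sum.inl (a, k, l))) s i).1 z = _ :=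
      fun k l => colVec_apply h (outer_ne_one a)
        (sepHol_modeRed hq η k₀ a (Nat.lt_succ_iff.1 k.2)) _ hs i z
    simp only [Function.comp_apply, hD, e1, hB]
    split_ifs
    · simp
    · rw [sum_range]; refine Finset.sum_congr rfl fun k _ => ?_
      rw [← (𝔟 V).sum_repr' (cuspCoeff V hq h k a f), map_sum]
      exact Finset.sum_congr rfl fun l _ => by rw [map_smul]; exact congrArg _ (one_smul _ _).symm
  · refine (hasSum_tailVec hq η h hρ hs.1 (remOp V hq h (k₀ + 1) f) i z).congr_fun fun b => ?_
    simp only [Function.comp_apply, hD]; exact congrArg _ (one_smul _ _)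

/-- The meromorphic continuation of the transfer operator. -/
def transferOp (s : ℂ) : BSpace V c r →L[ℂ] BSpace V c r := opAt hq η h hρ (⌈-(2 * s.re)⌉₊ + 1) s

local notation "𝓛" => transferOp hq η h hρ

theorem mem_polDom {k₀ : ℕ} {s : ℂ} (h1 : -(k₀ : ℝ) < 2 * s.re) (hs : s ∉ poleSet) :
    s ∈ polDom k₀ ∧ s ≠ polePt k₀ := by
  refine ⟨⟨?_, fun k _ hk => hs ⟨k, ?_⟩⟩, fun h0 => hs ⟨k₀, h0⟩⟩
  · change 1 - ((k₀ + 1 : ℕ) : ℝ) < 2 * s.re; push_cast; linarith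
  · linear_combination hk / 2

theorem not_mem_poleSet {k₀ : ℕ} {s : ℂ} (hs : s ∈ polDom k₀) (hs₀ : s ≠ polePt k₀) :
    s ∉ poleSet := by
  rintro ⟨k, rfl⟩; rcases lt_trichotomy k k₀ with hk | rfl | hk
  · exact hs.2 k (Finset.mem_range.2 hk) (by ring)
  · exact hs₀ rfl
  · have h1 : 1 - ((k₀ + 1 : ℕ) : ℝ) < 2 * ((1 - (k : ℂ)) / 2).re := hs.1
    have h2 : ((k₀ + 1 : ℕ) : ℝ) ≤ k := by exact_mod_cast hk
    rw [div_ofNat_re, sub_re, one_re, natCast_re] at h1; linarith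

theorem opAt_eq_of_le {k k' : ℕ} (hk : k ≤ k') {s : ℂ} (h1 : -(k : ℝ) < 2 * s.re)
    (hs : s ∉ poleSet) : opAt hq η h hρ k' s = opAt hq η h hρ k s := by
  have hkr : (k : ℝ) ≤ k' := by exact_mod_cast hk
  obtain ⟨a1, a2⟩ := mem_polDom h1 hs; obtain ⟨b1, b2⟩ := mem_polDom (k₀ := k') (by linarith) hs
  refine ContinuousLinearMap.ext fun f => funext fun i => discSpace_ext fun z => ?_
  rw [opAt_apply hq η h hρ a1 a2, opAt_apply hq η h hρ b1 b2,
    opVal_eq_of_le hq η h (Nat.succ_le_succ hk) a1.1 f z.2 hρ]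

theorem transferOp_eq {k₀ : ℕ} {s : ℂ} (hs : s ∈ polDom k₀) (hs₀ : s ≠ polePt k₀) :
    𝓛 s = opAt hq η h hρ k₀ s := by
  have hp := not_mem_poleSet hs hs₀; have h1 : 1 - ((k₀ + 1 : ℕ) : ℝ) < 2 * s.re := hs.1
  push_cast at h1; have h2 := Nat.le_ceil (-(2 * s.re)); rw [transferOp]
  rcases le_total k₀ (⌈-(2 * s.re)⌉₊ + 1) with hk | hk
  · exact opAt_eq_of_le hq η h hρ hk (by linarith) hp
  · refine (opAt_eq_of_le hq η h hρ hk ?_ hp).symm; push_cast; linarith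

theorem hasSum_transferOp (k₀ : ℕ) : ∀ s ∈ polDom k₀, s ≠ polePt k₀ → ∀ f : BSpace V c r,
    HasSum (fun b => (family hq η h hρ k₀).φ b f •
    NuclearFamily.scale (s - polePt k₀) b • (family hq η h hρ k₀).e b s)
    (𝓛 s f) := by
  intro s hs hs₀ f; rw [transferOp_eq hq η h hρ hs hs₀]
  exact (family hq η h hρ k₀).hasSum_scaledSum hs f

theorem polePt_mem (k₀ : ℕ) : polePt k₀ ∈ polDom k₀ := by
  refine ⟨?_, fun k hk h0 => ?_⟩
  · change 1 - ((k₀ + 1 : ℕ) : ℝ) < 2 * ((1 - (k₀ : ℂ)) / 2).re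
    rw [div_ofNat_re, sub_re, one_re, natCast_re]; push_cast; linarith
  · have h1 := two_mul_polePt k₀; have h2 : (k : ℂ) = k₀ := by linear_combination h0 - h1
    exact (Finset.mem_range.1 hk).ne (by exact_mod_cast h2)

theorem exists_polDom {s : ℂ} (hs : s ∉ poleSet) : ∃ k₀, s ∈ polDom k₀ \ {polePt k₀} := by
  have h2 := Nat.le_ceil (-(2 * s.re))
  obtain ⟨h3, h4⟩ := mem_polDom (k₀ := ⌈-(2 * s.re)⌉₊ + 1) (by push_cast; linarith) hs
  exact ⟨_, h3, h4⟩

theorem isOpen_polDom_diff (k₀ : ℕ) : IsOpen (polDom k₀ \ {polePt k₀}) :=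
  (isOpen_polDom k₀).sdiff isClosed_singleton

theorem analyticOnNhd_transferOp : AnalyticOnNhd ℂ (𝓛) poleSetᶜ := by
  intro s hs; obtain ⟨k₀, hk⟩ := exists_polDom hs
  exact ((family hq η h hρ k₀).differentiableOn_of_hasSum
    (hasSum_transferOp hq η h hρ k₀)).analyticAt ((isOpen_polDom_diff k₀).mem_nhds hk)

theorem meromorphicOn_transferOp : MeromorphicOn (𝓛) Set.univ := by
  intro s _; by_cases hs : s ∈ poleSet
  · obtain ⟨k₀, rfl⟩ := hs
    exact (family hq η h hρ k₀).meromorphicAt_of_hasSum (isOpen_polDom k₀) (polePt_mem k₀)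
      (hasSum_transferOp hq η h hρ k₀)
  · exact (analyticOnNhd_transferOp hq η h hρ s hs).meromorphicAt

theorem isNuclearOrderZero_transferOp {s : ℂ} (hs : s ∉ poleSet) :
    IsNuclearOrderZero (𝓛 s) := by
  obtain ⟨k₀, hk⟩ := exists_polDom hs
  exact (family hq η h hρ k₀).isNuclearOrderZero_of_hasSum (hasSum_transferOp hq η h hρ k₀)
    hk.1 hk.2

theorem analyticOnNhd_fredholmDet :
    AnalyticOnNhd ℂ (fun s => fredholmDet (𝓛 s)) poleSetᶜ := by
  intro s hs; obtain ⟨k₀, hk⟩ := exists_polDom hs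
  exact ((family hq η h hρ k₀).differentiableOn_fredholmDet (discBasis h.radius_pos)
    (hasSum_transferOp hq η h hρ k₀)).analyticAt ((isOpen_polDom_diff k₀).mem_nhds hk)

theorem meromorphicAt_fredholmDet_transferOp (k₀ : ℕ) :
    MeromorphicAt (fun s => fredholmDet (𝓛 s)) (polePt k₀) ∧
    ((-(Fintype.card (PolarIdx η) : ℤ) : ℤ) : WithTop ℤ)
    ≤ meromorphicOrderAt (fun s => fredholmDet (𝓛 s)) (polePt k₀) :=
  (family hq η h hρ k₀).meromorphicAt_fredholmDet (isOpen_polDom k₀) (discBasis h.radius_pos)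
    (polePt_mem k₀) (hasSum_transferOp hq η h hρ k₀)

theorem meromorphicOn_fredholmDet :
    MeromorphicOn (fun s => fredholmDet (𝓛 s)) Set.univ := by
  intro s _; by_cases hs : s ∈ poleSet
  · obtain ⟨k₀, rfl⟩ := hs; exact (meromorphicAt_fredholmDet_transferOp hq η h hρ k₀).1
  · exact (analyticOnNhd_fredholmDet hq η h hρ s hs).meromorphicAt

theorem not_mem_poleSet_of_re {s : ℂ} (hs : 1 / 2 < s.re) : s ∉ poleSet := by
  rintro ⟨k, rfl⟩; rw [div_ofNat_re, sub_re, one_re, natCast_re] at hs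
  linarith [k.cast_nonneg (α := ℝ)]

theorem mem_tailDom_zero {s : ℂ} (hs : 1 / 2 < s.re) : s ∈ tailDom 0 := by
  change 1 - ((0 : ℕ) : ℝ) < 2 * s.re; push_cast; linarith

theorem transferOp_apply {s : ℂ} (hs : 1 / 2 < s.re) (f : BSpace V c r) (i : Fin 3)
    (z : 𝔻(c i, r i)) : (𝓛 s f i).1 z = ∑ j, tailVal hq η 0 s f i z j := by
  obtain ⟨h1, h2⟩ := mem_polDom (k₀ := 0) (by push_cast; linarith) (not_mem_poleSet_of_re hs)
  rw [transferOp_eq hq η h hρ h1 h2, opAt_apply hq η h hρ h1 h2,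
    opVal_eq_of_le hq η h (Nat.zero_le _) (mem_tailDom_zero hs) f z.2 hρ, opVal, remOp_zero]
  simp

theorem beta_eq {s : ℂ} (f : BSpace V c r) {i j : Fin 3} (hj : j ≠ 1) (hij : i ≠ j) {z : ℂ}
    (hz : z ∈ 𝔻(c i, r i)) (h : AdmissibleDiscs q c r) (n : ℕ) :
    beta η s (parIdx q j) (n + 1) (ext0 (f j).1) z = prefac (sgn j) 0 s (cuspCoord (sgn j) z) •
    ((parData hq η j).node n (cuspCoord (sgn j) z) ^ (-(2 * s + ((0 : ℕ) : ℂ))) •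
    ((parData hq η j).ω ^ (n + 1)) (ext0 (f j).1
    (cuspPoint (sgn j) ((parData hq η j).node n (cuspCoord (sgn j) z))))) := by
  have hre := h.re_lt hj hij hz
  rw [beta, par_jfac hq hj _ hre, par_moebius hq hj _ hre, parData_node, smul_smul]
  have e : (parData hq η j).ω = unitaryCLM (η (eltH q (parIdx q j))) := rfl
  rw [e, unitaryCLM_pow_apply, map_pow, prefac]; push_cast; simp

theorem summable_beta (hq : 3 ≤ q) {s : ℂ} (hs : 1 / 2 < s.re) (f : BSpace V c r) {i j : Fin 3}
    (hj : j ≠ 1) (hij : i ≠ j) {z : ℂ} (hz : z ∈ 𝔻(c i, r i)) (h : AdmissibleDiscs q c r) :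
    Summable fun n : ℕ => beta η s (parIdx q j) (n + 1) (ext0 (f j).1) z := by
  simp only [beta_eq hq η f hj hij hz h]; refine Summable.const_smul _ ?_
  have hv := cuspCoord_re_pos (h.re_lt hj hij hz)
  refine Summable.of_norm_bounded ((summable_node_smul hq η j
    (one_lt_re_of_mem_tailDom (mem_tailDom_zero hs)) hv).mul_right ‖(f j).1‖) fun n => ?_
  have h1 := le_opNorm
    ((parData hq η j).node n (cuspCoord (sgn j) z) ^ (-(2 * s + ((0 : ℕ) : ℂ))) •
      (parData hq η j).ω ^ (n + 1)) (ext0 (f j).1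
          (cuspPoint (sgn j) ((parData hq η j).node n (cuspCoord (sgn j) z))))
  exact h1.trans (mul_le_mul_of_nonneg_left (norm_ext0_le _ _) (norm_nonneg _))

theorem tailVal_zero_eq {s : ℂ} (f : BSpace V c r) {i j : Fin 3} (hj : j ≠ 1) {z : ℂ}
    (hz : z ∈ 𝔻(c i, r i)) (h : AdmissibleDiscs q c r) :
    tailVal hq η 0 s f i z j = if i = j then 0 else
    ∑' n : ℕ, beta η s (parIdx q j) (n + 1) (ext0 (f j).1) z := by
  rw [tailVal, if_neg hj]
  split_ifs with hij
  · rfl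
  · rw [← tsum_const_smul'']; exact tsum_congr fun n => (beta_eq hq η f hj hij hz h n).symm

theorem isTransferOperator_transferOp {s : ℂ} (hs : 1 / 2 < s.re) :
    IsTransferOperator η c r s (𝓛 s) := by
  intro f i z
  refine ⟨fun hi => summable_beta η hq hs f (j := 0) (by decide) hi z.2 h,
    fun hi => summable_beta η hq hs f (j := 2) (by decide) hi z.2 h, ?_⟩
  rw [transferOp_apply hq η h hρ hs, Fin.sum_univ_three,
    tailVal_zero_eq hq η f (j := 0) (by decide) z.2 h,
    tailVal_zero_eq hq η f (j := 2) (by decide) z.2 h]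
  congr 2; rw [tailVal, if_pos rfl]; refine Finset.sum_congr rfl fun k _ => ?_
  rw [beta, pow_one, pow_one]

end Operator

/-! ### Fixed points and traces of weighted composition operators -/

section FixedPoint

theorem denom_mul (A B : SL(2, ℝ)) {z : ℂ} (h : denom B z ≠ 0) :
    denom (A * B) z = denom A (moebius B z) * denom B z := by
  have e : denom A (moebius B z) * denom B z = A 1 0 * (B 0 0 * z + B 0 1) + A 1 1 * denom B z := by
    rw [denom, moebius]; field_simp
  rw [e, denom, denom]; simp only [sl_mul_apply]; push_cast; ring

theorem moebius_mul (A B : SL(2, ℝ)) {z : ℂ} (h : denom B z ≠ 0)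
    (h' : denom A (moebius B z) ≠ 0) : moebius (A * B) z = moebius A (moebius B z) := by
  have e : moebius A (moebius B z) = (A 0 0 * (B 0 0 * z + B 0 1) + A 0 1 * denom B z)
        / (denom A (moebius B z) * denom B z) := by
    rw [eq_div_iff (mul_ne_zero h' h)]
    rw [show moebius A (moebius B z) = (A 0 0 * moebius B z + A 0 1) / denom A (moebius B z) from rfl]
    rw [← mul_assoc, div_mul_cancel₀ _ h', moebius]; field_simp
  rw [e, ← denom_mul A B h, moebius]; congr 1; rw [denom]; simp only [sl_mul_apply]; push_cast; ring

theorem denom_ofReal (A : SL(2, ℝ)) (x : ℝ) : denom A x = (A 1 0 * x + A 1 1 : ℝ) := by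
  rw [denom]; push_cast
  rfl

theorem moebius_ofReal (A : SL(2, ℝ)) (x : ℝ) :
    moebius A x = ((A 0 0 * x + A 0 1) / (A 1 0 * x + A 1 1) : ℝ) := by
  rw [moebius, denom_ofReal]; push_cast
  rfl

theorem det_eq_one (A : SL(2, ℝ)) : A 0 0 * A 1 1 - A 0 1 * A 1 0 = 1 := by
  rw [← det_fin_two]; exact A.det_coe

theorem moebius_sub (A : SL(2, ℝ)) {z w : ℂ} (hz : denom A z ≠ 0) (hw : denom A w ≠ 0) :
    moebius A z - moebius A w = (z - w) * (denom A z * denom A w)⁻¹ := by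
  have h : ((A 0 0 : ℂ) * A 1 1 - A 0 1 * A 1 0) = 1 := by exact_mod_cast det_eq_one A
  rw [moebius, moebius, div_sub_div _ _ hz hw, ← div_eq_mul_inv]; congr 1; rw [denom, denom]
  linear_combination (z - w) * h

/-- The data of the attracting fixed point `x` of a contraction of a disc. -/
structure IsAttracting (A : SL(2, ℝ)) (c r ρ x D : ℝ) : Prop where
  mem : (x : ℂ) ∈ 𝔻(c, ρ * r)
  denom_eq : denom A x = D
  fix : moebius A x = x
  one_lt : 1 < D ^ 2
  lt_re : ∀ z ∈ 𝔻(c, r), 1 < (denom A z * D).re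
  le_sq : ∀ t : ℝ, |t - c| ≤ r → (1 - ρ) ^ 2 * (A 1 0 * t + A 1 1) ^ 2 ≤ 4 * D ^ 2
  trace_eq : A 0 0 + A 1 1 = D + D⁻¹

variable {A : SL(2, ℝ)} {c r ρ : ℝ}

theorem exists_isAttracting (hr : 0 < r) (hρ0 : 0 ≤ ρ) (hρ : ρ < 1)
    (hm : MapsInto A 𝔻(c, r) 𝔻(c, ρ * r)) : ∃ x D : ℝ, IsAttracting A c r ρ x D := by
  set I := Set.Icc (c - r) (c + r)
  set d : ℝ → ℝ := fun t => A 1 0 * t + A 1 1 with hd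
  set g : ℝ → ℝ := fun t => (A 0 0 * t + A 0 1) / d t with hg
  have hmem : ∀ t ∈ I, (t : ℂ) ∈ 𝔻(c, r) := by
    intro t ht; rw [mem_closedBall_iff_norm, ← ofReal_sub, norm_real, norm_eq_abs, abs_le]
    constructor <;> linarith [ht.1, ht.2]
  have hd0 : ∀ t ∈ I, d t ≠ 0 := by
    intro t ht h0; apply (hm _ (hmem t ht)).1; rw [denom_ofReal]; exact_mod_cast h0
  have hgm : ∀ t ∈ I, |g t - c| ≤ ρ * r := by
    intro t ht; have h1 := (hm _ (hmem t ht)).2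
    rw [moebius_ofReal, mem_closedBall_iff_norm, ← ofReal_sub, norm_real] at h1; exact h1
  have hρr : ρ * r < r := by nlinarith
  have hcont : ContinuousOn (fun t => t - g t) (I) :=
    continuousOn_id.sub (ContinuousOn.div (by fun_prop) (by fun_prop) hd0)
  have hl : c - r ∈ I := ⟨le_rfl, by linarith⟩
  have hu : c + r ∈ I := ⟨by linarith, le_rfl⟩
  have gl := abs_le.1 (hgm _ hl); have gu := abs_le.1 (hgm _ hu)
  obtain ⟨x, hx, hx0⟩ := intermediate_value_Icc (by linarith) hcont
    (show (0 : ℝ) ∈ Set.Icc _ _ from ⟨by linarith, by linarith⟩)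
  have hfix : g x = x := by have : x - g x = 0 := hx0; linarith
  have hDx := hd0 x hx; have hxm : |x - c| ≤ ρ * r := by have := hgm x hx; rwa [hfix] at this
  have hxl := abs_le.1 hxm
  have hnum : A 0 0 * x + A 0 1 = x * d x := by
    have : (A 0 0 * x + A 0 1) / d x = x := hfix; rwa [div_eq_iff hDx] at this
  have hdet := det_eq_one A
  have key : ∀ t, d t ≠ 0 → t - g t = (t - x) * (1 - (d t * d x)⁻¹) := by
    intro t ht; rw [hg]; field_simp; rw [hd] at hnum ⊢; dsimp only at hnum ⊢
    linear_combination (-(A 1 0) * t - A 1 1) * hnum + (x - t) * hdet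
  have hend : ∀ t ∈ I, 0 < (t - x) * (t - g t) → 1 < d t * d x := by
    intro t ht h0; rw [key t (hd0 t ht), ← mul_assoc] at h0
    have h1 := pos_of_mul_pos_right h0 (mul_self_nonneg _)
    have hpos : 0 < d t * d x := by
      by_contra hneg
      push Not at hneg
      obtain ⟨y, hy, hy0⟩ : (0 : ℝ) ∈ d '' Set.uIcc t x :=
        intermediate_value_uIcc (by fun_prop) (Set.mem_uIcc.2
          ((mul_nonpos_iff.1 hneg).symm.imp id And.symm))
      exact hd0 y (Set.uIcc_subset_Icc ht hx hy) hy0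
    exact (inv_lt_one₀ hpos).1 (by linarith)
  have el := hend _ hl (mul_pos_of_neg_of_neg (by linarith) (by linarith))
  have eu := hend _ hu (mul_pos (by linarith) (by linarith))
  have hall : ∀ t ∈ I, 1 < d t * d x := by
    intro t ht
    rcases le_total 0 (A 1 0 * d x) with h0 | h0 <;> simp only [hd] at * <;> nlinarith [ht.1, ht.2]
  refine ⟨x, d x, ⟨?_, ?_, ?_, ?_, ?_, ?_, ?_⟩⟩
  · rw [mem_closedBall_iff_norm, ← ofReal_sub, norm_real]; exact hxm
  · rw [denom_ofReal]
  · rw [moebius_ofReal]; exact_mod_cast hfix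
  · rw [pow_two]; exact hall x hx
  · intro z hz; rw [mul_re, ofReal_re, ofReal_im, mul_zero, sub_zero, denom_re]; refine hall z.re ?_
    have := ofReal_re_mem_closedBall hz
    rw [mem_closedBall_iff_norm, ← ofReal_sub, norm_real, norm_eq_abs, abs_le] at this
    constructor <;> linarith
  · intro t ht
    have htm : t ∈ I := by rw [abs_le] at ht; constructor <;> linarith
    have e0 : 0 < d x ^ 2 := by positivity
    have h1 : |A 1 0 * d x| * r ≤ d c * d x := by
      rcases abs_cases (A 1 0 * d x) with ⟨h, _⟩ | ⟨h, _⟩ <;> rw [h] <;> simp only [hd] at * <;>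
        nlinarith
    have h2 : ∀ y R, |y - c| ≤ R → |d y * d x - d c * d x| ≤ |A 1 0 * d x| * R := fun y R hy => by
      rw [show d y * d x - d c * d x = A 1 0 * d x * (y - c) by simp only [hd]; ring, abs_mul]
      exact mul_le_mul_of_nonneg_left hy (abs_nonneg _)
    have e1 : (1 - ρ) * (d c * d x) ≤ d x ^ 2 := by nlinarith [(abs_le.1 (h2 x _ hxm)).1]
    have e1' : d t * d x ≤ 2 * (d c * d x) := by linarith [(abs_le.1 (h2 t _ ht)).2]
    have e2 : 0 ≤ (1 - ρ) * (d t * d x) := mul_nonneg (by linarith) (by linarith [hall t htm])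
    have e5 : (1 - ρ) * (d t * d x) ≤ 2 * d x ^ 2 := by nlinarith
    have e3 := pow_le_pow_left₀ e2 e5 2
    have e4 : ((1 - ρ) ^ 2 * d t ^ 2) * d x ^ 2 ≤ 4 * d x ^ 2 * d x ^ 2 := by nlinarith
    exact le_of_mul_le_mul_right e4 e0
  · have : A 0 0 - A 1 0 * x = (d x)⁻¹ := by
      refine eq_inv_of_mul_eq_one_left ?_; simp only [hd] at hnum ⊢
      linear_combination hdet + A 1 0 * hnum
    rw [← this]; simp only [hd]; ring

theorem hasSum_circleIntegral {c : ℂ} {r : ℝ} (hr : 0 ≤ r) {f : ℕ → ℂ → ℂ} {F : ℂ → ℂ}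
    {b : ℕ → ℝ} (hb : Summable b) (hf : ∀ n, ContinuousOn (f n) (sphere c r))
    (hle : ∀ n, ∀ z ∈ sphere c r, ‖f n z‖ ≤ b n)
    (hF : ∀ z ∈ sphere c r, HasSum (fun n => f n z) (F z)) :
    HasSum (fun n => ∮ z in C(c, r), f n z) (∮ z in C(c, r), F z) := by
  have hmem : ∀ θ, circleMap c r θ ∈ sphere c r := circleMap_mem_sphere c hr
  refine intervalIntegral.hasSum_integral_of_dominated_convergence (fun n _ => r * b n)
    (fun n => ?_) (fun n => ?_) ?_ ?_ ?_
  · refine Continuous.aestronglyMeasurable ?_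
    have hd : Continuous (deriv (circleMap c r)) := by rw [funext (deriv_circleMap c r)]; fun_prop
    exact hd.smul ((hf n).comp_continuous (continuous_circleMap c r) hmem)
  · refine Eventually.of_forall fun θ _ => ?_; rw [norm_smul, deriv_circleMap]
    simp only [norm_mul, norm_circleMap_zero, norm_I, mul_one, abs_of_nonneg hr]
    exact mul_le_mul_of_nonneg_left (hle n _ (hmem θ)) hr
  · exact Eventually.of_forall fun θ _ => hb.mul_left r
  · exact continuous_const.intervalIntegrable _ _
  · exact Eventually.of_forall fun θ _ => (hF _ (hmem θ)).const_smul _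

/-- The trace of the weighted composition operator `f ↦ J • f ∘ A`. -/
theorem hasSum_circleIntegral_pow (hr : 0 < r) (hρ0 : 0 ≤ ρ) (hρ : ρ < 1)
    (hm : MapsInto A 𝔻(c, r) 𝔻(c, ρ * r)) {x D : ℝ} (hx : IsAttracting A c r ρ x D) {J : ℂ → ℂ}
    (hJ : DifferentiableOn ℂ J 𝔻(c, r)) :
    HasSum (fun m : ℕ => (2 * π * Complex.I : ℂ)⁻¹ * ∮ z in C(c, r),
    ((r : ℂ) / (z - c)) ^ m * ((z - c)⁻¹ * (J z * ((moebius A z - c) / r) ^ m)))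
    (J x / (1 - ((D ^ 2)⁻¹ : ℝ))) := by
  have hr0 : (r : ℂ) ≠ 0 := by exact_mod_cast hr.ne'
  have hsub : sphere (c : ℂ) r ⊆ 𝔻(c, r) := sphere_subset_closedBall
  have hD : (D : ℂ) ≠ 0 := fun h => by
    have h1 := hx.one_lt; rw [ofReal_eq_zero.1 h] at h1; norm_num at h1
  set u : ℂ → ℂ := fun z => 1 - (denom A z * D)⁻¹ with hu
  have hu0 : ∀ z ∈ 𝔻(c, r), u z ≠ 0 := by
    intro z hz h0; have h1 := hx.lt_re z hz
    have h2 : (denom A z * D)⁻¹ = 1 := by linear_combination -h0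
    rw [inv_eq_one] at h2; rw [h2] at h1; simp at h1
  have hfac : ∀ z ∈ 𝔻(c, r), z - moebius A z = (z - x) * u z := by
    intro z hz; have h1 := moebius_sub A (hm z hz).1 (w := x) (by rw [hx.denom_eq]; exact hD)
    rw [hx.fix, hx.denom_eq] at h1; rw [hu]
    linear_combination -h1
  have hud : DifferentiableOn ℂ u 𝔻(c, r) := by
    refine (differentiableOn_const _).sub (DifferentiableOn.inv (by unfold denom; fun_prop) ?_)
    exact fun z hz => mul_ne_zero (hm z hz).1 hD
  have hxb : (x : ℂ) ∈ ball (c : ℂ) r := mem_ball_of_mem_closedBall_mul hr hρ hx.mem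
  have hcauchy := DiffContOnCl.circleIntegral_sub_inv_smul (c := (c : ℂ)) (R := r)
    (f := fun z => J z / u z)
    ((hJ.div hud hu0).diffContOnCl_ball le_rfl) hxb
  have hux : u x = 1 - ((D ^ 2)⁻¹ : ℝ) := by rw [hu]; dsimp only; rw [hx.denom_eq]; push_cast; ring
  have hne : ∀ z ∈ sphere (c : ℂ) r, z - c ≠ 0 := by
    intro z hz h0; rw [mem_sphere_iff_norm, h0, norm_zero] at hz; exact hr.ne hz
  obtain ⟨B, hB⟩ := (isCompact_closedBall _ _).exists_bound_of_continuousOn hJ.continuousOn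
  have hB0 : 0 ≤ B := (norm_nonneg _).trans (hB c (mem_closedBall_self hr.le))
  have hnorm : ∀ z ∈ sphere (c : ℂ) r, ‖(moebius A z - c) / (z - c)‖ ≤ ρ := by
    intro z hz; have h1 := (hm z (hsub hz)).2; rw [mem_closedBall_iff_norm] at h1
    rw [norm_div, mem_sphere_iff_norm.1 hz, div_le_iff₀ hr]; exact h1
  have hre : ∀ z ∈ sphere (c : ℂ) r, ∀ m : ℕ,
      ((r : ℂ) / (z - c)) ^ m * ((z - c)⁻¹ * (J z * ((moebius A z - c) / r) ^ m))
        = ((moebius A z - c) / (z - c)) ^ m * (J z / (z - c)) := by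
    intro z hz m
    rw [show (moebius A z - c) / (z - c) = (r / (z - c)) * ((moebius A z - c) / r) by
      field_simp, mul_pow]
    ring
  have hsum : HasSum (fun m : ℕ => ∮ z in C(c, r),
      ((r : ℂ) / (z - c)) ^ m * ((z - c)⁻¹ * (J z * ((moebius A z - c) / r) ^ m)))
      (∮ z in C(c, r), ((z - x)⁻¹ • (J z / u z))) := by
    refine hasSum_circleIntegral hr.le ((summable_geometric_of_lt_one hρ0 hρ).mul_right (B / r))
      (fun m => ?_) (fun m z hz => ?_) fun z hz => ?_
    · have hg := (continuousOn_moebius hm).mono hsub; have hJc := hJ.continuousOn.mono hsub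
      refine ContinuousOn.mul (ContinuousOn.pow (ContinuousOn.div (by fun_prop) (by fun_prop) hne) m)
        (ContinuousOn.mul (ContinuousOn.inv₀ (by fun_prop) hne) ?_)
      fun_prop
    · rw [hre z hz, norm_mul, norm_pow, norm_div (J z), mem_sphere_iff_norm.1 hz]; gcongr
      · exact hnorm z hz
      · exact hB z (hsub hz)
    · have hlt : ‖(moebius A z - c) / (z - c)‖ < 1 := (hnorm z hz).trans_lt hρ
      have h1 := (hasSum_geometric_of_norm_lt_one hlt).mul_right (J z / (z - c))
      have h2 : (z - x : ℂ)⁻¹ • (J z / u z)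
          = (1 - (moebius A z - c) / (z - c))⁻¹ * (J z / (z - c)) := by
        have e1 : 1 - (moebius A z - c) / (z - c) = (z - moebius A z) / (z - c) := by
          rw [eq_div_iff (hne z hz), sub_mul, div_mul_cancel₀ _ (hne z hz)]; ring
        rw [e1, hfac z (hsub hz), smul_eq_mul, inv_div, div_mul_div_comm, mul_comm (z - (c : ℂ)),
          mul_div_mul_right _ _ (hne z hz), ← div_eq_inv_mul, div_div, mul_comm (u z)]
      rw [h2]; exact h1.congr_fun fun m => hre z hz m
  have h3 := hsum.mul_left (2 * π * Complex.I : ℂ)⁻¹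
  rwa [hcauchy, hux, smul_eq_mul, inv_mul_cancel_left₀ two_pi_I_ne_zero] at h3

end FixedPoint

/-! ### Blocks of letters and the operators attached to them -/

/-- The blocks `h_1^(n+1)`, `h_{n+2}` and `h_{q-1}^(n+1)` occurring in the three columns of the
transfer operator. -/
abbrev Blk (q : ℕ) : Type := {b : Fin 3 × ℕ // b.1 = 1 → b.2 + 4 ≤ q}

namespace Blk

variable {q : ℕ}

/-- The column of a block. -/
def col (b : Blk q) : Fin 3 := b.1.1

/-- The letter of a block. -/
def idx (b : Blk q) : ℕ := if b.col = 1 then b.1.2 + 2 else parIdx q b.col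

/-- The multiplicity of the letter. -/
def exp (b : Blk q) : ℕ := if b.col = 1 then 1 else b.1.2 + 1

/-- The matrix of the inverse of a block. -/
def mat (b : Blk q) : SL(2, ℝ) := (matH q b.idx ^ b.exp)⁻¹

/-- A block as an element of `Λ`. -/
def elt (b : Blk q) : Lam q := eltH q b.idx ^ b.exp

/-- The block acts on functions on the `i`-th disc. -/
def Ok (i : Fin 3) (b : Blk q) : Prop := i = b.col → i = 1

theorem mapsInto {c r : Fin 3 → ℝ} {ρ : ℝ} (hq : 3 ≤ q) (h : AdmissibleDiscs q c r)
    (hρ : IsContraction q c r ρ) {i : Fin 3} {b : Blk q} (hb : Ok i b) : MapsInto b.mat 𝔻(c i, r i)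
    𝔻(c b.col, ρ * r b.col) := by
  intro z hz; by_cases h1 : b.col = 1
  · have hk : b.1.2 + 2 ∈ Finset.Icc 2 (q - 2) := by have := b.2 h1; rw [Finset.mem_Icc]; omega
    rw [mat, idx, exp, if_pos h1, if_pos h1, pow_one, h1]
    exact ⟨(h.maps_mid _ hk i z hz).1, hρ.mid _ hk i z hz⟩
  · have hi : i ≠ b.col := fun hi => h1 (hi ▸ hb hi); rw [mat, idx, exp, if_neg h1, if_neg h1]
    refine ⟨(h.mapsInto_par h1 hi (Nat.succ_pos _) z hz).1, ?_⟩
    rw [par_moebius hq h1 _ (h.re_lt h1 hi hz)]; have := hρ.par b.col h1 i hi z hz b.1.2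
    push_cast at this ⊢; exact this

theorem exists_summable_bound {c r : Fin 3 → ℝ} (hq : 3 ≤ q) (h : AdmissibleDiscs q c r) {s : ℂ}
    (hs : 1 / 2 < s.re) : ∃ B : Blk q → ℝ, (∀ b, 0 ≤ B b) ∧ Summable B ∧
    ∀ i b, Ok i b → ∀ z ∈ 𝔻(c i, r i), ‖jfac s b.mat z‖ ≤ B b := by
  have h1 : ∀ (k : ℕ) (i : Fin 3), ∃ C : ℝ, k ∈ Finset.Icc 2 (q - 2) →
      ∀ z ∈ 𝔻(c i, r i), ‖jfac s (matH q k)⁻¹ z‖ ≤ C := by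
    intro k i; by_cases hk : k ∈ Finset.Icc 2 (q - 2)
    · obtain ⟨C, hC⟩ := exists_bound_jfac h hk i s
      exact ⟨C, fun _ => hC s (mem_closedBall_self zero_le_one)⟩
    · exact ⟨0, fun h => absurd h hk⟩
  have h2 : ∀ i j : Fin 3, ∃ C : ℝ, j ≠ 1 → i ≠ j → ∀ z ∈ 𝔻(c i, r i),
      ‖cuspCoord (sgn j) z ^ (2 * s)‖ ≤ C := by
    intro i j; by_cases hj : j ≠ 1 ∧ i ≠ j
    · obtain ⟨C, hC⟩ := exists_bound_prefac h 0 hj.1 hj.2 s; refine ⟨C, fun _ _ z hz => ?_⟩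
      have := hC s (mem_closedBall_self zero_le_one) z hz; rwa [prefac, pow_zero, mul_one] at this
    · exact ⟨0, fun h1 h2 => absurd ⟨h1, h2⟩ hj⟩
  choose C hC using h1; choose P hP using h2; set E : ℝ := Real.exp (π * |(2 * s).im|) with hE
  have hσ : 1 < (2 * s).re := by simp; linarith
  set B : Fin 3 × ℕ → ℝ := fun b => if b.1 = 1 then (if b.2 + 4 ≤ q then ∑ i, |C (b.2 + 2) i| else 0)
    else (∑ i, |P i b.1|) * (((b.2 : ℝ) + 1) ^ (-(2 * s).re) * E) with hB
  have hB0 : ∀ b, 0 ≤ B b := by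
    intro b; simp only [hB]
    split_ifs
    · exact Finset.sum_nonneg fun _ _ => abs_nonneg _
    · exact le_rfl
    · exact mul_nonneg (Finset.sum_nonneg fun _ _ => abs_nonneg _) (by positivity)
  have hBs : Summable B := by
    rw [summable_prod_of_nonneg hB0]; refine ⟨fun j => ?_, Summable.of_finite⟩; simp only [hB]
    by_cases hj : j = 1
    · simp only [if_pos hj]; refine summable_of_ne_finset_zero (s := Finset.range q) fun n hn => ?_
      rw [Finset.mem_range] at hn; exact if_neg (by omega)
    · simp only [if_neg hj]; exact ((summable_succ_rpow hσ).mul_right E).mul_left _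
  refine ⟨fun b => B b.1, fun b => hB0 _, hBs.subtype _, fun i b hb z hz => ?_⟩
  have hsum : ∀ F : Fin 3 → ℝ, F i ≤ ∑ i, |F i| := fun F => (le_abs_self _).trans
    (Finset.single_le_sum (f := fun i => |F i|) (fun _ _ => abs_nonneg _) (Finset.mem_univ i))
  by_cases h1 : b.col = 1
  · have h1' : b.1.1 = 1 := h1; have h4 := b.2 h1
    have hk : b.1.2 + 2 ∈ Finset.Icc 2 (q - 2) := by rw [Finset.mem_Icc]; omega
    rw [mat, idx, exp, if_pos h1, if_pos h1, pow_one]; simp only [hB]; rw [if_pos h1', if_pos h4]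
    exact (hC _ i hk z hz).trans (hsum fun i => C (b.1.2 + 2) i)
  · have h1' : ¬ b.1.1 = 1 := h1; have hi : i ≠ b.col := fun hi => h1 (hi ▸ hb hi)
    have hre := h.re_lt h1 hi hz
    rw [mat, idx, exp, if_neg h1, if_neg h1, par_jfac hq h1 _ hre, norm_mul]; simp only [hB]
    rw [if_neg h1']
    refine mul_le_mul ((hP i b.1.1 h1 hi z hz).trans (hsum fun i => P i b.1.1)) ?_ (norm_nonneg _)
      (Finset.sum_nonneg fun _ _ => abs_nonneg _)
    refine norm_cpow_neg_le (by linarith) le_rfl le_rfl ?_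
    have h3 := cuspCoord_re_pos hre; have h4 := one_le_lam hq; rw [add_re, ofReal_re]; push_cast
    nlinarith [b.1.2.cast_nonneg (α := ℝ)]

end Blk

section Words

variable {q : ℕ}

/-- The element of `Λ` spelled by a list of blocks. -/
def wordElt (W : List (Blk q)) : Lam q := (W.map Blk.elt).prod

/-- The matrix of its inverse. -/
def wordMat : List (Blk q) → SL(2, ℝ)
  | [] => 1
  | b :: W => wordMat W * b.mat

/-- The product of the automorphy factors along a list of blocks. -/
def wordFac (s : ℂ) : List (Blk q) → ℂ → ℂ
  | [], _ => 1
  | b :: W, z => jfac s b.mat z * wordFac s W (moebius b.mat z)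

/-- Consecutive blocks can be composed, starting in the `i`-th disc. -/
def Adm : Fin 3 → List (Blk q) → Prop
  | _, [] => True
  | i, b :: W => b.Ok i ∧ Adm b.col W

/-- The disc in which the images of the `i`-th disc end up. -/
def endCol : Fin 3 → List (Blk q) → Fin 3
  | i, [] => i
  | _, b :: W => endCol b.col W

theorem endCol_eq {W : List (Blk q)} (hW : W ≠ []) (i j : Fin 3) : endCol i W = endCol j W := by
  cases W with
  | nil => exact absurd rfl hW
  | cons b W => rfl

variable {c r : Fin 3 → ℝ} {ρ : ℝ} (hq : 3 ≤ q) (h : AdmissibleDiscs q c r)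
  (hρ : IsContraction q c r ρ)

theorem closedBall_mul_subset (h : AdmissibleDiscs q c r) (hρ : IsContraction q c r ρ) (i : Fin 3) :
    𝔻(c i, ρ * r i) ⊆ ball (c i : ℂ) (r i) := fun _ hz =>
  mem_ball_of_mem_closedBall_mul (h.radius_pos i) hρ.lt_one hz

theorem mapsInto_wordMat (hq : 3 ≤ q) (h : AdmissibleDiscs q c r) (hρ : IsContraction q c r ρ)
    {W : List (Blk q)} (hW : W ≠ []) {i : Fin 3} (ha : Adm i W) : MapsInto (wordMat W) 𝔻(c i, r i)
    (closedBall (c (endCol i W) : ℂ) (ρ * r (endCol i W))) := by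
  induction W generalizing i with
  | nil => exact absurd rfl hW
  | cons b W ih =>
    have hb := Blk.mapsInto hq h hρ ha.1; by_cases hW' : W = []
    · subst hW'; rw [wordMat, wordMat, one_mul]; exact hb
    · intro z hz; obtain ⟨h1, h2⟩ := hb z hz
      obtain ⟨h3, h4⟩ := ih hW' ha.2 _ (ball_subset_closedBall (closedBall_mul_subset h hρ _ h2))
      rw [wordMat, denom_mul _ _ h1, moebius_mul _ _ h1 h3]; exact ⟨mul_ne_zero h3 h1, h4⟩

theorem differentiableOn_wordFac (hq : 3 ≤ q) (h : AdmissibleDiscs q c r)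
    (hρ : IsContraction q c r ρ) (s : ℂ) {W : List (Blk q)} {i : Fin 3} (ha : Adm i W) :
    DifferentiableOn ℂ (wordFac s W) 𝔻(c i, r i) := by
  induction W generalizing i with
  | nil => exact differentiableOn_const 1
  | cons b W ih =>
    have hb := Blk.mapsInto hq h hρ ha.1
    exact (differentiableOn_jfac hb s).mul ((ih ha.2).comp (differentiableOn_moebius hb) fun z hz =>
      ball_subset_closedBall (closedBall_mul_subset h hρ _ (hb z hz).2))

theorem jfac_ofReal_mul (s : ℂ) (A B : SL(2, ℝ)) {x : ℝ} (hx : denom B x ≠ 0) :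
    jfac s B x * jfac s A (moebius B x) = jfac s (A * B) x := by
  rw [jfac, jfac, jfac, denom_mul _ _ hx, moebius_ofReal, denom_ofReal, denom_ofReal]
  simp only [← ofReal_pow, ← ofReal_inv, ← ofReal_mul]
  rw [← mul_cpow_ofReal_nonneg (by positivity) (by positivity), ← ofReal_mul]
  congr 2; rw [mul_pow, mul_inv, mul_comm]

theorem wordFac_ofReal (hq : 3 ≤ q) (h : AdmissibleDiscs q c r) (hρ : IsContraction q c r ρ) (s : ℂ)
    {W : List (Blk q)} {i : Fin 3} (ha : Adm i W) {x : ℝ} (hx : (x : ℂ) ∈ 𝔻(c i, r i)) :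
    wordFac s W x = jfac s (wordMat W) x := by
  induction W generalizing i x with
  | nil => simp [wordFac, wordMat, jfac, denom]
  | cons b W ih =>
    obtain ⟨h1, h2⟩ := Blk.mapsInto hq h hρ ha.1 x hx
    rw [wordFac, wordMat, ← jfac_ofReal_mul _ _ _ h1]; congr 1
    have h3 := ball_subset_closedBall (closedBall_mul_subset h hρ _ h2); rw [moebius_ofReal] at h3 ⊢
    exact ih ha.2 h3

end Words

section Ops

variable {q : ℕ} {V : Type*} [NormedAddCommGroup V] [InnerProductSpace ℂ V]
  {c r : Fin 3 → ℝ} {ρ : ℝ} (hq : 3 ≤ q) (η : Lam q →* (V ≃ₗᵢ[ℂ] V))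
  (h : AdmissibleDiscs q c r) (hρ : IsContraction q c r ρ) (s : ℂ)

open Classical in
/-- The action of a block on functions. -/
def blockFun (b : Blk q) (f : BSpace V c r) (i : Fin 3) (z : ℂ) : V :=
  if b.Ok i then jfac s b.mat z • η b.elt (ext0 (f b.col).1 (moebius b.mat z)) else 0

theorem differentiableOn_blockFun (hq : 3 ≤ q) (h : AdmissibleDiscs q c r)
    (hρ : IsContraction q c r ρ) (b : Blk q) (f : BSpace V c r) (i : Fin 3) :
    DifferentiableOn ℂ (blockFun η s b f i) 𝔻(c i, r i) := by
  by_cases hb : b.Ok i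
  · have hm := Blk.mapsInto hq h hρ hb
    have e : blockFun η s b f i = fun z =>
        jfac s b.mat z • unitaryCLM (η b.elt) (ext0 (f b.col).1 (moebius b.mat z)) :=
      funext fun z => if_pos hb
    rw [e]
    refine (differentiableOn_jfac hm s).smul ((unitaryCLM _).differentiable.comp_differentiableOn ?_)
    exact (f b.col).2.comp (differentiableOn_moebius hm) fun z hz =>
      closedBall_mul_subset h hρ _ (hm z hz).2
  · have e : blockFun η s b f i = fun z => 0 := funext fun z => if_neg hb; rw [e]
    exact differentiableOn_const 0

theorem blockFun_bound {B : Blk q → ℝ} (hB0 : ∀ b, 0 ≤ B b)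
    (hB : ∀ i b, Blk.Ok i b → ∀ z ∈ 𝔻(c i, r i), ‖jfac s b.mat z‖ ≤ B b)
    (b : Blk q) (f : BSpace V c r) (i : Fin 3) {z : ℂ}
    (hz : z ∈ 𝔻(c i, r i)) : ‖blockFun η s b f i z‖ ≤ B b * ‖f‖ := by
  rw [blockFun]
  split_ifs with hb
  · rw [norm_smul, LinearIsometryEquiv.norm_map]
    exact mul_le_mul (hB i b hb z hz) ((norm_ext0_le _ _).trans (norm_le_pi_norm f b.col))
      (norm_nonneg _) (hB0 b)
  · rw [norm_zero]; exact mul_nonneg (hB0 b) (norm_nonneg _)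

theorem exists_blockFun_bound (hq : 3 ≤ q) (h : AdmissibleDiscs q c r) (hρ : IsContraction q c r ρ)
    (b : Blk q) : ∃ C : ℝ, 0 ≤ C ∧ ∀ (f : BSpace V c r) (i : Fin 3),
    ∀ z ∈ 𝔻(c i, r i), ‖blockFun η s b f i z‖ ≤ C * ‖f‖ := by
  have h1 : ∀ i, ∃ C : ℝ, b.Ok i → ∀ z ∈ 𝔻(c i, r i),
      ‖jfac s b.mat z‖ ≤ C := by
    intro i; by_cases hb : b.Ok i
    · obtain ⟨C, hC⟩ := (isCompact_closedBall _ _).exists_bound_of_continuousOn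
        (differentiableOn_jfac (Blk.mapsInto hq h hρ hb) s).continuousOn
      exact ⟨C, fun _ => hC⟩
    · exact ⟨0, fun h => absurd h hb⟩
  choose C hC using h1; have h0 : 0 ≤ ∑ i, |C i| := Finset.sum_nonneg fun _ _ => abs_nonneg _
  refine ⟨∑ i, |C i|, h0, fun f i z hz => ?_⟩; rw [blockFun]
  split_ifs with hb
  · rw [norm_smul, LinearIsometryEquiv.norm_map]
    refine mul_le_mul ((hC i hb z hz).trans ((le_abs_self _).trans ?_))
      ((norm_ext0_le _ _).trans (norm_le_pi_norm f b.col)) (norm_nonneg _) h0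
    exact Finset.single_le_sum (f := fun i => |C i|) (fun _ _ => abs_nonneg _) (Finset.mem_univ i)
  · rw [norm_zero]; exact mul_nonneg h0 (norm_nonneg _)

/-- The operator of a block. -/
def blockOp (b : Blk q) : BSpace V c r →L[ℂ] BSpace V c r :=
  have happ : ∀ (f : BSpace V c r) (i : Fin 3) (z : 𝔻(c i, r i)),
      (toDisc V (c i) (r i) (blockFun η s b f i)).1 z = blockFun η s b f i z := fun f i z =>
    toDisc_apply (differentiableOn_blockFun η s hq h hρ b f i).continuousOn
      ((differentiableOn_blockFun η s hq h hρ b f i).mono ball_subset_closedBall) z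
  mkContinuousOfExistsBound
    { toFun := fun f i => toDisc V (c i) (r i) (blockFun η s b f i)
      map_add' := fun f g => funext fun i => discSpace_ext fun z => by
        rw [happ]
        change _ = (toDisc V (c i) (r i) (blockFun η s b f i)).1 z
          + (toDisc V (c i) (r i) (blockFun η s b g i)).1 z
        rw [happ, happ, blockFun, blockFun, blockFun]
        split_ifs
        · rw [← smul_add, ← map_add, ← ext0_add]; rfl
        · rw [add_zero]
      map_smul' := fun a f => funext fun i => discSpace_ext fun z => by
        rw [happ]; change _ = a • (toDisc V (c i) (r i) (blockFun η s b f i)).1 z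
        rw [happ, blockFun, blockFun]
        split_ifs
        · rw [smul_comm a, ← map_smul (η b.elt) a, ← ext0_smul]; rfl
        · rw [smul_zero] }
    (by
      obtain ⟨C, hC0, hC⟩ := exists_blockFun_bound η s hq h hρ b
      refine ⟨C, fun f => (pi_norm_le_iff_of_nonneg (by positivity)).2 fun i => ?_⟩
      exact norm_toDisc_le (by positivity) (hC f i))

theorem blockOp_apply (b : Blk q) (f : BSpace V c r) (i : Fin 3) (z : 𝔻(c i, r i)) :
    (blockOp hq η h hρ s b f i).1 z = blockFun η s b f i z :=
  toDisc_apply (differentiableOn_blockFun η s hq h hρ b f i).continuousOn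
      ((differentiableOn_blockFun η s hq h hρ b f i).mono ball_subset_closedBall) z

theorem norm_blockOp_apply_le {C : ℝ} (hC : 0 ≤ C) (b : Blk q) (f : BSpace V c r)
    (hf : ∀ i, ∀ z ∈ 𝔻(c i, r i), ‖blockFun η s b f i z‖ ≤ C) : ‖blockOp hq η h hρ s b f‖ ≤ C :=
  (pi_norm_le_iff_of_nonneg hC).2 fun i => norm_toDisc_le hC (hf i)

/-- The operator of a list of blocks. -/
def wordOp (W : List (Blk q)) : BSpace V c r →L[ℂ] BSpace V c r :=
  (W.map (blockOp hq η h hρ s)).prod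

open Classical in
theorem wordOp_apply (W : List (Blk q)) (f : BSpace V c r) (i : Fin 3) (z : 𝔻(c i, r i)) :
    (wordOp hq η h hρ s W f i).1 z = if Adm i W then wordFac s W z •
    η (wordElt W) (ext0 (f (endCol i W)).1 (moebius (wordMat W) z)) else 0 := by
  induction W generalizing i z with
  | nil =>
    rw [if_pos (show Adm i ([] : List (Blk q)) from trivial)]
    have e : moebius (wordMat ([] : List (Blk q))) (z : ℂ) = z := by simp [wordMat, moebius, denom]
    rw [e, wordFac, one_smul, wordElt, map_nil, prod_nil, map_one]; exact (ext0_coe (f i).1 z).symm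
  | cons b W ih =>
    have e : wordOp hq η h hρ s (b :: W) f = blockOp hq η h hρ s b (wordOp hq η h hρ s W f) := by
      rw [wordOp, List.map_cons, List.prod_cons]
      rfl
    rw [e, blockOp_apply, blockFun]; by_cases hb : b.Ok i
    · obtain ⟨h1, h2⟩ := Blk.mapsInto hq h hρ hb z z.2
      have h2' := ball_subset_closedBall (closedBall_mul_subset h hρ _ h2)
      rw [if_pos hb, ext0_apply _ h2', ih b.col ⟨_, h2'⟩]; by_cases ha : Adm b.col W
      · rw [if_pos ha, if_pos (show Adm i (b :: W) from ⟨hb, ha⟩), map_smul, smul_smul]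
        have h3 : moebius (wordMat (b :: W)) (z : ℂ) = moebius (wordMat W) (moebius b.mat z) := by
          by_cases hW : W = []
          · subst hW; simp [wordMat, moebius, denom]
          · exact moebius_mul _ _ h1 (mapsInto_wordMat hq h hρ hW ha _ h2').1
        rw [h3, wordElt, wordElt, List.map_cons, List.prod_cons, map_mul]
        rfl
      · rw [if_neg ha, if_neg (fun h : Adm i (b :: W) => ha h.2), map_zero, smul_zero]
    · rw [if_neg hb, if_neg fun h : Adm i (b :: W) => hb h.1]

end Ops

/-! ### Norms of hyperbolic elements -/

section Hyp

theorem toPSL_eq_iff {A B : SL(2, ℝ)} :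
    toPSL A = toPSL B ↔ ∃ σ : ℝ, σ * σ = 1 ∧ ∀ i j, B i j = σ * A i j := by
  have h1 : toPSL A = toPSL B ↔ A⁻¹ * B ∈ Subgroup.center SL(2, ℝ) := QuotientGroup.eq
  rw [h1, Matrix.SpecialLinearGroup.mem_center_iff]; simp only [Fintype.card_fin, pow_two]
  constructor
  · rintro ⟨σ, hσ, h⟩; refine ⟨σ, hσ, fun i j => ?_⟩; have h2 : B = A * (A⁻¹ * B) := by group
    have h3 : (B : Matrix (Fin 2) (Fin 2) ℝ) = A * scalar (Fin 2) σ := by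
      rw [h]; exact congrArg Subtype.val h2
    rw [h3]; simp [scalar_apply, mul_diagonal, mul_comm]
  · rintro ⟨σ, hσ, h⟩; refine ⟨σ, hσ, ?_⟩
    have h3 : (B : Matrix (Fin 2) (Fin 2) ℝ) = A * scalar (Fin 2) σ := by
      ext i j; rw [h i j]; simp [scalar_apply, mul_diagonal, mul_comm]
    rw [Matrix.SpecialLinearGroup.coe_mul, h3, ← mul_assoc, ← Matrix.SpecialLinearGroup.coe_mul]
    simp

theorem mem_spectrum_iff (A : SL(2, ℝ)) (μ : ℝ) :
    μ ∈ spectrum ℝ (A : Matrix (Fin 2) (Fin 2) ℝ) ↔ μ ^ 2 - (A 0 0 + A 1 1) * μ + 1 = 0 := by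
  have h := det_eq_one A
  rw [spectrum.mem_iff, Matrix.isUnit_iff_isUnit_det, isUnit_iff_ne_zero, not_not,
    det_fin_two]
  simp only [Matrix.sub_apply, algebraMap_matrix_apply, if_true, Fin.isValue,
    zero_ne_one, one_ne_zero, if_false, Algebra.algebraMap_self, RingHom.id_apply]
  constructor <;> intro h1
  · linear_combination h1 - h
  · linear_combination h1 + h

theorem toPSL_out (g : PSLR) : toPSL (Quotient.out g) = g := QuotientGroup.out_eq' g

/-- The norm is the square of the eigenvalue `D`. -/
theorem hypNorm_toPSL {A : SL(2, ℝ)} {D : ℝ} (hD : 1 < D ^ 2) (ht : A 0 0 + A 1 1 = D + D⁻¹) :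
    hypNorm (toPSL A) = D ^ 2 := by
  obtain ⟨σ, hσ, h⟩ := toPSL_eq_iff.1 (toPSL_out (toPSL A)).symm
  have hD0 : D ≠ 0 := by rintro rfl; norm_num at hD
  have hi : D * D⁻¹ = 1 := mul_inv_cancel₀ hD0; rw [hypNorm]
  refine IsGreatest.csSup_eq ⟨⟨σ * D, ?_, ?_⟩, ?_⟩
  · rw [mem_spectrum_iff, h, h]; linear_combination (-(σ * σ * D)) * ht - (σ * σ) * hi - hσ
  · dsimp only; linear_combination D ^ 2 * hσ
  · rintro _ ⟨μ, hμ, rfl⟩; rw [mem_spectrum_iff, h, h] at hμ; dsimp only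
    have h2 : (μ - σ * D) * (μ - σ * D⁻¹) = 0 := by
      linear_combination hμ + σ * μ * ht + (D * D⁻¹) * hσ + hi
    rcases mul_eq_zero.1 h2 with h3 | h3
    · rw [show μ = σ * D by linarith, mul_pow, pow_two σ, hσ, one_mul]
    · rw [show μ = σ * D⁻¹ by linarith, mul_pow, pow_two σ, hσ, one_mul, inv_pow]
      exact (inv_le_one_of_one_le₀ hD.le).trans hD.le

theorem trace_eq_add (A : SL(2, ℝ)) :
    (A : Matrix (Fin 2) (Fin 2) ℝ).trace = A 0 0 + A 1 1 := trace_fin_two _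

theorem isHyperbolic_toPSL {A : SL(2, ℝ)} : IsHyperbolic (toPSL A) ↔ 2 < |A 0 0 + A 1 1| := by
  constructor
  · rintro ⟨B, hB, h⟩; obtain ⟨σ, hσ, hA⟩ := toPSL_eq_iff.1 hB
    have h1 : |σ| = 1 := by
      rw [← pow_left_inj₀ (abs_nonneg _) zero_le_one two_ne_zero, sq_abs, pow_two, hσ, one_pow]
    rwa [hA, hA, ← mul_add, abs_mul, h1, one_mul, ← trace_eq_add]
  · intro h; exact ⟨A, rfl, by rwa [trace_eq_add]⟩

theorem two_lt_abs_add_inv {D : ℝ} (hD : 1 < D ^ 2) : 2 < |D + D⁻¹| := by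
  have hD0 : D ≠ 0 := by rintro rfl; norm_num at hD
  have hi : D * D⁻¹ = 1 := mul_inv_cancel₀ hD0; refine lt_abs.2 ?_
  have h1 : (D - D⁻¹) ≠ 0 := by
    intro h0; have : D ^ 2 = 1 := by rw [pow_two]; nth_rewrite 2 [sub_eq_zero.1 h0]; exact hi
    linarith
  have h2 : 0 < (D - D⁻¹) ^ 2 := by positivity
  by_contra hc
  push Not at hc
  nlinarith

/-- The eigenvalue of a matrix with trace of absolute value greater than `2`. -/
theorem exists_eigenvalue {t : ℝ} (ht : 2 < |t|) : ∃ D : ℝ, 1 < D ^ 2 ∧ t = D + D⁻¹ := by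
  have h1 : 4 < t ^ 2 := by rw [← sq_abs]; nlinarith
  have hs := mul_self_sqrt (show 0 ≤ t ^ 2 - 4 by linarith)
  have h0 : 0 < √(t ^ 2 - 4) := sqrt_pos.2 (by linarith)
  rcases lt_abs.1 ht with h | h
  · refine ⟨(t + √(t ^ 2 - 4)) / 2, by nlinarith, ?_⟩
    rw [show ((t + √(t ^ 2 - 4)) / 2)⁻¹ = (t - √(t ^ 2 - 4)) / 2 from
      inv_eq_of_mul_eq_one_right (by linear_combination -hs / 4)]
    ring
  · refine ⟨(t - √(t ^ 2 - 4)) / 2, by nlinarith, ?_⟩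
    rw [show ((t - √(t ^ 2 - 4)) / 2)⁻¹ = (t + √(t ^ 2 - 4)) / 2 from
      inv_eq_of_mul_eq_one_right (by linear_combination -hs / 4)]
    ring

theorem trace_pow_succ_succ (A : SL(2, ℝ)) (n : ℕ) :
    (A ^ (n + 2)) 0 0 + (A ^ (n + 2)) 1 1 = (A 0 0 + A 1 1) * ((A ^ (n + 1)) 0 0 + (A ^ (n + 1)) 1 1)
    - ((A ^ n) 0 0 + (A ^ n) 1 1) := by
  have h := det_eq_one A; have e1 : A ^ (n + 1) = A ^ n * A := pow_succ _ _
  have e2 : A ^ (n + 2) = A ^ n * A * A := by rw [pow_succ, pow_succ]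
  rw [e2, e1]; simp only [sl_mul_apply]
  linear_combination (-((A ^ n) 0 0) - (A ^ n) 1 1) * h

/-- The trace of a power, for a sequence with the recursion of `x ^ n + x ^ (-n)`. -/
theorem trace_pow_eq {A : SL(2, ℝ)} {a : ℕ → ℝ} (h0 : a 0 = 2) (h1 : A 0 0 + A 1 1 = a 1)
    (h2 : ∀ n, a (n + 2) = a 1 * a (n + 1) - a n) (n : ℕ) : (A ^ n) 0 0 + (A ^ n) 1 1 = a n := by
  induction n using Nat.strong_induction_on with
  | _ n ih => match n, ih with
    | 0, _ =>
      rw [h0, pow_zero]; norm_num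
    | 1, _ => rw [pow_one, h1]
    | n + 2, ih => rw [trace_pow_succ_succ, ih n (by omega), ih (n + 1) (by omega), h1, h2]

theorem trace_pow_hyp {A : SL(2, ℝ)} {D : ℝ} (hD : D ≠ 0) (ht : A 0 0 + A 1 1 = D + D⁻¹) (n : ℕ) :
    (A ^ n) 0 0 + (A ^ n) 1 1 = D ^ n + (D ^ n)⁻¹ := by
  refine trace_pow_eq (a := fun n => D ^ n + (D ^ n)⁻¹) (by norm_num) (by simpa using ht)
    (fun n => ?_) n
  have hi : D * D⁻¹ = 1 := mul_inv_cancel₀ hD; simp only [← inv_pow, pow_one, pow_add]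
  linear_combination (-(D ^ n) - D⁻¹ ^ n) * hi

theorem exists_rep (g : PSLR) : ∃ A : SL(2, ℝ), toPSL A = g := ⟨_, toPSL_out g⟩

theorem one_lt_sq_pow {D : ℝ} (hD : 1 < D ^ 2) {n : ℕ} (hn : n ≠ 0) : 1 < (D ^ n) ^ 2 := by
  rw [← pow_mul, mul_comm, pow_mul]; exact one_lt_pow₀ hD hn

theorem IsHyperbolic.pow {g : PSLR} (hg : IsHyperbolic g) {n : ℕ} (hn : n ≠ 0) :
    IsHyperbolic (g ^ n) ∧ hypNorm (g ^ n) = hypNorm g ^ n := by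
  obtain ⟨A, rfl⟩ := exists_rep g; obtain ⟨D, hD, ht⟩ := exists_eigenvalue (isHyperbolic_toPSL.1 hg)
  have hD0 : D ≠ 0 := by rintro rfl; norm_num at hD
  have h1 := trace_pow_hyp hD0 ht n; have h2 := one_lt_sq_pow hD hn; rw [← map_pow]
  refine ⟨isHyperbolic_toPSL.2 ?_, ?_⟩
  · rw [h1]; exact two_lt_abs_add_inv h2
  · rw [hypNorm_toPSL h2 h1, hypNorm_toPSL hD ht, ← pow_mul, ← pow_mul, mul_comm]

theorem IsHyperbolic.one_lt {g : PSLR} (hg : IsHyperbolic g) : 1 < hypNorm g := by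
  obtain ⟨A, rfl⟩ := exists_rep g; obtain ⟨D, hD, ht⟩ := exists_eigenvalue (isHyperbolic_toPSL.1 hg)
  rwa [hypNorm_toPSL hD ht]

theorem IsHyperbolic.of_pow {g : PSLR} {n : ℕ} (hg : IsHyperbolic (g ^ n)) : IsHyperbolic g := by
  obtain ⟨A, rfl⟩ := exists_rep g; rw [← map_pow, isHyperbolic_toPSL] at hg; rw [isHyperbolic_toPSL]
  by_contra hc
  push Not at hc
  obtain ⟨h1, h2⟩ := abs_le.1 hc; set θ := arccos ((A 0 0 + A 1 1) / 2) with hθ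
  have hcos : Real.cos θ = (A 0 0 + A 1 1) / 2 := cos_arccos (by linarith) (by linarith)
  have h3 := trace_pow_eq (A := A) (a := fun n => 2 * Real.cos (n * θ)) (by simp)
    (by simp [hcos]; ring) (fun n => by
      have e1 : ((n + 2 : ℕ) : ℝ) * θ = ((n + 1 : ℕ) : ℝ) * θ + θ := by push_cast; ring
      have e2 : (n : ℝ) * θ = ((n + 1 : ℕ) : ℝ) * θ - θ := by push_cast; ring
      rw [e1, e2, Real.cos_add, Real.cos_sub]; push_cast; rw [one_mul]; ring) n
  rw [h3, abs_mul, abs_two] at hg; have := abs_cos_le_one (n * θ); linarith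

theorem trace_conj (A B : SL(2, ℝ)) : (B * A * B⁻¹) 0 0 + (B * A * B⁻¹) 1 1 = A 0 0 + A 1 1 := by
  rw [← trace_eq_add, ← trace_eq_add, Matrix.SpecialLinearGroup.coe_mul, Matrix.trace_mul_comm,
    ← Matrix.SpecialLinearGroup.coe_mul, ← mul_assoc, inv_mul_cancel, one_mul]

theorem IsHyperbolic.conj {g : PSLR} (hg : IsHyperbolic g) (γ : PSLR) :
    IsHyperbolic (γ * g * γ⁻¹) ∧ hypNorm (γ * g * γ⁻¹) = hypNorm g := by
  obtain ⟨A, rfl⟩ := exists_rep g; obtain ⟨B, rfl⟩ := exists_rep γ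
  have h1 := isHyperbolic_toPSL.1 hg; obtain ⟨D, hD, ht⟩ := exists_eigenvalue h1
  rw [← map_mul, ← map_inv, ← map_mul]; refine ⟨isHyperbolic_toPSL.2 (by rwa [trace_conj]), ?_⟩
  rw [hypNorm_toPSL hD ht, hypNorm_toPSL hD (by rw [trace_conj, ht])]

theorem trace_inv (A : SL(2, ℝ)) : (A⁻¹) 0 0 + (A⁻¹) 1 1 = A 0 0 + A 1 1 := by
  rw [SL2_inv_expl]; simp [add_comm]

end Hyp

/-! ### Sums over lists of given length -/

section Lists

variable {β : Type*}

/-- Lists of length `n + 1` as pairs of head and tail. -/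
def consEquiv (β : Type*) (n : ℕ) :
    β × {W : List β // W.length = n} ≃ {W : List β // W.length = n + 1} where
  toFun p := ⟨p.1 :: p.2.1, by simp [p.2.2]⟩
  invFun W := (W.1.head (ne_nil_of_length_eq_add_one W.2), ⟨W.1.tail, by simp [W.2]⟩)
  left_inv _ := rfl
  right_inv W := Subtype.ext (List.cons_head_tail _)

theorem coe_consEquiv (n : ℕ) (p : β × {W : List β // W.length = n}) :
    (consEquiv β n p).1 = p.1 :: p.2.1 := rfl

theorem summable_words {w : β → ℝ} (h0 : ∀ b, 0 ≤ w b) (hw : Summable w) (n : ℕ) :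
    Summable fun W : {W : List β // W.length = n} => (W.1.map w).prod := by
  induction n with
  | zero =>
    have : Finite {W : List β // W.length = 0} := by
      refine Finite.of_injective (fun _ => ()) fun W W' _ => Subtype.ext ?_
      rw [List.length_eq_zero_iff.1 W.2, List.length_eq_zero_iff.1 W'.2]
    exact Summable.of_finite
  | succ n ih =>
    rw [← (consEquiv β n).summable_iff]
    refine (hw.mul_of_nonneg ih h0 fun W => List.prod_nonneg ?_).congr fun p => ?_
    · simp only [List.mem_map, forall_exists_index, and_imp, forall_apply_eq_imp_iff₂]
      exact fun b _ => h0 b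
    · rw [Function.comp_apply, coe_consEquiv, List.map_cons, List.prod_cons]

theorem hasSum_words {R : Type*} [NormedRing R] [CompleteSpace R] {B : β → R}
    (hB : Summable fun b => ‖B b‖) (n : ℕ) :
    (Summable fun W : {W : List β // W.length = n} => ‖(W.1.map B).prod‖) ∧
    HasSum (fun W : {W : List β // W.length = n} => (W.1.map B).prod) ((∑' b, B b) ^ n) := by
  induction n with
  | zero =>
    have : Unique {W : List β // W.length = 0} :=
      ⟨⟨⟨[], rfl⟩⟩, fun W => Subtype.ext (List.length_eq_zero_iff.1 W.2)⟩
    refine ⟨Summable.of_finite, ?_⟩; convert hasSum_unique _ using 1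
    rw [pow_zero, List.length_eq_zero_iff.1 (default : {W : List β // W.length = 0}).2]
    rfl
  | succ n ih =>
    have h1 : ∀ p : β × {W : List β // W.length = n},
        (((consEquiv β n p).1).map B).prod = B p.1 * (p.2.1.map B).prod := fun p => by
      rw [coe_consEquiv, List.map_cons, List.prod_cons]
    have hsn : Summable fun p : β × {W : List β // W.length = n} =>
        ‖B p.1 * (p.2.1.map B).prod‖ := Summable.mul_norm (f := B)
          (g := fun W : {W : List β // W.length = n} => (W.1.map B).prod) hB ih.1
    refine ⟨(consEquiv β n).summable_iff.1 (hsn.congr fun p => by rw [Function.comp_apply, h1]),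
      (consEquiv β n).hasSum_iff.1 ?_⟩
    have h2 := tsum_mul_tsum_of_summable_norm hB ih.1; rw [ih.2.tsum_eq] at h2; rw [pow_succ', h2]
    have h3 : Summable fun p : β × {W : List β // W.length = n} =>
        B p.1 * (p.2.1.map B).prod := hsn.of_norm
    exact h3.hasSum.congr_fun fun p => h1 p

end Lists

section Closed

variable {q : ℕ}

/-- Lists of blocks which can be repeated cyclically. -/
def ClosedWord (W : List (Blk q)) : Prop := W ≠ [] ∧ Adm (endCol 0 W) W

theorem coe_elt (b : Blk q) : (b.elt : PSLR) = toPSL b.mat⁻¹ := by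
  rw [Blk.elt, Blk.mat, inv_inv, map_pow]
  rfl

theorem coe_wordElt (W : List (Blk q)) : (wordElt W : PSLR) = toPSL (wordMat W)⁻¹ := by
  induction W with
  | nil => simp [wordElt, wordMat]
  | cons b W ih =>
    rw [wordElt, List.map_cons, List.prod_cons, Subgroup.coe_mul, coe_elt, wordMat, _root_.mul_inv_rev,
      map_mul, ← ih]
    rfl

variable {c r : Fin 3 → ℝ} {ρ : ℝ}

theorem ClosedWord.exists_isAttracting (hq : 3 ≤ q) (h : AdmissibleDiscs q c r)
    (hρ : IsContraction q c r ρ) {W : List (Blk q)} (hW : ClosedWord W) :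
    ∃ x D : ℝ, IsAttracting (wordMat W) (c (endCol 0 W)) (r (endCol 0 W)) ρ x D ∧
    IsHyperbolic (wordElt W : PSLR) ∧ hypNorm (wordElt W : PSLR) = D ^ 2 := by
  have hm := mapsInto_wordMat hq h hρ hW.1 hW.2; rw [endCol_eq hW.1 (endCol 0 W) 0] at hm
  obtain ⟨x, D, hx⟩ := HeckeZeta.exists_isAttracting (h.radius_pos _) hρ.pos.le hρ.lt_one hm
  have ht := hx.trace_eq; rw [← trace_inv] at ht; refine ⟨x, D, hx, ?_, ?_⟩
  · rw [coe_wordElt, isHyperbolic_toPSL, ht]; exact two_lt_abs_add_inv hx.one_lt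
  · rw [coe_wordElt, hypNorm_toPSL hx.one_lt ht]

end Closed

section Trace

variable {V : Type*} [NormedAddCommGroup V] [InnerProductSpace ℂ V] [FiniteDimensional ℂ V]
  [CompleteSpace V] {c r : Fin 3 → ℝ}

theorem taylor_toDisc_smul {c r : ℝ} (hr : 0 < r) (m : ℕ) {f : DiscSpace V c r} {φ : ℂ → ℂ} {v : V}
    (hf : ∀ z, f.1 z = φ z • v) : taylor hr m f = ((2 * π * Complex.I : ℂ)⁻¹ *
    ∮ z in C(c, r), ((r : ℂ) / (z - c)) ^ m * ((z - c)⁻¹ * φ z)) • v := by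
  rw [taylor_eq_circleIntegral, mul_smul, ← circleIntegral.integral_smul_const]; congr 1
  refine circleIntegral.integral_congr hr.le fun z hz => ?_
  rw [ext0_apply _ (sphere_subset_closedBall hz), hf, smul_smul, smul_smul, mul_assoc]

theorem circleIntegral_monomial {c r : ℝ} (hr : 0 < r) (m k : ℕ) :
    (2 * π * Complex.I : ℂ)⁻¹ * (∮ z in C(c, r),
    ((r : ℂ) / (z - c)) ^ m * ((z - c)⁻¹ * (((z - c) / r) ^ k))) = if m = k then 1 else 0 := by
  have hr0 : (r : ℂ) ≠ 0 := by exact_mod_cast hr.ne'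
  have hne : ∀ z ∈ sphere (c : ℂ) r, z - c ≠ 0 := by
    intro z hz h0; rw [mem_sphere_iff_norm, h0, norm_zero] at hz; exact hr.ne hz
  have h1 : (∮ z in C(c, r), ((r : ℂ) / (z - c)) ^ m * ((z - c)⁻¹ * (((z - c) / r) ^ k)))
      = ∮ z in C(c, r), (r : ℂ) ^ ((m : ℤ) - k) * (z - c) ^ ((k : ℤ) - m - 1) := by
    refine circleIntegral.integral_congr hr.le fun z hz => ?_; have h2 := hne z hz
    rw [zpow_sub₀ hr0, zpow_sub₀ h2, zpow_sub₀ h2]; simp only [zpow_natCast, zpow_one, div_pow]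
    field_simp
  rw [h1, circleIntegral.integral_const_mul]
  split_ifs with hmk
  · subst hmk
    have e : ∀ z : ℂ, (z - c) ^ ((m : ℤ) - m - 1) = (z - c)⁻¹ := fun z => by
      rw [sub_self, zero_sub, _root_.zpow_neg_one]
    simp only [e]
    rw [circleIntegral.integral_sub_center_inv _ hr.ne', sub_self, zpow_zero, one_mul,
      inv_mul_cancel₀ two_pi_I_ne_zero]
  · rw [circleIntegral.integral_sub_zpow_of_ne (by omega), mul_zero, mul_zero]

theorem coeffB_vecB (hr : ∀ i, 0 < r i) (b j : Idx V) :
    coeffB hr b (vecB c r j) = if b = j then 1 else 0 := by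
  obtain ⟨m, i, l⟩ := b; obtain ⟨m', i', l'⟩ := j; rw [coeffB_apply]; dsimp only
  by_cases hi : i' = i
  · subst hi
    have e : vecB c r ((m', i', l') : Idx V) i' = mono (c i') (r i') m' (𝔟 V l') :=
      Pi.single_eq_same _ _
    rw [e, taylor_toDisc_smul (hr i') m (φ := fun z => ((z - c i') / r i') ^ m') (mono_apply m' _),
      circleIntegral_monomial (hr i'),
      inner_smul_right, OrthonormalBasis.inner_eq_ite]
    by_cases hm : m = m' <;> by_cases hl : l = l' <;> simp [hm, hl]
  · have e : vecB c r ((m', i', l') : Idx V) i = 0 := Pi.single_eq_of_ne (Ne.symm hi) _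
    rw [e, map_zero, inner_zero_right, if_neg]; simp [Ne.symm hi]

variable {q : ℕ} {ρ : ℝ} (hq : 3 ≤ q) (η : Lam q →* (V ≃ₗᵢ[ℂ] V))
  (h : AdmissibleDiscs q c r) (hρ : IsContraction q c r ρ) {s : ℂ}

local notation "𝓛" => transferOp hq η h hρ

theorem summable_norm_blockOp (hs : 1 / 2 < s.re) : Summable fun b => ‖blockOp hq η h hρ s b‖ := by
  obtain ⟨B, hB0, hBs, hB⟩ := Blk.exists_summable_bound hq h hs
  refine hBs.of_nonneg_of_le (fun b => opNorm_nonneg _) fun b => ?_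
  refine opNorm_le_bound _ (hB0 b) fun f => ?_
  exact norm_blockOp_apply_le hq η h hρ s (mul_nonneg (hB0 b) (norm_nonneg _)) b f
    fun i z hz => blockFun_bound η s hB0 hB b f i hz

open Classical in
theorem hasSum_column (hs : 1 / 2 < s.re) (f : BSpace V c r) (i : Fin 3) (z : 𝔻(c i, r i))
    (j : Fin 3) (h : AdmissibleDiscs q c r) : HasSum (fun n : ℕ => if hp : j = 1 → n + 4 ≤ q then
    blockFun η s (⟨(j, n), hp⟩ : Blk q) f i z else 0) (tailVal hq η 0 s f i z j) := by
  by_cases hj : j = 1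
  · subst hj; rw [tailVal, if_pos rfl]
    have e : ∑ k ∈ Finset.Icc 2 (q - 2), jfac s (matH q k)⁻¹ z •
        η (eltH q k) (ext0 (f 1).1 (moebius (matH q k)⁻¹ z))
        = ∑ n ∈ Finset.range (q - 3), if hp : (1 : Fin 3) = 1 → n + 4 ≤ q then
          blockFun η s (⟨(1, n), hp⟩ : Blk q) f i z else 0 := by
      have e1 : Finset.Icc 2 (q - 2) = Finset.Ico (0 + 2) (q - 3 + 2) := by
        ext k; simp only [Finset.mem_Icc, Finset.mem_Ico]; omega
      rw [e1, ← sum_Ico_add', range_eq_Ico]; refine Finset.sum_congr rfl fun n hn => ?_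
      rw [Finset.mem_Ico] at hn
      rw [dif_pos (fun _ => by omega), blockFun,
        if_pos (show Blk.Ok i (⟨(1, n), _⟩ : Blk q) from fun hi => hi)]
      simp [Blk.mat, Blk.elt, Blk.idx, Blk.exp, Blk.col]
    rw [e]; refine hasSum_sum_of_ne_finset_zero fun n hn => dif_neg fun hp => hn ?_; have := hp rfl
    rw [Finset.mem_range]; omega
  · rw [tailVal_zero_eq hq η f hj z.2 h]; by_cases hij : i = j
    · rw [if_pos hij]; refine hasSum_zero.congr_fun fun n => ?_
      rw [dif_pos fun h => absurd h hj, blockFun, if_neg]; exact fun hok => hj (hij ▸ hok hij)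
    · rw [if_neg hij]; refine (summable_beta η hq hs f hj hij z.2 h).hasSum.congr_fun fun n => ?_
      rw [dif_pos fun h => absurd h hj, blockFun,
        if_pos (show Blk.Ok i (⟨(j, n), _⟩ : Blk q) from fun hok => absurd hok hij), beta]
      simp [Blk.mat, Blk.elt, Blk.idx, Blk.exp, Blk.col, hj]

theorem tsum_blockOp (hs : 1 / 2 < s.re) :
    ∑' b, blockOp hq η h hρ s b = 𝓛 s := by
  classical
  have hsum : Summable (blockOp hq η h hρ s) :=
    Summable.of_norm (f := blockOp hq η h hρ s) (summable_norm_blockOp hq η h hρ hs)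
  refine ContinuousLinearMap.ext fun f => funext fun i => discSpace_ext fun z => ?_
  have h1 := (hsum.hasSum.mapL (ContinuousLinearMap.apply ℂ (BSpace V c r) f)).mapL
    (evalAt V c r z)
  set G : Fin 3 × ℕ → V := fun p => if hp : p.1 = 1 → p.2 + 4 ≤ q then
    blockFun η s (⟨p, hp⟩ : Blk q) f i z else 0 with hG
  set a : V := ((∑' b, blockOp hq η h hρ s b) f i).1 z with ha
  have h2 : HasSum (G ∘ ((↑) : {p : Fin 3 × ℕ | p.1 = 1 → p.2 + 4 ≤ q} → Fin 3 × ℕ)) a := by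
    refine HasSum.congr_fun h1 fun b => ?_; change G b.1 = (blockOp hq η h hρ s b f i).1 z
    rw [blockOp_apply, hG]; exact dif_pos b.2
  have h3 : HasSum G a := by
    refine (hasSum_subtype_iff_of_support_subset ?_).1 h2; intro p hp; by_contra hc
    exact hp (dif_neg hc)
  rw [transferOp_apply hq η h hρ hs]
  exact (h3.prod_fiberwise fun j => hasSum_column hq η hs f i z j h).unique (hasSum_fintype _)

theorem transferOp_vecB (hs : 1 / 2 < s.re) (j : Idx V) :
    𝓛 s (vecB c r j) = tailVec hq η c r 0 s j := by
  classical
  refine funext fun i => discSpace_ext fun z => ?_; rw [transferOp_apply hq η h hρ hs]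
  refine (hasSum_tailVec hq η h hρ (mem_tailDom_zero hs) (vecB c r j) i z).unique ?_
  have h1 : ∀ b, coeffB h.radius_pos b (vecB c r j) • (tailVec hq η c r 0 s b i).1 z
      = if b = j then (tailVec hq η c r 0 s j i).1 z else 0 := by
    intro b; rw [coeffB_vecB]
    split_ifs with hb
    · rw [hb, one_smul]
    · rw [zero_smul]
  simp only [h1]; exact hasSum_ite_eq j _

theorem exists_bound_transferOp_vecB (hs : 1 / 2 < s.re) :
    ∃ C : ℝ, 0 ≤ C ∧ ∀ j : Idx V, ‖𝓛 s (vecB c r j)‖ ≤ C * ρ ^ j.1 := by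
  obtain ⟨W, -, hsW, C, hC, H⟩ := exists_bound_tailVec hq η h hρ (mem_tailDom_zero hs)
  refine ⟨C, hC, fun j => ?_⟩; rw [transferOp_vecB hq η h hρ hs]; exact H s hsW j

theorem hasSum_transferOp_vecB (hs : 1 / 2 < s.re) (f : BSpace V c r) :
    HasSum (fun j => coeffB h.radius_pos j f • 𝓛 s (vecB c r j))
    (𝓛 s f) := by
  obtain ⟨C, hC, H⟩ := exists_bound_transferOp_vecB hq η h hρ hs
  have hsum : Summable fun j => coeffB h.radius_pos j f • 𝓛 s (vecB c r j) := by
    refine Summable.of_norm_bounded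
      (((summable_pow_deg (V := V) hρ.pos.le hρ.lt_one).mul_left C).mul_left ‖f‖) fun j => ?_
    rw [norm_smul]
    exact mul_le_mul (norm_coeffB_apply_le h.radius_pos j f) (H j) (norm_nonneg _) (norm_nonneg _)
  have e : ∑' j, coeffB h.radius_pos j f • 𝓛 s (vecB c r j)
      = 𝓛 s f := by
    refine funext fun i => discSpace_ext fun z => ?_
    refine (hsum.hasSum.mapL (evalAt V c r z)).unique ?_; change HasSum _ ((𝓛 s f i).1 z)
    rw [transferOp_apply hq η h hρ hs]
    refine (hasSum_tailVec hq η h hρ (mem_tailDom_zero hs) f i z).congr_fun fun j => ?_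
    rw [map_smul, transferOp_vecB hq η h hρ hs]
    rfl
  rw [← e]; exact hsum.hasSum

/-- The matrix of the transfer operator in the monomial basis. -/
def transferMat (s : ℂ) (i j : Idx V) : ℂ :=
  coeffB h.radius_pos i (𝓛 s (vecB c r j))

theorem summable_sqrt_pow {C : ℝ} (hC : 0 ≤ C) (hρ : IsContraction q c r ρ) :
    Summable fun j : Idx V => √(C * ρ ^ j.1) := by
  refine ((summable_pow_deg (V := V) (sqrt_nonneg ρ) ?_).mul_left √C).congr fun j => ?_
  · rw [sqrt_lt' one_pos, one_pow]; exact hρ.lt_one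
  · have h0 := hρ.pos.le; rw [sqrt_mul hC]; congr 1
    refine ((sqrt_eq_iff_mul_self_eq (by positivity) (by positivity)).2 ?_).symm
    rw [← mul_pow, mul_self_sqrt h0]

theorem norm_transferMat_le {C : ℝ}
    (H : ∀ j : Idx V, ‖𝓛 s (vecB c r j)‖ ≤ C * ρ ^ j.1) (i j : Idx V) :
    ‖transferMat hq η h hρ s i j‖ ≤ C * ρ ^ j.1 :=
  (norm_coeffB_apply_le h.radius_pos i _).trans (H j)

theorem fredholmDet_transferOp (hs : 1 / 2 < s.re) :
    fredholmDet (𝓛 s) = fdet (transferMat hq η h hρ s) := by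
  obtain ⟨C, hC, H⟩ := exists_bound_transferOp_vecB hq η h hρ hs
  refine (discBasis h.radius_pos).fredholmDet_eq
    (isNuclearOrderZero_transferOp hq η h hρ (not_mem_poleSet_of_re hs)) ?_
    (hasSum_transferOp_vecB hq η h hρ hs)
  refine (summable_sqrt_pow hC hρ).of_nonneg_of_le (fun _ => sqrt_nonneg _) fun j => ?_
  refine sqrt_le_sqrt ((mul_le_of_le_one_left (norm_nonneg _) (norm_coeffB_le _ j)).trans (H j))

theorem fpow_transferMat (hs : 1 / 2 < s.re) (n : ℕ) (i j : Idx V) :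
    fpow (transferMat hq η h hρ s) n i j
    = coeffB h.radius_pos i ((𝓛 s ^ (n + 1)) (vecB c r j)) := by
  induction n generalizing j with
  | zero => rw [fpow, zero_add, pow_one, transferMat]
  | succ n ih =>
    have h1 := ((hasSum_transferOp_vecB hq η h hρ hs
      (𝓛 s (vecB c r j))).mapL (𝓛 s ^ n)).mapL
      (coeffB h.radius_pos i)
    rw [fpow]
    have h2 : (𝓛 s ^ (n + 1 + 1)) (vecB c r j)
        = (𝓛 s ^ n) (𝓛 s
          (𝓛 s (vecB c r j))) := by
      rw [pow_succ, pow_succ]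
      rfl
    rw [h2, ← h1.tsum_eq]; refine tsum_congr fun k => ?_
    rw [ih, map_smul, map_smul, smul_eq_mul, mul_comm, pow_succ]
    rfl

end Trace

section Abstract

variable {X : Type*} [NormedAddCommGroup X] [NormedSpace ℂ X] {ι β : Type*}

theorem hasSum_operator_words [CompleteSpace X] {B : β → X →L[ℂ] X} (hB : Summable fun b => ‖B b‖)
    (n : ℕ) : HasSum (fun W : {W : List β // W.length = n} => (W.1.map B).prod) ((∑' b, B b) ^ n) :=
  (hasSum_words hB n).2

theorem tsum_apply_comm {op : β → X →L[ℂ] X} {L : X →L[ℂ] X} (hL : HasSum op L)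
    (φ : ι → X →L[ℂ] ℂ) (x : ι → X) {a : ι → ℝ} {w : β → ℝ} (ha : Summable a) (hw : Summable w)
    (ha0 : ∀ i, 0 ≤ a i) (hw0 : ∀ b, 0 ≤ w b) (hle : ∀ i b, ‖φ i (op b (x i))‖ ≤ w b * a i) :
    ∑' i, φ i (L (x i)) = ∑' b, ∑' i, φ i (op b (x i)) := by
  have hsum : Summable fun p : ι × β => φ p.1 (op p.2 (x p.1)) :=
    Summable.of_norm_bounded (ha.mul_of_nonneg hw ha0 hw0) fun p => by
      rw [mul_comm]; exact hle p.1 p.2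
  rw [Summable.tsum_comm (f := fun i b => φ i (op b (x i))) hsum]
  refine tsum_congr fun i => ?_
  exact (((hL.mapL (ContinuousLinearMap.apply ℂ X (x i))).mapL (φ i)).tsum_eq).symm

theorem tsum_words_div_length {T : List β → ℂ} (hT : T [] = 0) (hsum : Summable fun W => ‖T W‖)
    {a : ℕ → ℂ} (ha : ∀ n, a n = ∑' W : {W : List β // W.length = n + 1}, T W.1) :
    (Summable fun n : ℕ => ‖a n / ((n : ℂ) + 1)‖) ∧
    ∑' n : ℕ, a n / ((n : ℂ) + 1) = ∑' W : List β, T W / W.length := by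
  have hle : ∀ W : List β, ‖T W / W.length‖ ≤ ‖T W‖ := by
    intro W; rcases eq_or_ne W [] with rfl | hW
    · rw [hT, zero_div]
    · have h1 : (1 : ℝ) ≤ W.length := by exact_mod_cast List.length_pos_iff.2 hW
      rw [norm_div, Complex.norm_natCast]; exact div_le_self (norm_nonneg _) h1
  have hF : Summable fun W : List β => T W / W.length := Summable.of_norm_bounded hsum hle
  have hsig : Summable fun p : (n : ℕ) × {W : List β // W.length = n} => ‖T p.2.1‖ :=
    (Equiv.summable_iff (f := fun W : List β => ‖T W‖)
      (Equiv.sigmaFiberEquiv (List.length (α := β)))).2 hsum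
  have hn := fun n => hsig.sigma_factor n
  have hnn : Summable fun n => ∑' W : {W : List β // W.length = n}, ‖T W.1‖ := hsig.sigma
  constructor
  · refine ((summable_nat_add_iff 1).2 hnn).of_nonneg_of_le (fun _ => norm_nonneg _) fun n => ?_
    rw [ha, norm_div]
    refine (div_le_self (norm_nonneg _) ?_).trans (norm_tsum_le_tsum_norm (hn (n + 1)))
    rw [show ((n : ℂ) + 1) = ((n + 1 : ℕ) : ℂ) by push_cast; rfl, Complex.norm_natCast]
    exact_mod_cast Nat.succ_pos n
  · have h1 : HasSum (fun p : (n : ℕ) × {W : List β // W.length = n} =>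
        T p.2.1 / p.2.1.length) (∑' W : List β, T W / W.length) :=
      (Equiv.hasSum_iff (f := fun W : List β => T W / W.length)
        (Equiv.sigmaFiberEquiv (List.length (α := β)))).2 hF.hasSum
    have h2 := h1.sigma fun n => (h1.summable.sigma_factor n).hasSum
    have h3 := (hasSum_nat_add_iff' 1).2 h2
    have h4 : ∑' W : {W : List β // W.length = 0}, T W.1 / W.1.length = 0 := by
      refine (tsum_congr fun W => ?_).trans tsum_zero
      rw [List.length_eq_zero_iff.1 W.2, hT, zero_div]
    rw [sum_range_one, h4, sub_zero] at h3; rw [← h3.tsum_eq]; refine tsum_congr fun n => ?_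
    rw [ha, ← tsum_div_const]; refine tsum_congr fun W => ?_; rw [W.2]; push_cast
    rfl

end Abstract

section WordTrace

variable {V : Type*} [NormedAddCommGroup V] [InnerProductSpace ℂ V]
  {c r : Fin 3 → ℝ} {q : ℕ} {ρ : ℝ} (hq : 3 ≤ q) (η : Lam q →* (V ≃ₗᵢ[ℂ] V))
  (h : AdmissibleDiscs q c r) (hρ : IsContraction q c r ρ) {s : ℂ}

open Classical in
/-- The trace of the operator of a list of blocks. -/
def wordTrace (s : ℂ) (W : List (Blk q)) : ℂ :=
  if ClosedWord W then LinearMap.trace ℂ V ((η (wordElt W)).toLinearEquiv : V →ₗ[ℂ] V) *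
    ((hypNorm (wordElt W : PSLR) : ℂ) ^ (-s) / (1 - ((hypNorm (wordElt W : PSLR))⁻¹ : ℝ))) else 0

theorem wordTrace_nil : wordTrace η s ([] : List (Blk q)) = 0 := if_neg fun h => h.1 rfl

variable [FiniteDimensional ℂ V] [CompleteSpace V]

theorem norm_wordOp_vecB_le {B : Blk q → ℝ} (hB0 : ∀ b, 0 ≤ B b)
    (hB : ∀ i b, Blk.Ok i b → ∀ z ∈ 𝔻(c i, r i), ‖jfac s b.mat z‖ ≤ B b) {W : List (Blk q)}
    (hW : W ≠ []) (j : Idx V) : ‖wordOp hq η h hρ s W (vecB c r j)‖ ≤ (W.map B).prod * ρ ^ j.1 := by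
  have hp := hρ.pos.le; induction W with
  | nil => exact absurd rfl hW
  | cons b W ih =>
    rw [List.map_cons, List.prod_cons]; by_cases hW' : W = []
    · subst hW'
      rw [wordOp, List.map_cons, map_nil, List.prod_singleton, map_nil, prod_nil, mul_one]
      refine norm_blockOp_apply_le hq η h hρ s (mul_nonneg (hB0 b) (pow_nonneg hp _)) b _
        fun i z hz => ?_
      rw [blockFun]
      split_ifs with hb
      · have hm := (Blk.mapsInto hq h hρ hb z hz).2; rw [norm_smul, LinearIsometryEquiv.norm_map]
        refine mul_le_mul (hB i b hb z hz) ?_ (norm_nonneg _) (hB0 b)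
        rw [ext0_apply _ (ball_subset_closedBall (closedBall_mul_subset h hρ _ hm)),
          vecB_apply]
        split_ifs
        · rw [norm_smul, OrthonormalBasis.norm_eq_one, mul_one, norm_pow]
          exact pow_le_pow_left₀ (norm_nonneg _) (norm_div_le_of_mem (h.radius_pos _) hm) _
        · rw [norm_zero]; exact pow_nonneg hp _
      · rw [norm_zero]; exact mul_nonneg (hB0 b) (pow_nonneg hp _)
    · have h1 := ih hW'; have h2 : 0 ≤ (W.map B).prod * ρ ^ j.1 := (norm_nonneg _).trans h1
      rw [mul_assoc]
      refine norm_blockOp_apply_le hq η h hρ s (mul_nonneg (hB0 b) h2) b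
        (wordOp hq η h hρ s W (vecB c r j)) fun i z hz => ?_
      exact (blockFun_bound η s hB0 hB b _ i hz).trans (mul_le_mul_of_nonneg_left h1 (hB0 b))

theorem inv_cpow_of_pos {x : ℝ} (hx : 0 < x) (s : ℂ) : ((x : ℂ)⁻¹) ^ s = (x : ℂ) ^ (-s) := by
  rw [inv_cpow _ _ (by rw [arg_ofReal_of_nonneg hx.le]; exact pi_pos.ne),
    cpow_neg]

theorem tsum_coeffB_wordOp (hs : 1 / 2 < s.re) {W : List (Blk q)} (hW : W ≠ []) :
    ∑' j, coeffB h.radius_pos j (wordOp hq η h hρ s W (vecB c r j)) = wordTrace η s W := by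
  obtain ⟨B, hB0, hBs, hB⟩ := Blk.exists_summable_bound hq h hs; have hr := h.radius_pos
  have hsum : Summable fun j : Idx V => coeffB h.radius_pos j (wordOp hq η h hρ s W (vecB c r j)) :=
    Summable.of_norm_bounded ((summable_pow_deg hρ.pos.le hρ.lt_one).mul_left (W.map B).prod)
      fun j => (norm_coeffB_apply_le hr j _).trans (norm_wordOp_vecB_le hq η h hρ hB0 hB hW j)
  set i₀ := endCol 0 W with hi₀; have hend : ∀ i, endCol i W = i₀ := fun i => endCol_eq hW i 0
  have hzero : ∀ (m : ℕ) (i : Fin 3) (l : Fin (finrank ℂ V)), (¬ i = i₀ ∨ ¬ Adm i W) →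
      coeffB hr (m, i, l) (wordOp hq η h hρ s W (vecB c r (m, i, l))) = 0 := by
    intro m i l hil
    have e : wordOp hq η h hρ s W (vecB c r (m, i, l)) i = 0 := by
      refine discSpace_ext fun z => ?_; rw [wordOp_apply]
      split_ifs with ha
      · have hi : i ≠ i₀ := hil.resolve_right (not_not.2 ha)
        have e1 : vecB c r ((m, i, l) : Idx V) (endCol i W) = 0 :=
          Pi.single_eq_of_ne (by rw [hend]; exact hi.symm) _
        simp [e1, ext0]
      · rfl
    rw [coeffB_apply]; dsimp only; rw [e, map_zero, inner_zero_right]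
  by_cases hc : ClosedWord W
  · rw [wordTrace, if_pos hc]; obtain ⟨x, D, hx, -, hN⟩ := hc.exists_isAttracting hq h hρ
    have hm := mapsInto_wordMat hq h hρ hW hc.2; rw [hend i₀] at hm
    have htr := hasSum_circleIntegral_pow (hr i₀) hρ.pos.le hρ.lt_one hm hx
      (differentiableOn_wordFac hq h hρ s hc.2)
    set t : ℕ → ℂ := fun m => (2 * π * Complex.I : ℂ)⁻¹ * ∮ z in C(c i₀, r i₀),
      ((r i₀ : ℂ) / (z - c i₀)) ^ m * ((z - c i₀)⁻¹ *
        (wordFac s W z * ((moebius (wordMat W) z - c i₀) / r i₀) ^ m)) with ht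
    have hval : ∀ (m : ℕ) (i : Fin 3) (l : Fin (finrank ℂ V)),
        coeffB hr (m, i, l) (wordOp hq η h hρ s W (vecB c r (m, i, l)))
          = t m * (if i = i₀ then inner ℂ (𝔟 V l) (η (wordElt W) (𝔟 V l)) else 0) := by
      intro m i l; by_cases hi : i = i₀
      · subst hi; rw [if_pos rfl, coeffB_apply]; dsimp only
        rw [taylor_toDisc_smul (hr i₀) m
          (φ := fun z => wordFac s W z * ((moebius (wordMat W) z - c i₀) / r i₀) ^ m)
          (v := η (wordElt W) (𝔟 V l)), inner_smul_right]
        intro z; have hmz := (hm z z.2).2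
        rw [wordOp_apply, if_pos hc.2, hend i₀, ext0_apply _
          (ball_subset_closedBall (closedBall_mul_subset h hρ _ hmz)), vecB_apply,
          if_pos rfl, map_smul, smul_smul]
      · rw [hzero m i l (Or.inl hi), if_neg hi, mul_zero]
    rw [hsum.tsum_prod]
    have hinner : ∀ m : ℕ, ∑' p : Fin 3 × Fin (finrank ℂ V),
        coeffB hr (m, p) (wordOp hq η h hρ s W (vecB c r (m, p)))
          = t m * LinearMap.trace ℂ V ((η (wordElt W)).toLinearEquiv : V →ₗ[ℂ] V) := by
      intro m; rw [tsum_fintype, sum_prod_type]; simp only [hval]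
      rw [trace_eq_sum_inner _ (𝔟 V), mul_sum,
        Finset.sum_eq_single i₀ (fun i _ hi => by simp [hi]) (by simp)]
      simp
    simp only [hinner]; rw [tsum_mul_right, htr.tsum_eq, mul_comm, hN]; congr 2
    have hxb : (x : ℂ) ∈ 𝔻(c i₀, r i₀) :=
      ball_subset_closedBall (closedBall_mul_subset h hρ _ hx.mem)
    rw [wordFac_ofReal hq h hρ s hc.2 hxb, jfac, hx.denom_eq, ← ofReal_pow,
      inv_cpow_of_pos (by linarith [hx.one_lt])]
  · rw [wordTrace, if_neg hc]; refine (tsum_congr fun j => ?_).trans tsum_zero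
    obtain ⟨m, i, l⟩ := j; refine hzero m i l ?_; by_contra hcon
    push Not at hcon
    exact hc ⟨hW, by rw [← hi₀, ← hcon.1]; exact hcon.2⟩

theorem hasSum_wordOp (hs : 1 / 2 < s.re) (n : ℕ) :
    HasSum (fun W : {W : List (Blk q) // W.length = n} => wordOp hq η h hρ s W.1)
    (transferOp hq η h hρ s ^ n) := by
  rw [← tsum_blockOp hq η h hρ hs]
  exact hasSum_operator_words (summable_norm_blockOp hq η h hρ hs) n

theorem tsum_fpow_transferMat (hs : 1 / 2 < s.re) (n : ℕ) :
    ∑' i, fpow (transferMat hq η h hρ s) n i i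
    = ∑' W : {W : List (Blk q) // W.length = n + 1}, wordTrace η s W.1 := by
  obtain ⟨B, hB0, hBs, hB⟩ := Blk.exists_summable_bound hq h hs; have hr := h.radius_pos
  have hne : ∀ W : {W : List (Blk q) // W.length = n + 1}, W.1 ≠ [] := fun W =>
    ne_nil_of_length_eq_add_one W.2
  have hw0 : ∀ W : {W : List (Blk q) // W.length = n + 1}, 0 ≤ (W.1.map B).prod := by
    intro W; refine List.prod_nonneg ?_
    simp only [List.mem_map, forall_exists_index, and_imp, forall_apply_eq_imp_iff₂]
    exact fun b _ => hB0 b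
  rw [tsum_congr fun i => fpow_transferMat hq η h hρ hs n i i]
  rw [tsum_apply_comm (hasSum_wordOp hq η h hρ hs (n + 1)) (coeffB hr) (vecB c r)
    (summable_pow_deg hρ.pos.le hρ.lt_one) (summable_words hB0 hBs (n + 1))
    (fun j => pow_nonneg hρ.pos.le _) hw0 fun i W => (norm_coeffB_apply_le hr _ _).trans
      (norm_wordOp_vecB_le hq η h hρ hB0 hB (hne W) i)]
  exact tsum_congr fun W => tsum_coeffB_wordOp hq η h hρ hs (hne W)

theorem fredholmDet_eq_exp_tsum (hs : 1 / 2 < s.re)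
    (hsum : Summable fun W : List (Blk q) => ‖wordTrace η s W‖) :
    fredholmDet (transferOp hq η h hρ s)
    = Complex.exp (-∑' W : List (Blk q), wordTrace η s W / W.length) := by
  obtain ⟨C, hC, H⟩ := exists_bound_transferOp_vecB hq η h hρ hs
  obtain ⟨h1, h2⟩ := tsum_words_div_length (T := wordTrace η s)
    (a := fun n => ∑' i, fpow (transferMat hq η h hρ s) n i i) (wordTrace_nil η) hsum
    (tsum_fpow_transferMat hq η h hρ hs)
  have h3 := fdet_eq_exp (M := transferMat hq η h hρ s) (b := fun j : Idx V => C * ρ ^ j.1)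
    (fun j => mul_nonneg hC (pow_nonneg hρ.pos.le _)) (summable_sqrt_pow hC hρ)
    (norm_transferMat_le hq η h hρ H) h1
  rw [fredholmDet_transferOp hq η h hρ hs, h3, h2]

end WordTrace

/-! ### Convergence of the sum over closed words -/

section Potential

variable {q : ℕ}

/-- The action of a block in the homogeneous coordinates `(1 + z, 1 - z)`. -/
def Blk.vec (b : Blk q) (v : ℝ × ℝ) : ℝ × ℝ :=
  if b.col = 1 then (sq q (b.1.2 + 2) * v.1 + sq q (b.1.2 + 3) * v.2,
    sq q (b.1.2 + 1) * v.1 + sq q (b.1.2 + 2) * v.2)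
  else (1 * v.1 + (1 + sgn b.col) / 2 * ((b.1.2 + 1 : ℕ) * lam q) * v.2,
    (1 - sgn b.col) / 2 * ((b.1.2 + 1 : ℕ) * lam q) * v.1 + 1 * v.2)

theorem Blk.isConj_mat (hq : 3 ≤ q) (b : Blk q) : ∃ α β γ δ : ℝ, IsConj b.mat α β γ δ ∧
    ∀ v, b.vec v = (α * v.1 + β * v.2, γ * v.1 + δ * v.2) := by
  by_cases h1 : b.col = 1
  · refine ⟨_, _, _, _, ?_, fun v => if_pos h1⟩; rw [mat, idx, exp, if_pos h1, if_pos h1, pow_one]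
    exact isConj_matH_inv hq _
  · refine ⟨_, _, _, _, ?_, fun v => if_neg h1⟩; rw [mat, idx, exp, if_neg h1, if_neg h1]
    exact isConj_parIdx hq h1 _

theorem IsConj.mul {A B : SL(2, ℝ)} {a b c d a' b' c' d' : ℝ} (hA : IsConj A a b c d)
    (hB : IsConj B a' b' c' d') : IsConj (A * B) (a * a' + b * c') (a * b' + b * d')
    (c * a' + d * c') (c * b' + d * d') := by
  obtain ⟨σ, hσ, h1, h2, h3, h4⟩ := hA; obtain ⟨τ, hτ, k1, k2, k3, k4⟩ := hB
  refine ⟨σ * τ, by linear_combination (τ * τ) * hσ + hτ, ?_, ?_, ?_, ?_⟩ <;>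
  · simp only [sl_mul_apply, h1, h2, h3,
      h4, k1, k2, k3, k4]
    ring

/-- The action of a list of blocks in homogeneous coordinates. -/
def wordVec : List (Blk q) → ℝ × ℝ → ℝ × ℝ
  | [], v => v
  | b :: W, v => wordVec W (b.vec v)

theorem isConj_wordMat (hq : 3 ≤ q) (W : List (Blk q)) : ∃ α β γ δ : ℝ,
    IsConj (wordMat W) α β γ δ ∧ ∀ v, wordVec W v = (α * v.1 + β * v.2, γ * v.1 + δ * v.2) := by
  induction W with
  | nil => exact ⟨1, 0, 0, 1, ⟨1, by norm_num, by simp [wordMat], by simp [wordMat],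
      by simp [wordMat], by simp [wordMat]⟩, fun v => by simp [wordVec]⟩
  | cons b W ih =>
    obtain ⟨α, β, γ, δ, h1, h2⟩ := ih; obtain ⟨α', β', γ', δ', h3, h4⟩ := b.isConj_mat hq
    refine ⟨_, _, _, _, h1.mul h3, fun v => ?_⟩; rw [wordVec, h2, h4]; ext <;> simp only <;> ring

theorem sq_denom_wordMat (hq : 3 ≤ q) (W : List (Blk q)) (t : ℝ) :
    (wordMat W 1 0 * t + wordMat W 1 1) ^ 2
    = ((wordVec W (1 + t, 1 - t)).1 + (wordVec W (1 + t, 1 - t)).2) ^ 2 / 4 := by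
  obtain ⟨α, β, γ, δ, ⟨σ, hσ, -, -, h1, h2⟩, h3⟩ := isConj_wordMat hq W; rw [h3, h1, h2]
  linear_combination ((α + γ) * (1 + t) + (β + δ) * (1 - t)) ^ 2 / 4 * hσ

/-- The invariant densities, in homogeneous coordinates. -/
def pot (q : ℕ) (j : Fin 3) (v : ℝ × ℝ) : ℝ :=
  ![lam q / (v.1 * (v.1 + lam q * v.2)), 1 / (v.1 * v.2), lam q / (v.2 * (lam q * v.1 + v.2))] j

/-- The densities at the images under the blocks of a column. -/
def colPot (q : ℕ) (P Q : ℝ) (j : Fin 3) (n : ℕ) : ℝ :=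
  ![lam q / ((P + (n + 1) * lam q * Q) * (P + (n + 2) * lam q * Q)),
    1 / ((sq q (n + 2) * P + sq q (n + 3) * Q) * (sq q (n + 1) * P + sq q (n + 2) * Q)),
    lam q / (((n + 1) * lam q * P + Q) * ((n + 2) * lam q * P + Q))] j

theorem pot_vec (b : Blk q) (P Q : ℝ) : pot q b.col (b.vec (P, Q)) = colPot q P Q b.1.1 b.1.2 := by
  obtain ⟨⟨j, n⟩, hb⟩ := b
  fin_cases j
  · simp [pot, colPot, Blk.vec, Blk.col, sgn]; ring
  · simp [pot, colPot, Blk.vec, Blk.col]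
  · simp [pot, colPot, Blk.vec, Blk.col, sgn]; ring

variable {P Q : ℝ}

theorem one_le_sq (hq : 3 ≤ q) {k : ℕ} (hk : k + 2 ≤ q) : 1 ≤ sq q (k + 1) := by
  have h1 := sq_mul_self hq k; have h2 := sq_nonneg' hq hk
  have h3 := sq_nonneg' hq (show k ≤ q by omega)
  have h4 := sq_pos hq (show 0 < k + 1 by omega) (by omega)
  nlinarith [mul_nonneg h2 h3]

theorem Blk.vec_pos (hq : 3 ≤ q) (b : Blk q) {v : ℝ × ℝ} (hv : 0 < v.1 ∧ 0 < v.2) :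
    0 < (b.vec v).1 ∧ 0 < (b.vec v).2 := by
  obtain ⟨hP, hQ⟩ := hv; have hl := one_le_lam hq; rw [vec]
  split_ifs with h1
  · have h4 := b.2 h1; have e1 := one_le_sq hq (k := b.1.2) (by omega)
    have e2 := one_le_sq hq (k := b.1.2 + 1) (by omega)
    have e3 := one_le_sq hq (k := b.1.2 + 2) (by omega)
    constructor <;> simp only <;> positivity
  · have h5 : 0 ≤ (1 + sgn b.col) / 2 := by generalize b.col = j; fin_cases j <;> simp [sgn]
    have h6 : 0 ≤ (1 - sgn b.col) / 2 := by generalize b.col = j; fin_cases j <;> simp [sgn]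
    constructor <;> simp only <;> positivity

theorem inv_sq_le_pot (hq : 3 ≤ q) (j : Fin 3) {v : ℝ × ℝ} (hv : 0 < v.1 ∧ 0 < v.2) :
    1 / (v.1 + v.2) ^ 2 ≤ pot q j v := by
  obtain ⟨hP, hQ⟩ := hv; have hl := one_le_lam hq; have hl2 := lam_lt_two hq
  have hPQ := mul_pos hP hQ
  fin_cases j <;> simp only [pot] <;> simp
  · rw [← one_div, div_le_div_iff₀ (by positivity) (by positivity)]; nlinarith
  · rw [← mul_inv]; exact inv_anti₀ (by positivity) (by nlinarith)
  · rw [← one_div, div_le_div_iff₀ (by positivity) (by positivity)]; nlinarith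

/-- Each block takes at most half of the density. -/
theorem colPot_le (hq : 3 ≤ q) (hP : 0 < P) (hQ : 0 < Q) {i j : Fin 3} (hij : i = j → i = 1) {n : ℕ}
    (hn : j = 1 → n + 4 ≤ q) : colPot q P Q j n ≤ pot q i (P, Q) / 2 := by
  have hl := one_le_lam hq; have hl0 : 0 < lam q := by linarith
  have hPQ := mul_pos hP hQ; have hn0 : (0 : ℝ) ≤ n := Nat.cast_nonneg n
  have a : ∀ {P Q : ℝ}, 0 < P → 0 < Q → 2 * lam q * (P * Q) + 2 * lam q ^ 2 * Q ^ 2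
      ≤ (P + (n + 1) * lam q * Q) * (P + (n + 2) * lam q * Q) := fun {P Q} hP hQ => by
    have b1 : 0 ≤ (2 * n + 1) * lam q * (P * Q) := by positivity
    have b2 : 0 ≤ (n ^ 2 + 3 * n) * lam q ^ 2 * Q ^ 2 := by positivity
    linarith [_root_.sq_nonneg P]
  have a1 := a hP hQ; have a2 := a hQ hP; have hl2 : 1 ≤ lam q ^ 2 := by nlinarith
  have c1 : Q ^ 2 ≤ lam q ^ 2 * Q ^ 2 := le_mul_of_one_le_left (by positivity) hl2
  have c2 : P ^ 2 ≤ lam q ^ 2 * P ^ 2 := le_mul_of_one_le_left (by positivity) hl2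
  set M := (sq q (n + 2) * P + sq q (n + 3) * Q) * (sq q (n + 1) * P + sq q (n + 2) * Q) with hM
  have mid : n + 4 ≤ q → 3 * (P * Q) ≤ M ∧
      2 * P ^ 2 + 3 * lam q * (P * Q) + 2 * Q ^ 2 ≤ lam q * M := by
    rw [hM]; intro h4; have e1 := one_le_sq hq (k := n) (by omega)
    have e2 := one_le_sq hq (k := n + 1) (by omega)
    have e3 := one_le_sq hq (k := n + 2) (by omega)
    have e4 := sq_mul_self hq (n + 1); have e5 := sq_add (q := q) (n + 1)
    simp only [add_assoc] at e2 e3 e4 e5; norm_num at e2 e3 e4 e5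
    generalize sq q (n + 1) = a at *
    generalize sq q (n + 2) = b at *
    generalize sq q (n + 3) = c at *
    have e9 := mul_le_mul_of_nonneg_right (show 3 ≤ b * b + c * a by nlinarith) hPQ.le
    constructor
    · have f1 : 0 ≤ b * a * P ^ 2 := by positivity
      have f2 : 0 ≤ b * c * Q ^ 2 := by positivity
      linarith
    · have g1 : 2 ≤ lam q * (b * a) := by rw [← mul_assoc, ← e5]; nlinarith
      have g2 : 2 ≤ lam q * (b * c) := by rw [← mul_assoc, ← e5]; nlinarith
      have g3 := mul_le_mul_of_nonneg_right g1 (_root_.sq_nonneg P)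
      have g4 := mul_le_mul_of_nonneg_right g2 (_root_.sq_nonneg Q)
      have g5 := mul_le_mul_of_nonneg_left e9 hl0.le; linarith
  have pos0 : 0 < (P + (n + 1) * lam q * Q) * (P + (n + 2) * lam q * Q) := by positivity
  have pos2 : 0 < ((n + 1) * lam q * P + Q) * ((n + 2) * lam q * P + Q) := by positivity
  have key : ∀ {a X Y b : ℝ}, 0 < X → 0 < Y → a * (2 * Y) ≤ b * X → a / X ≤ b / Y / 2 := by
    intro a X Y b hX hY hab; rw [div_div, div_le_div_iff₀ hX (by positivity)]
    linarith
  have hP2 : 0 < P * (P + lam q * Q) := by positivity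
  have hQ2 : 0 < Q * (lam q * P + Q) := by positivity
  fin_cases j <;> fin_cases i <;> simp [pot, colPot] at hij hn ⊢
  · rw [← one_div, ← one_div, div_mul_div_comm, one_mul, mul_comm Q P]
    exact key pos0 hPQ (by nlinarith [mul_nonneg hl0.le (_root_.sq_nonneg Q)])
  · exact key pos0 hQ2 (by nlinarith)
  · have hm := mid hn; rw [← mul_inv, mul_comm (sq q (n + 1) * P + _), ← one_div]
    exact key (by linarith) hP2 (by nlinarith [mid hn])
  · have hm := mid hn
    rw [← mul_inv, ← mul_inv, mul_comm (sq q (n + 1) * P + _), mul_comm Q P, ← one_div, ← one_div]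
    exact key (by linarith) hPQ (by linarith)
  · have hm := mid hn; rw [← mul_inv, mul_comm (sq q (n + 1) * P + _), ← one_div]
    exact key (by linarith) hQ2 (by nlinarith [mid hn])
  · exact key pos2 hP2 (by nlinarith)
  · rw [← one_div, ← one_div, div_mul_div_comm, one_mul, mul_comm Q P]
    exact key pos2 hPQ (by nlinarith [mul_nonneg hl0.le (_root_.sq_nonneg P)])

theorem tsum_telescope_le {f : ℕ → ℝ} (hf : ∀ n, 0 ≤ f n) (hle : ∀ n, f (n + 1) ≤ f n) :
    ∑' n, ENNReal.ofReal (f n - f (n + 1)) ≤ ENNReal.ofReal (f 0) := by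
  refine ENNReal.tsum_le_of_sum_range_le fun n => ?_
  rw [← ENNReal.ofReal_sum_of_nonneg fun i _ => sub_nonneg.2 (hle i), Finset.sum_range_sub']
  exact ENNReal.ofReal_le_ofReal (by linarith [hf n])

/-- The sums of the densities over the columns. -/
def colSum (q : ℕ) (P Q : ℝ) (j : Fin 3) : ℝ :=
  ![1 / (Q * (P + lam q * Q)), lam q / (Q * (lam q * P + Q)) - 1 / (Q * (P + lam q * Q)),
    1 / (P * (lam q * P + Q))] j

theorem tsum_outer_le {l P Q : ℝ} (hl : 0 < l) (hP : 0 < P) (hQ : 0 < Q) :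
    ∑' n : ℕ, ENNReal.ofReal (l / ((P + (n + 1) * l * Q) * (P + (n + 2) * l * Q)))
    ≤ ENNReal.ofReal (1 / (Q * (P + l * Q))) := by
  have hpos : ∀ n : ℕ, 0 < P + (n + 1) * l * Q := fun n => by positivity
  have e : ∀ n : ℕ, l / ((P + (n + 1) * l * Q) * (P + (n + 2) * l * Q))
      = 1 / (Q * (P + (n + 1) * l * Q)) - 1 / (Q * (P + ((n + 1 : ℕ) + 1) * l * Q)) := by
    intro n; have h1 := (hpos n).ne'; have h2 := (hpos (n + 1)).ne'
    have h3 : P + (n + 2) * l * Q ≠ 0 := by positivity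
    push_cast at h2 ⊢; rw [show (n : ℝ) + 1 + 1 = n + 2 by ring] at h2 ⊢
    field_simp; ring
  simp only [e]
  refine (tsum_telescope_le (f := fun n => 1 / (Q * (P + ((n : ℕ) + 1) * l * Q))) (fun n => ?_)
    fun n => ?_).trans (by simp)
  · have := hpos n; positivity
  · rw [← sub_nonneg, ← e]; positivity

theorem tsum_colPot_le (hq : 3 ≤ q) (hP : 0 < P) (hQ : 0 < Q) (j : Fin 3) : 0 ≤ colSum q P Q j ∧
    ∑' n : ℕ, (if j = 1 → n + 4 ≤ q then ENNReal.ofReal (colPot q P Q j n) else 0)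
    ≤ ENNReal.ofReal (colSum q P Q j) := by
  have hl := one_le_lam hq; have hl0 : 0 < lam q := by linarith
  fin_cases j
  · simp only [colSum, colPot]
    simp only [Fin.zero_eta, Fin.isValue, zero_ne_one, IsEmpty.forall_iff, if_true,
      cons_val_zero]
    exact ⟨by positivity, tsum_outer_le hl0 hP hQ⟩
  · have hS : 0 ≤ colSum q P Q 1 := by
      simp only [colSum, cons_val_one, cons_val_zero]
      rw [sub_nonneg, div_le_div_iff₀ (by positivity) (by positivity)]
      have h1 : Q ≤ lam q ^ 2 * Q := le_mul_of_one_le_left hQ.le (by nlinarith)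
      nlinarith
    refine ⟨hS, ?_⟩
    set τ : ℕ → ℝ := fun k => sq q k / (Q * (sq q k * P + sq q (k + 1) * Q)) with hτ
    have hpos : ∀ k, k + 2 ≤ q → 0 < sq q (k + 1) * P + sq q (k + 2) * Q := by
      intro k hk; have := one_le_sq hq hk; have := sq_nonneg' hq hk; positivity
    have e : ∀ n, n + 4 ≤ q → colPot q P Q 1 n = τ (n + 2) - τ (n + 1) := by
      intro n hn; have h1 := (hpos n (by omega)).ne'
      have h2 := (hpos (n + 1) (by omega)).ne'
      have h3 := sq_mul_self hq (n + 1); simp only [add_assoc] at h2 h3; norm_num at h2 h3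
      replace h2 : sq q (n + 2) * P + sq q (n + 3) * Q ≠ 0 := h2
      simp only [colPot, hτ, cons_val_one, cons_val_zero, add_assoc]; norm_num
      generalize sq q (n + 1) = a at *
      generalize sq q (n + 2) = b at *
      generalize sq q (n + 3) = c at *
      rw [← mul_inv, ← one_div, div_sub_div _ _ (by positivity) (by positivity),
        div_eq_div_iff (by positivity) (by positivity)]
      linear_combination (-(Q ^ 2 * (b * P + c * Q) * (a * P + b * Q))) * h3
    have h0 : ∀ n ∉ Finset.range (q - 3), (if (1 : Fin 3) = 1 → n + 4 ≤ q then
        ENNReal.ofReal (colPot q P Q 1 n) else 0) = 0 := by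
      intro n hn; rw [Finset.mem_range] at hn; exact if_neg fun h => by have := h rfl; omega
    change ∑' n : ℕ, (if (1 : Fin 3) = 1 → n + 4 ≤ q then
        ENNReal.ofReal (colPot q P Q 1 n) else 0) ≤ _
    rw [tsum_eq_sum h0]
    have h1 : ∑ n ∈ Finset.range (q - 3), (if (1 : Fin 3) = 1 → n + 4 ≤ q then
        ENNReal.ofReal (colPot q P Q 1 n) else 0)
        = ENNReal.ofReal (∑ n ∈ Finset.range (q - 3), (τ (n + 1 + 1) - τ (n + 1))) := by
      rw [ENNReal.ofReal_sum_of_nonneg]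
      · refine Finset.sum_congr rfl fun n hn => ?_; rw [Finset.mem_range] at hn
        rw [if_pos (fun _ => by omega), e n (by omega)]
      · intro n hn; rw [Finset.mem_range] at hn; rw [← e n (by omega)]
        have h2 := hpos n (by omega)
        have h3 := hpos (n + 1) (by omega)
        simp only [colPot, cons_val_one, cons_val_zero]; positivity
    rw [h1, Finset.sum_range_sub (fun n => τ (n + 1))]
    refine ENNReal.ofReal_le_ofReal (le_of_eq ?_); have h5 : q - 3 + 1 = q - 2 := by omega
    have h6 : q - 2 + 1 = q - 1 := by omega
    simp only [hτ, colSum, h5, h6, sq_sub hq (show 2 ≤ q by omega), sq_sub hq (show 1 ≤ q by omega)]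
    norm_num; rw [sq_one hq, sq_two hq]; norm_num
  · have := tsum_outer_le hl0 hQ hP; simp only [colSum, colPot]
    simp only [Fin.reduceFinMk, Fin.isValue, Fin.reduceEq, IsEmpty.forall_iff, if_true,
      Matrix.cons_val]
    refine ⟨by positivity, ?_⟩
    convert this using 4
    · ring
    · ring

open Classical in
theorem tsum_pot_le (hq : 3 ≤ q) (hP : 0 < P) (hQ : 0 < Q) (i : Fin 3) :
    ∑' b : Blk q, (if b.Ok i then ENNReal.ofReal (pot q b.col (b.vec (P, Q))) else 0)
    ≤ ENNReal.ofReal (pot q i (P, Q)) := by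
  have hl0 : 0 < lam q := by linarith [one_le_lam hq]
  set F : Fin 3 × ℕ → ENNReal := fun p => if i = p.1 → i = 1 then
    (if p.1 = 1 → p.2 + 4 ≤ q then ENNReal.ofReal (colPot q P Q p.1 p.2) else 0) else 0 with hF
  have h1 : ∀ b : Blk q, (if b.Ok i then ENNReal.ofReal (pot q b.col (b.vec (P, Q))) else 0)
      = F b.1 := by
    intro b; simp only [hF, Blk.Ok, pot_vec]; rw [if_pos b.2]
    rfl
  simp only [h1]; refine (ENNReal.tsum_comp_le_tsum_of_injective Subtype.val_injective F).trans ?_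
  rw [show ∑' y, F y = ∑' j, ∑' n, F (j, n) from ENNReal.tsum_prod (f := fun j n => F (j, n)),
    tsum_fintype]
  have h2 : ∀ j, ∑' n : ℕ, F (j, n)
      ≤ ENNReal.ofReal (if i = j → i = 1 then colSum q P Q j else 0) := by
    intro j; simp only [hF]
    split_ifs with hij
    · exact (tsum_colPot_le hq hP hQ j).2
    · simp
  refine (Finset.sum_le_sum fun j _ => h2 j).trans ?_
  rw [← ENNReal.ofReal_sum_of_nonneg fun j _ => by
    split_ifs; exacts [(tsum_colPot_le hq hP hQ j).1, le_rfl], Fin.sum_univ_three]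
  refine ENNReal.ofReal_le_ofReal (le_of_eq ?_)
  fin_cases i <;> simp [colSum, pot] <;> field_simp <;> ring

end Potential

section Convergence

open scoped ENNReal

variable {q : ℕ}

open Classical in
theorem tsum_pot_rpow_le (hq : 3 ≤ q) {v : ℝ × ℝ} (hv : 0 < v.1 ∧ 0 < v.2) (i : Fin 3) {σ : ℝ}
    (hσ : 1 < σ) : ∑' b : Blk q, (if b.Ok i then ENNReal.ofReal (pot q b.col (b.vec v)) ^ σ else 0)
    ≤ 2⁻¹ ^ (σ - 1) * ENNReal.ofReal (pot q i v) ^ σ := by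
  have hσ' : 0 ≤ σ - 1 := by linarith
  have hs : ∀ x : ℝ≥0∞, x ^ σ = x * x ^ (σ - 1) := fun x => by
    rw [← add_sub_cancel 1 σ, ENNReal.rpow_add_of_nonneg _ _ zero_le_one hσ', ENNReal.rpow_one,
      add_sub_cancel]
  calc _ ≤ ∑' b : Blk q, (if b.Ok i then ENNReal.ofReal (pot q b.col (b.vec v)) else 0) *
        (2⁻¹ * ENNReal.ofReal (pot q i v)) ^ (σ - 1) := by
        refine ENNReal.tsum_le_tsum fun b => ?_
        split_ifs with hb
        · rw [hs]; gcongr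
          rw [pot_vec, ← ENNReal.ofReal_ofNat, ← ENNReal.ofReal_inv_of_pos (by norm_num),
            ← ENNReal.ofReal_mul (by norm_num)]
          refine ENNReal.ofReal_le_ofReal ((colPot_le hq hv.1 hv.2 hb b.2).trans (le_of_eq ?_))
          ring
        · simp
    _ ≤ _ := by
        rw [ENNReal.tsum_mul_right, ENNReal.mul_rpow_of_nonneg _ _ hσ', hs, mul_left_comm]; gcongr
        exact tsum_pot_le hq hv.1 hv.2 i

open Classical in
theorem tsum_words_pot_le (hq : 3 ≤ q) {σ : ℝ} (hσ : 1 < σ) (n : ℕ) : ∀ {v : ℝ × ℝ}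
    (_ : 0 < v.1 ∧ 0 < v.2) (i : Fin 3), ∑' W : {W : List (Blk q) // W.length = n},
    (if Adm i W.1 then ENNReal.ofReal (pot q (endCol i W.1) (wordVec W.1 v)) ^ σ else 0)
    ≤ (2⁻¹ ^ (σ - 1)) ^ n * ENNReal.ofReal (pot q i v) ^ σ := by
  induction n with
  | zero =>
    intro v hv i
    rw [tsum_eq_single (⟨[], rfl⟩ : {W : List (Blk q) // W.length = 0}) fun W hW => absurd
      (Subtype.ext (List.length_eq_zero_iff.1 W.2)) hW]
    simp [Adm, endCol, wordVec]
  | succ n ih =>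
    intro v hv i; rw [← (consEquiv (Blk q) n).tsum_eq, ENNReal.tsum_prod']
    calc _ ≤ ∑' b : Blk q, (2⁻¹ ^ (σ - 1)) ^ n *
          (if b.Ok i then ENNReal.ofReal (pot q b.col (b.vec v)) ^ σ else 0) := by
          refine ENNReal.tsum_le_tsum fun b => ?_
          split_ifs with hb
          · refine le_trans (le_of_eq (tsum_congr fun W => ?_)) (ih (b.vec_pos hq hv) b.col)
            simp only [coe_consEquiv, Adm, hb, true_and, endCol, wordVec]
          · simp [coe_consEquiv, Adm, hb]
      _ ≤ _ := by
          rw [ENNReal.tsum_mul_left, pow_succ, mul_assoc]; gcongr; exact tsum_pot_rpow_le hq hv i hσ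

variable {c r : Fin 3 → ℝ} {ρ : ℝ}

theorem AdmissibleDiscs.exists_base (h : AdmissibleDiscs q c r) (hq : 3 ≤ q) (i : Fin 3) :
    ∃ t : ℝ, (-1 < t ∧ t < 1) ∧ |t - c i| ≤ r i := by
  have hl := one_le_lam hq
  have hμ : (lam q - 1) / (lam q + 1) < 1 := by rw [div_lt_one] <;> linarith
  have hμ' : 0 ≤ (lam q - 1) / (lam q + 1) := div_nonneg (by linarith) (by linarith)
  have key : ∀ (i : Fin 3) (x : ℝ), x ∈ closure (interval q i) → |x - c i| ≤ r i := fun i x hx => by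
    have := h.interval_subset i x hx
    rw [disc, mem_ball, Complex.dist_eq, ← ofReal_sub, norm_real] at this; exact this.le
  fin_cases i
  · refine ⟨_, ⟨by linarith, hμ⟩, key 0 _ ?_⟩
    simp only [interval, cons_val_zero]; rw [closure_Ioo hμ.ne]; exact ⟨le_rfl, hμ.le⟩
  · refine ⟨c 1, ?_, by simpa using (h.radius_pos 1).le⟩
    simpa using h.re_mid (c 1) (by simpa [cdisc] using (h.radius_pos 1).le)
  · refine ⟨-((lam q - 1) / (lam q + 1)), ⟨by linarith, by linarith⟩, key 2 _ ?_⟩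
    simp only [interval, Matrix.cons_val]; rw [closure_Ioo (by linarith)]
    exact ⟨by linarith, le_rfl⟩

theorem wordVec_pos (hq : 3 ≤ q) (W : List (Blk q)) {v : ℝ × ℝ} (hv : 0 < v.1 ∧ 0 < v.2) :
    0 < (wordVec W v).1 ∧ 0 < (wordVec W v).2 := by
  induction W generalizing v with
  | nil => exact hv
  | cons b W ih => exact ih (b.vec_pos hq hv)

theorem summable_hypNorm_rpow (hq : 3 ≤ q) (h : AdmissibleDiscs q c r) (hρ : IsContraction q c r ρ)
    {σ : ℝ} (hσ : 1 < σ) : Summable fun W : {W : List (Blk q) // ClosedWord W} =>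
    ((hypNorm (wordElt W.1 : PSLR))⁻¹) ^ σ := by
  classical
  have hσ0 : 0 ≤ σ := by linarith
  choose t ht1 ht using h.exists_base hq; have hρ1 := hρ.lt_one
  set v : Fin 3 → ℝ × ℝ := fun i => (1 + t i, 1 - t i) with hv
  have hvpos : ∀ i, 0 < (v i).1 ∧ 0 < (v i).2 := fun i =>
    ⟨by linarith [(ht1 i).1], by linarith [(ht1 i).2]⟩
  set C : ℝ := 16 / (1 - ρ) ^ 2 with hC
  have hC0 : 0 < C := div_pos (by norm_num) (pow_pos (by linarith) 2)
  set G : Fin 3 → List (Blk q) → ℝ≥0∞ := fun i W =>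
    if Adm i W then ENNReal.ofReal (pot q (endCol i W) (wordVec W (v i))) ^ σ else 0 with hG
  have hle : ∀ W : {W : List (Blk q) // ClosedWord W},
      ENNReal.ofReal (((hypNorm (wordElt W.1 : PSLR))⁻¹) ^ σ)
        ≤ ENNReal.ofReal C ^ σ * ∑ i, G i W.1 := by
    rintro ⟨W, hW⟩; obtain ⟨x, D, hx, -, hN⟩ := hW.exists_isAttracting hq h hρ
    have h1 := hx.le_sq _ (ht _); have h2 := hx.one_lt; rw [sq_denom_wordMat hq] at h1
    have h3 := wordVec_pos hq W (hvpos (endCol 0 W)); have h4 := inv_sq_le_pot hq (endCol 0 W) h3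
    have h5 : (D ^ 2)⁻¹ ≤ C * pot q (endCol 0 W) (wordVec W (v (endCol 0 W))) := by
      refine le_trans ?_ (mul_le_mul_of_nonneg_left h4 hC0.le)
      have h6 : 0 < (1 - ρ) ^ 2 := pow_pos (by linarith) 2
      have h7 : 0 < ((wordVec W (v (endCol 0 W))).1 + (wordVec W (v (endCol 0 W))).2) ^ 2 :=
        pow_pos (add_pos h3.1 h3.2) 2
      rw [hC, div_mul_div_comm, inv_eq_one_div, div_le_div_iff₀ (by linarith) (by positivity)]
      linarith
    dsimp only; rw [hN, ← ENNReal.ofReal_rpow_of_pos (inv_pos.2 (by linarith))]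
    calc _ ≤ ENNReal.ofReal C ^ σ * G (endCol 0 W) W := by
          simp only [hG, if_pos hW.2, endCol_eq hW.1 (endCol 0 W) 0]
          rw [← ENNReal.mul_rpow_of_nonneg _ _ hσ0, ← ENNReal.ofReal_mul hC0.le]
          exact ENNReal.rpow_le_rpow (ENNReal.ofReal_le_ofReal h5) hσ0
      _ ≤ _ := by
          gcongr
          exact Finset.single_le_sum (f := fun i => G i W) (fun _ _ => zero_le) (Finset.mem_univ _)
  have hfin : ∀ i, ∑' W, G i W ≠ ∞ := by
    intro i; rw [← (Equiv.sigmaFiberEquiv (List.length (α := Blk q))).tsum_eq, ENNReal.tsum_sigma']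
    refine ne_top_of_le_ne_top ?_ (ENNReal.tsum_le_tsum fun n =>
      tsum_words_pot_le hq hσ n (hvpos i) i)
    rw [ENNReal.tsum_mul_right, ENNReal.tsum_geometric]
    refine ENNReal.mul_ne_top (ENNReal.inv_ne_top.2 ?_)
      (ENNReal.rpow_ne_top_of_nonneg hσ0 ENNReal.ofReal_ne_top)
    rw [← pos_iff_ne_zero, tsub_pos_iff_lt]; exact ENNReal.rpow_lt_one (by norm_num) (by linarith)
  have hsum : ∑' W : {W : List (Blk q) // ClosedWord W},
      ENNReal.ofReal (((hypNorm (wordElt W.1 : PSLR))⁻¹) ^ σ) ≠ ∞ := by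
    refine ne_top_of_le_ne_top ?_ ((ENNReal.tsum_le_tsum hle).trans
      (ENNReal.tsum_comp_le_tsum_of_injective Subtype.val_injective
        fun W => ENNReal.ofReal C ^ σ * ∑ i, G i W))
    rw [ENNReal.tsum_mul_left, Summable.tsum_finsetSum fun _ _ => ENNReal.summable]
    exact ENNReal.mul_ne_top (ENNReal.rpow_ne_top_of_nonneg hσ0 ENNReal.ofReal_ne_top)
      (ENNReal.sum_ne_top.2 fun i _ => hfin i)
  refine (ENNReal.summable_toReal hsum).congr fun W => ENNReal.toReal_ofReal ?_
  have : 0 ≤ hypNorm (wordElt W.1 : PSLR) := by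
    obtain ⟨x, D, -, -, hN⟩ := W.2.exists_isAttracting hq h hρ; rw [hN]; positivity
  positivity

variable {V : Type*} [NormedAddCommGroup V] [InnerProductSpace ℂ V] [FiniteDimensional ℂ V]
  (η : Lam q →* (V ≃ₗᵢ[ℂ] V))

theorem norm_trace_le (u : V ≃ₗᵢ[ℂ] V) :
    ‖LinearMap.trace ℂ V (u.toLinearEquiv : V →ₗ[ℂ] V)‖ ≤ finrank ℂ V := by
  rw [trace_eq_sum_inner _ (𝔟 V)]
  refine (norm_sum_le _ _).trans ((Finset.sum_le_sum fun i _ => (?_ : _ ≤ (1 : ℝ))).trans (by simp))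
  refine (norm_inner_le_norm _ _).trans ?_; simp

/-- The contribution of an element of norm `N` to the trace formula. -/
def normTerm (s : ℂ) (N : ℝ) : ℂ := (N : ℂ) ^ (-s) / (1 - ((N⁻¹ : ℝ) : ℂ))

theorem norm_normTerm_le {s : ℂ} {N : ℝ} (hN : 2 ≤ N) : ‖normTerm s N‖ ≤ 2 * (N⁻¹) ^ s.re := by
  have h0 : 0 < N := by linarith
  have h1 : N⁻¹ ≤ 1 / 2 := by rw [inv_eq_one_div]; exact one_div_le_one_div_of_le (by norm_num) hN
  rw [normTerm, norm_div, norm_cpow_eq_rpow_re_of_pos h0, neg_re,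
    ← ofReal_one, ← ofReal_sub, norm_real, norm_eq_abs,
    abs_of_nonneg (by linarith), rpow_neg h0.le, inv_rpow h0.le,
    div_le_iff₀ (by linarith)]
  nlinarith [inv_pos.2 (rpow_pos_of_pos h0 s.re)]

theorem summable_norm_wordTrace (hq : 3 ≤ q) (h : AdmissibleDiscs q c r)
    (hρ : IsContraction q c r ρ) {s : ℂ} (hs : 1 < s.re) :
    Summable fun W : List (Blk q) => ‖wordTrace η s W‖ := by
  have hsum := summable_hypNorm_rpow hq h hρ hs
  rw [← (Subtype.val_injective (p := fun W : List (Blk q) => ClosedWord W)).summable_iff]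
  · refine Summable.of_norm_bounded_eventually (hsum.mul_left ((finrank ℂ V : ℝ) * 2)) ?_
    filter_upwards [hsum.tendsto_cofinite_zero.eventually (gt_mem_nhds
      (show (0 : ℝ) < 2⁻¹ ^ s.re by positivity))] with W hW
    have hN : 1 < hypNorm (wordElt W.1 : PSLR) := by
      obtain ⟨x, D, hx, -, hN⟩ := W.2.exists_isAttracting hq h hρ; rw [hN]; exact hx.one_lt
    rw [rpow_lt_rpow_iff (by positivity) (by norm_num) (by linarith)] at hW
    have hW := (inv_lt_inv₀ (by linarith) (by norm_num)).1 hW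
    rw [Function.comp_apply, norm_norm, wordTrace, if_pos W.2, norm_mul, mul_assoc]
    exact mul_le_mul (norm_trace_le _) (norm_normTerm_le hW.le) (norm_nonneg _) (by positivity)
  · intro W hW; rw [range_coe_subtype, mem_ofPred_eq] at hW; rw [wordTrace, if_neg hW, norm_zero]

end Convergence

/-! ### Conjugacy of words in a group generated by an involution and an element of finite order -/

section Group

theorem isRotated_of_append_eq {α : Type*} {w p p' : List α} (hp : p' ≠ [])
    (h : w ++ p = p' ++ w) : p ~r p' := by
  obtain ⟨n, hn⟩ : ∃ n, w.length = n := ⟨_, rfl⟩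
  induction n using Nat.strong_induction_on generalizing w with
  | _ n ih =>
    rcases append_eq_append_iff.1 h with ⟨z, rfl, h2⟩ | ⟨z, rfl, h2⟩
    · rw [h2]; exact isRotated_append
    · refine ih z.length ?_ (w := z) ?_ rfl
      · have := length_pos_of_ne_nil hp; rw [length_append] at hn; omega
      · simpa using h2.symm

variable {G : Type*} [Group G] {s u : G} {q : ℕ}

/-- The product of the letters `s u ^ k`. -/
def letterWord (s u : G) (p : List ℕ) : G := (p.map fun k => s * u ^ k).prod

/-- All letters are between `1` and `q - 1`. -/
def Letters (q : ℕ) (p : List ℕ) : Prop := ∀ k ∈ p, 0 < k ∧ k < q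

theorem letterWord_cons (k : ℕ) (p : List ℕ) :
    letterWord s u (k :: p) = s * u ^ k * letterWord s u p := by simp [letterWord]

theorem letterWord_nil : letterWord s u [] = 1 := rfl

theorem letterWord_append (p p' : List ℕ) :
    letterWord s u (p ++ p') = letterWord s u p * letterWord s u p' := by simp [letterWord]

theorem Letters.append {p p' : List ℕ} (h : Letters q p) (h' : Letters q p') :
    Letters q (p ++ p') := fun k hk => (mem_append.1 hk).elim (h k) (h' k)

theorem letters_cons {k : ℕ} {p : List ℕ} : Letters q (k :: p) ↔ (0 < k ∧ k < q) ∧ Letters q p :=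
  List.forall_mem_cons

theorem exists_bar (hs : s * s = 1) (hu : u ^ q = 1) {p : List ℕ} (hp : Letters q p) :
    ∃ p', Letters q p' ∧ p'.length = p.length ∧ letterWord s u p' * (s * letterWord s u p * s) = 1 := by
  induction p with
  | nil => exact ⟨[], hp, rfl, by simp [letterWord, hs]⟩
  | cons k p ih =>
    obtain ⟨hk, hp⟩ := letters_cons.1 hp; obtain ⟨p', h1, h2, h3⟩ := ih hp
    refine ⟨p' ++ [q - k], h1.append (letters_cons.2 ⟨by omega, by simp [Letters]⟩), by simp [h2], ?_⟩
    rw [letterWord_append, letterWord_cons k, letterWord_cons, letterWord_nil, mul_one]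
    have h4 : u ^ (q - k) * u ^ k = 1 := by rw [← pow_add, Nat.sub_add_cancel hk.2.le, hu]
    calc _ = letterWord s u p' * (s * (u ^ (q - k) * (s * s) * u ^ k) * letterWord s u p * s) := by
          group
      _ = _ := by rw [hs, mul_one, h4, mul_one, ← h3]

theorem exists_form_aux (hq : 1 < q) (hs : s * s = 1) (hu : u ^ q = 1) {g : G}
    (h : ∃ p a e, Letters q p ∧ (1 = a ∨ s = a) ∧ (1 = e ∨ s = e) ∧ g = a * letterWord s u p * e) :
    ∃ p a e, Letters q p ∧ (1 = a ∨ s = a) ∧ (1 = e ∨ s = e) ∧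
    u * g = a * letterWord s u p * e := by
  have h1 : s * (s * u ^ 1) = u := by rw [← mul_assoc, hs, one_mul, pow_one]
  obtain ⟨p, a, e, hp, rfl | rfl, he, rfl⟩ := h
  · refine ⟨1 :: p, s, e, letters_cons.2 ⟨by omega, hp⟩, .inr rfl, he, ?_⟩
    rw [letterWord_cons, ← mul_assoc s, h1, one_mul, mul_assoc]
  cases p with
  | nil =>
    refine ⟨[1], s, s * e, letters_cons.2 ⟨by omega, hp⟩, .inr rfl, ?_, ?_⟩
    · rcases he with rfl | rfl; exacts [.inr (mul_one _).symm, .inl hs.symm]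
    · rw [letterWord_cons, letterWord_nil, mul_one, mul_one, h1]
  | cons k p =>
    obtain ⟨hk, hp⟩ := letters_cons.1 hp
    have h2 : u * (s * letterWord s u (k :: p) * e) = u ^ (k + 1) * letterWord s u p * e := by
      rw [letterWord_cons, ← mul_assoc s, ← mul_assoc s s, hs, one_mul, pow_succ']
      group
    rw [h2]; by_cases hkq : k + 1 = q
    · exact ⟨p, 1, e, hp, .inl rfl, he, by rw [hkq, hu]⟩
    · refine ⟨(k + 1) :: p, s, e, letters_cons.2 ⟨by omega, hp⟩, .inr rfl, he, ?_⟩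
      rw [letterWord_cons, ← mul_assoc s, ← mul_assoc s s, hs, one_mul]

theorem exists_form (hq : 1 < q) (hs : s * s = 1) (hu : u ^ q = 1)
    (hgen : Subgroup.closure {s, u} = ⊤) (g : G) :
    ∃ p a e, Letters q p ∧ (1 = a ∨ s = a) ∧ (1 = e ∨ s = e) ∧ g = a * letterWord s u p * e := by
  have hS : ∀ y : G, (∃ p a e, Letters q p ∧ (1 = a ∨ s = a) ∧ (1 = e ∨ s = e) ∧
      y = a * letterWord s u p * e) → ∃ p a e, Letters q p ∧ (1 = a ∨ s = a) ∧ (1 = e ∨ s = e) ∧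
      s * y = a * letterWord s u p * e := by
    rintro _ ⟨p, a, e, hp, ha, he, rfl⟩; refine ⟨p, s * a, e, hp, ?_, he, by group⟩
    rcases ha with rfl | rfl
    exacts [.inr (mul_one _).symm, .inl hs.symm]
  have hg : g ∈ Subgroup.closure {s, u} := hgen ▸ Subgroup.mem_top g
  induction hg using Subgroup.closure_induction_left with
  | one => exact ⟨[], 1, 1, by simp [Letters], .inl rfl, .inl rfl, by simp [letterWord]⟩
  | mul_left x hx y _ ih =>
    rcases hx with rfl | rfl
    exacts [hS y ih, exists_form_aux hq hs hu ih]
  | inv_mul_cancel x hx y _ ih =>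
    rcases hx with rfl | rfl
    · rw [inv_eq_of_mul_eq_one_left hs]; exact hS y ih
    · rw [inv_eq_of_mul_eq_one_left (show x ^ (q - 1) * x = 1 by
        rw [← pow_succ, Nat.sub_add_cancel hq.le, hu])]
      generalize q - 1 = n
      induction n with
      | zero => simpa using ih
      | succ n ihn =>
        rw [pow_succ', mul_assoc]; exact exists_form_aux hq hs hu ihn

theorem isRotated_of_conj (hq : 1 < q) (hs : s * s = 1) (hu : u ^ q = 1)
    (hgen : Subgroup.closure {s, u} = ⊤)
    (hfree : ∀ p p', Letters q p → Letters q p' → letterWord s u p = letterWord s u p' → p = p')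
    {p p' : List ℕ} (hp : Letters q p) (hp' : Letters q p') (h0 : p ≠ []) (h0' : p' ≠ []) {g : G}
    (h : g * letterWord s u p = letterWord s u p' * g) : p ~r p' := by
  obtain ⟨w, a, e, hw, ha, he, rfl⟩ := exists_form hq hs hu hgen g
  have hl := length_pos_of_ne_nil h0; have hl' := length_pos_of_ne_nil h0'
  have hinv : ∀ x : G, s * (s * x) = x := fun x => by rw [← mul_assoc, hs, one_mul]
  rcases ha with rfl | rfl <;> rcases he with rfl | rfl
  · refine isRotated_of_append_eq h0' (w := w) (hfree _ _ (hw.append hp) (hp'.append hw) ?_)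
    rw [letterWord_append, letterWord_append]; simpa using h
  · obtain ⟨b, h1, h2, h3⟩ := exists_bar hs hu hp
    have := hfree w (p' ++ w ++ b) hw ((hp'.append hw).append h1) ?_
    · have := congrArg List.length this; simp only [length_append] at this; omega
    · rw [letterWord_append, letterWord_append, eq_inv_of_mul_eq_one_left h3, eq_mul_inv_iff_mul_eq]
      rw [one_mul] at h; rw [← mul_assoc, ← mul_assoc, h, ← mul_assoc, mul_assoc _ s s, hs, mul_one]
  · obtain ⟨b, h1, h2, h3⟩ := exists_bar hs hu hp'
    have := hfree w (b ++ w ++ p) hw ((h1.append hw).append hp) ?_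
    · have := congrArg List.length this; simp only [length_append] at this; omega
    · rw [letterWord_append, letterWord_append, eq_inv_of_mul_eq_one_left h3, mul_assoc,
        eq_inv_mul_iff_mul_eq]
      simp only [mul_one, mul_assoc] at h ⊢; rw [← h, hinv]
  · obtain ⟨b, h1, h2, h3⟩ := exists_bar hs hu hw
    refine (isRotated_of_append_eq h0 (w := b) (hfree _ _ (h1.append hp') (hp.append h1) ?_)).symm
    rw [letterWord_append, letterWord_append, eq_inv_of_mul_eq_one_left h3, inv_mul_eq_iff_eq_mul,
      ← mul_assoc, eq_mul_inv_iff_mul_eq, h]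

theorem exists_conj_letterWord (hq : 1 < q) (hs : s * s = 1) (hu : u ^ q = 1)
    (hgen : Subgroup.closure {s, u} = ⊤) (g : G) (hg : ∀ n, n ≠ 0 → g ^ n ≠ 1) :
    ∃ p, Letters q p ∧ ∃ γ : G, γ * g * γ⁻¹ = letterWord s u p := by
  have key : ∀ (n : ℕ) (p : List ℕ), Letters q p → p.length = n → ∀ g γ : G,
      (∀ n, n ≠ 0 → g ^ n ≠ 1) → γ * g * γ⁻¹ = s * letterWord s u p →
      ∃ p, Letters q p ∧ ∃ γ : G, γ * g * γ⁻¹ = letterWord s u p := by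
    intro n; induction n using Nat.strong_induction_on with
    | _ n ih =>
      intro p hp hn g γ hg h
      have hfin : ∀ n, n ≠ 0 → (s * letterWord s u p) ^ n ≠ 1 := fun n hn h1 => hg n hn (by
        rw [← h, conj_pow, mul_inv_eq_one] at h1; simpa using h1)
      rcases p with _ | ⟨k, p⟩
      · exact absurd (by simp [letterWord, pow_two, hs]) (hfin 2 two_ne_zero)
      obtain ⟨hk, hp⟩ := letters_cons.1 hp
      have h1 : s * letterWord s u (k :: p) = u ^ k * letterWord s u p := by
        rw [letterWord_cons, mul_assoc s, ← mul_assoc, hs, one_mul]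
      rcases eq_nil_or_concat p with rfl | ⟨p, l, rfl⟩
      · refine absurd ?_ (hfin q (by omega))
        rw [h1, letterWord_nil, mul_one, ← pow_mul, mul_comm, pow_mul, hu, one_pow]
      rw [concat_eq_append] at *
      have hl := letters_cons.1 (fun a ha => hp a (mem_append_right p ha))
      have hp2 : Letters q p := fun a ha => hp a (mem_append_left _ ha)
      have h2 : (u ^ k)⁻¹ * γ * g * ((u ^ k)⁻¹ * γ)⁻¹ = letterWord s u p * (s * u ^ (l + k)) := by
        calc _ = (u ^ k)⁻¹ * (γ * g * γ⁻¹) * u ^ k := by group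
          _ = _ := by
            rw [h, h1, letterWord_append, letterWord_cons, letterWord_nil, mul_one, pow_add]
            group
      rcases lt_trichotomy (l + k) q with hlt | heq | hgt
      · refine ⟨p ++ [l + k], hp2.append (letters_cons.2 ⟨by omega, by simp [Letters]⟩),
          (u ^ k)⁻¹ * γ, ?_⟩
        rw [h2, letterWord_append]; simp [letterWord]
      · refine ih p.length (by simp at hn; omega) p hp2 rfl g (s * ((u ^ k)⁻¹ * γ)) hg ?_
        rw [heq, hu, mul_one] at h2
        calc _ = s * ((u ^ k)⁻¹ * γ * g * ((u ^ k)⁻¹ * γ)⁻¹) * s⁻¹ := by group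
          _ = _ := by rw [h2]; group
      · refine ⟨p ++ [l + k - q], hp2.append (letters_cons.2 ⟨by omega, by simp [Letters]⟩),
          (u ^ k)⁻¹ * γ, ?_⟩
        rw [h2, letterWord_append, show l + k = l + k - q + q by omega, pow_add, hu]
        simp [letterWord]
  have hinv := inv_eq_of_mul_eq_one_left hs
  obtain ⟨p, a, e, hp, rfl | rfl, rfl | rfl, h⟩ := exists_form hq hs hu hgen g
  · exact ⟨p, hp, 1, by simp [h]⟩
  · exact key _ p hp rfl g s hg (by rw [h, hinv]; simp [mul_assoc, hs])
  · exact key _ p hp rfl g 1 hg (by simp [h])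
  · exact ⟨p, hp, s, by rw [h, hinv]; simp [← mul_assoc, hs]; simp [mul_assoc, hs]⟩

end Group

/-! ### The structure of the group -/

section Structure

variable {q : ℕ}

/-- The involution of `Λ`. -/
def eltS (q : ℕ) : Lam q := ⟨toPSL (matC * matS * matC⁻¹), conj_mem_Lam q (toPSL_matS_mem q)⟩

/-- The generator of order `q` of `Λ`. -/
def eltU (q : ℕ) : Lam q := ⟨toPSL (matC * (matT q * matS)⁻¹ * matC⁻¹),
  conj_mem_Lam q (by
    rw [map_inv, map_mul]; exact inv_mem (mul_mem (toPSL_matT_mem q) (toPSL_matS_mem q)))⟩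

theorem toPSL_matS_mul_self : toPSL matS * toPSL matS = 1 := by
  rw [← map_mul, ← map_one toPSL, toPSL_eq_iff]; refine ⟨-1, by norm_num, fun i j => ?_⟩
  have h : ∀ i j, matS i j = (!![0, 1; -1, 0] : Matrix _ _ ℝ) i j := fun i j => rfl
  rw [sl_mul_apply, h, h, h, h]
  fin_cases i <;> fin_cases j <;> simp

theorem eltS_mul_self : eltS q * eltS q = 1 := Subtype.ext <| by
  change toPSL _ * toPSL _ = 1; simp only [map_mul, map_inv]
  calc _ = toPSL matC * (toPSL matS * toPSL matS) * (toPSL matC)⁻¹ := by group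
    _ = 1 := by rw [toPSL_matS_mul_self]; group

theorem eltU_pow (hq : 3 ≤ q) : eltU q ^ q = 1 := Subtype.ext <| by
  change toPSL _ ^ q = 1
  have h : toPSL ((matT q * matS) ^ q) = 1 := by
    obtain ⟨h1, h2, h3, h4⟩ := matTS_pow_entries hq (q - 1); have e := sq_succ_succ (q := q) (q - 1)
    have e1 := sq_sub hq (show 1 ≤ q by omega)
    rw [show q - 1 + 1 = q by omega, sq_self hq] at *
    rw [e1, sq_one hq] at e h4; rw [e] at h1; rw [eq_comm, ← map_one toPSL, toPSL_eq_iff]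
    refine ⟨-(-1) ^ q, by linear_combination neg_one_pow_mul_self q, fun i j => ?_⟩
    fin_cases i <;> fin_cases j <;> simp [h1, h2, h3, h4]
  rw [← map_pow, conj_pow, inv_pow, map_mul, map_mul, map_inv toPSL (_ ^ q), h]; simp

theorem closure_eltS_eltU : Subgroup.closure {eltS q, eltU q} = ⊤ := by
  refine Subgroup.map_injective (Lam q).subtype_injective ?_
  rw [MonoidHom.map_closure, ← MonoidHom.range_eq_map, Subgroup.range_subtype]
  refine le_antisymm ((Subgroup.closure_le _).2 ?_) ?_
  · rintro _ ⟨x, -, rfl⟩; exact x.2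
  · change Subgroup.map _ (Subgroup.closure _) ≤ _; rw [MonoidHom.map_closure, Subgroup.closure_le]
    have hS := Subgroup.subset_closure (k := (Lam q).subtype '' {eltS q, eltU q})
      ⟨eltS q, by simp, rfl⟩
    have hU := Subgroup.subset_closure (k := (Lam q).subtype '' {eltS q, eltU q})
      ⟨eltU q, by simp, rfl⟩
    rintro _ ⟨_, rfl | rfl, rfl⟩
    · convert hS using 1; simp [eltS]
    · convert mul_mem (inv_mem hU) (inv_mem hS) using 1; simp [eltS, eltU, mul_assoc]

theorem eltS_mul_eltU_pow (k : ℕ) : eltS q * eltU q ^ k = eltH q k := Subtype.ext <| by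
  change toPSL _ * toPSL _ ^ k = toPSL _
  rw [← map_pow, conj_pow, inv_pow, ← map_mul, matH, matG, _root_.mul_inv_rev (_ ^ k)]
  generalize ((matT q * matS) ^ k)⁻¹ = Y
  have hS := inv_eq_of_mul_eq_one_left toPSL_matS_mul_self; simp only [map_mul, map_inv, hS]
  group

theorem letterWord_eltS (p : List ℕ) : letterWord (eltS q) (eltU q) p = (p.map (eltH q)).prod := by
  simp only [letterWord, eltS_mul_eltU_pow]

/-- The action of the inverse of a letter in homogeneous coordinates. -/
def letterVec (q : ℕ) (w : ℝ × ℝ) (k : ℕ) : ℝ × ℝ :=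
  (sq q k * w.1 + sq q (k + 1) * w.2, sq q (k - 1) * w.1 + sq q k * w.2)

theorem isConj_letters (hq : 3 ≤ q) {p : List ℕ} (hp : Letters q p) : ∃ α β γ δ : ℝ,
    IsConj ((p.map (matH q)).prod)⁻¹ α β γ δ ∧
    ∀ v, p.foldl (letterVec q) v = (α * v.1 + β * v.2, γ * v.1 + δ * v.2) := by
  induction p using reverseRecOn with
  | nil => exact ⟨1, 0, 0, 1, ⟨1, by norm_num, by simp, by simp, by simp, by simp⟩, by simp⟩
  | append_singleton p k ih =>
    obtain ⟨α, β, γ, δ, h1, h2⟩ := ih fun a ha => hp a (mem_append_left _ ha)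
    obtain ⟨m, rfl⟩ : ∃ m, k = m + 1 := ⟨k - 1, by have := hp k (by simp); omega⟩
    refine ⟨_, _, _, _, by simpa using (isConj_matH_inv hq m).mul h1, fun v => ?_⟩
    rw [foldl_append, foldl_cons, foldl_nil, h2, letterVec, Nat.add_sub_cancel]
    ext <;> simp only <;> ring

theorem letterVec_pos (hq : 3 ≤ q) {k : ℕ} (hk : 0 < k ∧ k < q) {w : ℝ × ℝ} (h1 : 0 < w.1)
    (h2 : 0 < w.2) : 0 < (letterVec q w k).1 ∧ 0 < (letterVec q w k).2 ∧
    w.1 + w.2 < (letterVec q w k).1 + (letterVec q w k).2 := by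
  obtain ⟨m, rfl⟩ : ∃ m, k = m + 1 := ⟨k - 1, by omega⟩
  have e1 := one_le_sq hq (k := m) (by omega)
  have e2 := sq_nonneg' hq (k := m + 2) (by omega)
  have e3 := sq_nonneg' hq (k := m) (by omega)
  have e4 := sq_add (q := q) m; have e5 := one_le_lam hq; simp only [letterVec, Nat.add_sub_cancel]
  refine ⟨by positivity, by positivity, ?_⟩
  have : 0 < sq q m * w.1 + sq q (m + 2) * w.2 := by
    rcases e3.eq_or_lt with h | h
    · have : 0 < sq q (m + 2) := by nlinarith
      positivity
    · positivity
  nlinarith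

theorem foldl_letterVec_pos (hq : 3 ≤ q) {p : List ℕ} (hp : Letters q p) {v : ℝ × ℝ} (h1 : 0 < v.1)
    (h2 : 0 < v.2) : 0 < (p.foldl (letterVec q) v).1 ∧ 0 < (p.foldl (letterVec q) v).2 ∧
    v.1 + v.2 ≤ (p.foldl (letterVec q) v).1 + (p.foldl (letterVec q) v).2 := by
  induction p generalizing v with
  | nil => exact ⟨h1, h2, le_rfl⟩
  | cons k p ih =>
    obtain ⟨hk, hp⟩ := letters_cons.1 hp; obtain ⟨a, b, c⟩ := letterVec_pos hq hk h1 h2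
    obtain ⟨a', b', c'⟩ := ih hp a b; exact ⟨a', b', c.le.trans c'⟩

theorem sq_rotate (m i : ℕ) (X Y : ℝ) (hq : 3 ≤ q) : sq q (m + 1 + i) * X - sq q (m + 2 + i) * Y
    = sq q (i + 1) * (sq q (m + 1) * X - sq q (m + 2) * Y)
    - sq q i * (sq q m * X - sq q (m + 1) * Y) := by
  induction i using Nat.twoStepInduction with
  | zero => simp [sq_zero, sq_one hq]
  | one =>
    have := sq_succ_succ (q := q) (m + 1); rw [sq_two hq, sq_one hq, sq_succ_succ m]
    rw [show m + 2 + 1 = m + 1 + 2 by ring, this, sq_succ_succ m]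
    ring
  | more i h1 h2 =>
    rw [show m + 1 + (i + 2) = m + 1 + i + 2 by ring, show m + 2 + (i + 2) = m + 2 + i + 2 by ring,
      sq_succ_succ (m + 1 + i), sq_succ_succ (m + 2 + i), show i + 2 + 1 = i + 1 + 2 by ring,
      sq_succ_succ (i + 1), sq_succ_succ i]
    rw [show m + 1 + (i + 1) = m + 1 + i + 1 by ring, show m + 2 + (i + 1) = m + 2 + i + 1 by ring,
      show i + 1 + 1 = i + 2 by ring, sq_succ_succ i] at h2
    linear_combination lam q * h2 - h1

theorem letterVec_inv (hq : 3 ≤ q) (m : ℕ) (w : ℝ × ℝ) :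
    sq q (m + 1) * (letterVec q w (m + 1)).1 - sq q (m + 2) * (letterVec q w (m + 1)).2 = w.1 ∧
    sq q m * (letterVec q w (m + 1)).1 - sq q (m + 1) * (letterVec q w (m + 1)).2 = -w.2 := by
  have := sq_mul_self hq m; simp only [letterVec, Nat.add_sub_cancel]
  exact ⟨by linear_combination w.1 * this, by linear_combination (-w.2) * this⟩

theorem letterVec_ne (hq : 3 ≤ q) {k l : ℕ} (hk : 0 < k) (hkl : k < l) (hl : l < q) {w w' : ℝ × ℝ}
    (hw : 0 < w.1 ∧ 0 < w.2) (hw' : 0 < w'.2) : letterVec q w k ≠ letterVec q w' l := by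
  intro h; obtain ⟨m, rfl⟩ : ∃ m, k = m + 1 := ⟨k - 1, by omega⟩
  obtain ⟨i, rfl⟩ : ∃ i, l = m + 1 + i + 1 := ⟨l - (m + 2), by omega⟩
  obtain ⟨a1, a2⟩ := letterVec_inv hq m w; obtain ⟨-, b2⟩ := letterVec_inv hq (m + 1 + i) w'
  have h1 := sq_rotate m i (letterVec q w (m + 1)).1 (letterVec q w (m + 1)).2 hq
  rw [a1, a2, h, show m + 2 + i = m + 1 + i + 1 by ring, b2] at h1
  have h2 := one_le_sq hq (k := i) (by omega)
  have h3 := sq_nonneg' hq (k := i) (by omega)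
  nlinarith [mul_pos (lt_of_lt_of_le zero_lt_one h2) hw.1, mul_nonneg h3 hw.2.le]

theorem letters_ext (hq : 3 ≤ q) {p p' : List ℕ} (hp : Letters q p) (hp' : Letters q p')
    (h : ∀ v, p.foldl (letterVec q) v = p'.foldl (letterVec q) v) : p = p' := by
  have hne : ∀ {p : List ℕ} {k : ℕ}, Letters q (p ++ [k]) →
      (p ++ [k]).foldl (letterVec q) (1, 1) ≠ (1, 1) := by
    intro p k hp he
    obtain ⟨a, b, c⟩ := foldl_letterVec_pos hq (v := (1, 1))
      (fun a ha => hp a (mem_append_left [k] ha)) one_pos one_pos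
    have := (letterVec_pos hq (hp k (by simp)) a b).2.2
    rw [foldl_append, foldl_cons, foldl_nil] at he; rw [he] at this; linarith
  induction p using reverseRecOn generalizing p' with
  | nil =>
    rcases eq_nil_or_concat p' with rfl | ⟨p', l, rfl⟩
    · rfl
    · rw [concat_eq_append] at *; exact absurd (h (1, 1)).symm (hne hp')
  | append_singleton p k ih =>
    rcases eq_nil_or_concat p' with rfl | ⟨p', l, rfl⟩
    · exact absurd (h (1, 1)) (hne hp)
    rw [concat_eq_append] at *
    have hk := hp k (by simp)
    have hl := hp' l (by simp)
    replace hp : Letters q p := fun a ha => hp a (mem_append_left _ ha)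
    replace hp' : Letters q p' := fun a ha => hp' a (mem_append_left _ ha)
    simp only [foldl_append, foldl_cons, foldl_nil] at h
    obtain ⟨a, b, -⟩ := foldl_letterVec_pos hq hp (v := (1, 1)) one_pos one_pos
    obtain ⟨a', b', -⟩ := foldl_letterVec_pos hq hp' (v := (1, 1)) one_pos one_pos
    have hkl : k = l := by
      rcases lt_trichotomy k l with hlt | heq | hgt
      · exact absurd (h (1, 1)) (letterVec_ne hq hk.1 hlt hl.2 ⟨a, b⟩ b')
      · exact heq
      · exact absurd (h (1, 1)).symm (letterVec_ne hq hl.1 hgt hk.2 ⟨a', b'⟩ b)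
    subst hkl; rw [ih hp hp' fun v => ?_]; obtain ⟨m, rfl⟩ : ∃ m, k = m + 1 := ⟨k - 1, by omega⟩
    obtain ⟨c1, c2⟩ := letterVec_inv hq m (p.foldl (letterVec q) v)
    obtain ⟨d1, d2⟩ := letterVec_inv hq m (p'.foldl (letterVec q) v); rw [h v] at c1 c2
    exact Prod.ext (c1.symm.trans d1) (neg_injective (c2.symm.trans d2))

/-- The letters generate a free monoid. -/
theorem letterWord_injective (hq : 3 ≤ q) (p p' : List ℕ) (hp : Letters q p) (hp' : Letters q p')
    (h : letterWord (eltS q) (eltU q) p = letterWord (eltS q) (eltU q) p') : p = p' := by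
  have hc : ∀ p : List ℕ, ((letterWord (eltS q) (eltU q) p : Lam q) : PSLR)
      = toPSL (p.map (matH q)).prod := by
    intro p
    rw [letterWord_eltS, map_list_prod, ← Subgroup.coe_subtype, map_list_prod, List.map_map,
      List.map_map]
    rfl
  have h1 : toPSL ((p.map (matH q)).prod)⁻¹ = toPSL ((p'.map (matH q)).prod)⁻¹ := by
    rw [map_inv, map_inv, ← hc, ← hc, h]
  obtain ⟨σ, hσ, hAB⟩ := toPSL_eq_iff.1 h1
  obtain ⟨a, b, c, d, ⟨τ, hτ, A00, A01, A10, A11⟩, hv⟩ := isConj_letters hq hp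
  obtain ⟨a', b', c', d', ⟨τ', hτ', B00, B01, B10, B11⟩, hv'⟩ := isConj_letters hq hp'
  have k00 := hAB 0 0; have k01 := hAB 0 1; have k10 := hAB 1 0; have k11 := hAB 1 1
  rw [A00, B00] at k00; rw [A01, B01] at k01; rw [A10, B10] at k10; rw [A11, B11] at k11
  set ε := τ' * σ * τ with hε
  have hε2 : ε * ε = 1 := by linear_combination hτ' + τ' * τ' * hσ + τ' * τ' * σ * σ * hτ
  have ea : a' = ε * a := by linear_combination (-a') * hτ' + τ' / 2 * (k00 + k01 + k10 + k11)
  have eb : b' = ε * b := by linear_combination (-b') * hτ' + τ' / 2 * (k01 - k00 + k11 - k10)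
  have ec : c' = ε * c := by linear_combination (-c') * hτ' + τ' / 2 * (k10 + k11 - k00 - k01)
  have ed : d' = ε * d := by linear_combination (-d') * hτ' + τ' / 2 * (k11 - k10 - k01 + k00)
  obtain ⟨x, -⟩ := foldl_letterVec_pos hq hp (v := (1, 1)) one_pos one_pos
  obtain ⟨x', -⟩ := foldl_letterVec_pos hq hp' (v := (1, 1)) one_pos one_pos; rw [hv] at x
  rw [hv', ea, eb] at x'
  have hε1 : ε = 1 := by
    rcases mul_self_eq_one_iff.1 hε2 with h | h
    · exact h
    · rw [h] at x'; simp only at x x'; linarith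
  refine letters_ext hq hp hp' fun v => ?_; rw [hv, hv', ea, eb, ec, ed, hε1]; simp only [one_mul]

theorem not_isHyperbolic_par (hq : 3 ≤ q) {j : Fin 3} (hj : j ≠ 1) (n : ℕ) :
    ¬ IsHyperbolic ((eltH q (parIdx q j) ^ n : Lam q) : PSLR) := by
  have e : ((eltH q (parIdx q j) ^ n : Lam q) : PSLR) = toPSL (matH q (parIdx q j) ^ n) := by
    rw [map_pow]
    rfl
  rw [e, isHyperbolic_toPSL, ← trace_inv]; obtain ⟨σ, hσ, h1, -, -, h2⟩ := isConj_parIdx hq hj n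
  rw [show _ + _ = 2 * σ by rw [h1, h2]; ring]
  rcases mul_self_eq_one_iff.1 hσ with h | h <;> rw [h] <;> norm_num

end Structure

/-! ### Closed words and conjugacy classes -/

section Flat

variable {q : ℕ}

/-- The letters of a list of blocks. -/
def flat (W : List (Blk q)) : List ℕ := W.flatMap fun b => replicate b.exp b.idx

/-- The column of the block which contains a letter. -/
def letterCol (q k : ℕ) : Fin 3 := if k = 1 then 0 else if k = q - 1 then 2 else 1

theorem flat_cons (b : Blk q) (W : List (Blk q)) :
    flat (b :: W) = replicate b.exp b.idx ++ flat W := rfl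

theorem flat_append (W W' : List (Blk q)) : flat (W ++ W') = flat W ++ flat W' := flatMap_append

theorem Blk.exp_pos (b : Blk q) : 0 < b.exp := by rw [exp]; split_ifs <;> omega

theorem Blk.letterCol_idx (hq : 3 ≤ q) (b : Blk q) :
    letterCol q b.idx = b.col ∧ 0 < b.idx ∧ b.idx < q := by
  obtain ⟨⟨j, n⟩, hb⟩ := b; have h1 : q - 1 ≠ 1 := by omega
  fin_cases j
  · simp [letterCol, idx, col, parIdx]; omega
  · have := hb rfl; simp only [letterCol, idx, col]; simp; omega
  · simp [letterCol, idx, col, parIdx, h1]; omega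

theorem letterCol_inj {k l : ℕ} (h : letterCol q k = letterCol q l) (h1 : letterCol q k ≠ 1) :
    k = l := by
  rw [letterCol, letterCol] at *
  split_ifs at h h1 <;> simp_all

theorem flat_eq_nil {W : List (Blk q)} : flat W = [] ↔ W = [] := by
  cases W with
  | nil => simp [flat]
  | cons b W => simp [flat_cons, b.exp_pos.ne']

theorem head_flat_cons (b : Blk q) (W : List (Blk q)) (F : List ℕ) :
    (flat (b :: W) ++ F).head? = some b.idx := by
  obtain ⟨n, hn⟩ := Nat.exists_eq_succ_of_ne_zero b.exp_pos.ne'; rw [flat_cons, hn, replicate_succ]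
  rfl

theorem letters_flat (hq : 3 ≤ q) (W : List (Blk q)) : Letters q (flat W) := by
  intro k hk; obtain ⟨b, -, hb⟩ := mem_flatMap.1 hk; rw [eq_of_mem_replicate hb]
  exact (b.letterCol_idx hq).2

theorem wordElt_eq (W : List (Blk q)) : wordElt W = letterWord (eltS q) (eltU q) (flat W) := by
  induction W with
  | nil => rfl
  | cons b W ih =>
    rw [flat_cons, letterWord_append, ← ih, letterWord_eltS, map_replicate, prod_replicate]
    rfl

theorem letterCol_getLast (hq : 3 ≤ q) (W : List (Blk q)) (i : Fin 3) :
    ∀ k ∈ (flat W).getLast?, letterCol q k = endCol i W := by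
  induction W generalizing i with
  | nil => simp [flat]
  | cons b W ih =>
    intro k hk; rw [flat_cons, getLast?_append] at hk; rcases W with _ | ⟨b', W⟩
    · simp [flat, getLast?_replicate, b.exp_pos.ne'] at hk; rw [← hk, (b.letterCol_idx hq).1]
      rfl
    · obtain ⟨l, hl⟩ := Option.ne_none_iff_exists'.1
        (mt getLast?_eq_none_iff.1 (mt flat_eq_nil.1 (cons_ne_nil b' W)))
      rw [hl, Option.some_or, Option.mem_def, Option.some.injEq] at hk; exact ih b.col k (hk ▸ hl)

theorem replicate_append_inj {α : Type*} {k : α} : ∀ {e e' : ℕ} {F F' : List α},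
    k ∉ F.head? → k ∉ F'.head? → replicate e k ++ F = replicate e' k ++ F' →
    e = e' ∧ F = F'
  | 0, 0, _, _, _, _, h => ⟨rfl, h⟩
  | 0, e + 1, F, F', hF, _, h => by
    rw [replicate_zero, nil_append] at h; simp [h, replicate_succ] at hF
  | e + 1, 0, F, F', _, hF', h => by
    rw [replicate_zero, nil_append] at h; simp [← h, replicate_succ] at hF'
  | e + 1, e' + 1, F, F', hF, hF', h => by
    simp only [replicate_succ, cons_append, cons.injEq, true_and] at h
    obtain ⟨rfl, h2⟩ := replicate_append_inj hF hF' h; exact ⟨rfl, h2⟩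

theorem flat_injective (hq : 3 ≤ q) {W W' : List (Blk q)} {i i' : Fin 3} (hW : Adm i W)
    (hW' : Adm i' W') (h : flat W = flat W') : W = W' := by
  induction W generalizing W' i i' with
  | nil => exact (flat_eq_nil.1 h.symm).symm
  | cons b W ih =>
    rcases W' with _ | ⟨b', W'⟩
    · exact absurd (flat_eq_nil.1 h) (cons_ne_nil _ _)
    have hidx : b.idx = b'.idx := by
      have h1 := head_flat_cons b W []; rw [h, head_flat_cons b' W' [], Option.some.injEq] at h1
      exact h1.symm
    have hcol : b.col = b'.col := by rw [← (b.letterCol_idx hq).1, hidx, (b'.letterCol_idx hq).1]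
    have hhd : ∀ {b : Blk q} {W : List (Blk q)}, b.col ≠ 1 → Adm b.col W →
        b.idx ∉ (flat W).head? := by
      intro b W hb hW hk; rcases W with _ | ⟨c, W⟩
      · simp [flat] at hk
      · have := head_flat_cons c W []; rw [append_nil] at this
        rw [this, Option.mem_def, Option.some.injEq] at hk
        exact hb (hW.1 (by rw [← (b.letterCol_idx hq).1, ← hk, (c.letterCol_idx hq).1]))
    have key : b.exp = b'.exp ∧ flat W = flat W' := by
      rw [flat_cons, flat_cons] at h; by_cases h1 : b.col = 1
      · have e : b.exp = b'.exp := by rw [Blk.exp, Blk.exp, if_pos h1, if_pos (hcol ▸ h1)]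
        rw [e, hidx] at h; exact ⟨e, append_cancel_left h⟩
      · rw [← hidx] at h; exact replicate_append_inj (hhd h1 hW.2) (hidx ▸ hhd (hcol ▸ h1) hW'.2) h
    rw [ih hW.2 hW'.2 key.2]; congr 1; refine Subtype.ext (Prod.ext hcol ?_); obtain ⟨key, -⟩ := key
    rw [Blk.exp, Blk.exp, ← hcol] at key; rw [Blk.idx, Blk.idx, ← hcol] at hidx
    split_ifs at key hidx <;> omega

theorem flat_eq_append (W : List (Blk q)) {A B : List ℕ} (h : flat W = A ++ B) (hq : 3 ≤ q) :
    (∃ W₁ W₂, W = W₁ ++ W₂ ∧ flat W₁ = A ∧ flat W₂ = B) ∨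
    ∃ k ∈ A.getLast?, k ∈ B.head? ∧ letterCol q k ≠ 1 := by
  induction W generalizing A with
  | nil =>
    rw [flat, flatMap_nil, eq_comm, append_eq_nil_iff] at h
    exact .inl ⟨[], [], rfl, h.1.symm, h.2.symm⟩
  | cons b W ih =>
    rw [flat_cons] at h; rcases append_eq_append_iff.1 h with ⟨z, rfl, h2⟩ | ⟨z, h2, rfl⟩
    · rcases ih h2 with ⟨W₁, W₂, rfl, rfl, h4⟩ | ⟨k, h3, h4⟩
      · exact .inl ⟨b :: W₁, W₂, rfl, rfl, h4⟩
      · refine .inr ⟨k, ?_, h4⟩; rw [getLast?_append, h3]; rfl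
    · rcases A.eq_nil_or_concat with rfl | ⟨A, k, rfl⟩
      · exact .inl ⟨[], b :: W, rfl, rfl, by rw [flat_cons, h2]; rfl⟩
      rcases z with _ | ⟨l, z⟩
      · exact .inl ⟨[b], W, rfl, by rw [flat_cons, h2]; simp [flat], rfl⟩
      · have hk : k = b.idx := eq_of_mem_replicate (n := b.exp) (by rw [h2]; simp)
        have hl : l = b.idx := eq_of_mem_replicate (n := b.exp) (by rw [h2]; simp)
        refine .inr ⟨k, by simp, by simp [hk, hl], fun h1 => ?_⟩
        rw [hk, (b.letterCol_idx hq).1] at h1; have := congrArg List.length h2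
        simp [Blk.exp, h1] at this; omega

theorem adm_append (W W' : List (Blk q)) (i : Fin 3) :
    (Adm i (W ++ W') ↔ Adm i W ∧ Adm (endCol i W) W') ∧
    endCol i (W ++ W') = endCol (endCol i W) W' := by
  induction W generalizing i with
  | nil => simp [Adm, endCol]
  | cons b W ih => simp [Adm, endCol, ih, and_assoc]

theorem ClosedWord.append_comm {W W' : List (Blk q)} (h : ClosedWord (W ++ W')) :
    ClosedWord (W' ++ W) := by
  rcases W with _ | ⟨b, W⟩
  · simpa using h
  rcases W' with _ | ⟨b', W'⟩
  · simpa using h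
  obtain ⟨-, h⟩ := h; rw [(adm_append _ _ _).1, (adm_append _ _ _).2] at h; refine ⟨by simp, ?_⟩
  rw [(adm_append _ _ _).1, (adm_append _ _ _).2]; exact ⟨h.2, h.1⟩

theorem ClosedWord.isRotated (hq : 3 ≤ q) {W W' : List (Blk q)} (hW : ClosedWord W)
    (hW' : ClosedWord W') {γ : Lam q} (h : γ * wordElt W = wordElt W' * γ) : W ~r W' := by
  rw [wordElt_eq, wordElt_eq] at h
  have hr := isRotated_of_conj (by omega) eltS_mul_self (eltU_pow hq) closure_eltS_eltU
    (letterWord_injective hq) (letters_flat hq W) (letters_flat hq W') (mt flat_eq_nil.1 hW.1)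
    (mt flat_eq_nil.1 hW'.1) h
  obtain ⟨n, hn, h1⟩ := isRotated_iff_mod.1 hr; rw [rotate_eq_drop_append_take hn] at h1
  rcases flat_eq_append W (take_append_drop n (flat W)).symm hq with
    ⟨W₁, W₂, rfl, h2, h3⟩ | ⟨k, h2, h3, h4⟩
  · rw [← h2, ← h3, ← flat_append] at h1; rw [← flat_injective hq hW.append_comm.2 hW'.2 h1]
    exact isRotated_append
  · have h5 := letterCol_getLast hq W' 0 k (by rw [← h1, getLast?_append, h2]; rfl)
    obtain ⟨b, W', rfl⟩ := exists_cons_of_ne_nil hW'.1; have h6 := head_flat_cons b W' []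
    rw [append_nil, ← h1, head?_append, h3, Option.some_or, Option.some.injEq] at h6
    refine absurd (h5.trans (hW'.2.1 ?_)) h4; rw [← h5, h6, (b.letterCol_idx hq).1]

theorem exists_flat (hq : 3 ≤ q) {p : List ℕ} (hp : Letters q p) : ∃ W : List (Blk q), flat W = p ∧
    ∀ i, (∀ k ∈ p.head?, letterCol q k = i → i = 1) → Adm i W := by
  induction p with
  | nil => exact ⟨[], rfl, fun _ _ => trivial⟩
  | cons k p ih =>
    obtain ⟨hk, hp⟩ := letters_cons.1 hp; obtain ⟨W, rfl, hW⟩ := ih hp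
    have hnew : ∃ b : Blk q, b.idx = k ∧ b.exp = 1 := by
      by_cases h1 : k = 1
      · exact ⟨⟨(0, 0), by simp⟩, by simp [Blk.idx, Blk.col, parIdx, h1], by simp [Blk.exp, Blk.col]⟩
      by_cases h2 : k = q - 1
      · exact ⟨⟨(2, 0), by simp⟩, by simp [Blk.idx, Blk.col, parIdx, h2], by simp [Blk.exp, Blk.col]⟩
      · refine ⟨⟨(1, k - 2), fun _ => ?_⟩, ?_, by simp [Blk.exp, Blk.col]⟩
        · dsimp only; omega
        · simp only [Blk.idx, Blk.col, if_true]; omega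
    by_cases hm : ∃ c W', W = c :: W' ∧ c.idx = k ∧ c.col ≠ 1
    · obtain ⟨c, W', rfl, rfl, hc⟩ := hm
      set c' : Blk q := ⟨(c.1.1, c.1.2 + 1), fun h => absurd h hc⟩ with hc'
      have hcol : c'.col = c.col := rfl
      have hidx : c'.idx = c.idx := by rw [Blk.idx, Blk.idx, hcol, if_neg hc, if_neg hc]
      have hexp : c'.exp = c.exp + 1 := by rw [Blk.exp, Blk.exp, hcol, if_neg hc, if_neg hc]
      refine ⟨c' :: W', ?_, fun i hi => ⟨fun h => ?_, (hW 1 fun _ _ _ => rfl).2⟩⟩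
      · rw [flat_cons, flat_cons, hexp, hidx, replicate_succ]; rfl
      · refine hi c.idx rfl ?_; rw [(c.letterCol_idx hq).1, h, hcol]
    · obtain ⟨b, rfl, hb⟩ := hnew
      refine ⟨b :: W, by rw [flat_cons, hb]; rfl, fun i hi => ⟨fun h => ?_, hW _ fun l hl h => ?_⟩⟩
      · exact hi b.idx rfl (by rw [(b.letterCol_idx hq).1, h])
      · by_contra h1; rcases W with _ | ⟨c, W⟩
        · simp [flat] at hl
        have h2 := head_flat_cons c W []; rw [append_nil] at h2
        rw [h2, Option.mem_def, Option.some.injEq] at hl; subst hl; refine hm ⟨c, W, rfl, ?_, ?_⟩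
        · exact letterCol_inj (h.trans (b.letterCol_idx hq).1.symm) (h ▸ h1)
        · rwa [← (c.letterCol_idx hq).1, h]

theorem exists_append_cons_of_ne {α : Type*} (k : α) (p : List α) : (∀ x ∈ p, x = k) ∨
    ∃ A b B, p = A ++ b :: B ∧ b ≠ k ∧ ∀ x ∈ A, x = k := by
  induction p with
  | nil => simp
  | cons a p ih =>
    by_cases ha : a = k
    · rcases ih with h | ⟨A, b, B, rfl, h1, h2⟩
      · exact .inl (List.forall_mem_cons.2 ⟨ha, h⟩)
      · exact .inr ⟨a :: A, b, B, rfl, h1, List.forall_mem_cons.2 ⟨ha, h2⟩⟩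
    · exact .inr ⟨[], a, p, rfl, ha, by simp⟩

theorem exists_closedWord (hq : 3 ≤ q) {g : Lam q} (hg : IsHyperbolic (g : PSLR)) :
    ∃ W : List (Blk q), ClosedWord W ∧ ∃ γ : Lam q, γ * g * γ⁻¹ = wordElt W := by
  have hone : ¬ IsHyperbolic (1 : PSLR) := by rw [← map_one toPSL, isHyperbolic_toPSL]; norm_num
  have hfin : ∀ n, n ≠ 0 → g ^ n ≠ 1 := fun n hn h => hone <| by
    have := (hg.pow hn).1; rwa [← Subgroup.coe_pow, h] at this
  obtain ⟨p, hp, γ, hγ⟩ := exists_conj_letterWord (by omega) eltS_mul_self (eltU_pow hq)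
    closure_eltS_eltU g hfin
  have key : ∀ (p : List ℕ) (γ : Lam q), Letters q p → p ≠ [] →
      γ * g * γ⁻¹ = letterWord (eltS q) (eltU q) p →
      (∀ k ∈ p.head?, ∀ l ∈ p.getLast?, k = l → letterCol q l = 1) →
      ∃ W : List (Blk q), ClosedWord W ∧ ∃ γ : Lam q, γ * g * γ⁻¹ = wordElt W := by
    intro p γ hp h0 hγ h; obtain ⟨W, rfl, hW⟩ := exists_flat hq hp
    refine ⟨W, ⟨mt flat_eq_nil.2 h0, hW _ fun k hk h1 => ?_⟩, γ, by rw [hγ, wordElt_eq]⟩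
    obtain ⟨l, hl⟩ := Option.ne_none_iff_exists'.1 (mt getLast?_eq_none_iff.1 h0)
    have h2 := letterCol_getLast hq W 0 l hl; rw [← h2] at h1 ⊢; by_contra h3
    exact h3 (h k hk l hl (letterCol_inj h1 (h1 ▸ h3)))
  rcases p with _ | ⟨k, p⟩
  · rw [letterWord_nil, mul_inv_eq_one] at hγ; exact absurd (by simpa using hγ) (hfin 1 one_ne_zero)
  rcases exists_append_cons_of_ne k p with h | ⟨A, b, B, rfl, h1, h2⟩
  · refine key _ γ hp (cons_ne_nil _ _) hγ fun a _ l hl _ => ?_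
    have hrep : k :: p = replicate (k :: p).length k :=
      eq_replicate_of_mem (List.forall_mem_cons.2 ⟨rfl, h⟩)
    have hlk : l = k := (List.forall_mem_cons.2 ⟨rfl, h⟩ : ∀ x ∈ k :: p, x = k) l
      (mem_of_mem_getLast? hl)
    rw [hlk]; by_contra h3
    have hpar : k = parIdx q (letterCol q k) := by
      rw [letterCol] at h3 ⊢
      split_ifs at h3 ⊢ with a b
      exacts [a, b, absurd rfl h3]
    refine not_isHyperbolic_par hq h3 (k :: p).length ?_
    rw [← hpar, ← prod_replicate, ← map_replicate, ← hrep, ← letterWord_eltS, ← hγ]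
    exact (hg.conj γ).1
  · rw [← cons_append] at hp hγ
    refine key (b :: B ++ k :: A) ((letterWord (eltS q) (eltU q) (k :: A))⁻¹ * γ)
      (fun a ha => hp a ?_) (by simp) ?_ ?_
    · rw [mem_append] at ha ⊢; exact ha.symm
    · rw [letterWord_append] at hγ ⊢
      calc _ = (letterWord (eltS q) (eltU q) (k :: A))⁻¹ * (γ * g * γ⁻¹) *
            letterWord (eltS q) (eltU q) (k :: A) := by group
        _ = _ := by rw [hγ]; group
    · intro a ha l hl hal; rw [getLast?_append] at hl
      rw [cons_append, head?_cons, Option.mem_def, Option.some.injEq] at ha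
      obtain ⟨m, hm⟩ := Option.ne_none_iff_exists'.1
        (mt getLast?_eq_none_iff.1 (cons_ne_nil k A))
      rw [hm, Option.some_or, Option.mem_def, Option.some.injEq] at hl
      have := (List.forall_mem_cons.2 ⟨rfl, h2⟩ : ∀ x ∈ k :: A, x = k) m
        (mem_of_mem_getLast? hm)
      exact absurd (by rw [ha, hal, ← hl, this]) h1

end Flat

/-! ### Powers of words and the decomposition of the set of closed words -/

section Powers

variable {α : Type*}

/-- The `l`-th power of a list. -/
def lpow (R : List α) (l : ℕ) : List α := (replicate l R).flatten

theorem lpow_succ (R : List α) (l : ℕ) : lpow R (l + 1) = R ++ lpow R l := by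
  simp [lpow, replicate_succ]

theorem length_lpow (R : List α) (l : ℕ) : (lpow R l).length = l * R.length := by simp [lpow]

theorem rotate_lpow (R : List α) (l i : ℕ) : (lpow R l).rotate i = lpow (R.rotate i) l := by
  have h : ∀ R : List α, (lpow R l).rotate 1 = lpow (R.rotate 1) l := by
    rintro (_ | ⟨a, R⟩)
    · simp [lpow]
    have h1 : ∀ l, lpow (a :: R) l ++ [a] = a :: lpow (R ++ [a]) l := by
      intro l; induction l with
      | zero => rfl
      | succ l ih => rw [lpow_succ, lpow_succ, append_assoc, ih]; simp
    cases l with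
    | zero => simp [lpow]
    | succ l =>
      rw [lpow_succ, cons_append, rotate_cons_succ, rotate_zero, append_assoc, h1,
        rotate_cons_succ, rotate_zero, lpow_succ]
      simp
  induction i with
  | zero => simp
  | succ i ih => rw [← rotate_rotate, ih, h, rotate_rotate]

theorem lpow_injective {R R' : List α} (h : R.length = R'.length) {l : ℕ}
    (h' : lpow R (l + 1) = lpow R' (l + 1)) : R = R' := by
  rw [lpow_succ, lpow_succ] at h'; exact (append_inj h' h).1

theorem eq_lpow_of_append_comm {A B : List α} {k : ℕ} (h : A ++ B = B ++ A)
    (hk : B.length = k * A.length) : B = lpow A k := by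
  induction k generalizing B with
  | zero => exact List.length_eq_zero_iff.1 (by simpa using hk)
  | succ k ih =>
    rcases append_eq_append_iff.1 h with ⟨z, rfl, h2⟩ | ⟨z, h1, h2⟩
    · rw [append_assoc] at h; rw [lpow_succ, ih h2]; simp only [length_append] at hk; linarith
    · have h3 : z = [] := List.length_eq_zero_iff.1 (by
        have := congrArg List.length h1; simp only [length_append] at this; nlinarith)
      subst h3; rw [append_nil, nil_append] at *
      subst h1; rcases A with _ | ⟨a, A⟩
      · simp [lpow]
      · have : k = 0 := by simp only [length_cons] at hk; nlinarith
        simp [this, lpow]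

theorem eq_lpow_of_rotate {W : List α} {p : ℕ} (hp : p ∣ W.length) (h0 : W ≠ [])
    (h : W.rotate p = W) : W = lpow (W.take p) (W.length / p) := by
  have hl := length_pos_of_ne_nil h0; have hle := Nat.le_of_dvd hl hp; obtain ⟨k, hk⟩ := hp
  rcases k with _ | k
  · omega
  have hp0 : 0 < p := by
    rcases Nat.eq_zero_or_pos p with rfl | h
    · omega
    · exact h
  rw [hk, Nat.mul_div_cancel_left _ hp0, lpow_succ]
  conv_lhs => rw [← take_append_drop p W]
  rw [rotate_eq_drop_append_take hle] at h; rw [← eq_lpow_of_append_comm (B := W.drop p) (k := k)]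
  · rw [take_append_drop, h]
  · rw [length_drop, length_take, hk, min_eq_left (by rw [← hk]; exact hle)]
    simp [Nat.mul_succ, mul_comm]

theorem iterate_rotate (W : List α) (n : ℕ) : (fun W : List α => W.rotate 1)^[n] W = W.rotate n := by
  induction n with
  | zero => simp
  | succ n ih => rw [iterate_succ_apply', ih, rotate_rotate]

theorem minimalPeriod_lpow {R : List α} (h0 : R ≠ []) (hR : ∀ A n, lpow A n = R → n ≤ 1) (l : ℕ) :
    minimalPeriod (fun W : List α => W.rotate 1) (lpow R (l + 1)) = R.length := by
  set p := minimalPeriod (fun W : List α => W.rotate 1) (lpow R (l + 1)) with hp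
  have h1 : p ∣ R.length := IsPeriodicPt.minimalPeriod_dvd (by
    rw [IsPeriodicPt, IsFixedPt, iterate_rotate, rotate_lpow, rotate_length])
  have h2 := isPeriodicPt_minimalPeriod (fun W : List α => W.rotate 1) (lpow R (l + 1))
  rw [← hp, IsPeriodicPt, IsFixedPt, iterate_rotate, rotate_lpow] at h2
  have h3 := hR _ _ (eq_lpow_of_rotate h1 h0 (lpow_injective (length_rotate ..) h2)).symm
  obtain ⟨k, hk⟩ := h1; have hl := length_pos_of_ne_nil h0
  have hp0 : 0 < p := Nat.pos_of_ne_zero fun h => by simp [hk, h] at hl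
  rw [hk, Nat.mul_div_cancel_left _ hp0] at h3
  interval_cases k
  · omega
  · omega

end Powers

section Closed

variable {q : ℕ}

theorem wordElt_append (W W' : List (Blk q)) : wordElt (W ++ W') = wordElt W * wordElt W' := by
  simp [wordElt]

theorem wordElt_lpow (R : List (Blk q)) (l : ℕ) : wordElt (lpow R l) = wordElt R ^ l := by
  induction l with
  | zero => simp [lpow, wordElt]
  | succ l ih => rw [lpow_succ, wordElt_append, ih, pow_succ']

theorem wordElt_rotate (W : List (Blk q)) (i : ℕ) :
    ∃ γ : Lam q, γ * wordElt W * γ⁻¹ = wordElt (W.rotate i) := by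
  refine ⟨(wordElt (W.take (i % W.length)))⁻¹, ?_⟩
  rw [rotate_eq_drop_append_take_mod, wordElt_append]
  conv_lhs => rw [← take_append_drop (i % W.length) W, wordElt_append]
  rw [take_append_drop]
  group

theorem ClosedWord.rotate {W : List (Blk q)} (h : ClosedWord W) (i : ℕ) :
    ClosedWord (W.rotate i) := by
  rw [rotate_eq_drop_append_take_mod]; exact ClosedWord.append_comm (by rwa [take_append_drop])

theorem ClosedWord.lpow {R : List (Blk q)} (h : ClosedWord R) {l : ℕ} (hl : l ≠ 0) :
    ClosedWord (lpow R l) := by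
  have key : ∀ l, Adm (endCol 0 R) (HeckeZeta.lpow R l) ∧
      endCol (endCol 0 R) (HeckeZeta.lpow R l) = endCol 0 R := by
    intro l; induction l with
    | zero => exact ⟨trivial, rfl⟩
    | succ l ih =>
      rw [lpow_succ, (adm_append _ _ _).1, (adm_append _ _ _).2, endCol_eq h.1 (endCol 0 R) 0]
      exact ⟨⟨h.2, ih.1⟩, ih.2⟩
  have h0 : HeckeZeta.lpow R l ≠ [] := by
    rw [← List.length_pos_iff, length_lpow]
    exact Nat.mul_pos (Nat.pos_of_ne_zero hl) (length_pos_of_ne_nil h.1)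
  refine ⟨h0, ?_⟩; rw [endCol_eq h0 0 (endCol 0 R), (key l).2]; exact (key l).1

theorem IsPrimitiveHyperbolic.conj {g : Lam q} (hg : IsPrimitiveHyperbolic g) (γ : Lam q) :
    IsPrimitiveHyperbolic (γ * g * γ⁻¹) := by
  refine ⟨(hg.1.conj γ).1, fun h n hn => hg.2 (γ⁻¹ * h * γ⁻¹⁻¹) n ?_⟩; rw [conj_pow, hn]
  group

/-- A representative of a conjugacy class. -/
def PrimClass.rep (κ : PrimClass q) : Lam q := Quotient.out κ.1

theorem PrimClass.mk_rep (κ : PrimClass q) : ConjClasses.mk κ.rep = κ.1 := Quotient.out_eq κ.1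

theorem PrimClass.isPrimitiveHyperbolic_rep (κ : PrimClass q) : IsPrimitiveHyperbolic κ.rep := by
  obtain ⟨g, hg, h⟩ := κ.2; rw [← κ.mk_rep, ConjClasses.mk_eq_mk_iff_isConj, isConj_iff] at h
  obtain ⟨γ, hγ⟩ := h; exact hγ ▸ hg.conj γ

theorem ClosedWord.isHyperbolic (hq : 3 ≤ q) {W : List (Blk q)} (hW : ClosedWord W) :
    IsHyperbolic (wordElt W : PSLR) := by
  obtain ⟨c, r, h⟩ := exists_admissibleDiscs hq
  obtain ⟨ρ, hρ⟩ := h.exists_contraction hq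
  obtain ⟨x, D, -, h1, -⟩ := hW.exists_isAttracting hq h hρ; exact h1

theorem ClosedWord.exists_primClass (hq : 3 ≤ q) {W : List (Blk q)} (hW : ClosedWord W) :
    ∃ (κ : PrimClass q) (l : ℕ) (γ : Lam q), γ * κ.rep ^ (l + 1) * γ⁻¹ = wordElt W := by
  obtain ⟨n, hn⟩ : ∃ n, W.length = n := ⟨_, rfl⟩
  induction n using Nat.strong_induction_on generalizing W with
  | _ n ih =>
    have hh := hW.isHyperbolic hq; by_cases hp : IsPrimitiveHyperbolic (wordElt W)
    · set κ : PrimClass q := ⟨ConjClasses.mk (wordElt W), _, hp, rfl⟩ with hκ; have h := κ.mk_rep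
      rw [hκ, ConjClasses.mk_eq_mk_iff_isConj, isConj_iff] at h; obtain ⟨γ, hγ⟩ := h
      exact ⟨κ, 0, γ, by rw [zero_add, pow_one]; exact hγ⟩
    · rw [IsPrimitiveHyperbolic, not_and] at hp
      push Not at hp
      obtain ⟨h, m, hm, hm1⟩ := hp hh
      have hhyp : IsHyperbolic (h : PSLR) := IsHyperbolic.of_pow (n := m) (by
        rw [← Subgroup.coe_pow, hm]; exact hh)
      obtain ⟨W', hW', γ, hγ⟩ := exists_closedWord hq hhyp
      have hr := ClosedWord.isRotated hq (hW'.lpow (l := m) (by omega)) hW (γ := γ⁻¹) (by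
        rw [wordElt_lpow, ← hγ, conj_pow, hm]
        group)
      have hlen := hr.perm.length_eq; rw [length_lpow, hn] at hlen
      have hpos := length_pos_of_ne_nil hW'.1
      obtain ⟨κ, l, δ, hδ⟩ := ih W'.length (by nlinarith) hW' rfl
      refine ⟨κ, (l + 1) * m - 1, γ⁻¹ * δ, ?_⟩
      rw [Nat.sub_add_cancel (Nat.mul_pos (Nat.succ_pos l) (by omega)), pow_mul, ← hm]
      calc _ = γ⁻¹ * (δ * κ.rep ^ (l + 1) * δ⁻¹) ^ m * γ := by
            rw [conj_pow]; simp only [mul_assoc, _root_.mul_inv_rev, inv_inv]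
        _ = _ := by rw [hδ, ← hγ, conj_pow]; simp [mul_assoc]

/-- The closed words are the rotations of the powers of words representing the primitive
conjugacy classes. -/
theorem exists_closedWord_decomposition (hq : 3 ≤ q) : ∃ R : PrimClass q → List (Blk q),
    (∀ κ, ClosedWord (R κ) ∧ ∃ γ : Lam q, γ * κ.rep * γ⁻¹ = wordElt (R κ)) ∧
    Function.Injective (fun x : Σ κ : PrimClass q, ℕ × Fin (R κ).length =>
    (lpow (R x.1) (x.2.1 + 1)).rotate x.2.2) ∧
    ∀ W, ClosedWord W → ∃ x : Σ κ : PrimClass q, ℕ × Fin (R κ).length,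
    (lpow (R x.1) (x.2.1 + 1)).rotate x.2.2 = W := by
  choose R hR γ hγ using fun κ : PrimClass q => exists_closedWord hq κ.isPrimitiveHyperbolic_rep.1
  have hprim : ∀ κ A n, lpow A n = R κ → n ≤ 1 := fun κ A n h =>
    (κ.isPrimitiveHyperbolic_rep.conj (γ κ)).2 (wordElt A) n (by rw [hγ, ← wordElt_lpow, h])
  have hmp := fun κ l => minimalPeriod_lpow (hR κ).1 (hprim κ) l
  have hpos := fun κ => length_pos_of_ne_nil (hR κ).1
  refine ⟨R, fun κ => ⟨hR κ, γ κ, hγ κ⟩, ?_, ?_⟩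
  · rintro ⟨κ, l, i⟩ ⟨κ', l', i'⟩ h; dsimp only at h
    obtain ⟨n, hn⟩ : lpow (R κ) (l + 1) ~r lpow (R κ') (l' + 1) := by
      have h1 := IsRotated.forall (lpow (R κ) (l + 1)) i; rw [h] at h1
      exact h1.symm.trans (IsRotated.forall _ _)
    have hlen : (R κ).length = (R κ').length := by
      rw [← hmp κ l, ← hmp κ' l', ← hn, ← iterate_rotate, eq_comm]
      refine minimalPeriod_apply_iterate ?_ n
      exact mk_mem_periodicPts (n := (R κ).length) (hpos κ) (by
        rw [IsPeriodicPt, IsFixedPt, iterate_rotate, rotate_lpow,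
          rotate_length])
    have hl : l = l' := by
      have := congrArg List.length hn; rw [length_rotate, length_lpow, length_lpow, hlen] at this
      have := Nat.eq_of_mul_eq_mul_right (hpos κ') this; omega
    subst hl; rw [rotate_lpow] at hn; have hrot := lpow_injective (by rw [length_rotate, hlen]) hn
    have hκ : κ = κ' := by
      refine Subtype.ext ?_; obtain ⟨δ, hδ⟩ := wordElt_rotate (R κ) n
      rw [← κ.mk_rep, ← κ'.mk_rep, ConjClasses.mk_eq_mk_iff_isConj, isConj_iff]
      refine ⟨(γ κ')⁻¹ * δ * γ κ, ?_⟩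
      calc _ = (γ κ')⁻¹ * (δ * (γ κ * κ.rep * (γ κ)⁻¹) * δ⁻¹) * γ κ' := by group
        _ = _ := by rw [hγ, hδ, hrot, ← hγ]; group
    subst hκ
    have hi : (i : ℕ) = i' := by
      rw [← iterate_rotate, ← iterate_rotate] at h
      exact (iterate_eq_iterate_iff_of_lt_minimalPeriod (by rw [hmp]; exact i.2)
        (by rw [hmp]; exact i'.2)).1 h
    rw [Fin.ext hi]
  · intro W hW; obtain ⟨κ, l, δ, hδ⟩ := hW.exists_primClass hq
    obtain ⟨n, hn⟩ := ClosedWord.isRotated hq ((hR κ).lpow (l := l + 1) (by omega)) hW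
      (γ := δ * (γ κ)⁻¹) (by rw [wordElt_lpow, ← hγ, conj_pow, ← hδ]; group)
    refine ⟨⟨κ, l, n % (R κ).length, Nat.mod_lt _ (hpos κ)⟩, ?_⟩
    rw [← hn, rotate_lpow, rotate_lpow, rotate_mod]

end Closed

/-! ### The Selberg zeta function as a Fredholm determinant -/

section Zeta

variable {q : ℕ} {V : Type*} [NormedAddCommGroup V] [InnerProductSpace ℂ V]
  (η : Lam q →* (V ≃ₗᵢ[ℂ] V))

/-- The representation by linear maps. -/
def linRep : Lam q →* (V →ₗ[ℂ] V) where
  toFun g := ((η g).toLinearEquiv : V →ₗ[ℂ] V)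
  map_one' := by ext; simp
  map_mul' g g' := by ext; simp

/-- The contribution of a group element to the trace formula. -/
def elemTrace (s : ℂ) (g : Lam q) : ℂ :=
  LinearMap.trace ℂ V (linRep η g) * normTerm s (hypNorm (g : PSLR))

theorem elemTrace_conj (s : ℂ) {g : Lam q} (hg : IsHyperbolic (g : PSLR)) (γ : Lam q) :
    elemTrace η s (γ * g * γ⁻¹) = elemTrace η s g := by
  rw [elemTrace, elemTrace, mul_assoc, map_mul, LinearMap.trace_mul_comm, ← map_mul,
    inv_mul_cancel_right, ← mul_assoc]
  exact congrArg _ (congrArg _ (hg.conj γ).2)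

theorem normTerm_pow {N : ℝ} (hN : 1 < N) (s : ℂ) (n : ℕ) :
    normTerm s (N ^ n) = ((N : ℂ) ^ (-s)) ^ n / (1 - ((N : ℂ)⁻¹) ^ n) := by
  have h0 : (N : ℂ) ≠ 0 := by rw [ofReal_ne_zero]; linarith
  rw [normTerm, cpow_def_of_ne_zero h0, ← Complex.exp_nat_mul,
    cpow_def_of_ne_zero (by push_cast; exact pow_ne_zero n h0), ← ofReal_log
      (by positivity), log_pow, ← ofReal_log (by linarith)]
  push_cast; rw [inv_pow]; congr 2; ring

variable [FiniteDimensional ℂ V]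

theorem zetaFactor_eq {s : ℂ} (hs : 0 < s.re) {g : Lam q} (hg : IsHyperbolic (g : PSLR)) (k : ℕ) :
    zetaFactor η s g k = Complex.exp (-∑' l : ℕ, LinearMap.trace ℂ V (linRep η (g ^ (l + 1))) /
    (l + 1) * ((hypNorm (g : PSLR) : ℂ) ^ (-(s + k))) ^ (l + 1)) := by
  have hN := hg.one_lt; set b := (𝔟 V).toBasis; set M := toMatrix b b (linRep η g) with hM
  have htr : ∀ l, (M ^ l).trace = LinearMap.trace ℂ V (linRep η (g ^ l)) := fun l => by
    rw [trace_eq_matrix_trace ℂ b, map_pow, toMatrix_pow]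
  have h := det_one_sub_smul_eq_exp M (C := finrank ℂ V) (B := 1) zero_le_one (fun l => by
    rw [htr, one_pow, mul_one]
    exact norm_trace_le _) (t := (hypNorm (g : PSLR) : ℂ) ^ (-(s + k))) (by
      rw [mul_one, norm_cpow_eq_rpow_re_of_pos (by linarith)]
      refine rpow_lt_one_of_one_lt_of_neg hN ?_; rw [neg_re, add_re, natCast_re]
      linarith [k.cast_nonneg (α := ℝ)])
  simp only [htr] at h; rw [← h, zetaFactor, ← det_toMatrix b, map_sub, map_smul, toMatrix_id]
  rfl

theorem HasSum.hasProd_cexp_neg {ι : Type*} {f : ι → ℂ} {a : ℂ} (h : HasSum f a) :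
    HasProd (fun i => Complex.exp (-f i)) (Complex.exp (-a)) := h.neg.cexp

theorem hasProd_zetaFactor {s : ℂ} (hs : 0 < s.re) {g : Lam q} (hg : IsHyperbolic (g : PSLR)) :
    HasProd (fun k : ℕ => zetaFactor η s g k)
    (Complex.exp (-∑' l : ℕ, elemTrace η s (g ^ (l + 1)) / (l + 1))) := by
  have hN := hg.one_lt; set N := hypNorm (g : PSLR) with hNdef
  have hN0 : (N : ℂ) ≠ 0 := by rw [ofReal_ne_zero]; linarith
  set x : ℂ := (N : ℂ) ^ (-s) with hx; set y : ℂ := (N : ℂ)⁻¹ with hy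
  have hyn : ‖y‖ = N⁻¹ := by rw [hy, norm_inv, norm_real, norm_eq_abs, abs_of_pos (by linarith)]
  have hy1 : ‖y‖ < 1 := hyn ▸ inv_lt_one_of_one_lt₀ hN
  have hx1 : ‖x‖ < 1 := by
    rw [hx, norm_cpow_eq_rpow_re_of_pos (by linarith)]
    exact rpow_lt_one_of_one_lt_of_neg hN (by simpa using hs)
  have ht : ∀ k : ℕ, (N : ℂ) ^ (-(s + k)) = x * y ^ k := fun k => by
    rw [neg_add, cpow_add _ _ hN0, cpow_neg _ (k : ℂ), cpow_natCast, hy,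
      inv_pow]
  set τ : ℕ → ℂ := fun l => LinearMap.trace ℂ V (linRep η (g ^ (l + 1))) / (l + 1) with hτ
  have hτn : ∀ l, ‖τ l‖ ≤ finrank ℂ V := fun l => by
    rw [hτ, norm_div]
    refine div_le_of_le_mul₀ (norm_nonneg _) (by positivity) ((norm_trace_le _).trans ?_)
    refine le_mul_of_one_le_right (by positivity) ?_
    rw [← Nat.cast_succ, Complex.norm_natCast]; simp
  have hF : Summable fun p : ℕ × ℕ => τ p.2 * (x * y ^ p.1) ^ (p.2 + 1) := by
    have h1 := summable_geometric_of_lt_one (norm_nonneg _) hy1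
    have h2 := ((summable_nat_add_iff 1).2
      (summable_geometric_of_lt_one (norm_nonneg _) hx1)).mul_left (finrank ℂ V : ℝ)
    refine Summable.of_norm_bounded (h1.mul_of_nonneg h2 (fun _ => by positivity)
      fun _ => by positivity) fun p => ?_
    rw [norm_mul, mul_pow, norm_mul, norm_pow, norm_pow, norm_pow, mul_comm (‖y‖ ^ p.1), mul_assoc]
    refine mul_le_mul (hτn _) (mul_le_mul_of_nonneg_left ?_ (by positivity)) (by positivity)
      (by positivity)
    exact pow_le_of_le_one (by positivity) (pow_le_one₀ (norm_nonneg _) hy1.le) (Nat.succ_ne_zero _)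
  have hsum : HasSum (fun k => ∑' l, τ l * (x * y ^ k) ^ (l + 1))
      (∑' l : ℕ, elemTrace η s (g ^ (l + 1)) / (l + 1)) := by
    have h1 : HasSum (fun k => ∑' l, τ l * (x * y ^ k) ^ (l + 1))
      (∑' k, ∑' l, τ l * (x * y ^ k) ^ (l + 1)) := hF.prod.hasSum
    rw [← Summable.tsum_comm (f := fun k l => τ l * (x * y ^ k) ^ (l + 1)) hF] at h1
    refine (congrArg (HasSum _) (tsum_congr fun l => ?_)).mp h1
    have hyl : ‖y ^ (l + 1)‖ < 1 := by
      rw [norm_pow]; exact pow_lt_one₀ (norm_nonneg _) hy1 (Nat.succ_ne_zero _)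
    rw [tsum_mul_left, elemTrace, Subgroup.coe_pow, (hg.pow (Nat.add_one_ne_zero l)).2,
      normTerm_pow hN, ← hx, ← hy]
    simp only [mul_pow, ← pow_mul, mul_comm _ (l + 1)]; simp only [pow_mul]
    rw [tsum_mul_left, tsum_geometric_of_norm_lt_one hyl, hτ]; ring
  refine (HasSum.hasProd_cexp_neg hsum).congr_fun fun k => ?_; rw [zetaFactor_eq η hs hg, ht]

variable {c r : Fin 3 → ℝ} {ρ : ℝ} [CompleteSpace V]

theorem selbergZeta_eq (hq : 3 ≤ q) (h : AdmissibleDiscs q c r) (hρ : IsContraction q c r ρ) {s : ℂ}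
    (hs : 1 < s.re) : (∀ κ : PrimClass q, Multipliable fun k : ℕ => classFactor η s κ k) ∧
    (Multipliable fun κ : PrimClass q => ∏' k : ℕ, classFactor η s κ k) ∧
    selbergZeta η s = fredholmDet (transferOp hq η h hρ s) := by
  have hP := fun κ : PrimClass q => hasProd_zetaFactor η (by linarith : 0 < s.re)
    κ.isPrimitiveHyperbolic_rep.1
  have hw := summable_norm_wordTrace η hq h hρ hs
  set f : List (Blk q) → ℂ := fun W => wordTrace η s W / W.length with hf
  have hfs : Summable f := Summable.of_norm_bounded hw fun W => by
    rcases W with _ | ⟨b, W⟩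
    · simp [hf]
    · rw [hf, norm_div, Complex.norm_natCast]; exact div_le_self (norm_nonneg _) (by simp)
  obtain ⟨R, hR, hinj, hsurj⟩ := exists_closedWord_decomposition hq
  set Ψ : (Σ κ : PrimClass q, ℕ × Fin (R κ).length) → List (Blk q) :=
    fun x => (lpow (R x.1) (x.2.1 + 1)).rotate x.2.2 with hΨ
  have hS := (hinj.hasSum_iff (f := f) (a := ∑' W, f W) fun W hW => by
    rw [hf]; dsimp only; rw [wordTrace, if_neg fun hc => hW (hsurj W hc), zero_div]).2 hfs.hasSum
  have hfac := fun κ => hS.summable.sigma_factor κ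
  have hsum : HasSum (fun κ : PrimClass q => ∑' l : ℕ, elemTrace η s (κ.rep ^ (l + 1)) / (l + 1))
      (∑' W, f W) := by
    refine (hS.sigma fun κ => (hfac κ).hasSum).congr_fun fun κ => ?_; obtain ⟨hc, γ, hγ⟩ := hR κ
    have hlen : ((R κ).length : ℂ) ≠ 0 := Nat.cast_ne_zero.2 (length_pos_of_ne_nil hc.1).ne'
    rw [Summable.tsum_prod (hfac κ)]; refine tsum_congr fun l => ?_
    have hval : ∀ i : Fin (R κ).length, (f ∘ Ψ) ⟨κ, l, i⟩
        = elemTrace η s (κ.rep ^ (l + 1)) / ((l + 1) * (R κ).length) := by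
      intro i; obtain ⟨δ, hδ⟩ := wordElt_rotate (lpow (R κ) (l + 1)) i
      have hcl := (hc.lpow (Nat.succ_ne_zero l)).rotate i
      have hhyp := (κ.isPrimitiveHyperbolic_rep.1.pow (Nat.succ_ne_zero l)).1
      rw [Function.comp_apply, hf, hΨ]; dsimp only
      rw [length_rotate, length_lpow,
        show wordTrace η s _ = elemTrace η s (wordElt _) from if_pos hcl]
      push_cast; congr 1
      rw [← hδ, wordElt_lpow, ← hγ, conj_pow, elemTrace_conj, elemTrace_conj η s hhyp]
      exact (hhyp.conj (γ : PSLR)).1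
    rw [tsum_congr hval, tsum_fintype, sum_const, card_univ, Fintype.card_fin,
      nsmul_eq_mul]
    field_simp
  have hprod := HasSum.hasProd_cexp_neg hsum; simp only [← (hP _).tprod_eq] at hprod
  refine ⟨fun κ => (hP κ).multipliable, hprod.multipliable, ?_⟩
  rw [fredholmDet_eq_exp_tsum hq η h hρ (by linarith) hw]
  exact hprod.tprod_eq

end Zeta

section Singularity

variable {q : ℕ} {V : Type*} [NormedAddCommGroup V] [InnerProductSpace ℂ V] [FiniteDimensional ℂ V]
  (η : Lam q →* (V ≃ₗᵢ[ℂ] V))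

theorem fixSpace_inv (g : Lam q) : fixSpace (η g⁻¹) = fixSpace (η g) := by
  ext x; rw [mem_fixSpace, mem_fixSpace, map_inv]
  exact (LinearIsometryEquiv.symm_apply_eq (η g)).trans eq_comm

theorem finrank_fixSpace_conj (g γ : Lam q) : finrank ℂ (fixSpace (η (γ * g * γ⁻¹)))
    = finrank ℂ (fixSpace (η g)) := by
  have : fixSpace (η (γ * g * γ⁻¹)) = (fixSpace (η g)).map ((η γ).toLinearEquiv : V →ₗ[ℂ] V) := by
    ext x; rw [Submodule.mem_map_equiv, mem_fixSpace, mem_fixSpace, map_mul, map_mul, map_inv]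
    exact (LinearIsometryEquiv.eq_symm_apply (η γ)).symm
  rw [this]; exact LinearEquiv.finrank_map_eq (η γ).toLinearEquiv _

theorem eltT_eq : eltT q = (eltU q)⁻¹ * (eltS q)⁻¹ := Subtype.ext <| by
  change toPSL _ = (toPSL _)⁻¹ * (toPSL _)⁻¹; simp [mul_assoc]

theorem card_polarIdx (hq : 3 ≤ q) : Fintype.card (PolarIdx η) = 2 * sd η := by
  have h0 : eltH q 1 = (eltT q)⁻¹ := by rw [← eltS_mul_eltU_pow, eltT_eq, pow_one]; group
  have h1 : eltH q (q - 1) = eltS q * eltT q * (eltS q)⁻¹ := by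
    have hu : eltU q ^ (q - 1) = (eltU q)⁻¹ := eq_inv_of_mul_eq_one_left (by
      rw [← pow_succ, Nat.sub_add_cancel (by omega), eltU_pow hq])
    rw [← eltS_mul_eltU_pow, eltT_eq, hu, mul_assoc, mul_assoc, ← _root_.mul_inv_rev, eltS_mul_self]
    simp
  have hsd : sd η = finrank ℂ (fixSpace (η (eltT q))) := rfl
  rw [Fintype.card_sigma, Fin.sum_univ_two, Fintype.card_fin, Fintype.card_fin]
  change finrank ℂ (fixSpace (η (eltH q 1))) +
    finrank ℂ (fixSpace (η (eltH q (q - 1)))) = _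
  rw [h0, h1, fixSpace_inv, finrank_fixSpace_conj, hsd, two_mul]

end Singularity

end

end HeckeZeta

open HeckeZeta in
theorem mainTheorem1 (q : ℕ) (hq : 3 ≤ q)
    {V : Type*} [NormedAddCommGroup V] [InnerProductSpace ℂ V] [FiniteDimensional ℂ V]
    (η : Lam q →* (V ≃ₗᵢ[ℂ] V)) :
    (∃ c r : Fin 3 → ℝ, AdmissibleDiscs q c r) ∧
    ∀ c r : Fin 3 → ℝ, AdmissibleDiscs q c r →
      ∃ L : ℂ → (BSpace V c r →L[ℂ] BSpace V c r),
        -- `L s` is the transfer operator for `Re s > 1/2`, continued meromorphically to `ℂ`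
        (∀ s : ℂ, 1 / 2 < s.re → IsTransferOperator η c r s (L s)) ∧
        MeromorphicOn L Set.univ ∧
        AnalyticOnNhd ℂ L poleSetᶜ ∧
        (∀ s ∉ poleSet, IsNuclearOrderZero (L s)) ∧
        -- the zeta function converges and is the Fredholm determinant for `Re s > 1`
        (∀ s : ℂ, 1 < s.re →
          (∀ κ : PrimClass q, Multipliable fun k : ℕ => classFactor η s κ k) ∧
          (Multipliable fun κ : PrimClass q => ∏' k : ℕ, classFactor η s κ k) ∧
          selbergZeta η s = fredholmDet (L s)) ∧
        -- the Fredholm determinant, and hence the zeta function, continues meromorphically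
        ∃ D : ℂ → ℂ,
          MeromorphicOn D Set.univ ∧
          AnalyticOnNhd ℂ D poleSetᶜ ∧
          (∀ s ∉ poleSet, D s = fredholmDet (L s)) ∧
          (∀ s : ℂ, 1 < s.re → D s = selbergZeta η s) ∧
          ∀ s ∈ poleSet, ((-(4 * (sd η : ℤ)) : ℤ) : WithTop ℤ) ≤ meromorphicOrderAt D s := by
  refine ⟨exists_admissibleDiscs hq, fun c r h => ?_⟩
  have := FiniteDimensional.complete ℂ V
  obtain ⟨ρ, hρ⟩ := h.exists_contraction hq
  refine ⟨transferOp hq η h hρ, fun s hs => isTransferOperator_transferOp hq η h hρ hs,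
    meromorphicOn_transferOp hq η h hρ, analyticOnNhd_transferOp hq η h hρ,
    fun s hs => isNuclearOrderZero_transferOp hq η h hρ hs,
    fun s hs => selbergZeta_eq η hq h hρ hs, fun s => fredholmDet (transferOp hq η h hρ s),
    meromorphicOn_fredholmDet hq η h hρ, analyticOnNhd_fredholmDet hq η h hρ, fun _ _ => rfl,
    fun s hs => (selbergZeta_eq η hq h hρ hs).2.2.symm, ?_⟩
  rintro s ⟨k, rfl⟩
  refine le_trans ?_ (meromorphicAt_fredholmDet_transferOp hq η h hρ k).2
  rw [card_polarIdx η hq, WithTop.coe_le_coe]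
  push_cast
  omega
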